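/- **Setting.** Let $d\ge 8$, $1\le s\le d$, $\delta\in(0,\frac1{10})$, $L,R,U,\beta>0$. Let $D$ be a distribution on $\mathbb R^d\times\{-1,+1\}$ with marginal $D_X$, let $w^\star\in\mathbb R^d$ be an $s$-sparse unit vector, $h_w(x)=\mathrm{sign}\langle w,x\rangle$, $\mathrm{err}(h,D)=\mathbb P_D(h(x)\ne y)$, $\eta(x)=\mathbb P_D(y\neq h_{w^\star}(x)\mid x)$. Assume $D_X$ is $(2,L,R,U,\beta)$-well-behaved: for each orthonormal pair $v_1,v_2$ the vector $(\langle v_1,x\rangle,\langle v_2,x\rangle)$ has a density that is at most $U$ on $\mathbb R^2$ and at least $L$ on $\{\|z\|_2\le R\}$; and $\mathbb P(|\langle w,x\rangle|\ge t)\le e^{1-t/\beta}$ for all unit vectors $w$ and $t>0$. The noise conditions are (almost surely in $x$): * $\eta$-Massart, $\eta\in[0,\frac12)$: $\eta(x)\le\eta$; * $(A,\alpha)$-Tsybakov, $A>0$, $\alpha\in(\frac12,1]$: $\mathbb P(\frac12-\eta(x)\le t)\le A t^{\alpha/(1-\alpha)}$ for all $t\in[0,\frac12)$ (for $\alpha=1$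 the right-hand side is $0$); * $(B,\alpha)$-geometric Tsybakov, $B>0$, $\alpha\in(0,1]$: $\frac12-\eta(x)\ge\min(\frac12,B|\langle w^\star,x\rangle|^{(1-\alpha)/\alpha})$. **Algorithm.** $\hat w=w/\|w\|_2$, with $\hat 0=e_1$. $\mathrm{HT}_s(w)$ keeps the $s$ entries of $w$ that are largest in absolute value (ties broken by index). Put $p=\frac{\ln d}{\ln d-1}$. *Optimize*$(w_1,r,b,T,\mathrm{agg})$: let $u_1=\mathrm{HT}_s(w_1)$, $\mathcal K=\{w:\|w-w_1\|_2\le 4r,\ \|w-u_1\|_1\le 8r\sqrt{2s}\}$, step size $a=\frac r\beta\sqrt{\frac{s\ln d}{T}}\big/\ln\frac{Td}{\delta rbRL}$, regularizer $F(w)=\frac1{2(p-1)}\|w-u_1\|_p^2$ with Bregman divergence $D_F$. For $t=1,\dots,T$: draw $x_t\sim D_X$ conditioned on $|\langle\hat u_t,x\rangle|\le b$ by rejection sampling, query its label $y_t$, and set $u_{t+1}=\arg\min_{w\in\mathcal K}\big(a\langle w,-y_tx_t\rangle+D_F(w,u_t)\big)$ (and $u_{t+1}=u_t$ if there is no minimizer).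 Return $\frac1T\sum_{t\le T}\hat u_t$ if agg = average; return $\sigma\hat u_\tau$ with $\tau\in\{1,\dots,T\}$ and $\sigma\in\{\pm1\}$ uniformly random if agg = random. *Initialize*: let $r_0=\frac{\epsilon_0}{64U\beta^2(\ln\frac{24}{\epsilon_0})^2}$, $k_0=\lceil\log_4\frac1{r_0}\rceil$ (replaced by $0$ if negative), $N=\lceil10\ln\frac4\delta\rceil$. For each $i\le N$ put $v_{i,0}=0$ and $v_{i,j+1}=$ Optimize$(v_{i,j},4^{-(j+1)},b_j,T_j,\cdot)$ for $j=0,\dots,k_0$, in mode random for $j=0$ and average otherwise. Draw $m$ labelled examples; return the normalization of the vector among $v_{1,k_0+1},\dots,v_{N,k_0+1}$ whose halfspace has the smallest empirical error. *Main algorithm*: let $r_\epsilon=\frac{\epsilon}{32U\beta^2(\ln\frac{12}{\epsilon})^2}$, $k_\epsilon=\lceil\log_4\frac1{r_\epsilon}\rceil$ (replaced by $0$ if negative), $v_1=$ Initialize, and $v_{j+1}=$ Optimize$(v_j,4^{-(j+1)},b_j,T_j,\text{average})$ for $j=1,\dots,k_\epsilon$. Output $\tilde v=v_{k_\epsilon+1}$.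 **Theorem.** Below, $\tilde O,\tilde\Theta$ hide a factor $C\Lambda^k$, where $\Lambda$ is the logarithm of $\frac{d}{\delta r(1-2\eta)}$, $\frac{d(1+A)}{\delta r}$, $\frac{d(1+1/B)}{\delta r}$ in the three cases respectively (with $\epsilon$ in place of $r$ in the label complexity bounds), $k$ depends only on the noise condition and on $\alpha$, and $C$ depends only on these and on $L,R,U,\beta$. Under each of the three noise conditions there is a setting of $b_j>0$ and of integers $T_j\ge1$ $(j\ge0)$, $\epsilon_0\in(0,1]$ and an integer $m\ge 1$, depending only on $d,s,\delta,L,R,U,\beta$ and the noise parameters, with $m=O(\epsilon_0^{-2}\ln\frac N\delta)$ and, for all $j\ge0$ and $r=4^{-(j+1)}$, * (Massart) $b_j=\tilde\Theta((1-2\eta)r)$, $T_j=\tilde O\big(\frac{s\ln d}{(1-2\eta)^2}(\ln\frac1{\delta r})^3\big)$, $\epsilon_0=O(1-2\eta)$; * (Tsybakov) $b_j=\tilde\Theta\big(\min(r,(\frac1A)^{\frac{1-\alpha}{2\alpha-1}}r^{\frac\alpha{2\alpha-1}})\big)$, $T_j=\tilde O\big(s\ln d\,(\ln\frac1{\delta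 r})^3(1+(\frac Ar)^{\frac{2-2\alpha}{2\alpha-1}})\big)$, $\epsilon_0=O\big((\frac1A)^{\frac{1-\alpha}\alpha}\big)$; * (geometric Tsybakov) $b_j=\tilde\Theta(\min(r,Br^{1/\alpha}))$, $T_j=\tilde O\big(s\ln d\,(\ln\frac1{\delta r})^3(1+\frac1{B^2}(\frac1r)^{\frac{2-2\alpha}\alpha})\big)$, $\epsilon_0=O(B)$, such that for every $\epsilon\in(0,1)$ and every $D,w^\star$ as above satisfying the noise condition, with probability at least $1-\delta$ the output satisfies $\mathrm{err}(h_{\tilde v},D)-\mathrm{err}(h_{w^\star},D)\le\epsilon$, and the total number of label queries is at most 1. $\tilde O\big(\frac{s}{(1-2\eta)^2}\big)$ under $\eta$-Massart noise, that is, at most $C\frac{s}{(1-2\eta)^2}\big(\ln\frac{d}{\epsilon\delta(1-2\eta)}\big)^k$; 2. $\tilde O\big(s\,(1+A^{\frac{2-2\alpha}{\alpha(2\alpha-1)}}+(\frac A\epsilon)^{\frac{2-2\alpha}{2\alpha-1}})\big)$ under $(A,\alpha)$-Tsybakov noise with $\alpha\in(\frac12,1]$; 3. $\tilde O\big(s\,(1+(\frac1B)^{\frac2\alpha}+\frac1{B^2}(\frac1\epsilon)^{\frac{2-2\alpha}\alpha})\big)$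 under $(B,\alpha)$-geometric Tsybakov noise. -/

import Mathlib

open MeasureTheory ProbabilityTheory

noncomputable section

namespace SparseHalfspace

/-- The instance space `ℝ^d`; `‖·‖` is the Euclidean norm. -/
abbrev Pt (d : ℕ) : Type := EuclideanSpace ℝ (Fin d)

/-- A labelled example; the label `true` stands for `+1` and `false` for `-1`. -/
abbrev Ex (d : ℕ) : Type := Pt d × Bool

/-- The numerical value `±1` of a label. -/
def sgn (y : Bool) : ℝ := if y then 1 else -1

/-- The halfspace classifier `h_w(x) = sign ⟨w, x⟩`. -/
def halfspace {d : ℕ} (w x : Pt d) : Bool := decide (0 ≤ inner ℝ w x)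

/-- The error rate `err(h_w, D)`. -/
def err {d : ℕ} (w : Pt d) (D : Measure (Ex d)) : ℝ := D.real {z | halfspace w z.1 ≠ z.2}

/-- `w` has at most `s` nonzero entries. -/
def IsSparse {d : ℕ} (s : ℕ) (w : Pt d) : Prop := {i : Fin d | w i ≠ 0}.ncard ≤ s

/-! ### Assumptions on the data distribution -/

/-- `(2, L, R, U, β)`-well-behaved distributions on `ℝ^d`. A pair of orthonormal vectors `v` is an
orthonormal basis of a two-dimensional subspace. -/
def WellBehaved {d : ℕ} (L R U β : ℝ) (μ : Measure (Pt d)) : Prop :=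
  (∀ v : Fin 2 → Pt d, Orthonormal ℝ v →
    ∃ p : Pt 2 → ℝ, Measurable p ∧ (∀ z, 0 ≤ p z) ∧
      μ.map (fun x => (WithLp.toLp 2 (fun i => inner ℝ (v i) x) : Pt 2)) =
        volume.withDensity (fun z => ENNReal.ofReal (p z)) ∧
      (∀ z, ‖z‖ ≤ R → L ≤ p z) ∧ ∀ z, p z ≤ U) ∧
  ∀ w : Pt d, ‖w‖ = 1 → ∀ t : ℝ, 0 < t → μ.real {x | t ≤ |inner ℝ w x|} ≤ Real.exp (1 - t / β)

/-- `η(x) = P_D(y ≠ sign ⟨w⋆, x⟩ | x)`, through the regular conditional law of `y` given `x`. -/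
def noiseRate {d : ℕ} (D : Measure (Ex d)) [IsFiniteMeasure D] (wstar x : Pt d) : ℝ :=
  (D.condKernel x).real {y | y ≠ halfspace wstar x}

/-- `η`-Massart noise. -/
def Massart {d : ℕ} (η : ℝ) (D : Measure (Ex d)) [IsFiniteMeasure D] (wstar : Pt d) : Prop :=
  ∀ᵐ x ∂D.fst, noiseRate D wstar x ≤ η

/-- `(A, α)`-Tsybakov noise. For `α = 1` the exponent `α / (1 - α)` is `∞`, and `t ^ ∞ = 0` for
`0 ≤ t < 1/2`. -/
def Tsybakov {d : ℕ} (A α : ℝ) (D : Measure (Ex d)) [IsFiniteMeasure D] (wstar : Pt d) : Prop :=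
  ∀ t : ℝ, 0 ≤ t → t < 1 / 2 →
    D.fst.real {x | 1 / 2 - noiseRate D wstar x ≤ t} ≤
      if α = 1 then 0 else A * t ^ (α / (1 - α))

/-- `(B, α)`-geometric Tsybakov noise. -/
def GeomTsybakov {d : ℕ} (B α : ℝ) (D : Measure (Ex d)) [IsFiniteMeasure D] (wstar : Pt d) :
    Prop :=
  ∀ᵐ x ∂D.fst,
    min (1 / 2) (B * |inner ℝ wstar x| ^ ((1 - α) / α)) ≤ 1 / 2 - noiseRate D wstar x

/-! ### Parameters, schedules and the randomness used by the algorithm -/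

/-- The scalar parameters known to the algorithm. -/
structure Param where
  s : ℕ
  L : ℝ
  R : ℝ
  U : ℝ
  β : ℝ
  δ : ℝ

/-- Bandwidths `b_j`, iteration numbers `T_j`, the initial target excess error `ε₀`, and the number
`m` of labelled examples drawn in the second stage of the initialization. -/
structure Schedule where
  b : ℕ → ℝ
  T : ℕ → ℕ+
  eps0 : ℝ
  m : ℕ+

/-- The places of the algorithm at which the example oracle is called: iteration `t` of the `j`-th
call of `optimize` in trial `i` of the initialization, the labelled sample in the second stage of
the initialization, and iteration `t` of the `j`-th call of `optimize` by the main loop. -/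
inductive Site where
  | init (i j t : ℕ)
  | holdout
  | refine (j t : ℕ)

/-- An outcome of all the randomness: the `n`-th example returned by the example oracle at each
place, together with the label that the labelling oracle would return for it, and, for each trial
of the initialization, the index and the random sign used by the random aggregation. -/
abbrev Outcome (d : ℕ) (S : Schedule) : Type :=
  (Site × ℕ → Ex d) × (ℕ → Fin (S.T 0) × Bool)

/-- The law of the randomness: all examples are i.i.d. from `D`, and the internal coins are
independent and uniform. -/
def law {d : ℕ} (S : Schedule) (D : Measure (Ex d)) : Measure (Outcome d S) :=
  (Measure.infinitePi fun _ : Site × ℕ => D).prod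
    (Measure.infinitePi fun _ : ℕ => (PMF.uniformOfFintype (Fin (S.T 0) × Bool)).toMeasure)

/-! ### The procedure `optimize` -/

/-- The `ℓ₂`-normalization `ŵ`, with the convention that the normalization of `0` is the first
basis vector. -/
def hat {d : ℕ} (w : Pt d) : Pt d :=
  open Classical in
  if w = 0 then WithLp.toLp 2 (fun i => if (i : ℕ) = 0 then 1 else 0) else ‖w‖⁻¹ • w

/-- Hard thresholding: keep the `s` entries of `w` that are largest in absolute value (of two
entries of the same absolute value, the one with the smaller index counts as the larger) and zero
out all the others. -/
def hardThreshold {d : ℕ} (s : ℕ) (w : Pt d) : Pt d :=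
  open Classical in
  WithLp.toLp 2 fun i =>
    if {j : Fin d | |w i| < |w j| ∨ (|w j| = |w i| ∧ j < i)}.ncard < s then w i else 0

/-- `p = ln d / (ln d - 1)`. -/
def pExp (d : ℕ) : ℝ := Real.log d / (Real.log d - 1)

/-- The `ℓ_p` norm. -/
def pNorm {d : ℕ} (p : ℝ) (w : Pt d) : ℝ := (∑ i, |w i| ^ p) ^ (1 / p)

/-- The regularizer `w ↦ ‖w - c‖_p² / (2 (p - 1))`. -/
def regularizer {d : ℕ} (c w : Pt d) : ℝ :=
  1 / (2 * (pExp d - 1)) * pNorm (pExp d) (w - c) ^ 2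

/-- The Bregman divergence `D_F(u, v) = F(u) - F(v) - ⟨∇F(v), u - v⟩`. -/
def bregman {d : ℕ} (F : Pt d → ℝ) (u v : Pt d) : ℝ := F u - F v - fderiv ℝ F v (u - v)

/-- A minimizer of `f` on `K`; the value `w₀` if there is none. -/
def argminOn {d : ℕ} (K : Set (Pt d)) (f : Pt d → ℝ) (w₀ : Pt d) : Pt d :=
  open Classical in
  if h : ∃ w ∈ K, ∀ w' ∈ K, f w ≤ f w' then h.choose else w₀

/-- The constraint set `{w : ‖w - w₁‖ ≤ 4 r, ‖w - HT_s(w₁)‖₁ ≤ 8 r √(2 s)}`. -/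
def feasible {d : ℕ} (s : ℕ) (r : ℝ) (w₁ : Pt d) : Set (Pt d) :=
  {w | ‖w - w₁‖ ≤ 4 * r ∧ ∑ i, |w i - hardThreshold s w₁ i| ≤ 8 * r * √(2 * s)}

/-- The step size of `optimize`. -/
def stepSize (d : ℕ) (P : Param) (r b : ℝ) (T : ℕ) : ℝ :=
  r / P.β * √(P.s * Real.log d / T) / Real.log (T * d / (P.δ * r * b * P.R * P.L))

/-- Rejection sampling from the band `{x : |⟨ŵ, x⟩| ≤ b}` with `ŵ` the normalization of `u`: the
first example of the stream `z` that falls into the band. Only the label of this example is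
queried. (If no example falls into the band, the first one of the stream is taken; this is an event
of probability zero whenever the band has positive probability.) -/
def sampleBand {d : ℕ} (b : ℝ) (u : Pt d) (z : ℕ → Ex d) : Ex d :=
  z (sInf {n | |inner ℝ (hat u) (z n).1| ≤ b})

/-- The state of `optimize` after `t` iterations: the iterate `u_{t+1}` and the number of label
queries made so far. Here `z t n` is the `n`-th example returned by the example oracle in
iteration `t`. Each iteration queries one label and makes one step of online mirror descent with
`g = - y x`. -/
def optimizeState {d : ℕ} (P : Param) (w₁ : Pt d) (r b : ℝ) (T : ℕ) (z : ℕ → ℕ → Ex d) :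
    ℕ → Pt d × ℕ
  | 0 => (hardThreshold P.s w₁, 0)
  | t + 1 =>
    let (u, q) := optimizeState P w₁ r b T z t
    let (x, y) := sampleBand b u (z t)
    let g : Pt d := -(sgn y • x)
    (argminOn (feasible P.s r w₁)
      (fun w => stepSize d P r b T * inner ℝ w g +
        bregman (regularizer (hardThreshold P.s w₁)) w u) u, q + 1)

/-- The aggregation modes; the random mode carries the outcomes of its two coins. -/
inductive Agg where
  | average
  | random (τ : ℕ) (σ : Bool)

/-- The procedure `optimize`: its output vector and the number of its label queries. -/
def optimize {d : ℕ} (P : Param) (w₁ : Pt d) (r b : ℝ) (T : ℕ) (agg : Agg)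
    (z : ℕ → ℕ → Ex d) : Pt d × ℕ :=
  let st := optimizeState P w₁ r b T z
  (match agg with
    | .average => (1 / (T : ℝ)) • ∑ t ∈ Finset.range T, hat (st t).1
    | .random τ σ => sgn σ • hat (st τ).1,
   (st T).2)

/-! ### Initialization and the main algorithm -/

/-- The number of iterations `⌈log₄ (1 / r₀)⌉` of a trial of the initialization. -/
def k0 (P : Param) (S : Schedule) : ℕ :=
  ⌈Real.logb 4 (1 / (S.eps0 / (64 * P.U * P.β ^ 2 * Real.log (24 / S.eps0) ^ 2)))⌉₊

/-- The number `⌈10 ln (4 / δ)⌉` of trials of the initialization. -/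
def trials (P : Param) : ℕ := ⌈10 * Real.log (4 / P.δ)⌉₊

/-- Trial `i` of the first stage of the initialization: the vector `v_{i,j}` and the number of label
queries made by the trial so far. -/
def trial {d : ℕ} (P : Param) (S : Schedule) (ω : Outcome d S) (i : ℕ) : ℕ → Pt d × ℕ
  | 0 => (0, 0)
  | j + 1 =>
    let (v, q) := trial P S ω i j
    let agg : Agg := if j = 0 then .random (ω.2 i).1 (ω.2 i).2 else .average
    let (v', q') := optimize P v (1 / 4 ^ (j + 1)) (S.b j) (S.T j) agg
      (fun t n => ω.1 (.init i j t, n))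
    (v', q + q')

/-- The empirical error rate of `h_u` on the labelled sample `z 0, …, z (m - 1)`. -/
def empErr {d : ℕ} (m : ℕ) (u : Pt d) (z : ℕ → Ex d) : ℝ :=
  (1 / (m : ℝ)) * ∑ n ∈ Finset.range m, if halfspace u (z n).1 ≠ (z n).2 then 1 else 0

/-- The procedure `initProc`: the normalization of the candidate of smallest empirical error (the
first one in case of ties), and the number of label queries in both stages. -/
def initProc {d : ℕ} (P : Param) (S : Schedule) (ω : Outcome d S) : Pt d × ℕ :=
  let cand : ℕ → Pt d := fun i => (trial P S ω i (k0 P S + 1)).1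
  let e : ℕ → ℝ := fun i => empErr S.m (cand i) (fun n => ω.1 (.holdout, n))
  let best : ℕ := sInf {i | i < trials P ∧ ∀ i' < trials P, e i ≤ e i'}
  (hat (cand best),
    ∑ i ∈ Finset.range (trials P), (trial P S ω i (k0 P S + 1)).2 + S.m)

/-- The number `k_ε = ⌈log₄ (1 / r_ε)⌉` of iterations of the main loop. -/
def kEps (P : Param) (ε : ℝ) : ℕ :=
  ⌈Real.logb 4 (1 / (ε / (32 * P.U * P.β ^ 2 * Real.log (12 / ε) ^ 2)))⌉₊

/-- The vector `v_{j+1}` after `j` iterations of the main loop, and the total number of label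
queries made so far. -/
def refineState {d : ℕ} (P : Param) (S : Schedule) (ω : Outcome d S) : ℕ → Pt d × ℕ
  | 0 => initProc P S ω
  | i + 1 =>
    let j := i + 1
    let (v, q) := refineState P S ω i
    let (v', q') := optimize P v (1 / 4 ^ (j + 1)) (S.b j) (S.T j) .average
      (fun t n => ω.1 (.refine j t, n))
    (v', q + q')

/-- The attribute-efficient active learning algorithm with target excess error `ε`: the output
vector and the total number of label queries. -/
def algorithm {d : ℕ} (P : Param) (S : Schedule) (ε : ℝ) (ω : Outcome d S) : Pt d × ℕ :=
  refineState P S ω (kEps P ε)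

/-! ### Parameter settings and the guarantee

Throughout, `C` and `k` are the constant and the exponent of the logarithm that are hidden in
`Õ` and `Θ̃`. -/

/-- `4^{-(j+1)}`, the target proximity of the `j`-th call of `optimize`. -/
def prox (j : ℕ) : ℝ := 1 / 4 ^ (j + 1)

/-- `a = Θ̃(f)`, where `Λ` is the logarithm. -/
def ThetaTilde (C : ℝ) (k : ℕ) (Λ a f : ℝ) : Prop :=
  f / (C * Λ ^ k) ≤ a ∧ a ≤ C * f * Λ ^ k

/-- `ε₀ ∈ (0, 1]` and `m = O(ε₀⁻² ln (N / δ))`. -/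
def ValidHoldout (C : ℝ) (P : Param) (S : Schedule) : Prop :=
  0 < S.eps0 ∧ S.eps0 ≤ 1 ∧
    (S.m : ℝ) ≤ C * (1 / S.eps0 ^ 2 * Real.log (trials P / P.δ))

/-- The parameter setting under `η`-Massart noise. -/
def MassartSchedule (C : ℝ) (k d : ℕ) (P : Param) (η : ℝ) (S : Schedule) : Prop :=
  (∀ j, ThetaTilde C k (Real.log (d / (P.δ * prox j * (1 - 2 * η)))) (S.b j)
      ((1 - 2 * η) * prox j) ∧
    (S.T j : ℝ) ≤ C * (P.s * Real.log d * (1 / (1 - 2 * η) ^ 2) *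
        Real.log (1 / (P.δ * prox j)) ^ 3) *
      Real.log (d / (P.δ * prox j * (1 - 2 * η))) ^ k) ∧
  S.eps0 ≤ C * (1 - 2 * η) ∧ ValidHoldout C P S

/-- The parameter setting under `(A, α)`-Tsybakov noise. -/
def TsybakovSchedule (C : ℝ) (k d : ℕ) (P : Param) (A α : ℝ) (S : Schedule) : Prop :=
  (∀ j, ThetaTilde C k (Real.log (d * (1 + A) / (P.δ * prox j))) (S.b j)
      (min (prox j)
        ((1 / A) ^ ((1 - α) / (2 * α - 1)) * prox j ^ (α / (2 * α - 1)))) ∧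
    (S.T j : ℝ) ≤ C * (P.s * Real.log d * Real.log (1 / (P.δ * prox j)) ^ 3 *
        (1 + (A / prox j) ^ ((2 - 2 * α) / (2 * α - 1)))) *
      Real.log (d * (1 + A) / (P.δ * prox j)) ^ k) ∧
  S.eps0 ≤ C * (1 / A) ^ ((1 - α) / α) ∧ ValidHoldout C P S

/-- The parameter setting under `(B, α)`-geometric Tsybakov noise. -/
def GeomTsybakovSchedule (C : ℝ) (k d : ℕ) (P : Param) (B α : ℝ) (S : Schedule) : Prop :=
  (∀ j, ThetaTilde C k (Real.log (d * (1 + 1 / B) / (P.δ * prox j))) (S.b j)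
      (min (prox j) (B * prox j ^ (1 / α))) ∧
    (S.T j : ℝ) ≤ C * (P.s * Real.log d * Real.log (1 / (P.δ * prox j)) ^ 3 *
        (1 + 1 / B ^ 2 * (1 / prox j) ^ ((2 - 2 * α) / α))) *
      Real.log (d * (1 + 1 / B) / (P.δ * prox j)) ^ k) ∧
  S.eps0 ≤ C * B ∧ ValidHoldout C P S

/-- For every target `ε ∈ (0, 1)` and every distribution `D` that is well-behaved and satisfies the
noise condition with respect to an `s`-sparse unit vector `w⋆`: the probability that the output of
the algorithm has excess error larger than `ε` is at most `δ`, and the number of label queries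
never exceeds `bound ε`. -/
def Guarantee (d : ℕ) (P : Param) (S : Schedule)
    (Noise : (D : Measure (Ex d)) → [IsFiniteMeasure D] → Pt d → Prop) (bound : ℝ → ℝ) : Prop :=
  ∀ ε : ℝ, 0 < ε → ε < 1 → ∀ (D : Measure (Ex d)) [IsProbabilityMeasure D] (wstar : Pt d),
    ‖wstar‖ = 1 → IsSparse P.s wstar → WellBehaved P.L P.R P.U P.β D.fst → Noise D wstar →
      law S D {ω | ε < err (algorithm P S ε ω).1 D - err wstar D} ≤ ENNReal.ofReal P.δ ∧
      ∀ ω : Outcome d S, ((algorithm P S ε ω).2 : ℝ) ≤ bound ε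

end SparseHalfspace

end

noncomputable section

namespace SparseHalfspace

/-! ### Uniform convexity of the `ℓ_p` norm -/

/-! One call of `optimize` runs online mirror descent on the linear losses `-y⟨u, x⟩`, with examples
drawn from a thin band around the hyperplane of the current iterate. Two estimates of the sum of
`y_t⟨w⋆, x_t⟩` are played against each other.

Upper estimate: in the band `|⟨u_t, x_t⟩| ≤ 3b`, so the sum is at most `3bT` plus the regret against
`w⋆`. The regularizer is strongly convex in `ℓ_p` (`bregman_regularizer_ge`, from the
Ball–Carlen–Lieb inequality), the gradients are only of logarithmic size in `ℓ_∞`, and the choice of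
`p` makes `ℓ_∞` dual to `ℓ_p` up to the factor `e`. Since `w⋆` is sparse, it lies in an `ℓ_1` ball
of radius of order `r√s` around the start, so `regret_le` depends on the dimension only through
logarithms.

Lower estimate: write `w⋆ = c û_t + σ_t e` with `e ⊥ û_t` a unit vector. On a constant fraction of
the band, up to logarithms, `⟨e, x⟩` is of constant size, so `|⟨w⋆, x⟩|` is at least a constant
times `σ_t`. The conditional mean of `y⟨w⋆, x⟩` is the mean of `(1 - 2η(x))|⟨w⋆, x⟩|`, hence at
least a constant times `γ(σ_t - r/20)` (`drift_le_integral_score`), where `γ` is an average noise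
margin (`MarginBound`). An exponential supermartingale for the truncated scores transfers this to
the sum. Comparing both, `iterates_close` shows that the average of the `σ_t` is at most `r/10` with
probability at least `1 - δr`.

From a start within `4r` of `w⋆` with `r ≤ 1/16`, all iterates make an acute angle with `w⋆`, so
small `σ_t` means small distance and the averaged output is within `r` (`optimize_average_close`).
Each stage shrinks the radius by four, and the failure probabilities form a geometric series
(`law_chain_le`). The very first call starts from `0` and determines only the line through `w⋆`; a
random index and sign then succeed with constant probability (`card_bad_coins_le`). Among
logarithmically many trials one is good, and the empirical error finds a good one, because a
direction farther than `1/4` from `w⋆` has excess error at least `ε₀` (`initProc_close`).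

Adaptivity is handled by resampling: the coordinates that a stage reads are replaced by an
independent copy, which freezes everything determined before it (`law_le_of_resample`,
`lintegral_adaptive_step`). This requires the whole algorithm to be measurable, in particular the
choice of minimizers (`measurable_argminOn`).

The noise conditions enter through a single factor `g(r)`: the bandwidth is `g(r)r` and the number
of rounds `s ln d / g(r)²`, up to logarithms. `exists_schedule` treats all factors at once under
`NoiseInterface`; each noise condition supplies its `g`, the margin bound, and the comparison of the
cost of the initialization with the claimed label bound. -/

lemma rpow_sub_rpow_ge {s t : ℝ} (hs0 : 0 < s) (hs1 : s < 1) (ht0 : 0 ≤ t) (ht1 : t ≤ 1) :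
    2 * s * t ≤ (1 + t) ^ s - (1 - t) ^ s := by
  let h : ℝ → ℝ := fun t => (1 + t) ^ s - (1 - t) ^ s - 2 * s * t
  have hmono : MonotoneOn h (Set.Icc 0 1) := by
    apply monotoneOn_of_deriv_nonneg (convex_Icc 0 1)
    · apply ContinuousOn.sub
      · apply ContinuousOn.sub
        · exact ContinuousOn.rpow_const (by fun_prop) (fun x hx => Or.inr hs0.le)
        · exact ContinuousOn.rpow_const (by fun_prop) (fun x hx => Or.inr hs0.le)
      · fun_prop
    · intro x hx
      rw [interior_Icc] at hx
      have h1 : (1 + x) ≠ 0 := by linarith [hx.1]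
      have h2 : (1 - x) ≠ 0 := by linarith [hx.2]
      fun_prop (disch := simp [h1, h2])
    · intro x hx
      rw [interior_Icc] at hx
      have h1 : 0 < 1 + x := by linarith [hx.1]
      have h2 : 0 < 1 - x := by linarith [hx.2]
      have d1 : HasDerivAt (fun t : ℝ => (1 + t) ^ s) (1 * s * (1 + x) ^ (s - 1)) x :=
        ((hasDerivAt_id x).const_add 1).rpow_const (Or.inl h1.ne')
      have d2 : HasDerivAt (fun t : ℝ => (1 - t) ^ s) (-1 * s * (1 - x) ^ (s - 1)) x :=
        ((hasDerivAt_id x).const_sub 1).rpow_const (Or.inl h2.ne')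
      have d3 : HasDerivAt (fun t : ℝ => 2 * s * t) (2 * s * 1) x :=
        (hasDerivAt_id x).const_mul _
      have d : HasDerivAt h _ x := (d1.sub d2).sub d3
      rw [d.deriv]
      set A := (1 + x) ^ (s - 1)
      set B := (1 - x) ^ (s - 1)
      have hA : 0 < A := Real.rpow_pos_of_pos h1 _
      have hB : 0 < B := Real.rpow_pos_of_pos h2 _
      -- The product is `(1 - x²)^(s-1)` with a negative exponent, so AM–GM gives `A + B ≥ 2`, which
      -- is the sign of the derivative.
      have hAB : 1 ≤ A * B := by
        rw [← Real.mul_rpow h1.le h2.le]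
        apply Real.one_le_rpow_of_pos_of_le_one_of_nonpos
        · positivity
        · nlinarith [hx.1]
        · linarith
      have : 2 ≤ A + B := by nlinarith [sq_nonneg (A - B)]
      nlinarith
  have := hmono (Set.left_mem_Icc.2 zero_le_one) ⟨ht0, ht1⟩ ht0
  simp only [h] at this
  norm_num at this
  linarith

/-- Both sides agree at `0`, and the comparison of their derivatives is `rpow_sub_rpow_ge` with
exponent `p - 1`. -/
lemma one_add_sq_le_rpow_mean {p t : ℝ} (hp1 : 1 < p) (hp2 : p < 2) (ht0 : 0 ≤ t) (ht1 : t ≤ 1) :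
    1 + p * (p - 1) / 2 * t ^ 2 ≤ ((1 + t) ^ p + (1 - t) ^ p) / 2 := by
  let h : ℝ → ℝ := fun t => ((1 + t) ^ p + (1 - t) ^ p) / 2 - p * (p - 1) / 2 * t ^ 2
  have dd : ∀ x, HasDerivAt h ((1 * p * (1 + x) ^ (p - 1) + -1 * p * (1 - x) ^ (p - 1)) / 2
      - p * (p - 1) / 2 * (2 * x)) x := by
    intro x
    have d1 : HasDerivAt (fun t : ℝ => (1 + t) ^ p) (1 * p * (1 + x) ^ (p - 1)) x :=
      ((hasDerivAt_id x).const_add 1).rpow_const (Or.inr hp1.le)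
    have d2 : HasDerivAt (fun t : ℝ => (1 - t) ^ p) (-1 * p * (1 - x) ^ (p - 1)) x :=
      ((hasDerivAt_id x).const_sub 1).rpow_const (Or.inr hp1.le)
    have d3 : HasDerivAt (fun t : ℝ => p * (p - 1) / 2 * t ^ 2) (p * (p - 1) / 2 * (2 * x)) x := by
      simpa using (hasDerivAt_pow 2 x).const_mul (p * (p - 1) / 2)
    exact ((d1.add d2).div_const 2).sub d3
  have hmono : MonotoneOn h (Set.Icc 0 1) := by
    apply monotoneOn_of_deriv_nonneg (convex_Icc 0 1)
    · exact fun x _ => (dd x).continuousAt.continuousWithinAt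
    · exact fun x _ => (dd x).differentiableAt.differentiableWithinAt
    · intro x hx
      rw [interior_Icc] at hx
      rw [(dd x).deriv]
      have := rpow_sub_rpow_ge (s := p - 1) (by linarith) (by linarith) hx.1.le hx.2.le
      nlinarith
  have := hmono (Set.left_mem_Icc.2 zero_le_one) ⟨ht0, ht1⟩ ht0
  simp only [h] at this
  norm_num at this
  linarith

/-- The two-point inequality behind the uniform convexity of `ℓ_p`. -/
lemma two_point_inequality {p : ℝ} (hp1 : 1 < p) (hp2 : p < 2) (a b : ℝ) :
    (a ^ 2 + (p - 1) * b ^ 2) ^ (p / 2) ≤ (|a + b| ^ p + |a - b| ^ p) / 2 := by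
  have key : ∀ a b : ℝ, 0 ≤ b → b ≤ a →
      (a ^ 2 + (p - 1) * b ^ 2) ^ (p / 2) ≤ (|a + b| ^ p + |a - b| ^ p) / 2 := by
    intro a b hb hab
    rcases (hb.trans hab).eq_or_lt with h0 | ha
    · have : b = 0 := by linarith
      subst this; subst h0
      simp [show p / 2 ≠ 0 by linarith, show p ≠ 0 by linarith]
    have ht1 : b / a ≤ 1 := (div_le_one ha).2 hab
    have ht0 : 0 ≤ b / a := by positivity
    set t := b / a with ht
    have hbt : b = a * t := by rw [ht]; field_simp
    have e1 : a ^ 2 + (p - 1) * b ^ 2 = a ^ 2 * (1 + (p - 1) * t ^ 2) := by rw [hbt]; ring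
    have hsq : 0 ≤ (p - 1) * t ^ 2 := mul_nonneg (by linarith) (sq_nonneg _)
    have e2 : (a ^ 2 : ℝ) ^ (p / 2) = a ^ p := by
      rw [← Real.rpow_natCast, ← Real.rpow_mul ha.le]; congr 1; push_cast; ring
    rw [e1, Real.mul_rpow (by positivity) (by linarith), e2,
      abs_of_nonneg (by linarith), abs_of_nonneg (by linarith),
      show a + b = a * (1 + t) by rw [hbt]; ring, show a - b = a * (1 - t) by rw [hbt]; ring,
      Real.mul_rpow ha.le (by linarith), Real.mul_rpow ha.le (by linarith)]
    -- Bernoulli's inequality with exponent `p / 2 ≤ 1` produces exactly the quadratic polynomial of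
    -- `one_add_sq_le_rpow_mean`.
    have h1 := rpow_one_add_le_one_add_mul_self (s := (p - 1) * t ^ 2) (by linarith)
      (p := p / 2) (by linarith) (by linarith)
    have h2 := one_add_sq_le_rpow_mean hp1 hp2 ht0 ht1
    have hap : 0 < a ^ p := Real.rpow_pos_of_pos ha _
    nlinarith
  have key2 : ∀ a b : ℝ, 0 ≤ a → 0 ≤ b →
      (a ^ 2 + (p - 1) * b ^ 2) ^ (p / 2) ≤ (|a + b| ^ p + |a - b| ^ p) / 2 := by
    intro a b ha hb
    rcases le_total b a with h | h
    · exact key a b hb h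
    -- The right-hand side is symmetric in `a` and `b`; since `p - 1 ≤ 1`, exchanging them so that
    -- the larger one has coefficient `1` only increases the left-hand side.
    · have := key b a ha h
      rw [add_comm b a, abs_sub_comm b a] at this
      refine le_trans (Real.rpow_le_rpow ?_ ?_ (by linarith)) this
      · nlinarith [sq_nonneg a, sq_nonneg b]
      · have : a ^ 2 ≤ b ^ 2 := by gcongr
        nlinarith
  have h := key2 |a| |b| (abs_nonneg _) (abs_nonneg _)
  simp only [sq_abs] at h
  have h3 : (|(|a| + |b|)| ^ p + |(|a| - |b|)| ^ p) = |a + b| ^ p + |a - b| ^ p := by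
    rcases abs_cases a with ⟨h1, _⟩ | ⟨h1, _⟩ <;> rcases abs_cases b with ⟨h2, _⟩ | ⟨h2, _⟩ <;>
      rw [h1, h2]
    · rw [← sub_eq_add_neg, sub_neg_eq_add, add_comm]
    · rw [show -a + b = -(a - b) by ring, show -a - b = -(a + b) by ring, abs_neg, abs_neg,
        add_comm]
    · rw [show -a + -b = -(a + b) by ring, show -a - -b = -(a - b) by ring, abs_neg, abs_neg]
  rwa [h3] at h

/-- This is the triangle inequality in the `ℓ_q` norm of the plane for the vectors `(f i, g i)`,
added one at a time. -/
lemma rpow_sum_add_rpow_sum_le {ι : Type*} (s : Finset ι) {q : ℝ} (hq : 1 ≤ q) (f g : ι → ℝ)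
    (hf : ∀ i, 0 ≤ f i) (hg : ∀ i, 0 ≤ g i) :
    ((∑ i ∈ s, f i) ^ q + (∑ i ∈ s, g i) ^ q) ^ (1 / q) ≤
      ∑ i ∈ s, (f i ^ q + g i ^ q) ^ (1 / q) := by
  classical
  induction s using Finset.induction_on with
  | empty => simp [show q ≠ 0 by linarith]
  | insert a s ha ih =>
    rw [Finset.sum_insert ha, Finset.sum_insert ha, Finset.sum_insert ha]
    have := Real.Lp_add_le_of_nonneg (Finset.univ : Finset (Fin 2)) (p := q)
      (f := ![f a, g a]) (g := ![∑ i ∈ s, f i, ∑ i ∈ s, g i]) hq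
      (by intro i _; fin_cases i <;> simp [hf, hg])
      (by intro i _; fin_cases i <;> simp [Finset.sum_nonneg, hf, hg])
    simp only [Fin.sum_univ_two, Matrix.cons_val_zero, Matrix.cons_val_one] at this
    linarith

/-! ### The `ℓ_p` norm on `ℝ^d`: uniform convexity, smoothness of its square, comparison with `ℓ_1`.
-/

section pNorm
variable {d : ℕ} {p : ℝ}

lemma pNorm_nonneg (x : Pt d) : 0 ≤ pNorm p x :=
  Real.rpow_nonneg (Finset.sum_nonneg fun _ _ => Real.rpow_nonneg (abs_nonneg _) _) _

lemma pNorm_rpow (hp : 1 < p) (x : Pt d) : pNorm p x ^ p = ∑ i, |x i| ^ p := by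
  rw [pNorm, ← Real.rpow_mul (Finset.sum_nonneg fun _ _ => Real.rpow_nonneg (abs_nonneg _) _),
    one_div_mul_cancel (by linarith), Real.rpow_one]

lemma pNorm_smul (hp : 1 < p) (c : ℝ) (x : Pt d) : pNorm p (c • x) = |c| * pNorm p x := by
  have h0 : 0 ≤ ∑ i, |x i| ^ p :=
    Finset.sum_nonneg fun _ _ => Real.rpow_nonneg (abs_nonneg _) _
  unfold pNorm
  simp only [PiLp.smul_apply, smul_eq_mul, abs_mul]
  simp_rw [Real.mul_rpow (abs_nonneg c) (abs_nonneg _)]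
  rw [← Finset.mul_sum, Real.mul_rpow (Real.rpow_nonneg (abs_nonneg _) _) h0,
    ← Real.rpow_mul (abs_nonneg _), mul_one_div_cancel (by linarith), Real.rpow_one]

lemma pNorm_zero (hp : 1 < p) : pNorm p (0 : Pt d) = 0 := by
  have := pNorm_smul (d := d) hp 0 0
  simpa using this

lemma pNorm_pos (hp : 1 < p) {x : Pt d} (hx : x ≠ 0) : 0 < pNorm p x := by
  rcases (pNorm_nonneg (p := p) x).eq_or_lt with h | h
  · exfalso
    apply hx
    have h1 := pNorm_rpow hp x
    rw [← h, Real.zero_rpow (by linarith)] at h1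
    ext i
    have := (Finset.sum_eq_zero_iff_of_nonneg
      (fun i _ => Real.rpow_nonneg (abs_nonneg (x i)) p)).1 h1.symm i (Finset.mem_univ i)
    have h2 := (Real.rpow_eq_zero (abs_nonneg _) (by linarith)).1 this
    simpa using h2
  · exact h

/-- The Ball–Carlen–Lieb inequality in `ℓ_p`, `1 < p < 2`. -/
lemma pNorm_uniform_convexity (hp1 : 1 < p) (hp2 : p < 2) (x y : Pt d) :
    pNorm p x ^ 2 + (p - 1) * pNorm p y ^ 2 ≤
      (pNorm p (x + y) ^ 2 + pNorm p (x - y) ^ 2) / 2 := by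
  have hp0 : 0 < p := by linarith
  have hq : 1 ≤ 2 / p := by rw [le_div_iff₀ hp0]; linarith
  have hpm : 0 ≤ p - 1 := by linarith
  set c := √(p - 1) with hc
  have hc0 : 0 ≤ c := Real.sqrt_nonneg _
  have hc2 : c ^ 2 = p - 1 := Real.sq_sqrt hpm
  have epow : ∀ u : ℝ, 0 ≤ u → (u ^ p) ^ (2 / p) = u ^ 2 := by
    intro u hu
    rw [← Real.rpow_mul hu, mul_div_cancel₀ _ hp0.ne']
    exact Real.rpow_two u
  -- Minkowski with exponent `2 / p ≥ 1` moves the squares inside the sum over coordinates. With `c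
  -- = √(p - 1)`, each summand is then a case of the two-point inequality.
  have h1 := rpow_sum_add_rpow_sum_le (Finset.univ : Finset (Fin d)) hq
    (fun i => |x i| ^ p) (fun i => |(c • y) i| ^ p)
    (fun i => Real.rpow_nonneg (abs_nonneg _) _) (fun i => Real.rpow_nonneg (abs_nonneg _) _)
  rw [← pNorm_rpow hp1, ← pNorm_rpow hp1, epow _ (pNorm_nonneg _), epow _ (pNorm_nonneg _),
    pNorm_smul hp1, abs_of_nonneg hc0, mul_pow, hc2, one_div_div] at h1
  have h2 : ∑ i, ((|x i| ^ p) ^ (2 / p) + (|(c • y) i| ^ p) ^ (2 / p)) ^ (p / 2) ≤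
      (pNorm p (x + y) ^ p + pNorm p (x - y) ^ p) / 2 := by
    rw [pNorm_rpow hp1, pNorm_rpow hp1, ← Finset.sum_add_distrib, Finset.sum_div]
    apply Finset.sum_le_sum
    intro i _
    rw [epow _ (abs_nonneg _), epow _ (abs_nonneg _)]
    simp only [PiLp.smul_apply, smul_eq_mul, sq_abs, mul_pow, hc2, PiLp.add_apply, PiLp.sub_apply]
    exact two_point_inequality hp1 hp2 _ _
  set A := pNorm p (x + y)
  set B := pNorm p (x - y)
  have hA : 0 ≤ A := pNorm_nonneg _
  have hB : 0 ≤ B := pNorm_nonneg _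
  -- Power means: `t ↦ t^(2/p)` is convex.
  have h3 : ((A ^ p + B ^ p) / 2) ^ (2 / p) ≤ (A ^ 2 + B ^ 2) / 2 := by
    have := (convexOn_rpow hq).2 (Real.rpow_nonneg hA p) (Real.rpow_nonneg hB p)
      (show (0 : ℝ) ≤ 1 / 2 by norm_num) (show (0 : ℝ) ≤ 1 / 2 by norm_num) (by norm_num)
    simp only [smul_eq_mul] at this
    rw [epow _ hA, epow _ hB] at this
    calc ((A ^ p + B ^ p) / 2) ^ (2 / p) = (1 / 2 * A ^ p + 1 / 2 * B ^ p) ^ (2 / p) := by ring_nf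
      _ ≤ _ := this
      _ = _ := by ring
  set Z := pNorm p x ^ 2 + (p - 1) * pNorm p y ^ 2
  have hZ : 0 ≤ Z := by positivity
  have h4 := Real.rpow_le_rpow (Real.rpow_nonneg hZ _) (h1.trans h2) (z := 2 / p) (by positivity)
  rw [← Real.rpow_mul hZ, show p / 2 * (2 / p) = 1 by field_simp, Real.rpow_one] at h4
  exact h4.trans h3

/-- As `(∑ |x_i|^p)^(2/p)` this is a composition of `C¹` maps: `p > 1` takes care of vanishing
coordinates and `2 / p ≥ 1` of the origin. Hence the derivative in the Bregman divergence exists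
everywhere, and its continuity later yields measurability. -/
lemma contDiff_pNorm_sq (hp1 : 1 < p) (hp2 : p < 2) :
    ContDiff ℝ 1 (fun x : Pt d => pNorm p x ^ 2) := by
  have e : (fun x : Pt d => pNorm p x ^ 2) = fun x => (∑ i, ‖x i‖ ^ p) ^ (2 / p) := by
    ext x
    rw [pNorm, ← Real.rpow_natCast, ← Real.rpow_mul
      (Finset.sum_nonneg fun _ _ => Real.rpow_nonneg (abs_nonneg _) _)]
    simp only [Real.norm_eq_abs]
    congr 1
    push_cast; ring
  rw [e]
  have h1 : ContDiff ℝ 1 (fun x : Pt d => ∑ i, ‖x i‖ ^ p) := by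
    apply ContDiff.sum
    intro i _
    exact ContDiff.norm_rpow (by fun_prop) hp1
  have := ContDiff.rpow_const_of_le (m := 1) (p := 2 / p) h1
    (by rw [Nat.cast_one, le_div_iff₀ (by linarith)]; linarith)
  simpa using this

lemma pNorm_le_l1 (hp : 1 < p) (x : Pt d) : pNorm p x ≤ ∑ i, |x i| := by
  have hS : 0 ≤ ∑ i, |x i| := Finset.sum_nonneg fun _ _ => abs_nonneg _
  have h1 : ∑ i, |x i| ^ p ≤ (∑ i, |x i|) ^ p := by
    calc ∑ i, |x i| ^ p = ∑ i, |x i| * |x i| ^ (p - 1) := by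
          refine Finset.sum_congr rfl fun i _ => ?_
          rcases (abs_nonneg (x i)).eq_or_lt with h | h
          · rw [← h, Real.zero_rpow (by linarith), zero_mul]
          · nth_rewrite 2 [← Real.rpow_one |x i|]
            rw [← Real.rpow_add h]; congr 1; ring
      _ ≤ ∑ i, |x i| * (∑ i, |x i|) ^ (p - 1) := by
          refine Finset.sum_le_sum fun i hi => ?_
          have h2 : |x i| ≤ ∑ i, |x i| :=
            Finset.single_le_sum (f := fun i => |x i|) (fun _ _ => abs_nonneg _) hi
          exact mul_le_mul_of_nonneg_left
            (Real.rpow_le_rpow (abs_nonneg _) h2 (by linarith)) (abs_nonneg _)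
      _ = (∑ i, |x i|) * (∑ i, |x i|) ^ (p - 1) := by rw [Finset.sum_mul]
      _ = (∑ i, |x i|) ^ p := by
          rcases hS.eq_or_lt with h | h
          · rw [← h, Real.zero_rpow (by linarith : p ≠ 0), zero_mul]
          · nth_rewrite 1 [← Real.rpow_one (∑ i, |x i|)]
            rw [← Real.rpow_add h]; congr 1; ring
  calc pNorm p x ≤ ((∑ i, |x i|) ^ p) ^ (1 / p) :=
        Real.rpow_le_rpow (Finset.sum_nonneg fun _ _ => Real.rpow_nonneg (abs_nonneg _) _) h1
          (by positivity)
    _ = ∑ i, |x i| := by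
        rw [← Real.rpow_mul hS, mul_one_div_cancel (by linarith), Real.rpow_one]

lemma l1_le_pNorm (hp : 1 < p) (x : Pt d) :
    ∑ i, |x i| ≤ (d : ℝ) ^ (1 - 1 / p) * pNorm p x := by
  have h := Real.inner_le_Lp_mul_Lq_of_nonneg (Finset.univ : Finset (Fin d)) (p := p)
    (q := p.conjExponent) (Real.HolderConjugate.conjExponent hp) (f := fun i => |x i|)
    (g := fun _ => 1) (fun _ _ => abs_nonneg _) (fun _ _ => zero_le_one)
  simp only [mul_one, Real.one_rpow, Finset.sum_const, Finset.card_univ, Fintype.card_fin,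
    nsmul_eq_mul] at h
  refine h.trans (le_of_eq ?_)
  rw [mul_comm]
  unfold pNorm Real.conjExponent
  congr 2
  have : p ≠ 0 := by linarith
  have : p - 1 ≠ 0 := by linarith
  field_simp

end pNorm

/-! ### The exponent `p = ln d / (ln d - 1)` and the duality with `ℓ_∞`. -/

section pExp
variable {d : ℕ}

lemma two_lt_log (hd : 8 ≤ d) : 2 < Real.log d := by
  have h8 : Real.log 8 ≤ Real.log d := Real.log_le_log (by norm_num) (by exact_mod_cast hd)
  have : Real.log 8 = 3 * Real.log 2 := by
    rw [show (8 : ℝ) = 2 ^ 3 by norm_num, Real.log_pow]; norm_num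
  linarith [Real.log_two_gt_d9]

lemma one_lt_pExp (hd : 8 ≤ d) : 1 < pExp d := by
  have := two_lt_log hd
  rw [pExp, lt_div_iff₀] <;> linarith

lemma pExp_lt_two (hd : 8 ≤ d) : pExp d < 2 := by
  have := two_lt_log hd
  rw [pExp, div_lt_iff₀] <;> linarith

lemma pExp_sub_one (hd : 8 ≤ d) : pExp d - 1 = 1 / (Real.log d - 1) := by
  have := two_lt_log hd
  rw [pExp]
  have : Real.log d - 1 ≠ 0 := by linarith
  field_simp
  ring

/-- The exponent is chosen so that `1 - 1/p = 1 / ln d`; the Hölder constant `d^(1 - 1/p)` is then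
`e`. -/
lemma l1_le_exp_one_mul_pNorm (hd : 8 ≤ d) (x : Pt d) :
    ∑ i, |x i| ≤ Real.exp 1 * pNorm (pExp d) x := by
  have h := l1_le_pNorm (one_lt_pExp hd) x
  have hl := two_lt_log hd
  have e : (d : ℝ) ^ (1 - 1 / pExp d) = Real.exp 1 := by
    rw [Real.rpow_def_of_pos (by positivity)]
    congr 1
    rw [pExp]
    have : Real.log d ≠ 0 := by linarith
    have : Real.log d - 1 ≠ 0 := by linarith
    field_simp
    ring
  rwa [e] at h

/-- The dual norm of `ℓ_p` is at most `e` times the `ℓ_∞` norm, so gradients need only be controlled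
coordinatewise. This keeps powers of `d` out of the regret. -/
lemma abs_inner_le (hd : 8 ≤ d) (x g : Pt d) {G : ℝ} (hG : ∀ i, |g i| ≤ G) :
    |inner ℝ x g| ≤ Real.exp 1 * pNorm (pExp d) x * G := by
  rw [PiLp.inner_apply]
  have h0 : ∀ i, |x i| * |g i| ≤ |x i| * G := fun i => by gcongr; exact hG i
  have hd0 : 0 < d := by omega
  have hG0 : 0 ≤ G := (abs_nonneg _).trans (hG ⟨0, hd0⟩)
  calc |∑ i, inner ℝ (x i) (g i)| ≤ ∑ i, |inner ℝ (x i) (g i)| := Finset.abs_sum_le_sum_abs _ _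
    _ = ∑ i, |x i| * |g i| := by simp [abs_mul, mul_comm]
    _ ≤ ∑ i, |x i| * G := Finset.sum_le_sum fun i _ => h0 i
    _ = (∑ i, |x i|) * G := by rw [Finset.sum_mul]
    _ ≤ _ := by gcongr; exact l1_le_exp_one_mul_pNorm hd x

end pExp

/-! ### The regularizer -/

section regularizer
variable {d : ℕ}

lemma regularizer_eq (c w : Pt d) : regularizer c w = regularizer 0 (w - c) := by
  simp [regularizer]

lemma contDiff_regularizer (hd : 8 ≤ d) (c : Pt d) : ContDiff ℝ 1 (regularizer c) := by
  unfold regularizer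
  exact contDiff_const.mul
    ((contDiff_pNorm_sq (one_lt_pExp hd) (pExp_lt_two hd)).comp (contDiff_id.sub contDiff_const))

lemma differentiable_regularizer (hd : 8 ≤ d) (c : Pt d) : Differentiable ℝ (regularizer c) :=
  (contDiff_regularizer hd c).differentiable one_ne_zero

lemma regularizer_nonneg (hd : 8 ≤ d) (c w : Pt d) : 0 ≤ regularizer c w := by
  have := one_lt_pExp hd
  unfold regularizer
  have : 0 < pExp d - 1 := by linarith
  positivity

lemma regularizer_self (hd : 8 ≤ d) (c : Pt d) : regularizer c c = 0 := by
  simp [regularizer, pNorm_zero (one_lt_pExp hd)]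

lemma fderiv_regularizer_self (hd : 8 ≤ d) (c : Pt d) : fderiv ℝ (regularizer c) c = 0 := by
  apply IsLocalMin.fderiv_eq_zero
  apply Filter.Eventually.of_forall
  intro w
  rw [regularizer_self hd]
  exact regularizer_nonneg hd c w

lemma fderiv_regularizer (c w : Pt d) :
    fderiv ℝ (regularizer c) w = fderiv ℝ (regularizer (0 : Pt d)) (w - c) := by
  have : regularizer c = fun w => regularizer (0 : Pt d) (w - c) := by
    ext w; exact regularizer_eq c w
  rw [this, fderiv_comp_sub]

/-- Uniform convexity applied to the midpoint minus `c` and to half the difference. The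
normalization `1 / (2(p - 1))` cancels the modulus `p - 1`. -/
lemma regularizer_midpoint (hd : 8 ≤ d) (c v h : Pt d) :
    regularizer c (v + (1 / 2 : ℝ) • h) ≤
      (regularizer c (v + h) + regularizer c v) / 2 - pNorm (pExp d) h ^ 2 / 8 := by
  have hp1 := one_lt_pExp hd
  have hp2 := pExp_lt_two hd
  have hp : 0 < pExp d - 1 := by linarith
  have := pNorm_uniform_convexity hp1 hp2 (v + (1 / 2 : ℝ) • h - c) ((1 / 2 : ℝ) • h)
  rw [show v + (1 / 2 : ℝ) • h - c + (1 / 2 : ℝ) • h = v + h - c by module,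
    show v + (1 / 2 : ℝ) • h - c - (1 / 2 : ℝ) • h = v - c by module, pNorm_smul hp1] at this
  unfold regularizer
  have h3 : (1 : ℝ) / (2 * (pExp d - 1)) * (2 * (pExp d - 1)) = 1 := by field_simp
  set k := (1 : ℝ) / (2 * (pExp d - 1))
  have hk : 0 < k := by positivity
  rw [abs_of_pos (by norm_num : (0 : ℝ) < 1 / 2)] at this
  have h4 := mul_le_mul_of_nonneg_left this hk.le
  have h5 : k * (pExp d - 1) = 1 / 2 := by linarith
  have h6 : k * ((pExp d - 1) * (1 / 2 * pNorm (pExp d) h) ^ 2) = pNorm (pExp d) h ^ 2 / 8 := by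
    rw [← mul_assoc, h5]; ring
  rw [mul_add, h6] at h4
  linarith

/-- The regularizer is `1`-strongly convex with respect to the `ℓ_p` norm. -/
lemma bregman_regularizer_ge (hd : 8 ≤ d) (c u v : Pt d) :
    pNorm (pExp d) (u - v) ^ 2 / 2 ≤ bregman (regularizer c) u v := by
  have hp1 := one_lt_pExp hd
  obtain ⟨h, rfl⟩ : ∃ h, u = v + h := ⟨u - v, by abel⟩
  rw [add_sub_cancel_left]
  unfold bregman
  rw [add_sub_cancel_left]
  set F := regularizer c
  set N := pNorm (pExp d) h
  set F' := fderiv ℝ F v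
  -- `E` is the excess over strong convexity along the segment. Midpoint convexity gives `E (t/2) ≤
  -- E t / 2`, so `2^n E(2^{-n}) ≤ E 1`, and the left-hand side tends to `E'(0) = 0`.
  let E : ℝ → ℝ := fun t => F (v + t • h) - F v - t * F' h - t ^ 2 * N ^ 2 / 2
  have hhalf : ∀ t, E (t / 2) ≤ E t / 2 := by
    intro t
    have := regularizer_midpoint hd c v (t • h)
    rw [pNorm_smul hp1, smul_smul, mul_pow, sq_abs, show (1 : ℝ) / 2 * t = t / 2 by ring] at this
    simp only [E]
    linarith
  have hpow : ∀ n : ℕ, 2 ^ n * E (1 / 2 ^ n) ≤ E 1 := by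
    intro n
    induction n with
    | zero => simp
    | succ n ih =>
      have := hhalf (1 / 2 ^ n)
      rw [div_div, ← pow_succ] at this
      have h2 : (0 : ℝ) < 2 ^ n := by positivity
      calc (2 : ℝ) ^ (n + 1) * E (1 / 2 ^ (n + 1)) ≤ 2 ^ (n + 1) * (E (1 / 2 ^ n) / 2) := by gcongr
        _ = 2 ^ n * E (1 / 2 ^ n) := by rw [pow_succ]; ring
        _ ≤ E 1 := ih
  have hder : HasDerivAt E 0 0 := by
    have h1 : HasDerivAt (fun t : ℝ => F (v + t • h)) (F' h) 0 := by
      have hF : HasFDerivAt F F' (v + (0 : ℝ) • h) := by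
        simpa using (differentiable_regularizer hd c v).hasFDerivAt
      have hl : HasDerivAt (fun t : ℝ => v + t • h) ((1 : ℝ) • h) 0 :=
        ((hasDerivAt_id (0 : ℝ)).smul_const h).const_add v
      have := hF.comp_hasDerivAt (0 : ℝ) hl
      rw [one_smul] at this
      exact this
    have h2 : HasDerivAt (fun t : ℝ => t * F' h) (1 * F' h) 0 := (hasDerivAt_id _).mul_const _
    have h3 : HasDerivAt (fun t : ℝ => t ^ 2 * N ^ 2 / 2) (((2 : ℕ) * (0 : ℝ) ^ 1) * N ^ 2 / 2) 0 :=
      ((hasDerivAt_pow 2 (0 : ℝ)).mul_const _).div_const _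
    have := ((h1.sub_const (F v)).sub h2).sub h3
    exact this.congr_deriv (by ring)
  have hE0 : E 0 = 0 := by simp [E]
  have hlim : Filter.Tendsto (fun n : ℕ => (2 : ℝ) ^ n * E (1 / 2 ^ n)) Filter.atTop (nhds 0) := by
    have h1 := hder.tendsto_slope_zero
    have h2 : Filter.Tendsto (fun n : ℕ => (1 : ℝ) / 2 ^ n) Filter.atTop (nhdsWithin 0 {0}ᶜ) := by
      rw [tendsto_nhdsWithin_iff]
      constructor
      · have := tendsto_pow_atTop_nhds_zero_of_lt_one (r := (1 / 2 : ℝ)) (by norm_num) (by norm_num)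
        simpa using this
      · exact Filter.Eventually.of_forall fun n => by simp
    refine (h1.comp h2).congr fun n => ?_
    simp [hE0]
  have := le_of_tendsto' hlim hpow
  simp only [E] at this
  simp only [one_smul, one_mul, one_pow] at this
  linarith

end regularizer

/-! ### Hard thresholding -/

section hardThreshold
variable {d : ℕ}

/-- The indices that precede `i` when the entries of `w` are sorted by decreasing absolute value. -/
def beats (w : Pt d) (i : Fin d) : Set (Fin d) :=
  {j | |w i| < |w j| ∨ (|w j| = |w i| ∧ j < i)}

lemma beats_ncard_lt {w : Pt d} {i k : Fin d} (h : i ∈ beats w k) :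
    (beats w i).ncard < (beats w k).ncard := by
  apply Set.ncard_lt_ncard _ (Set.toFinite _)
  refine ⟨fun j hj => ?_, fun hs => ?_⟩
  · rcases h with h | ⟨h, h'⟩ <;> rcases hj with hj | ⟨hj, hj'⟩
    · exact Or.inl (h.trans hj)
    · exact Or.inl (by rw [hj]; exact h)
    · exact Or.inl (by rw [← h]; exact hj)
    · exact Or.inr ⟨hj.trans h, hj'.trans h'⟩
  · rcases hs h with h | ⟨_, h⟩ <;> exact lt_irrefl _ h

lemma beats_total {w : Pt d} {i k : Fin d} (h : i ≠ k) : i ∈ beats w k ∨ k ∈ beats w i := by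
  rcases lt_trichotomy |w i| |w k| with h1 | h1 | h1
  · exact Or.inr (Or.inl h1)
  · rcases lt_or_gt_of_ne h with h2 | h2
    · exact Or.inl (Or.inr ⟨h1, h2⟩)
    · exact Or.inr (Or.inr ⟨h1.symm, h2⟩)
  · exact Or.inl (Or.inl h1)

lemma beats_ncard_injective (w : Pt d) : Function.Injective fun i => (beats w i).ncard := by
  intro i k h
  by_contra hne
  rcases beats_total (w := w) hne with h1 | h1 <;> have := beats_ncard_lt h1 <;> simp_all

lemma beats_ncard_lt_dim (w : Pt d) (i : Fin d) : (beats w i).ncard < d := by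
  have : (beats w i).ncard < (Set.univ : Set (Fin d)).ncard := by
    apply Set.ncard_lt_ncard _ (Set.toFinite _)
    refine ⟨Set.subset_univ _, fun hs => ?_⟩
    rcases hs (Set.mem_univ i) with h | ⟨_, h⟩ <;> exact lt_irrefl _ h
  simpa using this

/-- The set of the indices kept by hard thresholding. -/
def topSet (s : ℕ) (w : Pt d) : Finset (Fin d) :=
  open Classical in Finset.univ.filter fun i => (beats w i).ncard < s

lemma mem_topSet {s : ℕ} {w : Pt d} {i : Fin d} : i ∈ topSet s w ↔ (beats w i).ncard < s := by
  simp [topSet]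

/-- Breaking ties by index makes the rank `(beats w i).ncard` injective, hence a bijection onto `{0,
…, d - 1}`; exactly `s` indices have rank below `s`. -/
lemma card_topSet {s : ℕ} (hs : s ≤ d) (w : Pt d) : (topSet s w).card = s := by
  classical
  let f : Fin d → Fin d := fun i => ⟨(beats w i).ncard, beats_ncard_lt_dim w i⟩
  have hf : Function.Injective f := fun i k h =>
    beats_ncard_injective w (congrArg Fin.val h)
  have hb := Finite.injective_iff_surjective.1 hf
  have : (topSet s w).image f = Finset.univ.filter fun k : Fin d => (k : ℕ) < s := by
    ext k
    simp only [Finset.mem_image, mem_topSet, Finset.mem_filter, Finset.mem_univ, true_and]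
    constructor
    · rintro ⟨i, hi, rfl⟩; exact hi
    · intro hk
      obtain ⟨i, rfl⟩ := hb k
      exact ⟨i, hk, rfl⟩
  rw [← Finset.card_image_of_injective _ hf, this, Fin.card_filter_val_lt]
  omega

lemma abs_le_of_topSet {s : ℕ} {w : Pt d} {i k : Fin d} (hi : i ∈ topSet s w)
    (hk : k ∉ topSet s w) : |w k| ≤ |w i| := by
  rw [mem_topSet] at hi hk
  by_contra h
  have := beats_ncard_lt (w := w) (i := k) (k := i) (Or.inl (not_le.1 h))
  omega

lemma hardThreshold_apply (s : ℕ) (w : Pt d) (i : Fin d) :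
    hardThreshold s w i = open Classical in if i ∈ topSet s w then w i else 0 := by
  simp only [mem_topSet]
  rfl

/-- Hard thresholding is the best `s`-sparse approximation. -/
lemma norm_sub_hardThreshold_le {s : ℕ} (hs : s ≤ d) (w : Pt d) {v : Pt d} (hv : IsSparse s v) :
    ‖w - hardThreshold s w‖ ≤ ‖w - v‖ := by
  classical
  rw [EuclideanSpace.norm_eq, EuclideanSpace.norm_eq]
  apply Real.sqrt_le_sqrt
  set S := topSet s w
  set V : Finset (Fin d) := Finset.univ.filter fun i => v i ≠ 0
  have hV : V.card ≤ s := by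
    have : {i : Fin d | v i ≠ 0}.ncard = V.card := by
      rw [← Set.ncard_coe_finset]; congr 1; ext i; simp [V]
    rw [← this]; exact hv
  have h1 : ∑ i, ‖(w - hardThreshold s w) i‖ ^ 2 = ∑ i ∈ Sᶜ, (w i) ^ 2 := by
    rw [← Finset.sum_add_sum_compl S]
    have : ∑ i ∈ S, ‖(w - hardThreshold s w) i‖ ^ 2 = 0 := by
      apply Finset.sum_eq_zero
      intro i hi
      rw [PiLp.sub_apply, hardThreshold_apply, if_pos hi]; simp
    rw [this, zero_add]
    refine Finset.sum_congr rfl fun i hi => ?_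
    rw [PiLp.sub_apply, hardThreshold_apply, if_neg (Finset.mem_compl.1 hi)]; simp
  have h2 : ∑ i ∈ Vᶜ, (w i) ^ 2 ≤ ∑ i, ‖(w - v) i‖ ^ 2 := by
    rw [← Finset.sum_add_sum_compl V]
    have h3 : 0 ≤ ∑ i ∈ V, ‖(w - v) i‖ ^ 2 := Finset.sum_nonneg fun _ _ => by positivity
    have h4 : ∑ i ∈ Vᶜ, ‖(w - v) i‖ ^ 2 = ∑ i ∈ Vᶜ, (w i) ^ 2 := by
      refine Finset.sum_congr rfl fun i hi => ?_
      have : v i = 0 := by simpa [V] using hi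
      simp [this]
    linarith
  rw [h1]
  refine le_trans ?_ h2
  -- Exchange argument: the support `V` of the competitor has at most `s = |S|` elements, so no more
  -- indices of `V` are dropped than foreign ones are kept, and every kept entry dominates every
  -- dropped one.
  have hc : (V \ S).card ≤ (S \ V).card := by
    have h5 := Finset.card_sdiff_add_card_inter V S
    have h6 := Finset.card_sdiff_add_card_inter S V
    rw [Finset.inter_comm] at h6
    have h7 : S.card = s := card_topSet hs w
    omega
  have h8 : ∑ i ∈ V \ S, (w i) ^ 2 ≤ ∑ i ∈ S \ V, (w i) ^ 2 := by
    rcases (V \ S).eq_empty_or_nonempty with he | hne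
    · rw [he, Finset.sum_empty]; exact Finset.sum_nonneg fun _ _ => by positivity
    obtain ⟨k, hk, hmax⟩ := Finset.exists_max_image (V \ S) (fun i => (w i) ^ 2) hne
    calc ∑ i ∈ V \ S, (w i) ^ 2 ≤ (V \ S).card • (w k) ^ 2 := Finset.sum_le_card_nsmul _ _ _ hmax
      _ ≤ (S \ V).card • (w k) ^ 2 := by
          rw [nsmul_eq_mul, nsmul_eq_mul]; gcongr
      _ ≤ ∑ i ∈ S \ V, (w i) ^ 2 := by
          apply Finset.card_nsmul_le_sum
          intro i hi
          exact sq_le_sq.2 (abs_le_of_topSet (Finset.mem_sdiff.1 hi).1 (Finset.mem_sdiff.1 hk).2)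
  have e1 : Sᶜ = (V \ S) ∪ (Vᶜ ∩ Sᶜ) := by
    ext i; simp only [Finset.mem_compl, Finset.mem_union, Finset.mem_sdiff, Finset.mem_inter]; tauto
  have e2 : Vᶜ = (S \ V) ∪ (Vᶜ ∩ Sᶜ) := by
    ext i; simp only [Finset.mem_compl, Finset.mem_union, Finset.mem_sdiff, Finset.mem_inter]; tauto
  have d1 : Disjoint (V \ S) (Vᶜ ∩ Sᶜ) := by
    rw [Finset.disjoint_left]; intro i; simp; tauto
  have d2 : Disjoint (S \ V) (Vᶜ ∩ Sᶜ) := by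
    rw [Finset.disjoint_left]; intro i; simp; tauto
  have s1 := Finset.sum_union d1 (f := fun i => (w i) ^ 2)
  have s2 := Finset.sum_union d2 (f := fun i => (w i) ^ 2)
  rw [← e1] at s1
  rw [← e2] at s2
  linarith

/-- The difference of two `s`-sparse vectors has at most `2s` nonzero entries; the rest is
Cauchy–Schwarz. -/
lemma l1_sub_hardThreshold_le {s : ℕ} (hs : s ≤ d) (w : Pt d) {v : Pt d} (hv : IsSparse s v) :
    ∑ i, |v i - hardThreshold s w i| ≤ √(2 * s) * ‖v - hardThreshold s w‖ := by
  classical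
  set S := topSet s w
  set V : Finset (Fin d) := Finset.univ.filter fun i => v i ≠ 0
  have hV : V.card ≤ s := by
    have : {i : Fin d | v i ≠ 0}.ncard = V.card := by
      rw [← Set.ncard_coe_finset]; congr 1; ext i; simp [V]
    rw [← this]; exact hv
  set x := v - hardThreshold s w
  have hx : ∀ i, i ∉ V ∪ S → x i = 0 := by
    intro i hi
    rw [Finset.mem_union, not_or] at hi
    have h1 : v i = 0 := by simpa [V] using hi.1
    simp only [x, PiLp.sub_apply]
    rw [hardThreshold_apply, if_neg hi.2, h1, sub_zero]
  have h1 : ∑ i, |v i - hardThreshold s w i| = ∑ i ∈ V ∪ S, |x i| := by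
    symm
    apply Finset.sum_subset (Finset.subset_univ _)
    intro i _ hi
    rw [hx i hi, abs_zero]
  rw [h1]
  have h2 := sq_sum_le_card_mul_sum_sq (s := V ∪ S) (f := fun i => |x i|)
  have h3 : ((V ∪ S).card : ℝ) ≤ 2 * s := by
    have := Finset.card_union_le V S
    have h7 : S.card = s := card_topSet hs w
    have : (V ∪ S).card ≤ 2 * s := by omega
    exact_mod_cast this
  have h4 : ∑ i ∈ V ∪ S, |x i| ^ 2 ≤ ‖x‖ ^ 2 := by
    rw [EuclideanSpace.norm_sq_eq]
    simp only [Real.norm_eq_abs]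
    exact Finset.sum_le_univ_sum_of_nonneg fun _ => by positivity
  have h5 : ∑ i ∈ V ∪ S, |x i| ≤ √(2 * s * ‖x‖ ^ 2) := by
    apply Real.le_sqrt_of_sq_le
    refine h2.trans (mul_le_mul h3 h4 ?_ (by positivity))
    exact Finset.sum_nonneg fun _ _ => by positivity
  rwa [Real.sqrt_mul' _ (by positivity : (0 : ℝ) ≤ ‖x‖ ^ 2), Real.sqrt_sq (norm_nonneg _)] at h5

end hardThreshold

/-! ### The constraint set -/

section feasible
variable {d : ℕ}

/-- Thresholding is a best `s`-sparse approximation, so it lies within `4r + 4r` of any sparse `v`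
that is `4r`-close to `w₁`. This explains the `ℓ_1` radius `8r√(2s)` of the constraint set. -/
lemma mem_feasible_of_close {s : ℕ} (hs : s ≤ d) {r : ℝ} {w₁ v : Pt d} (hv : IsSparse s v)
    (h : ‖w₁ - v‖ ≤ 4 * r) : v ∈ feasible s r w₁ := by
  have h1 := norm_sub_hardThreshold_le hs w₁ hv
  refine ⟨by rw [norm_sub_rev]; exact h, ?_⟩
  refine (l1_sub_hardThreshold_le hs w₁ hv).trans ?_
  have : ‖v - hardThreshold s w₁‖ ≤ 8 * r := by
    calc ‖v - hardThreshold s w₁‖ = ‖(w₁ - hardThreshold s w₁) - (w₁ - v)‖ := by congr 1; abel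
      _ ≤ ‖w₁ - hardThreshold s w₁‖ + ‖w₁ - v‖ := norm_sub_le _ _
      _ ≤ 8 * r := by linarith
  rw [mul_comm]
  gcongr

lemma hardThreshold_mem_feasible {s : ℕ} (hs : s ≤ d) {r : ℝ} (hr : 0 ≤ r) {w₁ v : Pt d}
    (hv : IsSparse s v) (h : ‖w₁ - v‖ ≤ 4 * r) : hardThreshold s w₁ ∈ feasible s r w₁ := by
  refine ⟨?_, ?_⟩
  · rw [norm_sub_rev]; exact (norm_sub_hardThreshold_le hs w₁ hv).trans h
  · simp; positivity

lemma isClosed_feasible (s : ℕ) (r : ℝ) (w₁ : Pt d) : IsClosed (feasible s r w₁) := by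
  have h1 : IsClosed {w : Pt d | ‖w - w₁‖ ≤ 4 * r} := isClosed_le (by fun_prop) continuous_const
  have h2 : IsClosed {w : Pt d | ∑ i, |w i - hardThreshold s w₁ i| ≤ 8 * r * √(2 * s)} :=
    isClosed_le (by fun_prop) continuous_const
  exact h1.inter h2

lemma isCompact_feasible (s : ℕ) (r : ℝ) (w₁ : Pt d) : IsCompact (feasible s r w₁) := by
  apply (isCompact_closedBall w₁ (4 * r)).of_isClosed_subset (isClosed_feasible s r w₁)
  intro w hw
  rw [mem_closedBall_iff_norm]; exact hw.1

lemma convex_constraint (r ρ : ℝ) (w₁ c : Pt d) :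
    Convex ℝ {w : Pt d | ‖w - w₁‖ ≤ r ∧ ∑ i, |w i - c i| ≤ ρ} := by
  intro x hx y hy a b ha hb hab
  refine ⟨?_, ?_⟩
  · calc ‖a • x + b • y - w₁‖ = ‖a • (x - w₁) + b • (y - w₁)‖ := by
          congr 1
          rw [smul_sub, smul_sub]
          have : w₁ = a • w₁ + b • w₁ := by rw [← add_smul, hab, one_smul]
          nth_rewrite 1 [this]; abel
      _ ≤ a * ‖x - w₁‖ + b * ‖y - w₁‖ := by
          refine (norm_add_le _ _).trans ?_
          rw [norm_smul, norm_smul, Real.norm_of_nonneg ha, Real.norm_of_nonneg hb]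
      _ ≤ a * r + b * r := by gcongr; exacts [hx.1, hy.1]
      _ = r := by rw [← add_mul, hab, one_mul]
  · calc ∑ i, |(a • x + b • y) i - c i|
        ≤ ∑ i, (a * |x i - c i| + b * |y i - c i|) := by
          refine Finset.sum_le_sum fun i _ => ?_
          have : (a • x + b • y) i - c i = a * (x i - c i) + b * (y i - c i) := by
            simp only [PiLp.add_apply, PiLp.smul_apply, smul_eq_mul]
            linear_combination (c i) * hab
          rw [this]
          refine (abs_add_le _ _).trans ?_
          rw [abs_mul, abs_mul, abs_of_nonneg ha, abs_of_nonneg hb]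
      _ = a * ∑ i, |x i - c i| + b * ∑ i, |y i - c i| := by
          rw [Finset.sum_add_distrib, Finset.mul_sum, Finset.mul_sum]
      _ ≤ a * ρ + b * ρ := by gcongr; exacts [hx.2, hy.2]
      _ = ρ := by rw [← add_mul, hab, one_mul]

lemma convex_feasible (s : ℕ) (r : ℝ) (w₁ : Pt d) : Convex ℝ (feasible s r w₁) :=
  convex_constraint _ _ _ _

end feasible

/-! ### Online mirror descent -/

section mirrorDescent
variable {d : ℕ}

lemma argminOn_spec {K : Set (Pt d)} {f : Pt d → ℝ} (hK : IsCompact K) (hne : K.Nonempty)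
    (hf : Continuous f) (w₀ : Pt d) :
    argminOn K f w₀ ∈ K ∧ ∀ w ∈ K, f (argminOn K f w₀) ≤ f w := by
  have h : ∃ w ∈ K, ∀ w' ∈ K, f w ≤ f w' := hK.exists_isMinOn hne hf.continuousOn
  rw [argminOn, dif_pos h]
  exact h.choose_spec

lemma continuous_bregman {F : Pt d → ℝ} (hF : Continuous F) (u : Pt d) :
    Continuous fun w => bregman F w u := by
  unfold bregman
  fun_prop

/-- The objective of one step of online mirror descent. -/
def objective (a : ℝ) (c g u w : Pt d) : ℝ := a * inner ℝ w g + bregman (regularizer c) w u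

lemma continuous_objective (hd : 8 ≤ d) (a : ℝ) (c g u : Pt d) :
    Continuous (objective a c g u) := by
  unfold objective
  have := continuous_bregman (contDiff_regularizer hd c).continuous u
  fun_prop

/-- The three-point inequality for the minimizer of the objective. -/
lemma objective_three_point (hd : 8 ≤ d) {K : Set (Pt d)} (hK : Convex ℝ K) {a : ℝ}
    {c g u u' v : Pt d} (hu' : u' ∈ K) (hv : v ∈ K)
    (hmin : ∀ w ∈ K, objective a c g u u' ≤ objective a c g u w) :
    a * inner ℝ (u' - v) g ≤ bregman (regularizer c) v u - bregman (regularizer c) v u' -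
      bregman (regularizer c) u' u := by
  set F := regularizer c
  let ψ : Pt d →L[ℝ] ℝ := a • (innerSL ℝ g) + (fderiv ℝ F u' - fderiv ℝ F u)
  have hder : HasFDerivAt (objective a c g u) ψ u' := by
    have h1 : HasFDerivAt (fun w : Pt d => a * inner ℝ w g) (a • (innerSL ℝ g)) u' := by
      have := ((innerSL ℝ g).hasFDerivAt (x := u')).const_mul a
      simpa [real_inner_comm] using this
    have h2 : HasFDerivAt (fun w => bregman F w u) (fderiv ℝ F u' - fderiv ℝ F u) u' := by
      have h3 := (differentiable_regularizer hd c u').hasFDerivAt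
      have h4 : HasFDerivAt (fun w => fderiv ℝ F u (w - u)) (fderiv ℝ F u) u' := by
        have := (fderiv ℝ F u).hasFDerivAt.comp u' ((hasFDerivAt_id u').sub_const u)
        exact this
      exact (h3.sub_const (F u)).sub h4
    exact h1.add h2
  -- First-order optimality at `u'` in the direction `v - u'`, which points into the convex set;
  -- rearranged, it is the three-point inequality.
  have hm : IsMinOn (objective a c g u) K u' := hmin
  have := hm.localize.hasFDerivWithinAt_nonneg hder.hasFDerivWithinAt
    (sub_mem_posTangentConeAt_of_segment_subset (hK.segment_subset hu' hv))
  have e : ψ (v - u') = a * inner ℝ (v - u') g + (fderiv ℝ F u' (v - u') - fderiv ℝ F u (v - u')) := by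
    simp [ψ, real_inner_comm]
  rw [e] at this
  unfold bregman
  rw [show u' - v = -(v - u') by abel, inner_neg_left]
  have h5 : fderiv ℝ F u (v - u') = fderiv ℝ F u (v - u) - fderiv ℝ F u (u' - u) := by
    rw [← map_sub]; congr 1; abel
  linarith

/-- Of the loss at `u`, the part `⟨u' - v, g⟩` is paid by the three-point inequality. The part `⟨u -
u', g⟩` is bounded by duality and Young's inequality, and the resulting `‖u - u'‖_p² / 2` is
absorbed by the strong convexity of `-D_F(u', u)`. -/
lemma objective_step (hd : 8 ≤ d) {K : Set (Pt d)} (hK : Convex ℝ K) {a G : ℝ} (ha : 0 ≤ a)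
    {c g u u' v : Pt d} (hu' : u' ∈ K) (hv : v ∈ K) (hg : ∀ i, |g i| ≤ G)
    (hmin : ∀ w ∈ K, objective a c g u u' ≤ objective a c g u w) :
    a * inner ℝ (u - v) g ≤ a ^ 2 * Real.exp 1 ^ 2 * G ^ 2 / 2 +
      (bregman (regularizer c) v u - bregman (regularizer c) v u') := by
  have h1 := objective_three_point hd hK hu' hv hmin
  have h2 := bregman_regularizer_ge hd c u' u
  have h3 := (le_abs_self _).trans (abs_inner_le hd (u - u') g hg)
  have h4 : pNorm (pExp d) (u' - u) = pNorm (pExp d) (u - u') := by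
    have := pNorm_smul (one_lt_pExp hd) (-1) (u - u')
    simpa using this
  rw [h4] at h2
  set N := pNorm (pExp d) (u - u')
  have h5 : inner ℝ (u - v) g = inner ℝ (u - u') g + inner ℝ (u' - v) g := by
    rw [← inner_add_left]; congr 1; abel
  have h6 : a * inner ℝ (u - u') g ≤ a * (Real.exp 1 * N * G) := by gcongr
  have h7 : a * (Real.exp 1 * N * G) ≤ a ^ 2 * Real.exp 1 ^ 2 * G ^ 2 / 2 + N ^ 2 / 2 := by
    nlinarith [sq_nonneg (a * Real.exp 1 * G - N)]
  rw [h5]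
  nlinarith

end mirrorDescent

/-! ### The iterates of `optimize` -/

section iterates
variable {d : ℕ} (P : Param) (w₁ : Pt d) (r b : ℝ) (T : ℕ) (z : ℕ → ℕ → Ex d)

/-- The iterate `u_{t+1}`. -/
def iter (t : ℕ) : Pt d := (optimizeState P w₁ r b T z t).1

/-- The example used in iteration `t`. -/
def query (t : ℕ) : Ex d := sampleBand b (iter P w₁ r b T z t) (z t)

/-- The gradient of the loss in the example `e`. -/
def grad (e : Ex d) : Pt d := -(sgn e.2 • e.1)

lemma iter_zero : iter P w₁ r b T z 0 = hardThreshold P.s w₁ := rfl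

lemma iter_succ (t : ℕ) : iter P w₁ r b T z (t + 1) =
    argminOn (feasible P.s r w₁) (objective (stepSize d P r b T) (hardThreshold P.s w₁)
      (grad (query P w₁ r b T z t)) (iter P w₁ r b T z t)) (iter P w₁ r b T z t) := rfl

lemma optimizeState_snd (t : ℕ) : (optimizeState P w₁ r b T z t).2 = t := by
  induction t with
  | zero => rfl
  | succ t ih =>
    show (optimizeState P w₁ r b T z t).2 + 1 = t + 1
    rw [ih]

lemma optimize_snd (agg : Agg) : (optimize P w₁ r b T agg z).2 = T := optimizeState_snd P w₁ r b T z T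

lemma optimize_average : (optimize P w₁ r b T .average z).1 =
    (1 / (T : ℝ)) • ∑ t ∈ Finset.range T, hat (iter P w₁ r b T z t) := rfl

lemma optimize_random (τ : ℕ) (σ : Bool) : (optimize P w₁ r b T (.random τ σ) z).1 =
    sgn σ • hat (iter P w₁ r b T z τ) := rfl

variable {P w₁ r b T z}

lemma iter_mem (hd : 8 ≤ d) (h0 : hardThreshold P.s w₁ ∈ feasible P.s r w₁) (t : ℕ) :
    iter P w₁ r b T z t ∈ feasible P.s r w₁ := by
  cases t with
  | zero => exact h0
  | succ t =>
    rw [iter_succ]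
    exact (argminOn_spec (isCompact_feasible _ _ _) ⟨_, h0⟩ (continuous_objective hd _ _ _ _) _).1

/-- The regularizer and its derivative vanish at the centre, so the divergence equals the
regularizer; there `‖·‖_p ≤ ‖·‖_1 ≤ 8r√(2s)`, and `1 / (2(p - 1)) = (ln d - 1) / 2`. -/
lemma bregman_start_le (hd : 8 ≤ d) {s : ℕ} {v : Pt d} (hv : v ∈ feasible s r w₁) :
    bregman (regularizer (hardThreshold s w₁)) v (hardThreshold s w₁) ≤
      64 * r ^ 2 * (s * Real.log d) := by
  unfold bregman
  rw [fderiv_regularizer_self hd, regularizer_self hd]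
  simp only [zero_apply, sub_zero]
  unfold regularizer
  have hl := two_lt_log hd
  rw [pExp_sub_one hd]
  have h1 : pNorm (pExp d) (v - hardThreshold s w₁) ≤ 8 * r * √(2 * s) :=
    (pNorm_le_l1 (one_lt_pExp hd) _).trans hv.2
  have h2 : pNorm (pExp d) (v - hardThreshold s w₁) ^ 2 ≤ 128 * r ^ 2 * s := by
    calc _ ≤ (8 * r * √(2 * s)) ^ 2 := by
          gcongr; exact pNorm_nonneg _
      _ = 64 * r ^ 2 * (√(2 * s)) ^ 2 := by ring
      _ = _ := by rw [Real.sq_sqrt (by positivity)]; ring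
  have h3 : (1 : ℝ) / (2 * (1 / (Real.log d - 1))) = (Real.log d - 1) / 2 := by
    have : Real.log d - 1 ≠ 0 := by linarith
    field_simp
  rw [h3]
  have h4 : (Real.log d - 1) / 2 * pNorm (pExp d) (v - hardThreshold s w₁) ^ 2 ≤
      (Real.log d - 1) / 2 * (128 * r ^ 2 * s) := by gcongr; linarith
  have : 0 ≤ r ^ 2 * s := by positivity
  nlinarith

/-- The regret bound of online mirror descent. -/
lemma regret_le (hd : 8 ≤ d) {v : Pt d} {G : ℝ}
    (ha : 0 ≤ stepSize d P r b T) (h0 : hardThreshold P.s w₁ ∈ feasible P.s r w₁)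
    (hv : v ∈ feasible P.s r w₁) (n : ℕ)
    (hG : ∀ t < n, ∀ i, |(query P w₁ r b T z t).1 i| ≤ G) :
    stepSize d P r b T * ∑ t ∈ Finset.range n,
        inner ℝ (iter P w₁ r b T z t - v) (grad (query P w₁ r b T z t)) ≤
      64 * r ^ 2 * (P.s * Real.log d) +
        n * (stepSize d P r b T ^ 2 * Real.exp 1 ^ 2 * G ^ 2 / 2) := by
  set a := stepSize d P r b T
  set F := regularizer (hardThreshold P.s w₁)
  -- The divergence from `v` to the current iterate is kept so that the sum telescopes; it is
  -- nonnegative and is dropped at the end.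
  have key : ∀ n : ℕ, (∀ t < n, ∀ i, |(query P w₁ r b T z t).1 i| ≤ G) →
      a * ∑ t ∈ Finset.range n, inner ℝ (iter P w₁ r b T z t - v) (grad (query P w₁ r b T z t)) ≤
      bregman F v (hardThreshold P.s w₁) - bregman F v (iter P w₁ r b T z n) +
        n * (a ^ 2 * Real.exp 1 ^ 2 * G ^ 2 / 2) := by
    intro n
    induction n with
    | zero => intro _; simp [iter_zero]
    | succ n ih =>
      intro h
      have h1 := ih fun t ht => h t (by omega)
      have hs := argminOn_spec (isCompact_feasible P.s r w₁) ⟨_, h0⟩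
        (continuous_objective hd a (hardThreshold P.s w₁)
          (grad (query P w₁ r b T z n)) (iter P w₁ r b T z n)) (iter P w₁ r b T z n)
      rw [← iter_succ] at hs
      have h2 := objective_step hd (convex_feasible P.s r w₁) ha hs.1 hv (G := G) (by
        intro i
        have := h n (by omega) i
        unfold grad sgn
        split_ifs <;> simpa using this) hs.2
      rw [Finset.sum_range_succ, mul_add]
      push_cast
      linarith
  have h1 := key n hG
  have h2 := bregman_start_le hd hv
  have h3 := bregman_regularizer_ge hd (hardThreshold P.s w₁) v (iter P w₁ r b T z n)
  have h4 : 0 ≤ pNorm (pExp d) (v - iter P w₁ r b T z n) ^ 2 / 2 := by positivity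
  linarith

end iterates

/-! ### Measurability -/

section measurability

/-- The unique minimizer of a continuous function over a compact set depends measurably on the
parameters. -/
lemma measurable_argminOn {d : ℕ} {Y : Type*} [TopologicalSpace Y] [MeasurableSpace Y]
    [OpensMeasurableSpace Y] {K : Set (Y × Pt d)} (hK : IsClosed K) {f : Y × Pt d → ℝ}
    (hf : Continuous f) {ctr : Y → Pt d} (hctr : Continuous ctr) {ρ : ℝ}
    (hb : ∀ y w, (y, w) ∈ K → ‖w - ctr y‖ ≤ ρ) {u : Y → Pt d} (hu : Measurable u)
    (huniq : ∀ y w w', (y, w) ∈ K → (y, w') ∈ K → (∀ v, (y, v) ∈ K → f (y, w) ≤ f (y, v)) →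
      (∀ v, (y, v) ∈ K → f (y, w') ≤ f (y, v)) → w = w') :
    Measurable fun y => argminOn {w | (y, w) ∈ K} (fun w => f (y, w)) (u y) := by
  -- After translation by `ctr` all fibres lie in one fixed ball, so the projection is along a
  -- compact factor and therefore closed.
  have hproj : ∀ A : Set (Y × Pt d), IsClosed A → A ⊆ K → IsClosed {y | ∃ w, (y, w) ∈ A} := by
    intro A hA hAK
    let B := Metric.closedBall (0 : Pt d) ρ
    have : CompactSpace B := isCompact_iff_compactSpace.1 (isCompact_closedBall _ _)
    have hc : Continuous fun p : Y × B => (p.1, ctr p.1 + (p.2 : Pt d)) := by fun_prop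
    have h1 := isClosedMap_fst_of_compactSpace (X := Y) (Y := B) _ (hA.preimage hc)
    convert h1 using 1
    ext y
    simp only [Set.mem_ofPred_eq, Set.mem_image, Set.mem_preimage, Prod.exists, exists_and_right,
      exists_eq_right]
    constructor
    · rintro ⟨w, hw⟩
      exact ⟨⟨w - ctr y, by simpa [B] using hb y w (hAK hw)⟩, by simpa using hw⟩
    · rintro ⟨x, hx⟩
      exact ⟨_, hx⟩
  have hcpt : ∀ y, IsCompact {w | (y, w) ∈ K} := by
    intro y
    apply (isCompact_closedBall (ctr y) ρ).of_isClosed_subset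
    · exact hK.preimage (by fun_prop : Continuous fun w : Pt d => (y, w))
    · intro w hw
      rw [mem_closedBall_iff_norm]; exact hb y w hw
  have hfy : ∀ y, Continuous fun w => f (y, w) := fun y => by fun_prop
  refine measurable_of_isClosed fun C hC => ?_
  let A : ℚ → Set (Y × Pt d) := fun q => K ∩ {p | f p ≤ q}
  have hA : ∀ q, IsClosed (A q) := fun q => hK.inter (isClosed_le hf continuous_const)
  let A' : ℚ → Set (Y × Pt d) := fun q => A q ∩ Prod.snd ⁻¹' C
  have hA' : ∀ q, IsClosed (A' q) := fun q => (hA q).inter (hC.preimage continuous_snd)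
  -- The minimizer lies in `C` iff every nonempty sublevel set of rational level meets `C`:
  -- compactness then yields a point of `C` with minimal value, and uniqueness identifies it with
  -- the chosen minimizer. Over an empty fibre the default `u y` is returned, whence the last term.
  have key : (fun y => argminOn {w | (y, w) ∈ K} (fun w => f (y, w)) (u y)) ⁻¹' C =
      ({y | ∃ w, (y, w) ∈ K} ∩ ⋂ q, ({y | ∃ w, (y, w) ∈ A q}ᶜ ∪ {y | ∃ w, (y, w) ∈ A' q})) ∪
      ({y | ∃ w, (y, w) ∈ K}ᶜ ∩ u ⁻¹' C) := by
    ext y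
    by_cases hne : ∃ w, (y, w) ∈ K
    · obtain ⟨hm, hmin⟩ := argminOn_spec (hcpt y) hne (hfy y) (u y)
      have h1 : y ∈ {y | ∃ w, (y, w) ∈ K} := hne
      simp only [Set.mem_union, Set.mem_inter_iff, h1, Set.mem_compl_iff, not_true, false_and,
        or_false, true_and, Set.mem_preimage, Set.mem_iInter]
      set m := argminOn {w | (y, w) ∈ K} (fun w => f (y, w)) (u y)
      constructor
      · intro hmC q
        by_cases hq : ∃ w, (y, w) ∈ A q
        · obtain ⟨w, hw, hwq⟩ := hq
          exact Or.inr ⟨m, ⟨hm, (hmin w hw).trans hwq⟩, hmC⟩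
        · exact Or.inl hq
      · intro h
        have h2 : ∀ q : ℚ, f (y, m) ≤ q → ∃ w, (y, w) ∈ A' q := by
          intro q hq
          rcases h q with h3 | h3
          · exact absurd ⟨m, hm, hq⟩ h3
          · exact h3
        obtain ⟨q₀, hq₀⟩ := exists_rat_gt (f (y, m))
        obtain ⟨w₀, ⟨hw₀, _⟩, hw₀C⟩ := h2 q₀ hq₀.le
        obtain ⟨w, ⟨hw, hwC⟩, hwmin⟩ := ((hcpt y).inter_right hC).exists_isMinOn ⟨w₀, hw₀, hw₀C⟩
          (hfy y).continuousOn
        have hle : f (y, w) ≤ f (y, m) := by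
          apply le_of_forall_gt_imp_ge_of_dense
          intro t ht
          obtain ⟨q, hq1, hq2⟩ := exists_rat_btwn ht
          obtain ⟨w', ⟨hw', hw'q⟩, hw'C⟩ := h2 q hq1.le
          exact ((hwmin ⟨hw', hw'C⟩ : f (y, w) ≤ f (y, w')).trans hw'q).trans hq2.le
        have : m = w := huniq y m w hm hw (fun v hv => hmin v hv)
          fun v hv => hle.trans (hmin v hv)
        rw [this]; exact hwC
    · have h0 : argminOn {w | (y, w) ∈ K} (fun w => f (y, w)) (u y) = u y := by
        rw [argminOn, dif_neg]
        rintro ⟨w, hw, _⟩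
        exact hne ⟨w, hw⟩
      have h1 : y ∉ {y | ∃ w, (y, w) ∈ K} := hne
      simp only [Set.mem_union, Set.mem_inter_iff, h1, Set.mem_compl_iff, not_false_iff, false_and,
        false_or, true_and, Set.mem_preimage, h0]
  rw [key]
  have hKm := (hproj K hK subset_rfl).measurableSet
  refine (hKm.inter (MeasurableSet.iInter fun q => ?_)).union (hKm.compl.inter (hu hC.measurableSet))
  exact (hproj _ (hA q) Set.inter_subset_left).measurableSet.compl.union
    (hproj _ (hA' q) (Set.inter_subset_left.trans Set.inter_subset_left)).measurableSet

variable {d : ℕ}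

lemma objective_midpoint (hd : 8 ≤ d) (a : ℝ) (c g u v h : Pt d) :
    objective a c g u (v + (1 / 2 : ℝ) • h) ≤
      (objective a c g u (v + h) + objective a c g u v) / 2 - pNorm (pExp d) h ^ 2 / 8 := by
  have := regularizer_midpoint hd c v h
  unfold objective bregman
  rw [show v + (1 / 2 : ℝ) • h - u = (v - u) + (1 / 2 : ℝ) • h by abel,
    show v + h - u = (v - u) + h by abel]
  simp only [inner_add_left, inner_smul_left, map_add, map_smul, smul_eq_mul, RCLike.conj_to_real]
  linarith

/-- The midpoint of two distinct minimizers would have a strictly smaller value. Uniqueness is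
needed because `argminOn` picks its value by choice. -/
lemma objective_unique (hd : 8 ≤ d) {K : Set (Pt d)} (hK : Convex ℝ K) {a : ℝ} {c g u w w' : Pt d}
    (hw : w ∈ K) (hw' : w' ∈ K) (h : ∀ v ∈ K, objective a c g u w ≤ objective a c g u v)
    (h' : ∀ v ∈ K, objective a c g u w' ≤ objective a c g u v) : w = w' := by
  by_contra hne
  have h1 := objective_midpoint hd a c g u w (w' - w)
  have hm : w + (1 / 2 : ℝ) • (w' - w) ∈ K := by
    have := hK hw hw' (show (0 : ℝ) ≤ 1 / 2 by norm_num) (show (0 : ℝ) ≤ 1 / 2 by norm_num)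
      (by norm_num)
    convert this using 1
    module
  rw [add_sub_cancel] at h1
  have h2 := h _ hm
  have h3 := h' _ hm
  have h4 := pNorm_pos (one_lt_pExp hd) (sub_ne_zero.2 (Ne.symm hne))
  have : 0 < pNorm (pExp d) (w' - w) ^ 2 := by positivity
  linarith

lemma measurable_update (hd : 8 ≤ d) (a r ρ : ℝ) :
    Measurable fun y : Pt d × Pt d × Pt d × Pt d =>
      argminOn {w : Pt d | ‖w - y.1‖ ≤ r ∧ ∑ i, |w i - y.2.1 i| ≤ ρ}
        (objective a y.2.1 y.2.2.1 y.2.2.2) y.2.2.2 := by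
  let K : Set ((Pt d × Pt d × Pt d × Pt d) × Pt d) :=
    {p | ‖p.2 - p.1.1‖ ≤ r ∧ ∑ i, |p.2 i - p.1.2.1 i| ≤ ρ}
  have hK : IsClosed K := by
    have h1 : IsClosed {p : (Pt d × Pt d × Pt d × Pt d) × Pt d | ‖p.2 - p.1.1‖ ≤ r} :=
      isClosed_le (by fun_prop) continuous_const
    have h2 : IsClosed {p : (Pt d × Pt d × Pt d × Pt d) × Pt d |
        ∑ i, |p.2 i - p.1.2.1 i| ≤ ρ} := isClosed_le (by fun_prop) continuous_const
    exact h1.inter h2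
  let f : (Pt d × Pt d × Pt d × Pt d) × Pt d → ℝ :=
    fun p => objective a p.1.2.1 p.1.2.2.1 p.1.2.2.2 p.2
  have hf : Continuous f := by
    -- Moving the centre of the regularizer to `0` turns it into a translation, so joint continuity
    -- in all parameters follows from one fixed `C¹` function.
    have e : f = fun p => a * inner ℝ p.2 p.1.2.2.1 + (regularizer 0 (p.2 - p.1.2.1) -
        regularizer 0 (p.1.2.2.2 - p.1.2.1) -
        fderiv ℝ (regularizer (0 : Pt d)) (p.1.2.2.2 - p.1.2.1) (p.2 - p.1.2.2.2)) := by
      ext p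
      simp only [f, objective, bregman]
      rw [fderiv_regularizer, regularizer_eq, regularizer_eq p.1.2.1]
    rw [e]
    have hF := (contDiff_regularizer hd (0 : Pt d)).continuous
    have hF' := (contDiff_regularizer hd (0 : Pt d)).continuous_fderiv one_ne_zero
    have h2 : Continuous fun p : (Pt d × Pt d × Pt d × Pt d) × Pt d =>
        fderiv ℝ (regularizer (0 : Pt d)) (p.1.2.2.2 - p.1.2.1) (p.2 - p.1.2.2.2) :=
      (hF'.comp (by fun_prop : Continuous fun p : (Pt d × Pt d × Pt d × Pt d) × Pt d =>
        p.1.2.2.2 - p.1.2.1)).clm_apply (by fun_prop)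
    fun_prop
  refine measurable_argminOn hK hf (ctr := fun y => y.1) continuous_fst (ρ := r)
    (fun y w h => h.1) (u := fun y => y.2.2.2) (by fun_prop) ?_
  intro y w w' hw hw' h h'
  exact objective_unique hd (convex_constraint r ρ y.1 y.2.1) hw hw' (fun v hv => h v hv)
    (fun v hv => h' v hv)

lemma measurable_sInf_nat {α : Type*} [MeasurableSpace α] {A : α → Set ℕ}
    (hA : ∀ n, MeasurableSet {x | n ∈ A x}) : Measurable fun x => sInf (A x) := by
  refine measurable_to_countable' fun k => ?_
  -- Since `sInf ∅ = 0` in `ℕ`, the value `0` is also taken where the set is empty.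
  have : (fun x => sInf (A x)) ⁻¹' {k} = ({x | k ∈ A x} ∩ ⋂ n ∈ Finset.range k, {x | n ∈ A x}ᶜ) ∪
      (if k = 0 then ⋂ n, {x | n ∈ A x}ᶜ else ∅) := by
    ext x
    simp only [Set.mem_preimage, Set.mem_singleton_iff, Set.mem_union, Set.mem_inter_iff,
      Set.mem_ofPred_eq, Set.mem_iInter, Set.mem_compl_iff, Finset.mem_range]
    constructor
    · intro h
      rcases (A x).eq_empty_or_nonempty with he | hne
      · right
        rw [he, Nat.sInf_empty] at h
        rw [if_pos h.symm]
        simp [he]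
      · left
        rw [← h]
        exact ⟨Nat.sInf_mem hne, fun n hn => Nat.notMem_of_lt_sInf hn⟩
    · rintro (⟨h1, h2⟩ | h)
      · apply le_antisymm (Nat.sInf_le h1)
        by_contra hlt
        exact h2 _ (not_le.1 hlt) (Nat.sInf_mem ⟨k, h1⟩)
      · split_ifs at h with hk
        · have : A x = ∅ := by
            ext n; simpa using Set.mem_iInter.1 h n
          rw [this, Nat.sInf_empty, hk]
        · exact absurd h (Set.notMem_empty _)
  rw [this]
  refine ((hA k).inter (Finset.measurableSet_biInter _ fun n _ => (hA n).compl)).union ?_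
  split_ifs
  · exact MeasurableSet.iInter fun n => (hA n).compl
  · exact MeasurableSet.empty

lemma measurable_apply_countable {α β ι : Type*} [MeasurableSpace α] [MeasurableSpace β]
    [MeasurableSpace ι] [Countable ι] [MeasurableSingletonClass ι] {f : ι → α → β} {k : α → ι}
    (hf : ∀ i, Measurable (f i)) (hk : Measurable k) : Measurable fun x => f (k x) x := by
  have : Measurable fun p : ι × α => f p.1 p.2 := measurable_from_prod_countable_right hf
  exact this.comp (hk.prodMk measurable_id)

lemma measurable_hat : Measurable (hat : Pt d → Pt d) := by
  unfold hat
  apply Measurable.ite (measurableSet_singleton 0) measurable_const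
  fun_prop

lemma measurable_hardThreshold (s : ℕ) : Measurable (hardThreshold s : Pt d → Pt d) := by
  classical
  have h1 : ∀ i : Fin d, Measurable fun w : Pt d => hardThreshold s w i := by
    intro i
    have hset : ∀ j : Fin d, MeasurableSet {w : Pt d | j ∈ beats w i} := by
      intro j
      have m1 : MeasurableSet {w : Pt d | |w i| < |w j|} :=
        measurableSet_lt (by fun_prop) (by fun_prop)
      have m2 : MeasurableSet {w : Pt d | |w j| = |w i|} :=
        measurableSet_eq_fun (by fun_prop) (by fun_prop)
      by_cases hji : j < i
      · convert m1.union m2 using 1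
        ext w; simp [beats, hji]
      · convert m1 using 1
        ext w; simp [beats, hji]
    have hcard : Measurable fun w : Pt d => (beats w i).ncard := by
      have e : (fun w : Pt d => (beats w i).ncard) =
          fun w => ∑ j : Fin d, if j ∈ beats w i then 1 else 0 := by
        ext w
        rw [Finset.sum_boole, ← Set.ncard_coe_finset]
        simp
      rw [e]
      exact Finset.measurable_sum _ fun j _ => Measurable.ite (hset j) measurable_const measurable_const
    have e : (fun w : Pt d => hardThreshold s w i) =
        fun w => if (beats w i).ncard < s then w i else 0 := by
      ext w; rw [hardThreshold_apply]; simp only [mem_topSet]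
    rw [e]
    exact Measurable.ite (hcard (measurableSet_Iio (a := s))) (by fun_prop) measurable_const
  have h2 : Measurable fun w : Pt d => (WithLp.ofLp (hardThreshold s w)) :=
    measurable_pi_lambda _ h1
  exact (WithLp.measurable_toLp 2 _).comp h2

variable {α : Type*} [MeasurableSpace α]

lemma measurable_sgn : Measurable sgn := measurable_of_countable _

lemma measurable_sampleBand {b : ℝ} {U : α → Pt d} {Z : α → ℕ → Ex d} (hU : Measurable U)
    (hZ : Measurable Z) : Measurable fun x => sampleBand b (U x) (Z x) := by
  unfold sampleBand
  have hZn : ∀ n, Measurable fun x => Z x n := fun n => (measurable_pi_apply n).comp hZ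
  have hh : Measurable fun x => hat (U x) := measurable_hat.comp hU
  refine measurable_apply_countable (f := fun n x => Z x n) hZn (measurable_sInf_nat fun n => ?_)
  have h1 : Measurable fun x => (Z x n).1 := measurable_fst.comp (hZn n)
  have h2 : Measurable fun x => |inner ℝ (hat (U x)) (Z x n).1| := by
    have h3 : Measurable fun x => inner ℝ (hat (U x)) (Z x n).1 := hh.inner h1
    exact h3.abs
  exact measurableSet_le h2 measurable_const

lemma measurable_grad : Measurable (grad : Ex d → Pt d) := by
  unfold grad
  have h1 : Measurable fun e : Ex d => sgn e.2 := measurable_sgn.comp measurable_snd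
  exact (h1.smul measurable_fst).neg

lemma measurable_iter (hd : 8 ≤ d) (P : Param) (r b : ℝ) (T : ℕ) {W : α → Pt d}
    {Z : α → ℕ → ℕ → Ex d} (hW : Measurable W) (hZ : Measurable Z) (t : ℕ) :
    Measurable fun x => iter P (W x) r b T (Z x) t := by
  induction t with
  | zero => exact (measurable_hardThreshold P.s).comp hW
  | succ t ih =>
    have hq : Measurable fun x => query P (W x) r b T (Z x) t :=
      measurable_sampleBand ih ((measurable_pi_apply t).comp hZ)
    have hg : Measurable fun x => grad (query P (W x) r b T (Z x) t) := measurable_grad.comp hq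
    have hH : Measurable fun x => hardThreshold P.s (W x) :=
      (measurable_hardThreshold P.s).comp hW
    have hp : Measurable fun x => (W x, hardThreshold P.s (W x),
        grad (query P (W x) r b T (Z x) t), iter P (W x) r b T (Z x) t) :=
      hW.prodMk (hH.prodMk (hg.prodMk ih))
    have := (measurable_update hd (stepSize d P r b T) (4 * r) (8 * r * √(2 * P.s))).comp hp
    simp only [iter_succ]
    exact this

lemma measurable_optimize_average (hd : 8 ≤ d) (P : Param) (r b : ℝ) (T : ℕ) {W : α → Pt d}
    {Z : α → ℕ → ℕ → Ex d} (hW : Measurable W) (hZ : Measurable Z) :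
    Measurable fun x => (optimize P (W x) r b T .average (Z x)).1 := by
  simp only [optimize_average]
  exact (Finset.measurable_sum _ fun t _ =>
    measurable_hat.comp (measurable_iter hd P r b T hW hZ t)).const_smul (1 / (T : ℝ))

lemma measurable_optimize_random (hd : 8 ≤ d) (P : Param) (r b : ℝ) (T : ℕ) {W : α → Pt d}
    {Z : α → ℕ → ℕ → Ex d} {n : ℕ} {k : α → Fin n × Bool} (hW : Measurable W) (hZ : Measurable Z)
    (hk : Measurable k) :
    Measurable fun x => (optimize P (W x) r b T (.random (k x).1 (k x).2) (Z x)).1 := by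
  simp only [optimize_random]
  exact measurable_apply_countable
    (f := fun (i : Fin n × Bool) x => sgn i.2 • hat (iter P (W x) r b T (Z x) i.1))
    (fun i => (measurable_hat.comp (measurable_iter hd P r b T hW hZ i.1)).const_smul (sgn i.2)) hk

lemma measurable_halfspace : Measurable fun p : Pt d × Pt d => halfspace p.1 p.2 := by
  apply measurable_to_bool
  have : (fun p : Pt d × Pt d => halfspace p.1 p.2) ⁻¹' {true} = {p | 0 ≤ inner ℝ p.1 p.2} := by
    ext p; simp [halfspace]
  rw [this]
  exact measurableSet_le measurable_const (by fun_prop)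

lemma measurableSet_misclassified :
    MeasurableSet {p : Pt d × Ex d | halfspace p.1 p.2.1 ≠ p.2.2} := by
  have h1 : Measurable fun p : Pt d × Ex d => halfspace p.1 p.2.1 :=
    measurable_halfspace.comp (measurable_fst.prodMk (measurable_fst.comp measurable_snd))
  exact (measurableSet_eq_fun h1 (measurable_snd.comp measurable_snd)).compl

lemma measurable_err (D : Measure (Ex d)) [IsProbabilityMeasure D] :
    Measurable fun w : Pt d => err w D := by
  unfold err Measure.real
  exact (measurable_measure_prodMk_left measurableSet_misclassified).ennreal_toReal

variable (P : Param) (S : Schedule)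

/-- The examples at the sites of the `j`-th call of `optimize` in trial `i`. -/
def initStream (ω : Outcome d S) (i j : ℕ) : ℕ → ℕ → Ex d := fun t n => ω.1 (.init i j t, n)

/-- The examples at the sites of the `j`-th call of `optimize` in the main loop. -/
def refineStream (ω : Outcome d S) (j : ℕ) : ℕ → ℕ → Ex d := fun t n => ω.1 (.refine j t, n)

lemma measurable_initStream (i j : ℕ) : Measurable fun ω : Outcome d S => initStream S ω i j :=
  measurable_pi_lambda _ fun _ => measurable_pi_lambda _ fun _ =>
    (measurable_pi_apply _).comp measurable_fst

lemma measurable_refineStream (j : ℕ) : Measurable fun ω : Outcome d S => refineStream S ω j :=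
  measurable_pi_lambda _ fun _ => measurable_pi_lambda _ fun _ =>
    (measurable_pi_apply _).comp measurable_fst

lemma trial_one (ω : Outcome d S) (i : ℕ) : (trial P S ω i 1).1 =
    (optimize P 0 (prox 0) (S.b 0) (S.T 0) (.random (ω.2 i).1 (ω.2 i).2) (initStream S ω i 0)).1 :=
  rfl

lemma trial_succ (ω : Outcome d S) (i j : ℕ) : (trial P S ω i (j + 2)).1 =
    (optimize P (trial P S ω i (j + 1)).1 (prox (j + 1)) (S.b (j + 1)) (S.T (j + 1)) .average
      (initStream S ω i (j + 1))).1 :=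
  rfl

lemma refineState_succ (ω : Outcome d S) (i : ℕ) : (refineState P S ω (i + 1)).1 =
    (optimize P (refineState P S ω i).1 (prox (i + 1)) (S.b (i + 1)) (S.T (i + 1)) .average
      (refineStream S ω (i + 1))).1 :=
  rfl

lemma measurable_trial (hd : 8 ≤ d) (i j : ℕ) :
    Measurable fun ω : Outcome d S => (trial P S ω i j).1 := by
  induction j with
  | zero => exact measurable_const
  | succ j ih =>
    cases j with
    | zero =>
      simp only [zero_add, trial_one]
      exact measurable_optimize_random hd P _ _ _ measurable_const (measurable_initStream S i 0)
        ((measurable_pi_apply i).comp measurable_snd)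
    | succ j =>
      simp only [trial_succ]
      exact measurable_optimize_average hd P _ _ _ ih (measurable_initStream S i (j + 1))

/-- The candidate of trial `i`. -/
def cand (ω : Outcome d S) (i : ℕ) : Pt d := (trial P S ω i (k0 P S + 1)).1

/-- The empirical error of the candidate of trial `i`. -/
def candErr (ω : Outcome d S) (i : ℕ) : ℝ :=
  empErr S.m (cand P S ω i) (fun n => ω.1 (.holdout, n))

/-- The index of the selected candidate. -/
def best (ω : Outcome d S) : ℕ :=
  sInf {i | i < trials P ∧ ∀ i' < trials P, candErr P S ω i ≤ candErr P S ω i'}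

lemma initProc_fst (ω : Outcome d S) : (initProc P S ω).1 = hat (cand P S ω (best P S ω)) := rfl

lemma measurable_empErr (m : ℕ) :
    Measurable fun p : Pt d × (ℕ → Ex d) => empErr m p.1 p.2 := by
  unfold empErr
  refine (Finset.measurable_sum _ fun n _ => ?_).const_mul _
  refine Measurable.ite ?_ measurable_const measurable_const
  have h : Measurable fun p : Pt d × (ℕ → Ex d) => (p.1, p.2 n) :=
    measurable_fst.prodMk ((measurable_pi_apply n).comp measurable_snd)
  exact h measurableSet_misclassified

lemma measurable_holdout : Measurable fun ω : Outcome d S => fun n => ω.1 (.holdout, n) :=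
  measurable_pi_lambda _ fun _ => (measurable_pi_apply _).comp measurable_fst

lemma measurable_cand (hd : 8 ≤ d) (i : ℕ) : Measurable fun ω : Outcome d S => cand P S ω i := by
  unfold cand
  exact measurable_trial P S hd i (k0 P S + 1)

lemma measurable_candErr (hd : 8 ≤ d) (i : ℕ) :
    Measurable fun ω : Outcome d S => candErr P S ω i := by
  have h := (measurable_cand (d := d) P S hd i).prodMk (measurable_holdout S)
  have h2 := (measurable_empErr (d := d) S.m).comp h
  exact h2

lemma measurable_best (hd : 8 ≤ d) : Measurable fun ω : Outcome d S => best P S ω := by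
  unfold best
  refine measurable_sInf_nat fun n => ?_
  change MeasurableSet {ω : Outcome d S | n < trials P ∧
    ∀ i' < trials P, candErr P S ω n ≤ candErr P S ω i'}
  have h : MeasurableSet (⋂ i' ∈ Finset.range (trials P),
      {a : Outcome d S | candErr P S a n ≤ candErr P S a i'}) :=
    Finset.measurableSet_biInter _ fun i' _ =>
      measurableSet_le (measurable_candErr P S hd n) (measurable_candErr P S hd i')
  have e : {ω : Outcome d S | n < trials P ∧ ∀ i' < trials P, candErr P S ω n ≤ candErr P S ω i'} =
      {_ω | n < trials P} ∩ ⋂ i' ∈ Finset.range (trials P),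
        {a : Outcome d S | candErr P S a n ≤ candErr P S a i'} := by
    ext ω; simp
  rw [e]
  exact (MeasurableSet.const _).inter h

lemma measurable_initProc (hd : 8 ≤ d) : Measurable fun ω : Outcome d S => (initProc P S ω).1 := by
  simp only [initProc_fst]
  have h : Measurable fun ω : Outcome d S => cand P S ω (best P S ω) :=
    measurable_apply_countable (f := fun i ω => cand P S ω i)
      (fun i => measurable_cand P S hd i) (measurable_best P S hd)
  exact measurable_hat.comp h

lemma measurable_refineState (hd : 8 ≤ d) (i : ℕ) :
    Measurable fun ω : Outcome d S => (refineState P S ω i).1 := by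
  induction i with
  | zero => exact measurable_initProc P S hd
  | succ i ih =>
    simp only [refineState_succ]
    exact measurable_optimize_average hd P _ _ _ ih (measurable_refineStream S (i + 1))

end measurability

/-! ### Resampling some coordinates of a product measure -/

section resampling

/-- The family that agrees with `ω'` on `A` and with `ω` off `A`. -/
def mix {ι X : Type*} (A : Set ι) (ω ω' : ι → X) : ι → X :=
  open Classical in fun i => if i ∈ A then ω' i else ω i

lemma mix_of_mem {ι X : Type*} {A : Set ι} (ω ω' : ι → X) {i : ι} (h : i ∈ A) :
    mix A ω ω' i = ω' i := by simp [mix, h]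

lemma mix_of_notMem {ι X : Type*} {A : Set ι} (ω ω' : ι → X) {i : ι} (h : i ∉ A) :
    mix A ω ω' i = ω i := by simp [mix, h]

variable {ι X : Type*} [MeasurableSpace X] (ν : Measure X) [IsProbabilityMeasure ν]

lemma measurable_mix (A : Set ι) :
    Measurable fun p : (ι → X) × (ι → X) => mix A p.1 p.2 := by
  refine measurable_pi_lambda _ fun i => ?_
  by_cases h : i ∈ A
  · simp only [mix_of_mem _ _ h]; fun_prop
  · simp only [mix_of_notMem _ _ h]; fun_prop

/-- On boxes, the product measure factors over the coordinates in `A` and off `A`, so it does not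
matter that they come from different copies. -/
lemma map_mix (A : Set ι) :
    ((Measure.infinitePi fun _ : ι => ν).prod (Measure.infinitePi fun _ : ι => ν)).map
      (fun p => mix A p.1 p.2) = Measure.infinitePi fun _ : ι => ν := by
  classical
  apply Measure.eq_infinitePi
  intro s t ht
  rw [Measure.map_apply (measurable_mix A)
    (MeasurableSet.pi (Finset.countable_toSet s) fun i _ => ht i)]
  have e : (fun p : (ι → X) × (ι → X) => mix A p.1 p.2) ⁻¹' (Set.pi s t) =
      (Set.pi (s.filter fun i => i ∉ A : Finset ι) t) ×ˢ
        (Set.pi (s.filter fun i => i ∈ A : Finset ι) t) := by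
    ext p
    simp only [Set.mem_preimage, Set.mem_pi, Set.mem_prod, Finset.mem_coe, Finset.mem_filter]
    constructor
    · intro h
      refine ⟨fun i hi => ?_, fun i hi => ?_⟩
      · have := h i hi.1; rwa [mix_of_notMem _ _ hi.2] at this
      · have := h i hi.1; rwa [mix_of_mem _ _ hi.2] at this
    · rintro ⟨h1, h2⟩ i hi
      by_cases hA : i ∈ A
      · rw [mix_of_mem _ _ hA]; exact h2 i ⟨hi, hA⟩
      · rw [mix_of_notMem _ _ hA]; exact h1 i ⟨hi, hA⟩
  rw [e, Measure.prod_prod, Measure.infinitePi_pi _ fun i _ => ht i,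
    Measure.infinitePi_pi _ fun i _ => ht i, mul_comm]
  exact Finset.prod_filter_mul_prod_filter_not s (fun i => i ∈ A) fun i => ν (t i)

/-- This replaces conditioning: in the inner integral the coordinates off `A` are frozen and those
in `A` are fresh. -/
lemma lintegral_resample (A : Set ι) {Φ : (ι → X) → ENNReal} (hΦ : Measurable Φ) :
    ∫⁻ ω, Φ ω ∂(Measure.infinitePi fun _ : ι => ν) =
      ∫⁻ ω, ∫⁻ ω', Φ (mix A ω ω') ∂(Measure.infinitePi fun _ : ι => ν)
        ∂(Measure.infinitePi fun _ : ι => ν) := by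
  conv_lhs => rw [← map_mix ν A]
  rw [lintegral_map hΦ (measurable_mix A), lintegral_prod]
  exact (hΦ.comp (measurable_mix A)).aemeasurable

lemma infinitePi_map_comp {κ : Type*} {f : κ → ι} (hf : Function.Injective f) :
    (Measure.infinitePi fun _ : ι => ν).map (fun ω k => ω (f k)) =
      Measure.infinitePi fun _ : κ => ν := by
  classical
  apply Measure.eq_infinitePi
  intro s t ht
  rw [Measure.map_apply (measurable_pi_lambda _ fun k => measurable_pi_apply (f k))
    (MeasurableSet.pi (Finset.countable_toSet s) fun i _ => ht i)]
  let t' : ι → Set X := fun i => if h : ∃ k, f k = i then t h.choose else Set.univ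
  have ht' : ∀ k, t' (f k) = t k := by
    intro k
    have h : ∃ k', f k' = f k := ⟨k, rfl⟩
    simp only [t', dif_pos h]
    rw [hf h.choose_spec]
  have e : (fun (ω : ι → X) k => ω (f k)) ⁻¹' (Set.pi s t) =
      Set.pi (s.map ⟨f, hf⟩ : Finset ι) t' := by
    ext ω
    simp [Set.mem_pi, ht']
  rw [e, Measure.infinitePi_pi]
  · simp [Finset.prod_map, ht']
  · intro i hi
    obtain ⟨k, _, rfl⟩ := Finset.mem_map.1 hi
    simp only [Function.Embedding.coeFn_mk, ht']
    exact ht k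

/-- The first member of an i.i.d. sequence that falls into `B` has the conditional law on `B`. -/
lemma map_firstHit {B : Set X} (hB : MeasurableSet B) (h0 : ν B ≠ 0) :
    (Measure.infinitePi fun _ : ℕ => ν).map (fun z => z (sInf {n | z n ∈ B})) = ν[|B] := by
  have hm : Measurable fun z : ℕ → X => z (sInf {n | z n ∈ B}) :=
    measurable_apply_countable (f := fun n (z : ℕ → X) => z n) (fun n => measurable_pi_apply n)
      (measurable_sInf_nat fun n => measurable_pi_apply n hB)
  have : IsProbabilityMeasure ν[|B] := cond_isProbabilityMeasure h0
  have : IsProbabilityMeasure ((Measure.infinitePi fun _ : ℕ => ν).map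
      (fun z => z (sInf {n | z n ∈ B}))) := Measure.isProbabilityMeasure_map hm.aemeasurable
  symm
  -- Between probability measures an inequality suffices. It is enough to sum over the disjoint
  -- events `H n` that the first hit occurs at time `n` and lies in `E`, a geometric series of ratio
  -- `1 - ν B`; streams without a hit need no separate treatment.
  refine Measure.eq_of_le_of_isProbabilityMeasure (Measure.le_iff.2 fun E hE => ?_)
  rw [Measure.map_apply hm hE, cond_apply hB]
  let t : ℕ → ℕ → Set X := fun n k => if k < n then Bᶜ else B ∩ E
  have htm : ∀ n k, MeasurableSet (t n k) := by
    intro n k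
    simp only [t]
    split_ifs
    exacts [hB.compl, hB.inter hE]
  let H : ℕ → Set (ℕ → X) := fun n => Set.pi (Finset.range (n + 1) : Finset ℕ) (t n)
  have hHm : ∀ n, MeasurableSet (H n) := fun n =>
    MeasurableSet.pi (Finset.countable_toSet _) fun i _ => htm n i
  have hHz : ∀ n z, z ∈ H n → (∀ k < n, z k ∉ B) ∧ z n ∈ B ∧ z n ∈ E := by
    intro n z hz
    refine ⟨fun k hk => ?_, ?_⟩
    · have := hz k (by simp; omega)
      simpa [t, hk] using this
    · have := hz n (by simp)
      simpa [t] using this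
  have hHs : ∀ n z, z ∈ H n → sInf {n | z n ∈ B} = n := by
    intro n z hz
    obtain ⟨h1, h2, _⟩ := hHz n z hz
    apply le_antisymm (Nat.sInf_le h2)
    by_contra hlt
    exact h1 _ (not_le.1 hlt) (Nat.sInf_mem (s := {n | z n ∈ B}) ⟨n, h2⟩)
  have hdisj : Pairwise (Function.onFun Disjoint H) := by
    intro m n hmn
    rw [Function.onFun, Set.disjoint_left]
    intro z hz hz'
    exact hmn ((hHs m z hz).symm.trans (hHs n z hz'))
  have hsub : (⋃ n, H n) ⊆ (fun z : ℕ → X => z (sInf {n | z n ∈ B})) ⁻¹' E := by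
    intro z hz
    obtain ⟨n, hn⟩ := Set.mem_iUnion.1 hz
    rw [Set.mem_preimage, hHs n z hn]
    exact (hHz n z hn).2.2
  refine le_trans (le_of_eq ?_) (measure_mono hsub)
  rw [measure_iUnion hdisj hHm]
  have hHv : ∀ n, (Measure.infinitePi fun _ : ℕ => ν) (H n) = (1 - ν B) ^ n * ν (B ∩ E) := by
    intro n
    rw [Measure.infinitePi_pi _ fun i _ => htm n i, Finset.prod_range_succ]
    congr 1
    · rw [Finset.prod_congr rfl (g := fun _ => 1 - ν B), Finset.prod_const, Finset.card_range]
      intro k hk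
      simp only [t, Finset.mem_range.1 hk, if_true]
      exact prob_compl_eq_one_sub hB
    · simp [t]
  simp_rw [hHv]
  rw [ENNReal.tsum_mul_right, ENNReal.tsum_geometric,
    ENNReal.sub_sub_cancel ENNReal.one_ne_top prob_le_one]

end resampling

/-! ### Adaptive sampling -/

section adaptive
variable {d : ℕ}

/-- The band of the examples that `sampleBand` accepts. -/
def band (b : ℝ) (u : Pt d) : Set (Ex d) := {e | |inner ℝ (hat u) e.1| ≤ b}

lemma measurableSet_band (b : ℝ) (u : Pt d) : MeasurableSet (band b u) :=
  measurableSet_le (by fun_prop) measurable_const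

lemma map_sampleBand (D : Measure (Ex d)) [IsProbabilityMeasure D] {b : ℝ} {u : Pt d}
    (h0 : D (band b u) ≠ 0) :
    (Measure.infinitePi fun _ : ℕ => D).map (sampleBand b u) = D[|band b u] :=
  map_firstHit D (measurableSet_band b u) h0

variable {ι : Type*} (D : Measure (Ex d)) [IsProbabilityMeasure D]

/-- `Ψ` and `U` do not read the stream `i₀`. Resampling that stream freezes them, and the fresh
stream contributes one draw from the conditional law on the frozen band. -/
lemma lintegral_adaptive_step (i₀ : ι) {b : ℝ} {Ψ : (ι × ℕ → Ex d) → ENNReal}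
    (hΨm : Measurable Ψ) {U : (ι × ℕ → Ex d) → Pt d} (hUm : Measurable U)
    {φ : Pt d × Ex d → ENNReal} (hφm : Measurable φ)
    (hΨ : ∀ ω ω' : ι × ℕ → Ex d, (∀ i, i ≠ i₀ → ∀ n, ω (i, n) = ω' (i, n)) → Ψ ω = Ψ ω')
    (hU : ∀ ω ω' : ι × ℕ → Ex d, (∀ i, i ≠ i₀ → ∀ n, ω (i, n) = ω' (i, n)) → U ω = U ω')
    (h0 : ∀ ω, D (band b (U ω)) ≠ 0) {q : ENNReal}
    (hq : ∀ ω, ∫⁻ e, φ (U ω, e) ∂D[|band b (U ω)] ≤ q) :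
    ∫⁻ ω, Ψ ω * φ (U ω, sampleBand b (U ω) fun n => ω (i₀, n))
        ∂(Measure.infinitePi fun _ : ι × ℕ => D) ≤
      q * ∫⁻ ω, Ψ ω ∂(Measure.infinitePi fun _ : ι × ℕ => D) := by
  have hst : Measurable fun ω : ι × ℕ → Ex d => fun n => ω (i₀, n) :=
    measurable_pi_lambda _ fun n => measurable_pi_apply _
  rw [lintegral_resample D {p : ι × ℕ | p.1 = i₀}
    (Φ := fun ω => Ψ ω * φ (U ω, sampleBand b (U ω) fun n => ω (i₀, n)))
    (hΨm.mul (hφm.comp (hUm.prodMk (measurable_sampleBand hUm hst)))),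
    ← lintegral_const_mul _ hΨm]
  refine lintegral_mono fun ω => ?_
  have hagree : ∀ ω', ∀ i, i ≠ i₀ → ∀ n, mix {p : ι × ℕ | p.1 = i₀} ω ω' (i, n) = ω (i, n) :=
    fun ω' i hi n => mix_of_notMem _ _ (by simpa using hi)
  have hnew : ∀ ω', (fun n => mix {p : ι × ℕ | p.1 = i₀} ω ω' (i₀, n)) = fun n => ω' (i₀, n) :=
    fun ω' => funext fun n => mix_of_mem _ _ (by simp)
  simp_rw [fun ω' => hΨ _ ω (hagree ω'), fun ω' => hU _ ω (hagree ω'), hnew]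
  have hφ1 : Measurable fun e => φ (U ω, e) := hφm.comp (by fun_prop)
  have hsb : Measurable fun z : ℕ → Ex d => sampleBand b (U ω) z :=
    measurable_sampleBand measurable_const measurable_id
  rw [lintegral_const_mul (f := fun ω' : ι × ℕ → Ex d =>
    φ (U ω, sampleBand b (U ω) fun n => ω' (i₀, n))) _ (hφ1.comp (hsb.comp hst)), mul_comm]
  gcongr
  refine le_trans (le_of_eq ?_) (hq ω)
  rw [← map_sampleBand D (h0 ω), lintegral_map hφ1 hsb,
    ← infinitePi_map_comp D (f := fun n : ℕ => (i₀, n)) (fun _ _ h => (Prod.mk.inj h).2),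
    lintegral_map (f := fun z : ℕ → Ex d => φ (U ω, sampleBand b (U ω) z)) (hφ1.comp hsb) hst]

variable {site : ℕ → ι} {b : ℝ} {U : ℕ → (ι × ℕ → Ex d) → Pt d} {φ : Pt d × Ex d → ENNReal}

/-- The partial products form a supermartingale: the iterate `U t` and the earlier factors depend
only on earlier streams, so the last factor can be integrated out first. -/
lemma lintegral_adaptive_prod (hsite : Function.Injective site) (hUm : ∀ t, Measurable (U t))
    (hU : ∀ t (ω ω' : ι × ℕ → Ex d),
      (∀ k < t, ∀ n, ω (site k, n) = ω' (site k, n)) → U t ω = U t ω')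
    (hφm : Measurable φ) (h0 : ∀ t ω, D (band b (U t ω)) ≠ 0)
    (hq : ∀ t ω, ∫⁻ e, φ (U t ω, e) ∂D[|band b (U t ω)] ≤ 1) (n : ℕ) :
    ∫⁻ ω, ∏ t ∈ Finset.range n, φ (U t ω, sampleBand b (U t ω) fun n => ω (site t, n))
        ∂(Measure.infinitePi fun _ : ι × ℕ => D) ≤ 1 := by
  have hterm : ∀ t, Measurable fun ω : ι × ℕ → Ex d =>
      φ (U t ω, sampleBand b (U t ω) fun n => ω (site t, n)) := fun t =>
    hφm.comp ((hUm t).prodMk (measurable_sampleBand (hUm t)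
      (measurable_pi_lambda _ fun n => measurable_pi_apply _)))
  induction n with
  | zero => simp
  | succ n ih =>
    simp_rw [Finset.prod_range_succ]
    refine (lintegral_adaptive_step D (site n)
      (Finset.measurable_prod _ fun t _ => hterm t) (hUm n) hφm ?_ ?_ (h0 n) (hq n)).trans ?_
    · intro ω ω' h
      refine Finset.prod_congr rfl fun t ht => ?_
      have ht := Finset.mem_range.1 ht
      have h1 : ∀ k, k < n → ∀ m, ω (site k, m) = ω' (site k, m) := fun k hk =>
        h _ fun e => by have := hsite e; omega
      rw [hU t ω ω' fun k hk => h1 k (by omega)]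
      congr 3
      funext m
      exact h1 t ht m
    · intro ω ω' h
      exact hU n ω ω' fun k hk => h _ fun e => by have := hsite e; omega
    · rwa [one_mul]

/-- One adaptive step with `Ψ = 1` and the indicator of `B` as test function. -/
lemma measure_adaptive_le (hUm : ∀ t, Measurable (U t))
    (hsite : Function.Injective site)
    (hU : ∀ t (ω ω' : ι × ℕ → Ex d),
      (∀ k < t, ∀ n, ω (site k, n) = ω' (site k, n)) → U t ω = U t ω')
    (h0 : ∀ t ω, D (band b (U t ω)) ≠ 0) {q : ENNReal} {B : Set (Pt d × Ex d)}
    (hB : MeasurableSet B) (hq : ∀ t ω, D[|band b (U t ω)] {e | (U t ω, e) ∈ B} ≤ q) (t : ℕ) :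
    (Measure.infinitePi fun _ : ι × ℕ => D)
      {ω | (U t ω, sampleBand b (U t ω) fun n => ω (site t, n)) ∈ B} ≤ q := by
  have h := lintegral_adaptive_step D (b := b) (site t) (Ψ := fun _ => 1) measurable_const (hUm t)
    (φ := B.indicator 1) (measurable_one.indicator hB) (fun _ _ _ => rfl)
    (fun ω ω' h => hU t ω ω' fun k hk => h _ fun e => by have := hsite e; omega) (h0 t) (q := q) (by
      intro ω
      have e : (fun e => B.indicator (1 : Pt d × Ex d → ENNReal) (U t ω, e)) =
          {e | (U t ω, e) ∈ B}.indicator 1 := by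
        ext e; simp [Set.indicator]
      have hBs : MeasurableSet {e | (U t ω, e) ∈ B} := measurable_prodMk_left hB
      rw [e, lintegral_indicator_one hBs]
      exact hq t ω)
  simp only [one_mul, lintegral_const, measure_univ, mul_one] at h
  refine le_trans (le_of_eq ?_) h
  have hm : MeasurableSet {ω | (U t ω, sampleBand b (U t ω) fun n => ω (site t, n)) ∈ B} :=
    ((hUm t).prodMk (measurable_sampleBand (hUm t)
      (measurable_pi_lambda _ fun n => measurable_pi_apply _))) hB
  rw [← lintegral_indicator_one hm]
  rfl

end adaptive

/-! ### Resampling under the law of the algorithm -/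

section law
variable {d : ℕ} (S : Schedule) (D : Measure (Ex d)) [IsProbabilityMeasure D]

instance : IsProbabilityMeasure (law S D) := by unfold law; infer_instance

/-- The outcome that agrees with `ω'` at the places in `A` and `B` and with `ω` elsewhere. -/
def mixOutcome {S : Schedule} (A : Set (Site × ℕ)) (B : Set ℕ) (ω ω' : Outcome d S) :
    Outcome d S :=
  (mix A ω.1 ω'.1, mix B ω.2 ω'.2)

lemma measurable_mixOutcome (A : Set (Site × ℕ)) (B : Set ℕ) :
    Measurable fun p : Outcome d S × Outcome d S => mixOutcome A B p.1 p.2 := by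
  have h1 : Measurable fun p : Outcome d S × Outcome d S => mix A p.1.1 p.2.1 :=
    (measurable_mix A).comp (by fun_prop :
      Measurable fun p : Outcome d S × Outcome d S => (p.1.1, p.2.1))
  have h2 : Measurable fun p : Outcome d S × Outcome d S => mix B p.1.2 p.2.2 :=
    (measurable_mix B).comp (by fun_prop :
      Measurable fun p : Outcome d S × Outcome d S => (p.1.2, p.2.2))
  exact h1.prodMk h2

lemma lintegral_law_resample (A : Set (Site × ℕ)) (B : Set ℕ) {Φ : Outcome d S → ENNReal}
    (hΦ : Measurable Φ) :
    ∫⁻ ω, Φ ω ∂law S D = ∫⁻ ω, ∫⁻ ω', Φ (mixOutcome A B ω ω') ∂law S D ∂law S D := by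
  set μ := Measure.infinitePi fun _ : Site × ℕ => D
  set Q := Measure.infinitePi fun _ : ℕ =>
    (PMF.uniformOfFintype (Fin (S.T 0) × Bool)).toMeasure
  have hl : law S D = μ.prod Q := rfl
  have hm := hΦ.comp (measurable_mixOutcome (d := d) S A B)
  have h3 : Measurable fun p : ((Site × ℕ → Ex d) × (ℕ → Fin (S.T 0) × Bool)) ×
      ((Site × ℕ → Ex d) × (ℕ → Fin (S.T 0) × Bool)) => Φ (mixOutcome A B p.1 p.2) := hm
  rw [hl, lintegral_prod _ hΦ.aemeasurable, lintegral_prod _ (by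
    exact h3.lintegral_prod_right'.aemeasurable)]
  rw [lintegral_resample D A (hΦ.lintegral_prod_right')]
  refine lintegral_congr fun x => ?_
  have e1 : ∀ x', ∫⁻ y, Φ (mix A x x', y) ∂Q =
      ∫⁻ y, ∫⁻ y', Φ (mix A x x', mix B y y') ∂Q ∂Q := fun x' =>
    lintegral_resample (PMF.uniformOfFintype (Fin (S.T 0) × Bool)).toMeasure B
      (Φ := fun y => Φ (mix A x x', y)) (hΦ.comp (by fun_prop))
  simp_rw [e1]
  have h4 : Measurable fun p : ((Site × ℕ → Ex d) × (ℕ → Fin (S.T 0) × Bool)) ×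
      (ℕ → Fin (S.T 0) × Bool) => Φ (mix A x p.1.1, mix B p.1.2 p.2) := by
    have : Measurable fun p : ((Site × ℕ → Ex d) × (ℕ → Fin (S.T 0) × Bool)) ×
      (ℕ → Fin (S.T 0) × Bool) => (((x, p.1.2), (p.1.1, p.2)) :
        ((Site × ℕ → Ex d) × (ℕ → Fin (S.T 0) × Bool)) ×
      ((Site × ℕ → Ex d) × (ℕ → Fin (S.T 0) × Bool))) := by fun_prop
    exact h3.comp this
  -- The two resampled factors, examples and coins, give nested integrals in the order old example,
  -- new example, old coin, new coin; the swap brings the two old ones to the front.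
  rw [lintegral_lintegral_swap h4.lintegral_prod_right'.aemeasurable]
  refine lintegral_congr fun y => ?_
  rw [lintegral_prod _ (by
    have : Measurable fun p : (Site × ℕ → Ex d) × (ℕ → Fin (S.T 0) × Bool) =>
      Φ (mixOutcome A B (x, y) p) := h3.comp measurable_prodMk_left
    exact this.aemeasurable)]
  rfl

/-- If resampling leads into `E` with probability at most `q` on `F` and at most `0` off `F`, then
the probability of `E` is at most `q` times that of `F`. -/
lemma law_le_of_resample (A : Set (Site × ℕ)) (B : Set ℕ) {E F : Set (Outcome d S)}
    (hE : MeasurableSet E) (hF : MeasurableSet F) {q : ENNReal}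
    (h : ∀ ω, law S D {ω' | mixOutcome A B ω ω' ∈ E} ≤ F.indicator (fun _ => q) ω) :
    law S D E ≤ q * law S D F := by
  rw [← lintegral_indicator_one hE, lintegral_law_resample S D A B (measurable_one.indicator hE)]
  calc ∫⁻ ω, ∫⁻ ω', E.indicator 1 (mixOutcome A B ω ω') ∂law S D ∂law S D
      = ∫⁻ ω, law S D {ω' | mixOutcome A B ω ω' ∈ E} ∂law S D := by
        refine lintegral_congr fun ω => ?_
        have hm : MeasurableSet {ω' | mixOutcome A B ω ω' ∈ E} :=
          ((measurable_mixOutcome S A B).comp measurable_prodMk_left) hE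
        rw [← lintegral_indicator_one hm]
        rfl
    _ ≤ ∫⁻ ω, F.indicator (fun _ => q) ω ∂law S D := lintegral_mono h
    _ = q * law S D F := by rw [lintegral_indicator_const hF]

omit [IsProbabilityMeasure D] in
lemma law_fst (E : Set (Site × ℕ → Ex d)) :
    law S D {ω | ω.1 ∈ E} = (Measure.infinitePi fun _ : Site × ℕ => D) E := by
  have : {ω : Outcome d S | ω.1 ∈ E} = E ×ˢ Set.univ := by ext; simp
  rw [this, law, Measure.prod_prod, measure_univ, mul_one]

end law

/-! ### Geometry of well-behaved distributions -/

section geometry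
variable {d : ℕ}

lemma volume_box (a₁ a₂ c₁ c₂ : ℝ) :
    volume {z : Pt 2 | z 0 ∈ Set.Icc a₁ a₂ ∧ z 1 ∈ Set.Icc c₁ c₂} =
      ENNReal.ofReal (a₂ - a₁) * ENNReal.ofReal (c₂ - c₁) := by
  have e : {z : Pt 2 | z 0 ∈ Set.Icc a₁ a₂ ∧ z 1 ∈ Set.Icc c₁ c₂} =
      (WithLp.ofLp : Pt 2 → (Fin 2 → ℝ)) ⁻¹' (Set.Icc ![a₁, c₁] ![a₂, c₂]) := by
    ext z
    simp only [Set.mem_ofPred_eq, Set.mem_preimage, Set.mem_Icc, Pi.le_def, Fin.forall_fin_two,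
      Matrix.cons_val_zero, Matrix.cons_val_one]
    tauto
  rw [e, (PiLp.volume_preserving_ofLp (Fin 2)).measure_preimage
    measurableSet_Icc.nullMeasurableSet, Real.volume_Icc_pi]
  simp

lemma measurableSet_box (a₁ a₂ c₁ c₂ : ℝ) :
    MeasurableSet {z : Pt 2 | z 0 ∈ Set.Icc a₁ a₂ ∧ z 1 ∈ Set.Icc c₁ c₂} := by
  apply MeasurableSet.inter
  · exact (by fun_prop : Measurable fun z : Pt 2 => z 0) measurableSet_Icc
  · exact (by fun_prop : Measurable fun z : Pt 2 => z 1) measurableSet_Icc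

lemma orthonormal_pair {u v : Pt d} (hu : ‖u‖ = 1) (hv : ‖v‖ = 1) (huv : inner ℝ u v = 0) :
    Orthonormal ℝ ![u, v] := by
  constructor
  · intro i; fin_cases i <;> simp [hu, hv]
  · intro i j hij
    fin_cases i <;> fin_cases j <;> simp_all [real_inner_comm]

/-- The event that the coordinates of `x` along `u` and `v` lie in a box. -/
def boxEvent (u v : Pt d) (a₁ a₂ c₁ c₂ : ℝ) : Set (Pt d) :=
  {x | inner ℝ u x ∈ Set.Icc a₁ a₂ ∧ inner ℝ v x ∈ Set.Icc c₁ c₂}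

lemma measurableSet_boxEvent (u v : Pt d) (a₁ a₂ c₁ c₂ : ℝ) :
    MeasurableSet (boxEvent u v a₁ a₂ c₁ c₂) := by
  apply MeasurableSet.inter
  · exact (by fun_prop : Measurable fun x : Pt d => inner ℝ u x) measurableSet_Icc
  · exact (by fun_prop : Measurable fun x : Pt d => inner ℝ v x) measurableSet_Icc

variable {L R U β : ℝ} {μ : Measure (Pt d)}

lemma WellBehaved.measure_boxEvent (h : WellBehaved L R U β μ) {u v : Pt d} (hu : ‖u‖ = 1)
    (hv : ‖v‖ = 1) (huv : inner ℝ u v = 0) :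
    ∃ p : Pt 2 → ℝ, (∀ z, ‖z‖ ≤ R → L ≤ p z) ∧ (∀ z, p z ≤ U) ∧ ∀ a₁ a₂ c₁ c₂ : ℝ,
      μ (boxEvent u v a₁ a₂ c₁ c₂) =
        ∫⁻ z in {z : Pt 2 | z 0 ∈ Set.Icc a₁ a₂ ∧ z 1 ∈ Set.Icc c₁ c₂}, ENNReal.ofReal (p z) := by
  obtain ⟨p, _, _, hmap, hL, hU⟩ := h.1 _ (orthonormal_pair hu hv huv)
  refine ⟨p, hL, hU, fun a₁ a₂ c₁ c₂ => ?_⟩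
  rw [← withDensity_apply _ (measurableSet_box a₁ a₂ c₁ c₂), ← hmap, Measure.map_apply _
    (measurableSet_box a₁ a₂ c₁ c₂)]
  · congr 1
  · apply (WithLp.measurable_toLp 2 _).comp
    fun_prop

lemma WellBehaved.box_ge [IsFiniteMeasure μ] (h : WellBehaved L R U β μ) {u v : Pt d}
    (hu : ‖u‖ = 1) (hv : ‖v‖ = 1) (huv : inner ℝ u v = 0) {a₁ a₂ c₁ c₂ : ℝ} (hL : 0 ≤ L)
    (ha : a₁ ≤ a₂) (hR : 0 ≤ R)
    (hin : ∀ x ∈ Set.Icc a₁ a₂, ∀ y ∈ Set.Icc c₁ c₂, x ^ 2 + y ^ 2 ≤ R ^ 2) :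
    L * ((a₂ - a₁) * (c₂ - c₁)) ≤ μ.real (boxEvent u v a₁ a₂ c₁ c₂) := by
  obtain ⟨p, hp, _, hbox⟩ := h.measure_boxEvent hu hv huv
  rw [Measure.real, ← ENNReal.ofReal_le_iff_le_toReal (measure_ne_top _ _), hbox,
    ENNReal.ofReal_mul hL, ENNReal.ofReal_mul (by linarith), ← volume_box,
    ← setLIntegral_const]
  apply setLIntegral_mono' (measurableSet_box _ _ _ _)
  intro z hz
  apply ENNReal.ofReal_le_ofReal (hp z _)
  rw [EuclideanSpace.norm_eq, Real.sqrt_le_left hR]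
  simpa using hin _ hz.1 _ hz.2

lemma WellBehaved.box_le [IsFiniteMeasure μ] (h : WellBehaved L R U β μ) {u v : Pt d}
    (hu : ‖u‖ = 1) (hv : ‖v‖ = 1) (huv : inner ℝ u v = 0) {a₁ a₂ c₁ c₂ : ℝ} (hU : 0 ≤ U)
    (ha : a₁ ≤ a₂) (hc : c₁ ≤ c₂) :
    μ.real (boxEvent u v a₁ a₂ c₁ c₂) ≤ U * ((a₂ - a₁) * (c₂ - c₁)) := by
  obtain ⟨p, _, hp, hbox⟩ := h.measure_boxEvent hu hv huv
  refine ENNReal.toReal_le_of_le_ofReal (by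
    have := mul_nonneg (sub_nonneg.2 ha) (sub_nonneg.2 hc); positivity) ?_
  rw [hbox, ENNReal.ofReal_mul hU, ENNReal.ofReal_mul (by linarith), ← volume_box,
    ← setLIntegral_const]
  exact lintegral_mono fun z => ENNReal.ofReal_le_ofReal (hp z)

lemma WellBehaved.tail [IsFiniteMeasure μ] (h : WellBehaved L R U β μ) {w : Pt d} {ρ t : ℝ}
    (hρ : 0 < ρ) (hw : ‖w‖ ≤ ρ) (ht : 0 < t) :
    μ.real {x | ρ * t ≤ |inner ℝ w x|} ≤ Real.exp (1 - t / β) := by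
  rcases eq_or_ne w 0 with rfl | h0
  · have : {x : Pt d | ρ * t ≤ |inner ℝ (0 : Pt d) x|} = ∅ := by
      ext x
      simp only [inner_zero_left, abs_zero, Set.mem_ofPred_eq, Set.mem_empty_iff_false, iff_false,
        not_le]
      positivity
    rw [this, measureReal_empty]
    positivity
  · have hn : 0 < ‖w‖ := norm_pos_iff.2 h0
    refine le_trans (measureReal_mono (fun x hx => ?_)) (h.2 (‖w‖⁻¹ • w) (by
      rw [norm_smul, norm_inv, norm_norm, inv_mul_cancel₀ hn.ne']) t ht)
    simp only [Set.mem_ofPred_eq] at hx ⊢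
    rw [real_inner_smul_left, abs_mul, abs_of_pos (inv_pos.2 hn), inv_mul_eq_div, le_div_iff₀ hn]
    calc t * ‖w‖ ≤ t * ρ := by gcongr
      _ = ρ * t := mul_comm _ _
      _ ≤ _ := hx

lemma exists_unit_orthogonal (hd : 8 ≤ d) (u : Pt d) : ∃ e : Pt d, ‖e‖ = 1 ∧ inner ℝ u e = 0 := by
  have h1 : 0 < Module.finrank ℝ (ℝ ∙ u)ᗮ := by
    have := Submodule.finrank_add_finrank_orthogonal (ℝ ∙ u)
    have h2 : Module.finrank ℝ (ℝ ∙ u) ≤ 1 := by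
      have := finrank_span_le_card (R := ℝ) ({u} : Set (Pt d))
      simpa using this
    rw [finrank_euclideanSpace_fin] at this
    omega
  have := Module.finrank_pos_iff.1 h1
  obtain ⟨⟨e, he⟩, he0⟩ := exists_ne (0 : (ℝ ∙ u)ᗮ)
  have he1 : e ≠ 0 := fun h => he0 (Subtype.ext h)
  refine ⟨‖e‖⁻¹ • e, ?_, ?_⟩
  · rw [norm_smul, norm_inv, norm_norm, inv_mul_cancel₀ (norm_ne_zero_iff.2 he1)]
  · rw [real_inner_smul_right, Submodule.mem_orthogonal_singleton_iff_inner_right.1 he, mul_zero]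

/-- The component of `v` orthogonal to the unit vector `u`. -/
def perp (u v : Pt d) : Pt d := v - inner ℝ u v • u

/-- When `v` is parallel to `u`, any unit vector orthogonal to `u` serves as `e`. In every case `(u,
e)` is orthonormal, so the planar density bounds apply. -/
lemma exists_decomposition (hd : 8 ≤ d) {u : Pt d} (hu : ‖u‖ = 1) (v : Pt d) :
    ∃ e : Pt d, ‖e‖ = 1 ∧ inner ℝ u e = 0 ∧ v = inner ℝ u v • u + ‖perp u v‖ • e := by
  by_cases h : perp u v = 0
  · obtain ⟨e, he, hue⟩ := exists_unit_orthogonal hd u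
    refine ⟨e, he, hue, ?_⟩
    rw [h, norm_zero, zero_smul, add_zero]
    exact sub_eq_zero.1 h
  · have hn : ‖perp u v‖ ≠ 0 := norm_ne_zero_iff.2 h
    refine ⟨‖perp u v‖⁻¹ • perp u v, ?_, ?_, ?_⟩
    · rw [norm_smul, norm_inv, norm_norm, inv_mul_cancel₀ hn]
    · rw [real_inner_smul_right, perp, inner_sub_right, real_inner_smul_right,
        real_inner_self_eq_norm_sq, hu]
      ring
    · rw [smul_smul, mul_inv_cancel₀ hn, one_smul, perp]
      abel

lemma norm_perp_sq {u : Pt d} (hu : ‖u‖ = 1) (v : Pt d) :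
    ‖perp u v‖ ^ 2 = ‖v‖ ^ 2 - inner ℝ u v ^ 2 := by
  rw [perp, norm_sub_sq_real, real_inner_smul_right, norm_smul, hu, real_inner_comm, Real.norm_eq_abs,
    mul_one, sq_abs]
  ring

/-- The orthogonal component realizes the distance to the line through `u`. With `hat u` in place of
`u` and `c = ‖u‖`, it compares with the unnormalized iterate `u`. -/
lemma norm_perp_le {u : Pt d} (hu : ‖u‖ = 1) (v : Pt d) (c : ℝ) :
    ‖perp u v‖ ≤ ‖v - c • u‖ := by
  apply le_of_sq_le_sq _ (norm_nonneg _)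
  rw [norm_perp_sq hu, norm_sub_sq_real, real_inner_smul_right, norm_smul, hu, Real.norm_eq_abs,
    mul_one, sq_abs, real_inner_comm]
  nlinarith [sq_nonneg (inner ℝ v u - c)]

/-- An orthogonal coordinate is cut off at `M`: the density bound controls the rectangle and the
exponential tail the remainder. -/
lemma WellBehaved.band_le (hd : 8 ≤ d) [IsFiniteMeasure μ] (h : WellBehaved L R U β μ) {u : Pt d}
    (hu : ‖u‖ = 1) (hU : 0 ≤ U) {b M : ℝ} (hb : 0 ≤ b) (hM : 0 < M) :
    μ.real {x | |inner ℝ u x| ≤ b} ≤ 4 * U * b * M + Real.exp (1 - M / β) := by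
  obtain ⟨e, he, hue⟩ := exists_unit_orthogonal hd u
  have h1 := h.box_le hu he hue hU (a₁ := -b) (a₂ := b) (c₁ := -M) (c₂ := M) (by linarith)
    (by linarith)
  have h2 := h.tail (w := e) one_pos he.le hM
  have h3 : {x | |inner ℝ u x| ≤ b} ⊆ boxEvent u e (-b) b (-M) M ∪ {x | 1 * M ≤ |inner ℝ e x|} := by
    intro x hx
    rcases le_total (1 * M) |inner ℝ e x| with h4 | h4
    · exact Or.inr h4
    · refine Or.inl ⟨abs_le.1 hx, abs_le.1 (by simpa using h4)⟩
  calc _ ≤ _ := measureReal_mono h3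
    _ ≤ _ := measureReal_union_le _ _
    _ ≤ _ := by linarith

lemma half_box_sq_le {x y R : ℝ} (hx : |x| ≤ R / 2)
    (hy : |y| ≤ 3 * R / 4) : x ^ 2 + y ^ 2 ≤ R ^ 2 := by
  have h1 : x ^ 2 ≤ (R / 2) ^ 2 := sq_le_sq' (by linarith [(abs_le.1 hx).1]) (abs_le.1 hx).2
  have h2 : y ^ 2 ≤ (3 * R / 4) ^ 2 := sq_le_sq' (by linarith [(abs_le.1 hy).1]) (abs_le.1 hy).2
  nlinarith

/-- This rectangle of area `bR/2` lies in the disc where the density is at least `L`. Its points are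
in the band of `u` but have a coordinate along `v` of constant size, which makes them informative.
-/
lemma WellBehaved.band_box_ge [IsFiniteMeasure μ] (h : WellBehaved L R U β μ) {u v : Pt d}
    (hu : ‖u‖ = 1) (hv : ‖v‖ = 1) (huv : inner ℝ u v = 0) (hL : 0 ≤ L) (hR : 0 < R) {b : ℝ}
    (hb : 0 ≤ b) (hbR : b ≤ R / 2) :
    L * R / 2 * b ≤ μ.real (boxEvent u v (-b) b (R / 2) (3 * R / 4)) := by
  have := h.box_ge hu hv huv (a₁ := -b) (a₂ := b) (c₁ := R / 2) (c₂ := 3 * R / 4) hL (by linarith)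
    hR.le (fun x hx y hy => half_box_sq_le ((abs_le.2 hx).trans hbR)
      (by rw [abs_of_nonneg (by linarith [hy.1])]; exact hy.2))
  linarith

lemma WellBehaved.band_ge (hd : 8 ≤ d) [IsFiniteMeasure μ] (h : WellBehaved L R U β μ) {u : Pt d}
    (hu : ‖u‖ = 1) (hL : 0 ≤ L) (hR : 0 < R) {b : ℝ} (hb : 0 ≤ b) (hbR : b ≤ R / 2) :
    L * R / 2 * b ≤ μ.real {x | |inner ℝ u x| ≤ b} := by
  obtain ⟨e, he, hue⟩ := exists_unit_orthogonal hd u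
  exact (h.band_box_ge hu he hue hL hR hb hbR).trans
    (measureReal_mono fun x hx => abs_le.2 hx.1)

/-- Vectors close to `w` classify most points in the same way. -/
lemma WellBehaved.disagreement_le (hd : 8 ≤ d) [IsFiniteMeasure μ] (h : WellBehaved L R U β μ)
    {v w : Pt d} (hw : ‖w‖ = 1) (hU : 0 ≤ U) {ρ M : ℝ} (hρ : 0 < ρ) (hv : ‖v - w‖ ≤ ρ)
    (hM : 0 < M) :
    μ.real {x | halfspace v x ≠ halfspace w x} ≤
      2 * Real.exp (1 - M / β) + 4 * U * (ρ * M) * M := by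
  have h1 := h.tail (w := v - w) hρ hv hM
  have h2 := h.band_le hd hw hU (b := ρ * M) (by positivity) hM
  have h3 : {x | halfspace v x ≠ halfspace w x} ⊆
      {x | ρ * M ≤ |inner ℝ (v - w) x|} ∪ {x | |inner ℝ w x| ≤ ρ * M} := by
    intro x hx
    simp only [Set.mem_ofPred_eq, halfspace, ne_eq, decide_eq_decide] at hx
    -- The two inner products have different signs, so a point of disagreement is in a thin band
    -- around the boundary of `w` unless `⟨v - w, x⟩` is atypically large.
    have h4 : |inner ℝ w x| ≤ |inner ℝ (v - w) x| := by
      rw [inner_sub_left]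
      rcases le_or_gt 0 (inner ℝ v x) with h5 | h5 <;> rcases le_or_gt 0 (inner ℝ w x) with h6 | h6
      · exact absurd (iff_of_true h5 h6) hx
      · rw [abs_of_neg h6, abs_of_nonneg] <;> linarith
      · rw [abs_of_nonneg h6, abs_of_neg] <;> linarith
      · exact absurd (iff_of_false (not_le.2 h5) (not_le.2 h6)) hx
    rcases le_total (ρ * M) |inner ℝ (v - w) x| with h5 | h5
    · exact Or.inl h5
    · exact Or.inr (h4.trans h5)
  calc _ ≤ _ := measureReal_mono h3
    _ ≤ _ := measureReal_union_le _ _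
    _ ≤ _ := by linarith

lemma norm_hat (hd : 8 ≤ d) (w : Pt d) : ‖hat w‖ = 1 := by
  unfold hat
  split_ifs with h
  · have : (WithLp.toLp 2 (fun i : Fin d => if (i : ℕ) = 0 then (1 : ℝ) else 0) : Pt d) =
        EuclideanSpace.single (⟨0, by omega⟩ : Fin d) 1 := by
      ext i
      simp [Fin.ext_iff]
    rw [this]; simp
  · rw [norm_smul, norm_inv, norm_norm, inv_mul_cancel₀ (norm_ne_zero_iff.2 h)]

lemma norm_smul_hat (w : Pt d) : ‖w‖ • hat w = w := by
  unfold hat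
  split_ifs with h
  · simp [h]
  · rw [smul_smul, mul_inv_cancel₀ (norm_ne_zero_iff.2 h), one_smul]

lemma halfspace_hat {w : Pt d} (hw : w ≠ 0) (x : Pt d) : halfspace (hat w) x = halfspace w x := by
  have h0 : 0 < ‖w‖ := norm_pos_iff.2 hw
  nth_rewrite 2 [← norm_smul_hat w]
  unfold halfspace
  rw [real_inner_smul_left, decide_eq_decide]
  exact (mul_nonneg_iff_of_pos_left h0).symm

/-- A vector whose direction is far from `w` disagrees with `w` on a set of constant probability
outside of a band around the decision boundary of `w`. -/
lemma WellBehaved.exists_disagreement (hd : 8 ≤ d) [IsFiniteMeasure μ] (h : WellBehaved L R U β μ)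
    {v w : Pt d} (hw : ‖w‖ = 1) (hL : 0 ≤ L) (hR : 0 < R) (hv : 1 / 4 < ‖hat v - w‖) :
    ∃ E : Set (Pt d), MeasurableSet E ∧ L * R ^ 2 / 80 ≤ μ.real E ∧
      ∀ x ∈ E, halfspace v x ≠ halfspace w x ∧ R / 20 ≤ |inner ℝ w x| := by
  obtain ⟨e, he, hwe, hdec⟩ := exists_decomposition hd hw (hat v)
  have hsq := norm_perp_sq hw (hat v)
  have hdist : ‖hat v - w‖ ^ 2 = 2 - 2 * inner ℝ w (hat v) := by
    rw [norm_sub_sq_real, norm_hat hd, hw, real_inner_comm]; ring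
  rw [norm_hat hd] at hsq
  set c := inner ℝ w (hat v)
  set s := ‖perp w (hat v)‖
  have hs0 : 0 ≤ s := norm_nonneg _
  -- `2 - 2c = ‖hat v - w‖² > 1/16`.
  have hc : c < 31 / 32 := by nlinarith [norm_nonneg (hat v - w)]
  -- The zero vector is special: `halfspace 0` is constantly `true`, whereas `hat 0` is the first
  -- basis vector. For it, a box on the negative side of `w` is used.
  rcases eq_or_ne v 0 with rfl | hv0
  · refine ⟨boxEvent w e (-(R / 10)) (-(R / 20)) (-(3 * R / 4)) (-(R / 2)),
      measurableSet_boxEvent _ _ _ _ _ _, ?_, ?_⟩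
    · have := h.box_ge hw he hwe (a₁ := -(R / 10)) (a₂ := -(R / 20)) (c₁ := -(3 * R / 4))
        (c₂ := -(R / 2)) hL (by linarith) hR.le (fun x hx y hy => half_box_sq_le
          (abs_le.2 ⟨by linarith [hx.1], by linarith [hx.2]⟩)
          (abs_le.2 ⟨by linarith [hy.1], by linarith [hy.2]⟩))
      nlinarith
    · intro x hx
      have h1 := hx.1.2
      constructor
      · have : ¬ 0 ≤ inner ℝ w x := by linarith
        simp [halfspace, this]
      · rw [abs_of_neg (by linarith)]; linarith
  · refine ⟨boxEvent w e (R / 20) (R / 10) (-(3 * R / 4)) (-(R / 2)),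
      measurableSet_boxEvent _ _ _ _ _ _, ?_, ?_⟩
    · have := h.box_ge hw he hwe (a₁ := R / 20) (a₂ := R / 10) (c₁ := -(3 * R / 4))
        (c₂ := -(R / 2)) hL (by linarith) hR.le (fun x hx y hy => half_box_sq_le
          (abs_le.2 ⟨by linarith [hx.1], by linarith [hx.2]⟩)
          (abs_le.2 ⟨by linarith [hy.1], by linarith [hy.2]⟩))
      nlinarith
    · intro x hx
      obtain ⟨⟨hx1, hx2⟩, ⟨hx3, hx4⟩⟩ := hx
      constructor
      · rw [← halfspace_hat hv0]
        have h1 : 0 ≤ inner ℝ w x := by linarith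
        have h2 : ¬ 0 ≤ inner ℝ (hat v) x := by
          rw [not_le, hdec, inner_add_left, real_inner_smul_left, real_inner_smul_left]
          set z₁ := inner ℝ w x
          set z₂ := inner ℝ e x
          rcases lt_trichotomy c 0 with hc0 | hc0 | hc0
          · have : c * z₁ < 0 := mul_neg_of_neg_of_pos hc0 (by linarith)
            have : s * z₂ ≤ 0 := mul_nonpos_of_nonneg_of_nonpos hs0 (by linarith)
            linarith
          · have hs1 : 0 < s := by
              rcases hs0.eq_or_lt with h3 | h3
              · rw [← h3, hc0] at hsq; norm_num at hsq
              · exact h3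
            have : s * z₂ < 0 := mul_neg_of_pos_of_neg hs1 (by linarith)
            rw [hc0]; linarith
          -- `s² = 1 - c² > 63/1024`; then `s z₂ ≤ -0.12 R` outweighs `c z₁ ≤ R / 10`.
          · have hs1 : 24 / 100 ≤ s := by nlinarith
            have h3 : c * z₁ ≤ R / 10 := by nlinarith
            have h4 : s * z₂ ≤ 24 / 100 * (-(R / 2)) := by nlinarith
            linarith
        simp [halfspace, h1, h2]
      · rw [abs_of_nonneg (by linarith)]; exact hx1

end geometry

/-! ### Noise conditions -/

section noise
variable {d : ℕ} (D : Measure (Ex d)) [IsProbabilityMeasure D] (w : Pt d)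

/-- The margin `1 - 2 η(x)`. -/
def margin (x : Pt d) : ℝ := 1 - 2 * noiseRate D w x

lemma measurable_noiseRate : Measurable (noiseRate D w) := by
  have hm : MeasurableSet {p : Pt d × Bool | p.2 ≠ halfspace w p.1} := by
    have h1 : Measurable fun p : Pt d × Bool => halfspace w p.1 :=
      measurable_halfspace.comp (measurable_const.prodMk measurable_fst)
    exact (measurableSet_eq_fun measurable_snd h1).compl
  exact (Kernel.measurable_kernel_prodMk_left (κ := D.condKernel) hm).ennreal_toReal

lemma measurable_margin : Measurable (margin D w) :=
  measurable_const.sub ((measurable_noiseRate D w).const_mul 2)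

lemma noiseRate_nonneg (x : Pt d) : 0 ≤ noiseRate D w x := measureReal_nonneg

lemma noiseRate_le_one (x : Pt d) : noiseRate D w x ≤ 1 := measureReal_le_one

lemma abs_margin_le (x : Pt d) : |margin D w x| ≤ 1 := by
  have h1 := noiseRate_nonneg D w x
  have h2 := noiseRate_le_one D w x
  rw [margin, abs_le]; constructor <;> linarith

lemma integrable_of_bounded {α : Type*} [MeasurableSpace α] {μ : Measure α} [IsFiniteMeasure μ]
    {f : α → ℝ} (hf : Measurable f) {C : ℝ} (hC : ∀ x, |f x| ≤ C) : Integrable f μ :=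
  Integrable.of_bound hf.aestronglyMeasurable C (Filter.Eventually.of_forall hC)

/-- `1` if the label agrees with the classifier of `w`, and `-1` otherwise. -/
def agreement (w : Pt d) (e : Ex d) : ℝ := if e.2 ≠ halfspace w e.1 then -1 else 1

lemma measurable_agreement : Measurable (agreement w) := by
  unfold agreement
  refine Measurable.ite ?_ measurable_const measurable_const
  have h1 : Measurable fun p : Pt d × Bool => halfspace w p.1 :=
    measurable_halfspace.comp (measurable_const.prodMk measurable_fst)
  exact (measurableSet_eq_fun measurable_snd h1).compl

lemma abs_agreement (e : Ex d) : |agreement w e| = 1 := by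
  unfold agreement; split_ifs <;> simp

lemma sgn_mul_halfspace (e : Ex d) : sgn e.2 * sgn (halfspace w e.1) = agreement w e := by
  unfold agreement sgn
  cases e.2 <;> cases halfspace w e.1 <;> simp

/-- Disintegrating `D` over its marginal, the conditional mean of the agreement with `h_w` at `x` is
`1 - 2 η(x)`. -/
lemma integral_agreement {f : Pt d → ℝ} (hf : Measurable f) {C : ℝ} (hC : ∀ x, |f x| ≤ C) :
    ∫ e, f e.1 * agreement w e ∂D = ∫ x, f x * margin D w x ∂D.fst := by
  have hint : Integrable (fun e : Ex d => f e.1 * agreement w e) D := by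
    refine integrable_of_bounded ((hf.comp measurable_fst).mul (measurable_agreement w)) (C := C) ?_
    intro e
    rw [abs_mul, abs_agreement, mul_one]; exact hC _
  have hdis : D.fst ⊗ₘ D.condKernel = D := D.disintegrate D.condKernel
  have hint' := hint
  rw [← hdis] at hint'
  conv_lhs => rw [← hdis]
  rw [Measure.integral_compProd hint']
  refine integral_congr_ae (Filter.Eventually.of_forall fun x => ?_)
  simp only
  rw [integral_const_mul]
  congr 1
  have e1 : (fun y : Bool => agreement w (x, y)) =
      fun y => 1 - 2 * ({y | y ≠ halfspace w x} : Set Bool).indicator (fun _ => (1 : ℝ)) y := by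
    ext y
    unfold agreement
    by_cases h : y ≠ halfspace w x
    · simp [h]; norm_num
    · simp only [not_not] at h; simp [h]
  have hms : MeasurableSet {y | y ≠ halfspace w x} := MeasurableSet.of_discrete
  rw [e1, integral_sub (integrable_const _) (Integrable.of_finite), integral_const_mul,
    integral_indicator_const _ hms, integral_const, probReal_univ]
  simp only [margin, noiseRate, smul_eq_mul, mul_one]

lemma excess_identity (a c y : Bool) :
    (if a ≠ y then (1 : ℝ) else 0) - (if c ≠ y then 1 else 0) =
      (if a ≠ c then 1 else 0) * (if y ≠ c then -1 else 1) := by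
  cases a <;> cases c <;> cases y <;> simp

/-- The excess error dominates the integral of the margin over sets of disagreement. -/
lemma setIntegral_margin_le_excess (h0 : ∀ᵐ x ∂D.fst, noiseRate D w x ≤ 1 / 2) {v : Pt d}
    {E : Set (Pt d)} (hdis : ∀ x ∈ E, halfspace v x ≠ halfspace w x) :
    ∫ x in E, margin D w x ∂D.fst ≤ err v D - err w D := by
  let B : Set (Pt d) := {x | halfspace v x ≠ halfspace w x}
  have hB : MeasurableSet B := by
    have h1 : ∀ v : Pt d, Measurable fun x : Pt d => halfspace v x := fun v =>
      measurable_halfspace.comp (measurable_const.prodMk measurable_id)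
    exact (measurableSet_eq_fun (h1 v) (h1 w)).compl
  have hmis : ∀ v : Pt d, MeasurableSet {e : Ex d | halfspace v e.1 ≠ e.2} := fun v =>
    measurable_prodMk_left (x := v) measurableSet_misclassified
  have hexc : err v D - err w D = ∫ e, B.indicator (fun _ => (1 : ℝ)) e.1 * agreement w e ∂D := by
    unfold err
    rw [← integral_indicator_one (hmis v), ← integral_indicator_one (hmis w), ← integral_sub]
    · refine integral_congr_ae (Filter.Eventually.of_forall fun e => ?_)
      obtain ⟨x, y⟩ := e
      simp only [Set.indicator_apply, Set.mem_ofPred_eq, B, agreement, Pi.one_apply]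
      convert excess_identity (halfspace v x) (halfspace w x) y
    · exact (integrable_const (1 : ℝ)).indicator (hmis v)
    · exact (integrable_const (1 : ℝ)).indicator (hmis w)
  rw [hexc, integral_agreement D w (C := 1) (measurable_const.indicator hB)]
  · have e2 : (fun x => B.indicator (fun _ => (1 : ℝ)) x * margin D w x) =
        B.indicator (margin D w) := by
      ext x; by_cases h : x ∈ B <;> simp [h]
    rw [e2, integral_indicator hB]
    apply setIntegral_mono_set
    · exact (integrable_of_bounded (measurable_margin D w) (abs_margin_le D w)).integrableOn
    · filter_upwards [ae_restrict_of_ae h0] with x hx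
      simp only [Pi.zero_apply, margin]; linarith
    · exact Filter.Eventually.of_forall fun x hx => hdis x hx
  · intro x
    by_cases h : x ∈ B <;> simp [h]

/-- The integral of the margin over sets of probability at least `p` outside of the band of
half-width `ρ` around the decision boundary is at least `γ p`. -/
def MarginBound (p ρ γ : ℝ) : Prop :=
  ∀ E : Set (Pt d), MeasurableSet E → p ≤ D.fst.real E → (∀ x ∈ E, ρ ≤ |inner ℝ w x|) →
    γ * p ≤ ∫ x in E, margin D w x ∂D.fst

variable {D w}

lemma marginBound_of_ae {p ρ γ : ℝ} (hγ : 0 ≤ γ)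
    (h : ∀ᵐ x ∂D.fst, ρ ≤ |inner ℝ w x| → γ ≤ margin D w x) : MarginBound D w p ρ γ := by
  intro E hE hp hρ
  calc γ * p ≤ γ * D.fst.real E := by gcongr
    _ = ∫ x in E, γ ∂D.fst := by rw [setIntegral_const, smul_eq_mul, mul_comm]
    _ ≤ _ := by
      apply setIntegral_mono_ae_restrict (integrable_const γ).integrableOn
        (integrable_of_bounded (measurable_margin D w) (abs_margin_le D w)).integrableOn
      filter_upwards [ae_restrict_of_ae h, ae_restrict_mem hE] with x hx hxE
      exact hx (hρ x hxE)

lemma Massart.margin_nonneg {η : ℝ} (hη : η < 1 / 2) (h : Massart η D w) :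
    ∀ᵐ x ∂D.fst, noiseRate D w x ≤ 1 / 2 := by
  filter_upwards [h] with x hx
  linarith

lemma Massart.marginBound {η : ℝ} (hη : η < 1 / 2) (h : Massart η D w) (p ρ : ℝ) :
    MarginBound D w p ρ (1 - 2 * η) := by
  apply marginBound_of_ae (by linarith)
  filter_upwards [h] with x hx _
  rw [margin]; linarith

/-- The condition at `t = 0` says that `η(x) ≥ 1/2` has probability zero. -/
lemma Tsybakov.margin_nonneg {A α : ℝ} (hα : 1 / 2 < α) (hα1 : α ≤ 1) (h : Tsybakov A α D w) :
    ∀ᵐ x ∂D.fst, noiseRate D w x ≤ 1 / 2 := by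
  have h0 := h 0 le_rfl (by norm_num)
  have h1 : D.fst.real {x | 1 / 2 - noiseRate D w x ≤ 0} ≤ 0 := by
    refine h0.trans (le_of_eq ?_)
    split_ifs with h2
    · rfl
    · have h3 : α < 1 := lt_of_le_of_ne hα1 h2
      have h4 : 0 < 1 - α := by linarith
      rw [Real.zero_rpow (by positivity), mul_zero]
  have h2 : D.fst {x | 1 / 2 - noiseRate D w x ≤ 0} = 0 := by
    rw [← measureReal_eq_zero_iff]
    exact le_antisymm h1 measureReal_nonneg
  have h3 : ∀ᵐ x ∂D.fst, ¬ (1 / 2 - noiseRate D w x ≤ 0) := by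
    rw [ae_iff]; simpa using h2
  filter_upwards [h3] with x hx
  linarith

/-- The level `t` is chosen so that points with `1/2 - η(x) ≤ t` have probability at most `p / 2`.
At least half of the mass `p` of `E` then has margin `1 - 2η(x) ≥ 2t`. The cap `1/4` keeps `t` in
the range of the noise condition. -/
lemma Tsybakov.marginBound {A α : ℝ} (hA : 0 < A) (hα : 1 / 2 < α) (hα1 : α ≤ 1)
    (h : Tsybakov A α D w) {p : ℝ} (hp : 0 < p) (ρ : ℝ) :
    MarginBound D w p ρ (min (1 / 4) ((p / (2 * A)) ^ ((1 - α) / α))) := by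
  have h0 := h.margin_nonneg hα hα1
  intro E hE hpE _
  set t := min (1 / 4) ((p / (2 * A)) ^ ((1 - α) / α)) with ht
  have ht0 : 0 ≤ t := by positivity
  have ht4 : t ≤ 1 / 4 := min_le_left _ _
  have h1 := h t ht0 (by linarith)
  have h2 : D.fst.real {x | 1 / 2 - noiseRate D w x ≤ t} ≤ p / 2 := by
    refine h1.trans ?_
    split_ifs with h3
    · positivity
    · have h4 : 0 < 1 - α := by have := lt_of_le_of_ne hα1 h3; linarith
      have h5 : t ^ (α / (1 - α)) ≤ p / (2 * A) := by
        calc t ^ (α / (1 - α)) ≤ ((p / (2 * A)) ^ ((1 - α) / α)) ^ (α / (1 - α)) :=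
              Real.rpow_le_rpow ht0 (min_le_right _ _) (by positivity)
          _ = p / (2 * A) := by
              rw [← Real.rpow_mul (by positivity)]
              rw [show (1 - α) / α * (α / (1 - α)) = 1 by field_simp, Real.rpow_one]
      calc A * t ^ (α / (1 - α)) ≤ A * (p / (2 * A)) := by gcongr
        _ = p / 2 := by field_simp
  set B := {x | 1 / 2 - noiseRate D w x ≤ t}
  have hB : MeasurableSet B :=
    measurableSet_le (measurable_const.sub (measurable_noiseRate D w)) measurable_const
  have hint := integrable_of_bounded (μ := D.fst) (measurable_margin D w) (abs_margin_le D w)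
  have h6 : p / 2 ≤ D.fst.real (E \ B) := by
    have := measureReal_union_le (μ := D.fst) (E \ B) B
    have h7 : D.fst.real E ≤ D.fst.real (E \ B ∪ B) :=
      measureReal_mono (by intro x hx; by_cases h : x ∈ B <;> simp [h, hx])
    linarith
  calc t * p = 2 * t * (p / 2) := by ring
    _ ≤ 2 * t * D.fst.real (E \ B) := by gcongr
    _ = ∫ x in E \ B, 2 * t ∂D.fst := by rw [setIntegral_const, smul_eq_mul, mul_comm]
    _ ≤ ∫ x in E \ B, margin D w x ∂D.fst := by
        apply setIntegral_mono_on (integrable_const _).integrableOn hint.integrableOn (hE.diff hB)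
        intro x hx
        have : t < 1 / 2 - noiseRate D w x := not_le.1 hx.2
        rw [margin]; linarith
    _ ≤ ∫ x in E, margin D w x ∂D.fst := by
        apply setIntegral_mono_set hint.integrableOn
        · filter_upwards [ae_restrict_of_ae h0] with x hx
          simp only [Pi.zero_apply, margin]; linarith
        · exact Filter.Eventually.of_forall fun x hx => hx.1

lemma GeomTsybakov.margin_nonneg {B α : ℝ} (hB : 0 < B) (h : GeomTsybakov B α D w) :
    ∀ᵐ x ∂D.fst, noiseRate D w x ≤ 1 / 2 := by
  filter_upwards [h] with x hx
  have : 0 ≤ min (1 / 2) (B * |inner ℝ w x| ^ ((1 - α) / α)) := by positivity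
  linarith

lemma GeomTsybakov.marginBound {B α : ℝ} (hB : 0 < B) (hα : 0 < α) (hα1 : α ≤ 1)
    (h : GeomTsybakov B α D w) (p : ℝ) {ρ : ℝ} (hρ : 0 ≤ ρ) :
    MarginBound D w p ρ (min 1 (B * ρ ^ ((1 - α) / α))) := by
  apply marginBound_of_ae (by positivity)
  filter_upwards [h] with x hx hρx
  have h1 : ρ ^ ((1 - α) / α) ≤ |inner ℝ w x| ^ ((1 - α) / α) :=
    Real.rpow_le_rpow hρ hρx (div_nonneg (by linarith) hα.le)
  have h2 : B * ρ ^ ((1 - α) / α) ≤ B * |inner ℝ w x| ^ ((1 - α) / α) := by gcongr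
  have h3 : 0 ≤ B * ρ ^ ((1 - α) / α) := by positivity
  rw [margin]
  rcases min_cases (1 / 2) (B * |inner ℝ w x| ^ ((1 - α) / α)) with ⟨h4, _⟩ | ⟨h4, _⟩
  · rw [h4] at hx
    exact (min_le_left _ _).trans (by linarith)
  · rw [h4] at hx
    exact (min_le_right _ _).trans (by linarith)

end noise

/-! ### Analysis of one call of `optimize` -/

section score
variable {d : ℕ}

/-- The truncated score `y ⟨w, x⟩`. -/
def score (M : ℝ) (w : Pt d) (e : Ex d) : ℝ := sgn e.2 * max (-M) (min (inner ℝ w e.1) M)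

lemma measurable_score (M : ℝ) (w : Pt d) : Measurable (score M w) := by
  unfold score
  have h1 : Measurable fun e : Ex d => sgn e.2 := measurable_sgn.comp measurable_snd
  have h2 : Measurable fun e : Ex d => inner ℝ w e.1 := by fun_prop
  exact h1.mul (measurable_const.max (h2.min measurable_const))

lemma abs_sgn (y : Bool) : |sgn y| = 1 := by cases y <;> simp [sgn]

lemma abs_score_le {M : ℝ} (hM : 0 ≤ M) (w : Pt d) (e : Ex d) : |score M w e| ≤ M := by
  rw [score, abs_mul, abs_sgn, one_mul, abs_le]
  exact ⟨le_max_left _ _, max_le (by linarith) (min_le_right _ _)⟩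

lemma score_of_le {M : ℝ} {w : Pt d} {e : Ex d} (h : |inner ℝ w e.1| ≤ M) :
    score M w e = sgn e.2 * inner ℝ w e.1 := by
  rw [score, min_eq_left (abs_le.1 h).2, max_eq_right (abs_le.1 h).1]

lemma score_eq {M : ℝ} (hM : 0 ≤ M) (w : Pt d) (e : Ex d) :
    score M w e = min |inner ℝ w e.1| M * agreement w e := by
  rw [← sgn_mul_halfspace, score, mul_left_comm]
  congr 1
  unfold halfspace sgn
  rcases le_or_gt 0 (inner ℝ w e.1) with h | h
  · rw [abs_of_nonneg h, max_eq_right]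
    · simp [h]
    · have := le_min h hM; linarith
  · rw [abs_of_neg h, min_eq_left (by linarith)]
    simp only [not_le.2 h, decide_false, Bool.false_eq_true, if_false]
    rcases le_total (-inner ℝ w e.1) M with h1 | h1
    · rw [min_eq_left h1, max_eq_right (by linarith)]; ring
    · rw [min_eq_right h1, max_eq_left (by linarith)]; ring

/-- By `e^x ≤ 1 + x + x²` for `|x| ≤ 1`, the exponential moment of `-lam Y` is at most `1 - lam m +
lam² M²`, hence at most `exp(-lam m + lam² M²)`. This supplies the factors of the supermartingale.
-/
lemma lintegral_exp_le_one {α : Type*} [MeasurableSpace α] {ν : Measure α}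
    [IsProbabilityMeasure ν] {Y : α → ℝ} (hY : Measurable Y) {M lam m : ℝ} (hM : ∀ x, |Y x| ≤ M)
    (hlam : 0 ≤ lam) (hlM : lam * M ≤ 1) (hm : m ≤ ∫ x, Y x ∂ν) :
    ∫⁻ x, ENNReal.ofReal (Real.exp (lam * (m - Y x) - lam ^ 2 * M ^ 2)) ∂ν ≤ 1 := by
  have hpt : ∀ x, Real.exp (lam * (m - Y x) - lam ^ 2 * M ^ 2) ≤
      Real.exp (lam * m - lam ^ 2 * M ^ 2) * (1 - lam * Y x + lam ^ 2 * M ^ 2) := by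
    intro x
    rw [show lam * (m - Y x) - lam ^ 2 * M ^ 2 =
      (lam * m - lam ^ 2 * M ^ 2) + -(lam * Y x) by ring, Real.exp_add]
    gcongr
    have h1 : |-(lam * Y x)| ≤ lam * M := by
      rw [abs_neg, abs_mul, abs_of_nonneg hlam]; gcongr; exact hM x
    have h2 := Real.abs_exp_sub_one_sub_id_le (h1.trans hlM)
    have h3 : (-(lam * Y x)) ^ 2 ≤ (lam * M) ^ 2 := sq_le_sq' (by linarith [(abs_le.1 h1).1])
      (abs_le.1 h1).2
    have h4 := (abs_le.1 h2).2
    nlinarith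
  have hYi : Integrable Y ν := integrable_of_bounded hY hM
  have hint : Integrable (fun x => Real.exp (lam * m - lam ^ 2 * M ^ 2) *
      (1 - lam * Y x + lam ^ 2 * M ^ 2)) ν := by
    apply Integrable.const_mul
    exact ((integrable_const _).sub (hYi.const_mul _)).add (integrable_const _)
  calc ∫⁻ x, ENNReal.ofReal (Real.exp (lam * (m - Y x) - lam ^ 2 * M ^ 2)) ∂ν
      ≤ ∫⁻ x, ENNReal.ofReal (Real.exp (lam * m - lam ^ 2 * M ^ 2) *
          (1 - lam * Y x + lam ^ 2 * M ^ 2)) ∂ν :=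
        lintegral_mono fun x => ENNReal.ofReal_le_ofReal (hpt x)
    _ = ENNReal.ofReal (∫ x, Real.exp (lam * m - lam ^ 2 * M ^ 2) *
          (1 - lam * Y x + lam ^ 2 * M ^ 2) ∂ν) := by
        rw [ofReal_integral_eq_lintegral_ofReal hint]
        exact Filter.Eventually.of_forall fun x => (Real.exp_pos _).le.trans (hpt x)
    _ ≤ ENNReal.ofReal 1 := by
        apply ENNReal.ofReal_le_ofReal
        have hI : ∫ x, (1 - lam * Y x + lam ^ 2 * M ^ 2) ∂ν =
            1 - lam * ∫ x, Y x ∂ν + lam ^ 2 * M ^ 2 := by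
          have hi1 : Integrable (fun x => 1 - lam * Y x) ν :=
            (integrable_const _).sub (hYi.const_mul _)
          rw [integral_add hi1 (integrable_const _),
            integral_sub (integrable_const _) (hYi.const_mul _), integral_const_mul]
          simp only [integral_const, probReal_univ, smul_eq_mul, one_mul]
        rw [integral_const_mul, hI]
        have h1 : 1 - lam * ∫ x, Y x ∂ν + lam ^ 2 * M ^ 2 ≤
            Real.exp (-(lam * m - lam ^ 2 * M ^ 2)) := by
          have h2 := Real.add_one_le_exp (-(lam * m - lam ^ 2 * M ^ 2))
          have h3 : lam * m ≤ lam * ∫ x, Y x ∂ν := by gcongr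
          linarith
        calc _ ≤ Real.exp (lam * m - lam ^ 2 * M ^ 2) *
              Real.exp (-(lam * m - lam ^ 2 * M ^ 2)) := by gcongr
          _ = 1 := by rw [← Real.exp_add, add_neg_cancel, Real.exp_zero]
    _ = 1 := ENNReal.ofReal_one

variable {D : Measure (Ex d)} [IsProbabilityMeasure D] {w : Pt d} {L R U β : ℝ}

lemma band_eq_preimage (b : ℝ) (u : Pt d) :
    band b u = Prod.fst ⁻¹' {x : Pt d | |inner ℝ (hat u) x| ≤ b} := rfl

lemma measurableSet_slab (b : ℝ) (u : Pt d) : MeasurableSet {x : Pt d | |inner ℝ u x| ≤ b} :=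
  measurableSet_le (by fun_prop) measurable_const

omit [IsProbabilityMeasure D] in
lemma real_preimage_fst {A : Set (Pt d)} (hA : MeasurableSet A) :
    D.real (Prod.fst ⁻¹' A) = D.fst.real A := by
  rw [Measure.real, Measure.real, Measure.fst_apply hA]

lemma WellBehaved.band_pos (hd : 8 ≤ d) (h : WellBehaved L R U β D.fst) (hL : 0 < L) (hR : 0 < R)
    {b : ℝ} (hb : 0 < b) (hbR : b ≤ R / 2) (u : Pt d) :
    L * R / 2 * b ≤ D.real (band b u) ∧ D (band b u) ≠ 0 := by
  have h1 := h.band_ge hd (norm_hat hd u) hL.le hR hb.le hbR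
  rw [band_eq_preimage, real_preimage_fst (measurableSet_slab b _)]
  refine ⟨h1, fun h0 => ?_⟩
  have h2 := real_preimage_fst (D := D) (measurableSet_slab b (hat u))
  rw [Measure.real, h0, ENNReal.toReal_zero] at h2
  rw [← h2] at h1
  have : 0 < L * R / 2 * b := by positivity
  linarith

/-- The conditional expectation of the score in the band is large unless the direction is close to
the target. -/
lemma drift_le_integral_score (hd : 8 ≤ d) (h : WellBehaved L R U β D.fst) (hL : 0 < L)
    (hR : 0 < R) (hw : ‖w‖ = 1) (h0 : ∀ᵐ x ∂D.fst, noiseRate D w x ≤ 1 / 2) {r b M Q γ : ℝ}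
    (hr : 0 < r) (hb : 0 < b) (hbr : b ≤ r * R / 80) (hbR : b ≤ R / 2) (hM : 2 * r * R ≤ M)
    (hγ : 0 ≤ γ) (hQ : 0 < Q) (u : Pt d)
    (hband : D.fst.real {x | |inner ℝ (hat u) x| ≤ b} ≤ b * Q)
    (hm : MarginBound D w (L * R / 2 * b) (r * R / 80) γ) (hσ : ‖perp (hat u) w‖ ≤ 8 * r) :
    γ * (L * R / 2) * R / (4 * Q) * (‖perp (hat u) w‖ - r / 20) ≤
      ∫ e, score M w e ∂D[|band b u] := by
  have hM0 : 0 ≤ M := le_trans (by positivity) hM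
  set σ := ‖perp (hat u) w‖ with hσdef
  have hσ0 : 0 ≤ σ := norm_nonneg _
  set A := {x : Pt d | |inner ℝ (hat u) x| ≤ b} with hA
  have hAm : MeasurableSet A := measurableSet_slab b _
  obtain ⟨hpos, hne⟩ := h.band_pos hd hL hR hb hbR u
  have hpos' : 0 < D.real (band b u) := lt_of_lt_of_le (by positivity) hpos
  have hDA : D.real (band b u) = D.fst.real A := real_preimage_fst hAm
  let f : Pt d → ℝ := A.indicator fun x => min |inner ℝ w x| M
  have hfm : Measurable f := by
    apply Measurable.indicator _ hAm
    have : Measurable fun x : Pt d => |inner ℝ w x| := by fun_prop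
    exact this.min measurable_const
  have hf0 : ∀ x, 0 ≤ f x := fun x => Set.indicator_nonneg (fun x _ => by positivity) x
  have hfM : ∀ x, |f x| ≤ M := by
    intro x
    rw [abs_of_nonneg (hf0 x)]
    exact Set.indicator_le' (fun x _ => min_le_right _ _) (fun x _ => hM0) x
  have hint : ∫ e, score M w e ∂D[|band b u] =
      (D.real (band b u))⁻¹ * ∫ x, f x * margin D w x ∂D.fst := by
    rw [ProbabilityTheory.cond, integral_smul_measure, ENNReal.toReal_inv, smul_eq_mul,
      ← integral_agreement D w hfm hfM, ← integral_indicator (measurableSet_band b u)]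
    congr 1
    refine integral_congr_ae (Filter.Eventually.of_forall fun e => ?_)
    by_cases he : e ∈ band b u
    · have he' : e.1 ∈ A := he
      simp only [Set.indicator_of_mem he, f, Set.indicator_of_mem he', score_eq hM0]
    · have he' : e.1 ∉ A := he
      simp only [Set.indicator_of_notMem he, f, Set.indicator_of_notMem he', zero_mul]
  rw [hint]
  have hmarg0 : ∀ᵐ x ∂D.fst, 0 ≤ margin D w x := by
    filter_upwards [h0] with x hx; rw [margin]; linarith
  -- For small `σ` the left-hand side is nonpositive while the mean score is nonnegative.
  -- Subtracting `r / 20` thus confines the real work to `σ > r / 20`, where `b ≤ rR / 80` is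
  -- negligible against `σR / 2`.
  rcases le_or_gt σ (r / 20) with hs | hs
  · have h1 : γ * (L * R / 2) * R / (4 * Q) * (σ - r / 20) ≤ 0 :=
      mul_nonpos_of_nonneg_of_nonpos (by positivity) (by linarith)
    have h2 : 0 ≤ ∫ x, f x * margin D w x ∂D.fst := by
      apply integral_nonneg_of_ae
      filter_upwards [hmarg0] with x hx
      exact mul_nonneg (hf0 x) hx
    exact h1.trans (by positivity)
  · obtain ⟨e, he, hue, hdec⟩ := exists_decomposition hd (norm_hat hd u) w
    rw [← hσdef] at hdec
    set E := boxEvent (hat u) e (-b) b (R / 2) (3 * R / 4)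
    have hEm : MeasurableSet E := measurableSet_boxEvent _ _ _ _ _ _
    have hEp := h.band_box_ge (norm_hat hd u) he hue hL.le hR hb.le hbR
    have hEw : ∀ x ∈ E, σ * R / 4 ≤ |inner ℝ w x| := by
      intro x hx
      have h1 : inner ℝ w x = inner ℝ (hat u) w * inner ℝ (hat u) x + σ * inner ℝ e x := by
        conv_lhs => rw [hdec]
        rw [inner_add_left, real_inner_smul_left, real_inner_smul_left]
      have h2 : |inner ℝ (hat u) w * inner ℝ (hat u) x| ≤ b := by
        rw [abs_mul]
        have h3 := abs_real_inner_le_norm (hat u) w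
        rw [norm_hat hd, hw, one_mul] at h3
        have h4 : |inner ℝ (hat u) x| ≤ b := abs_le.2 hx.1
        calc _ ≤ 1 * b := by gcongr
          _ = b := one_mul b
      have h5 : σ * (R / 2) ≤ σ * inner ℝ e x := by gcongr; exact hx.2.1
      have h6 : r / 20 * R ≤ σ * R := by gcongr
      refine le_trans ?_ (le_abs_self _)
      rw [h1]
      have := (abs_le.1 h2).1
      linarith
    have hσR : r / 20 * R ≤ σ * R := by gcongr
    have hmE := hm E hEm hEp fun x hx => le_trans (by linarith) (hEw x hx)
    have hI : σ * R / 4 * (γ * (L * R / 2 * b)) ≤ ∫ x, f x * margin D w x ∂D.fst := by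
      have hmi := integrable_of_bounded (μ := D.fst) (measurable_margin D w) (abs_margin_le D w)
      calc σ * R / 4 * (γ * (L * R / 2 * b)) ≤ σ * R / 4 * ∫ x in E, margin D w x ∂D.fst := by
            gcongr
        _ = ∫ x, E.indicator (fun x => σ * R / 4 * margin D w x) x ∂D.fst := by
            rw [integral_indicator hEm, integral_const_mul]
        _ ≤ ∫ x, f x * margin D w x ∂D.fst := by
            apply integral_mono_ae ((hmi.const_mul _).indicator hEm)
            · apply integrable_of_bounded (hfm.mul (measurable_margin D w)) (C := M)
              intro x
              rw [Pi.mul_apply, abs_mul]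
              calc _ ≤ M * 1 := by gcongr; exacts [hfM x, abs_margin_le D w x]
                _ = M := mul_one M
            · filter_upwards [hmarg0] with x hx
              by_cases hxE : x ∈ E
              · have hxA : x ∈ A := abs_le.2 hxE.1
                simp only [Set.indicator_of_mem hxE, f, Set.indicator_of_mem hxA]
                apply mul_le_mul_of_nonneg_right _ hx
                -- Since `σ ≤ 8r`, the value `σR / 4` is at most `2rR ≤ M`, so truncation does not
                -- spoil the lower bound.
                refine le_min (hEw x hxE) (le_trans ?_ hM)
                have : σ * R ≤ 8 * r * R := by gcongr
                linarith
              · simp only [Set.indicator_of_notMem hxE]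
                exact mul_nonneg (hf0 x) hx
    rw [hDA] at hpos' ⊢
    calc γ * (L * R / 2) * R / (4 * Q) * (σ - r / 20) ≤ γ * (L * R / 2) * R / (4 * Q) * σ := by
          gcongr; linarith
      _ = (b * Q)⁻¹ * (σ * R / 4 * (γ * (L * R / 2 * b))) := by field_simp
      _ ≤ (D.fst.real A)⁻¹ * (σ * R / 4 * (γ * (L * R / 2 * b))) := by
          gcongr
      _ ≤ _ := by gcongr

end score

/-! ### The guarantee for one call of `optimize` -/

section core
variable {d : ℕ}

lemma iter_congr (P : Param) (w₁ : Pt d) (r b : ℝ) (T : ℕ) {z z' : ℕ → ℕ → Ex d} (t : ℕ)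
    (h : ∀ k < t, z k = z' k) : iter P w₁ r b T z t = iter P w₁ r b T z' t := by
  induction t with
  | zero => rfl
  | succ t ih =>
    have h1 := ih fun k hk => h k (by omega)
    rw [iter_succ, iter_succ, query, query, h1, h t (by omega)]

/-- Examples that are atypically large, or outside of the band. -/
def atypical (r b β l : ℝ) (w : Pt d) : Set (Pt d × Ex d) :=
  {p | (∃ i, β * l < |p.2.1 i|) ∨ 8 * r * (β * l) < |inner ℝ (w - p.1) p.2.1| ∨
    b < |inner ℝ (hat p.1) p.2.1|}

lemma measurableSet_atypical (r b β l : ℝ) (w : Pt d) :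
    MeasurableSet (atypical r b β l w) := by
  have h1 : MeasurableSet {p : Pt d × Ex d | ∃ i, β * l < |p.2.1 i|} := by
    have : {p : Pt d × Ex d | ∃ i, β * l < |p.2.1 i|} =
        ⋃ i, {p : Pt d × Ex d | β * l < |p.2.1 i|} := by ext; simp
    rw [this]
    refine MeasurableSet.iUnion fun i => measurableSet_lt measurable_const ?_
    have : Measurable fun p : Pt d × Ex d => p.2.1 i := by fun_prop
    fun_prop
  have h2 : Measurable fun p : Pt d × Ex d => inner ℝ (w - p.1) p.2.1 := by fun_prop
  have hh : Measurable fun p : Pt d × Ex d => hat p.1 := measurable_hat.comp measurable_fst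
  have hx : Measurable fun p : Pt d × Ex d => p.2.1 := by fun_prop
  have h3 : Measurable fun p : Pt d × Ex d => inner ℝ (hat p.1) p.2.1 := hh.inner hx
  have h2' : Measurable fun p : Pt d × Ex d => |inner ℝ (w - p.1) p.2.1| := h2.abs
  have h3' : Measurable fun p : Pt d × Ex d => |inner ℝ (hat p.1) p.2.1| := h3.abs
  exact h1.union ((measurableSet_lt measurable_const h2').union
    (measurableSet_lt measurable_const h3'))

variable {D : Measure (Ex d)} [IsProbabilityMeasure D] {w : Pt d} {L R U β : ℝ}

/-- A union bound over the `d` coordinates and the direction `w - u`; conditioning on the band costs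
the inverse of its probability. The clause about leaving the band cannot occur under the conditional
law. -/
lemma cond_band_atypical_le (hd : 8 ≤ d) (h : WellBehaved L R U β D.fst) (hL : 0 < L) (hR : 0 < R)
    (hβ : 0 < β) {r b l : ℝ} (hr : 0 < r) (hb : 0 < b) (hbR : b ≤ R / 2) (hl : 0 < l) {u : Pt d}
    (hu : ‖w - u‖ ≤ 8 * r) :
    D[|band b u] {e | (u, e) ∈ atypical r b β l w} ≤
      ENNReal.ofReal ((d + 1) * Real.exp (1 - l) / (L * R / 2 * b)) := by
  obtain ⟨hpos, hne⟩ := h.band_pos hd hL hR hb hbR u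
  set A : Set (Pt d) := {x | (∃ i, β * l ≤ |x i|) ∨ 8 * r * (β * l) ≤ |inner ℝ (w - u) x|}
  have hA : D.fst.real A ≤ (d + 1) * Real.exp (1 - l) := by
    have e : A = (⋃ i, {x : Pt d | β * l ≤ |x i|}) ∪
        {x | 8 * r * (β * l) ≤ |inner ℝ (w - u) x|} := by
      ext; simp [A]
    have hβl : β * l / β = l := by field_simp
    have h1 : ∀ i : Fin d, D.fst.real {x : Pt d | β * l ≤ |x i|} ≤ Real.exp (1 - l) := by
      intro i
      have := h.tail (w := EuclideanSpace.single i (1 : ℝ)) (ρ := 1) (t := β * l) one_pos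
        (by simp) (by positivity)
      rw [hβl] at this
      simpa [EuclideanSpace.inner_single_left] using this
    have h2 := h.tail (w := w - u) (ρ := 8 * r) (t := β * l) (by positivity) hu (by positivity)
    rw [hβl] at h2
    calc D.fst.real A ≤ D.fst.real (⋃ i, {x : Pt d | β * l ≤ |x i|}) +
          D.fst.real {x | 8 * r * (β * l) ≤ |inner ℝ (w - u) x|} := by
          rw [e]; exact measureReal_union_le _ _
      _ ≤ (∑ i : Fin d, Real.exp (1 - l)) + Real.exp (1 - l) := by
          gcongr
          exact (measureReal_iUnion_fintype_le _).trans (Finset.sum_le_sum fun i _ => h1 i)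
      _ = (d + 1) * Real.exp (1 - l) := by simp; ring
  have hAm : MeasurableSet A := by
    have e : A = (⋃ i, {x : Pt d | β * l ≤ |x i|}) ∪
        {x | 8 * r * (β * l) ≤ |inner ℝ (w - u) x|} := by
      ext; simp [A]
    rw [e]
    refine (MeasurableSet.iUnion fun i => measurableSet_le measurable_const ?_).union
      (measurableSet_le measurable_const (by fun_prop))
    have : Measurable fun x : Pt d => x i := by fun_prop
    fun_prop
  have hsub : band b u ∩ {e | (u, e) ∈ atypical r b β l w} ⊆ Prod.fst ⁻¹' A := by
    rintro e ⟨he, h1 | h1 | h1⟩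
    · exact Or.inl (h1.imp fun _ h => h.le)
    · exact Or.inr h1.le
    · exact absurd he (not_le.2 h1)
  rw [cond_apply (measurableSet_band b u)]
  have h3 : D (band b u ∩ {e | (u, e) ∈ atypical r b β l w}) ≤
      ENNReal.ofReal ((d + 1) * Real.exp (1 - l)) := by
    refine (measure_mono hsub).trans ?_
    rw [← ofReal_measureReal, real_preimage_fst hAm]
    exact ENNReal.ofReal_le_ofReal hA
  have h4 : (D (band b u))⁻¹ ≤ ENNReal.ofReal ((L * R / 2 * b)⁻¹) := by
    rw [ENNReal.ofReal_inv_of_pos (by positivity), ENNReal.inv_le_inv, ← ofReal_measureReal]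
    exact ENNReal.ofReal_le_ofReal hpos
  calc _ ≤ ENNReal.ofReal ((L * R / 2 * b)⁻¹) * ENNReal.ofReal ((d + 1) * Real.exp (1 - l)) := by
        gcongr
    _ = _ := by
        rw [← ENNReal.ofReal_mul (by positivity), inv_mul_eq_div]

/-- Sufficient conditions on the parameters of `optimize`: `γ` is the noise margin, `l` the
logarithmic tail parameter and `Q` the bound on the density of the band. -/
structure Admissible (d : ℕ) (P : Param) (r b : ℝ) (T : ℕ) (γ l Q : ℝ) : Prop where
  r_pos : 0 < r
  r_le : r ≤ 1 / 4
  b_pos : 0 < b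
  b_le : b ≤ r * P.R / 80
  γ_pos : 0 < γ
  l_pos : 0 < l
  Q_pos : 0 < Q
  T_pos : 0 < T
  step_pos : 0 < stepSize d P r b T
  density : ∃ M > 0, 4 * P.U * b * M + Real.exp (1 - M / P.β) ≤ b * Q
  tail : T * ((d + 1) * Real.exp (1 - l) / (P.L * P.R / 2 * b)) ≤ P.δ * r / 2
  log_le : Real.log (2 / (P.δ * r)) ≤ T
  drift : 3 * b + 64 * r ^ 2 * (P.s * Real.log d) / (stepSize d P r b T * T) +
      stepSize d P r b T * Real.exp 1 ^ 2 * (P.β * l) ^ 2 / 2 +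
      2 * (8 * r * (P.β * l) + 3 * b + 2 * r * P.R) * √(Real.log (2 / (P.δ * r)) / T) ≤
    γ * (P.L * P.R / 2) * P.R / (4 * Q) * (r / 20)

variable {P : Param} {r b γ l Q : ℝ} {T : ℕ} {w₁ : Pt d}

lemma norm_sub_iter_le (hd : 8 ≤ d) (hs : P.s ≤ d) (hr : 0 ≤ r) (hsp : IsSparse P.s w)
    (hw₁ : ‖w₁ - w‖ ≤ 4 * r) (z : ℕ → ℕ → Ex d) (t : ℕ) :
    ‖w - iter P w₁ r b T z t‖ ≤ 8 * r := by
  have h1 := (iter_mem (b := b) (T := T) (z := z) hd (hardThreshold_mem_feasible hs hr hsp hw₁) t).1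
  calc _ = ‖-(w₁ - w) - (iter P w₁ r b T z t - w₁)‖ := by congr 1; abel
    _ ≤ _ := norm_sub_le _ _
    _ ≤ 8 * r := by rw [norm_neg]; linarith

/-- The deterministic part of the analysis of `optimize`. -/
lemma sum_perp_le_of_typical (hd : 8 ≤ d) (hs : P.s ≤ d) (hL : 0 < P.L) (hR : 0 < P.R)
    (hβ : 0 < P.β) (hδ : 0 < P.δ) (hδ1 : P.δ < 1) (hw : ‖w‖ = 1) (hsp : IsSparse P.s w)
    (hadm : Admissible d P r b T γ l Q) (hw₁ : ‖w₁ - w‖ ≤ 4 * r) (z : ℕ → ℕ → Ex d) {lam : ℝ}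
    (hlam : lam = √(Real.log (2 / (P.δ * r)) / T) / (8 * r * (P.β * l) + 3 * b + 2 * r * P.R))
    (htyp : ∀ t < T, (iter P w₁ r b T z t, query P w₁ r b T z t) ∉ atypical r b P.β l w)
    (hmart : ∑ t ∈ Finset.range T, (lam * (γ * (P.L * P.R / 2) * P.R / (4 * Q) *
        (‖perp (hat (iter P w₁ r b T z t)) w‖ - r / 20) -
        score (8 * r * (P.β * l) + 3 * b + 2 * r * P.R) w (query P w₁ r b T z t)) -
        lam ^ 2 * (8 * r * (P.β * l) + 3 * b + 2 * r * P.R) ^ 2) ≤ Real.log (2 / (P.δ * r))) :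
    ∑ t ∈ Finset.range T, ‖perp (hat (iter P w₁ r b T z t)) w‖ ≤ r / 10 * T := by
  obtain ⟨hr, hr4, hb, -, hγ, hl, hQ, hT, ha, -, -, -, hdrift⟩ := hadm
  have hTr : (0 : ℝ) < T := by exact_mod_cast hT
  set M := 8 * r * (P.β * l) + 3 * b + 2 * r * P.R with hM
  set c := γ * (P.L * P.R / 2) * P.R / (4 * Q)
  set Λ := Real.log (2 / (P.δ * r))
  set a := stepSize d P r b T
  have hrδ : 0 < P.δ * r := by positivity
  have hMpos : 0 < M := by positivity
  have hc : 0 < c := by positivity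
  have hfe := hardThreshold_mem_feasible hs hr.le hsp hw₁
  have hwf := mem_feasible_of_close hs hsp hw₁
  set u := iter P w₁ r b T z
  set e := query P w₁ r b T z
  have hu : ∀ t, ‖w - u t‖ ≤ 8 * r := fun t => norm_sub_iter_le hd hs hr.le hsp hw₁ z t
  -- For a typical example truncation is inactive, and the score of `w` is `⟨u_t - w, grad⟩` plus
  -- `y⟨u_t, x⟩`. The latter is at most `3b`, because `‖u_t‖ ≤ 1 + 8r ≤ 3`.
  have hY : ∀ t < T, score M w (e t) ≤ 3 * b + inner ℝ (u t - w) (grad (e t)) := by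
    intro t ht
    have h1 := htyp t ht
    simp only [atypical, Set.mem_ofPred_eq, not_or, not_lt] at h1
    obtain ⟨-, h2, h3⟩ := h1
    have h4 : |inner ℝ (u t) (e t).1| ≤ 3 * b := by
      have hn : ‖u t‖ ≤ 3 := by
        calc ‖u t‖ = ‖w - (w - u t)‖ := by congr 1; abel
          _ ≤ ‖w‖ + ‖w - u t‖ := norm_sub_le _ _
          _ ≤ 3 := by have := hu t; linarith
      rw [← norm_smul_hat (u t), real_inner_smul_left, abs_mul, abs_norm]
      gcongr
    have h5 : inner ℝ w (e t).1 = inner ℝ (w - u t) (e t).1 + inner ℝ (u t) (e t).1 := by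
      rw [← inner_add_left, sub_add_cancel]
    rw [score_of_le (by
      rw [h5]
      refine (abs_add_le _ _).trans ?_
      have : 0 ≤ 2 * r * P.R := by positivity
      linarith)]
    rw [grad, inner_neg_right, real_inner_smul_right, inner_sub_left]
    have h6 : sgn (e t).2 * inner ℝ (u t) (e t).1 ≤ 3 * b := by
      refine (le_abs_self _).trans ?_
      rwa [abs_mul, abs_sgn, one_mul]
    rw [mul_sub]
    linarith
  have hreg := regret_le (P := P) (w₁ := w₁) (r := r) (b := b) (T := T) (z := z) hd ha.le hfe hwf
    T (G := P.β * l) (by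
      intro t ht i
      have h1 := htyp t ht
      simp only [atypical, Set.mem_ofPred_eq, not_or, not_lt, not_exists] at h1
      exact h1.1 i)
  have hsumY : ∑ t ∈ Finset.range T, score M w (e t) ≤
      T * (3 * b) + ∑ t ∈ Finset.range T, inner ℝ (u t - w) (grad (e t)) := by
    calc _ ≤ ∑ t ∈ Finset.range T, (3 * b + inner ℝ (u t - w) (grad (e t))) :=
          Finset.sum_le_sum fun t ht => hY t (Finset.mem_range.1 ht)
      _ = _ := by rw [Finset.sum_add_distrib]; simp
  have hreg' : ∑ t ∈ Finset.range T, inner ℝ (u t - w) (grad (e t)) ≤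
      T * (64 * r ^ 2 * (P.s * Real.log d) / (a * T) +
        a * Real.exp 1 ^ 2 * (P.β * l) ^ 2 / 2) := by
    rw [← mul_le_mul_iff_right₀ ha]
    refine hreg.trans (le_of_eq ?_)
    change 64 * r ^ 2 * (P.s * Real.log d) + T * (a ^ 2 * Real.exp 1 ^ 2 * (P.β * l) ^ 2 / 2) = _
    field_simp
  have hΛ : 0 < Λ := by
    apply Real.log_pos
    rw [lt_div_iff₀ hrδ]
    have : P.δ * r < 1 * 1 := by gcongr; linarith
    linarith
  -- The scale `lam` satisfies `lam * M = q`, so that the variance term `T (lam M)²` equals the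
  -- deviation level `Λ`; together they cost `2Mq` per round.
  set q := √(Λ / T) with hq
  have hq0 : 0 < q := Real.sqrt_pos.2 (by positivity)
  have hqq : q ^ 2 * T = Λ := by
    rw [hq, Real.sq_sqrt (by positivity)]; field_simp
  have hlM : lam * M = q := by rw [hlam]; field_simp
  have hlam0 : 0 < lam := by rw [hlam]; positivity
  rw [Finset.sum_sub_distrib, ← Finset.mul_sum, Finset.sum_sub_distrib, ← Finset.mul_sum,
    Finset.sum_sub_distrib] at hmart
  simp only [Finset.sum_const, Finset.card_range, nsmul_eq_mul] at hmart
  set X := ∑ t ∈ Finset.range T, ‖perp (hat (u t)) w‖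
  set Y := ∑ t ∈ Finset.range T, score M w (e t)
  have h1 : lam * (c * (X - T * (r / 20)) - Y) ≤ lam * (2 * M * q * T) := by
    have : lam * (2 * M * q * T) = 2 * (q ^ 2 * T) := by rw [← hlM]; ring
    rw [this]
    have h2 : (T : ℝ) * (lam ^ 2 * M ^ 2) = q ^ 2 * T := by rw [← hlM]; ring
    linarith
  have h2 := le_of_mul_le_mul_left h1 hlam0
  have h3 : c * (X - T * (r / 20)) ≤ c * (T * (r / 20)) := by
    have := mul_le_mul_of_nonneg_left hdrift hTr.le
    linarith
  have h4 := le_of_mul_le_mul_left h3 hc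
  linarith

/-- With high probability the iterates of `optimize` are on average close to the target. -/
theorem iterates_close (hd : 8 ≤ d) (hs : P.s ≤ d) (hL : 0 < P.L) (hR : 0 < P.R) (hU : 0 < P.U)
    (hβ : 0 < P.β) (hδ : 0 < P.δ) (hδ1 : P.δ < 1) (hwb : WellBehaved P.L P.R P.U P.β D.fst)
    (hw : ‖w‖ = 1) (hsp : IsSparse P.s w) (h0 : ∀ᵐ x ∂D.fst, noiseRate D w x ≤ 1 / 2)
    (hadm : Admissible d P r b T γ l Q)
    (hm : MarginBound D w (P.L * P.R / 2 * b) (r * P.R / 80) γ)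
    (hw₁ : ‖w₁ - w‖ ≤ 4 * r) {ι : Type*} {site : ℕ → ι} (hsite : Function.Injective site) :
    (Measure.infinitePi fun _ : ι × ℕ => D) {ω | ¬ ∑ t ∈ Finset.range T,
        ‖perp (hat (iter P w₁ r b T (fun t n => ω (site t, n)) t)) w‖ ≤ r / 10 * T} ≤
      ENNReal.ofReal (P.δ * r) := by
  obtain ⟨hr, hr4, hb, hbr, hγ, hl, hQ, hT, ha, ⟨M', hM', hdens⟩, htail, hlog, -⟩ := id hadm
  have hTr : (0 : ℝ) < T := by exact_mod_cast hT
  set M := 8 * r * (P.β * l) + 3 * b + 2 * r * P.R with hM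
  set c := γ * (P.L * P.R / 2) * P.R / (4 * Q)
  set Λ := Real.log (2 / (P.δ * r))
  have hrδ : 0 < P.δ * r := by positivity
  have hMpos : 0 < M := by positivity
  have hΛ : 0 < Λ := by
    apply Real.log_pos
    rw [lt_div_iff₀ hrδ]
    have : P.δ * r < 1 * 1 := by gcongr; linarith
    linarith
  have hbR : b ≤ P.R / 2 := by
    have : r * P.R ≤ 1 * P.R := by gcongr; linarith
    linarith
  set lam := √(Λ / T) / M with hlam
  have hlam0 : 0 ≤ lam := by positivity
  have hlM : lam * M ≤ 1 := by
    rw [hlam, div_mul_cancel₀ _ hMpos.ne']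
    exact Real.sqrt_le_one.2 ((div_le_one hTr).2 hlog)
  let U : ℕ → (ι × ℕ → Ex d) → Pt d := fun t ω => iter P w₁ r b T (fun t n => ω (site t, n)) t
  have hUm : ∀ t, Measurable (U t) := fun t =>
    measurable_iter hd P r b T measurable_const (by fun_prop) t
  have hUc : ∀ t (ω ω' : ι × ℕ → Ex d),
      (∀ k < t, ∀ n, ω (site k, n) = ω' (site k, n)) → U t ω = U t ω' := fun t ω ω' h =>
    iter_congr P w₁ r b T t fun k hk => funext fun n => h k hk n
  have hu : ∀ t ω, ‖w - U t ω‖ ≤ 8 * r := fun t ω =>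
    norm_sub_iter_le hd hs hr.le hsp hw₁ _ t
  have hperp : ∀ t ω, ‖perp (hat (U t ω)) w‖ ≤ 8 * r := fun t ω => by
    have := norm_perp_le (norm_hat hd (U t ω)) w ‖U t ω‖
    rw [norm_smul_hat] at this
    exact this.trans (hu t ω)
  have hne : ∀ t ω, D (band b (U t ω)) ≠ 0 := fun t ω => (hwb.band_pos hd hL hR hb hbR _).2
  -- Each factor has conditional mean at most `1`, so Markov's inequality for the product at level
  -- `2 / (δr)` gives the concentration of the scores around their drift.
  let φ : Pt d × Ex d → ENNReal := fun p => ENNReal.ofReal (Real.exp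
    (lam * (c * (‖perp (hat p.1) w‖ - r / 20) - score M w p.2) - lam ^ 2 * M ^ 2))
  have hφm : Measurable φ := by
    have h1 : Measurable fun p : Pt d × Ex d => hat p.1 := measurable_hat.comp measurable_fst
    have h2 : Measurable fun p : Pt d × Ex d => inner ℝ (hat p.1) w :=
      h1.inner measurable_const
    have h3 : Measurable fun p : Pt d × Ex d => ‖perp (hat p.1) w‖ :=
      (measurable_const.sub (h2.smul h1)).norm
    have h4 : Measurable fun p : Pt d × Ex d => score M w p.2 :=
      (measurable_score M w).comp measurable_snd
    exact (Real.measurable_exp.comp ((((h3.sub_const _).const_mul c).sub h4).const_mul lam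
      |>.sub_const _)).ennreal_ofReal
  have hφ1 : ∀ t ω, ∫⁻ e, φ (U t ω, e) ∂D[|band b (U t ω)] ≤ 1 := fun t ω => by
    have : IsProbabilityMeasure D[|band b (U t ω)] := cond_isProbabilityMeasure (hne t ω)
    refine lintegral_exp_le_one (ν := D[|band b (U t ω)])
      (m := c * (‖perp (hat (U t ω)) w‖ - r / 20)) (measurable_score M w)
      (abs_score_le hMpos.le w) hlam0 hlM ?_
    refine drift_le_integral_score hd hwb hL hR hw h0 hr hb hbr hbR ?_ hγ.le hQ _ ?_ hm
      (hperp t ω)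
    · have : 0 ≤ 8 * r * (P.β * l) := by positivity
      linarith
    · exact (hwb.band_le hd (norm_hat hd _) hU.le hb.le hM').trans hdens
  have hprod := lintegral_adaptive_prod D hsite hUm hUc hφm hne hφ1 T
  have htyp : ∀ t, (Measure.infinitePi fun _ : ι × ℕ => D)
      {ω | (U t ω, sampleBand b (U t ω) fun n => ω (site t, n)) ∈ atypical r b P.β l w} ≤
      ENNReal.ofReal ((d + 1) * Real.exp (1 - l) / (P.L * P.R / 2 * b)) := fun t =>
    measure_adaptive_le D hUm hsite hUc hne (measurableSet_atypical r b P.β l w)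
      (fun t ω => cond_band_atypical_le hd hwb hL hR hβ hr hb hbR hl (hu t ω)) t
  set G : (ι × ℕ → Ex d) → ENNReal := fun ω =>
    ∏ t ∈ Finset.range T, φ (U t ω, sampleBand b (U t ω) fun n => ω (site t, n))
  have hGm : Measurable G := Finset.measurable_prod _ fun t _ =>
    hφm.comp ((hUm t).prodMk (measurable_sampleBand (hUm t)
      (measurable_pi_lambda _ fun n => measurable_pi_apply _)))
  have hsub : {ω | ¬ ∑ t ∈ Finset.range T,
        ‖perp (hat (iter P w₁ r b T (fun t n => ω (site t, n)) t)) w‖ ≤ r / 10 * T} ⊆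
      (⋃ t ∈ Finset.range T, {ω | (U t ω, sampleBand b (U t ω) fun n => ω (site t, n)) ∈
        atypical r b P.β l w}) ∪ {ω | ENNReal.ofReal (2 / (P.δ * r)) ≤ G ω} := by
    intro ω hω
    by_contra hcon
    simp only [Set.mem_union, Set.mem_iUnion, Finset.mem_range, not_or, not_exists,
      Set.mem_ofPred_eq, not_le] at hcon
    refine hω (sum_perp_le_of_typical hd hs hL hR hβ hδ hδ1 hw hsp hadm hw₁ _ hlam
      (fun t ht => hcon.1 t ht) ?_)
    have h2 := hcon.2
    simp only [G, φ] at h2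
    rw [← ENNReal.ofReal_prod_of_nonneg (fun _ _ => (Real.exp_pos _).le), ← Real.exp_sum,
      ENNReal.ofReal_lt_ofReal_iff (by positivity)] at h2
    exact ((Real.lt_log_iff_exp_lt (by positivity)).2 h2).le
  refine (measure_mono hsub).trans ((measure_union_le _ _).trans ?_)
  have e : ENNReal.ofReal (P.δ * r) =
      ENNReal.ofReal (P.δ * r / 2) + ENNReal.ofReal (P.δ * r / 2) := by
    rw [← ENNReal.ofReal_add (by positivity) (by positivity), add_halves]
  rw [e]
  refine add_le_add ?_ ?_
  · refine (measure_biUnion_finset_le _ _).trans ((Finset.sum_le_sum fun t _ => htyp t).trans ?_)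
    rw [Finset.sum_const, Finset.card_range, ← ENNReal.ofReal_nsmul, nsmul_eq_mul]
    exact ENNReal.ofReal_le_ofReal htail
  · refine (meas_ge_le_lintegral_div hGm.aemeasurable (by
      rw [ne_eq, ENNReal.ofReal_eq_zero, not_le]; positivity) ENNReal.ofReal_ne_top).trans ?_
    calc _ ≤ 1 / ENNReal.ofReal (2 / (P.δ * r)) := by gcongr
      _ = _ := by
        rw [one_div, ← ENNReal.ofReal_inv_of_pos (by positivity), inv_div]

end core

/-! ### Chaining the calls of `optimize` -/

section chain
variable {d : ℕ}

/-- With `c = ⟨e, w⟩ ∈ [0, 1]` the claim squared is `2 - 2c ≤ (9/4)(1 - c²)`. -/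
lemma norm_sub_le_norm_perp {e w : Pt d} (he : ‖e‖ = 1) (hw : ‖w‖ = 1) (h : 0 ≤ inner ℝ e w) :
    ‖e - w‖ ≤ 3 / 2 * ‖perp e w‖ := by
  have h1 := norm_perp_sq he w
  have h2 : ‖e - w‖ ^ 2 = 2 - 2 * inner ℝ e w := by
    rw [norm_sub_sq_real, he, hw]; ring
  have h3 : inner ℝ e w ≤ 1 := by
    have := real_inner_le_norm e w
    rwa [he, hw, one_mul] at this
  apply le_of_sq_le_sq _ (by positivity)
  rw [mul_pow, h1, h2, hw]
  nlinarith

lemma inner_hat_nonneg {u w : Pt d} (hw : ‖w‖ = 1) (h : ‖w - u‖ ≤ 1 / 2) :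
    0 ≤ inner ℝ (hat u) w := by
  have h1 : ‖w - u‖ ^ 2 = 1 - 2 * inner ℝ u w + ‖u‖ ^ 2 := by
    rw [norm_sub_sq_real, hw, real_inner_comm]; ring
  have h2 : ‖w - u‖ ^ 2 ≤ (1 / 2) ^ 2 := by gcongr
  have h3 : 0 < inner ℝ u w := by nlinarith [sq_nonneg ‖u‖]
  rw [← norm_smul_hat u, real_inner_smul_left] at h3
  exact (pos_of_mul_pos_right h3 (norm_nonneg _)).le

lemma prox_pos (j : ℕ) : 0 < prox j := by unfold prox; positivity

lemma prox_succ (j : ℕ) : prox j = 4 * prox (j + 1) := by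
  unfold prox; rw [pow_succ 4 (j + 1)]; field_simp

lemma prox_zero : prox 0 = 1 / 4 := by norm_num [prox]

lemma prox_le (j : ℕ) : prox j ≤ 1 / 4 := by
  induction j with
  | zero => exact prox_zero.le
  | succ j ih => have := prox_succ j; have := prox_pos (j + 1); linarith

lemma prox_succ_le (j : ℕ) : prox (j + 1) ≤ 1 / 16 := by
  have := prox_succ j; have := prox_le j; linarith

/-- The standing assumptions on the parameters, the distribution and the target. -/
structure Regular (d : ℕ) (P : Param) (D : Measure (Ex d)) [IsProbabilityMeasure D] (w : Pt d) :
    Prop where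
  hd : 8 ≤ d
  hs : P.s ≤ d
  hL : 0 < P.L
  hR : 0 < P.R
  hU : 0 < P.U
  hβ : 0 < P.β
  hδ : 0 < P.δ
  hδ1 : P.δ < 1 / 10
  wb : WellBehaved P.L P.R P.U P.β D.fst
  hw : ‖w‖ = 1
  hsp : IsSparse P.s w
  h0 : ∀ᵐ x ∂D.fst, noiseRate D w x ≤ 1 / 2

/-- The parameters of the `j`-th calls of `optimize` suit the noise. -/
def GoodStage (P : Param) (S : Schedule) (D : Measure (Ex d)) [IsProbabilityMeasure D] (w : Pt d)
    (j : ℕ) : Prop :=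
  ∃ γ l Q, Admissible d P (prox j) (S.b j) (S.T j) γ l Q ∧
    MarginBound D w (P.L * P.R / 2 * S.b j) (prox j * P.R / 80) γ

variable {P : Param} {S : Schedule} {D : Measure (Ex d)} [IsProbabilityMeasure D] {w : Pt d}

/-- From the second stage on `r ≤ 1/16`, so all iterates are within `8r ≤ 1/2` of `w` and make an
acute angle with it. Their normalizations are then on average within `(3/2)(r/10) ≤ r` of `w`, and
so is their mean. -/
lemma optimize_average_close (hreg : Regular d P D w) {j : ℕ} (hj : GoodStage P S D w (j + 1))
    {w₁ : Pt d} (hw₁ : ‖w₁ - w‖ ≤ prox j) {ι : Type*} {site : ℕ → ι}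
    (hsite : Function.Injective site) :
    (Measure.infinitePi fun _ : ι × ℕ => D) {ω | ¬ ‖(optimize P w₁ (prox (j + 1)) (S.b (j + 1))
        (S.T (j + 1)) .average (fun t n => ω (site t, n))).1 - w‖ ≤ prox (j + 1)} ≤
      ENNReal.ofReal (P.δ * prox (j + 1)) := by
  obtain ⟨γ, l, Q, hadm, hm⟩ := hj
  rw [prox_succ] at hw₁
  have hr := prox_pos (j + 1)
  have hr16 := prox_succ_le j
  have hTr : (0 : ℝ) < (S.T (j + 1) : ℕ) := by exact_mod_cast (S.T (j + 1)).pos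
  refine le_trans (measure_mono ?_) (iterates_close (D := D) hreg.hd hreg.hs
    hreg.hL hreg.hR hreg.hU hreg.hβ hreg.hδ (hreg.hδ1.trans (by norm_num)) hreg.wb hreg.hw hreg.hsp
    hreg.h0 hadm hm hw₁ hsite)
  intro ω hω hcon
  refine hω ?_
  rw [optimize_average]
  set T : ℕ := ((S.T (j + 1) : ℕ+) : ℕ)
  set z : ℕ → ℕ → Ex d := fun t n => ω (site t, n)
  set u := iter P w₁ (prox (j + 1)) (S.b (j + 1)) T z
  have h1 : ∀ t, ‖hat (u t) - w‖ ≤ 3 / 2 * ‖perp (hat (u t)) w‖ := fun t =>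
    norm_sub_le_norm_perp (norm_hat hreg.hd _) hreg.hw (inner_hat_nonneg hreg.hw
      ((norm_sub_iter_le hreg.hd hreg.hs hr.le hreg.hsp hw₁ z t).trans (by linarith)))
  have h2 : (1 / (T : ℝ)) • ∑ t ∈ Finset.range T, hat (u t) - w =
      (1 / (T : ℝ)) • ∑ t ∈ Finset.range T, (hat (u t) - w) := by
    rw [Finset.sum_sub_distrib, smul_sub, Finset.sum_const, Finset.card_range,
      ← Nat.cast_smul_eq_nsmul ℝ, smul_smul, one_div_mul_cancel hTr.ne', one_smul]
  rw [h2, norm_smul, Real.norm_of_nonneg (by positivity), one_div_mul_eq_div, div_le_iff₀ hTr]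
  calc _ ≤ ∑ t ∈ Finset.range T, ‖hat (u t) - w‖ := norm_sum_le _ _
    _ ≤ ∑ t ∈ Finset.range T, 3 / 2 * ‖perp (hat (u t)) w‖ := Finset.sum_le_sum fun t _ => h1 t
    _ = 3 / 2 * ∑ t ∈ Finset.range T, ‖perp (hat (u t)) w‖ := by rw [Finset.mul_sum]
    _ ≤ 3 / 2 * (prox (j + 1) / 10 * T) := by gcongr
    _ ≤ prox (j + 1) * T := by nlinarith [mul_pos hr hTr]

lemma measurableSet_far {V : Outcome d S → Pt d} (hV : Measurable V) (w : Pt d) (ρ : ℝ) :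
    MeasurableSet {ω | ¬ ‖V ω - w‖ ≤ ρ} :=
  (measurableSet_le (hV.sub_const w).norm measurable_const).compl

/-- One call of `optimize` in the average mode. -/
lemma law_stage_le (hreg : Regular d P D w) {j : ℕ} (hj : GoodStage P S D w (j + 1))
    {V V' : Outcome d S → Pt d} (hV : Measurable V) (hV' : Measurable V') {site : ℕ → Site}
    (hsite : Function.Injective site)
    (hVV' : ∀ ω, V' ω = (optimize P (V ω) (prox (j + 1)) (S.b (j + 1)) (S.T (j + 1)) .average
      (fun t n => ω.1 (site t, n))).1)
    (hind : ∀ ω ω', V (mixOutcome {p | ∃ t, p.1 = site t} ∅ ω ω') = V ω) :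
    law S D {ω | ¬ ‖V' ω - w‖ ≤ prox (j + 1)} ≤
      law S D {ω | ¬ ‖V ω - w‖ ≤ prox j} + ENNReal.ofReal (P.δ * prox (j + 1)) := by
  have hsub : {ω | ¬ ‖V' ω - w‖ ≤ prox (j + 1)} ⊆ {ω | ¬ ‖V ω - w‖ ≤ prox j} ∪
      ({ω | ¬ ‖V' ω - w‖ ≤ prox (j + 1)} ∩ {ω | ¬ ‖V ω - w‖ ≤ prox j}ᶜ) := by
    intro ω hω
    by_cases h : ‖V ω - w‖ ≤ prox j
    · exact Or.inr ⟨hω, fun h' => h' h⟩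
    · exact Or.inl h
  refine (measure_mono hsub).trans ((measure_union_le _ _).trans ?_)
  gcongr
  -- Only the examples read by this call are resampled. The starting point `V` stays fixed, so the
  -- bound for a deterministic starting point applies.
  refine (law_le_of_resample S D {p | ∃ t, p.1 = site t} ∅
    ((measurableSet_far hV' w _).inter (measurableSet_far hV w _).compl) MeasurableSet.univ
    (q := ENNReal.ofReal (P.δ * prox (j + 1))) ?_).trans (by rw [measure_univ, mul_one])
  intro ω
  rw [Set.indicator_of_mem (Set.mem_univ _)]
  by_cases h : ‖V ω - w‖ ≤ prox j
  · refine le_trans (measure_mono ?_) ((law_fst S D _).trans_le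
      (optimize_average_close hreg hj h hsite))
    rintro ω' ⟨h1, -⟩ h2
    refine h1 ?_
    rw [hVV', hind]
    have e : (fun t n => (mixOutcome {p | ∃ t, p.1 = site t} ∅ ω ω').1 (site t, n)) =
        fun t n => ω'.1 (site t, n) :=
      funext fun t => funext fun n => mix_of_mem _ _ (show ∃ t', site t = site t' from ⟨t, rfl⟩)
    rw [e]
    exact h2
  · refine le_trans (measure_mono (t := ∅) ?_) (by simp)
    rintro ω' ⟨-, h1⟩
    refine h1 fun h2 => h ?_
    rwa [hind] at h2

/-- The failure probabilities `δ prox i` for `1 ≤ i ≤ j` add up to `δ (1/12 - prox j / 3)`. -/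
lemma law_chain_le (hreg : Regular d P D w) (hj : ∀ j, GoodStage P S D w j)
    {V : ℕ → Outcome d S → Pt d} (hV : ∀ j, Measurable (V j)) {site : ℕ → ℕ → Site}
    (hsite : ∀ j, Function.Injective (site j))
    (hVV : ∀ j ω, V (j + 1) ω = (optimize P (V j ω) (prox (j + 1)) (S.b (j + 1)) (S.T (j + 1))
      .average (fun t n => ω.1 (site j t, n))).1)
    (hind : ∀ j ω ω', V j (mixOutcome {p | ∃ t, p.1 = site j t} ∅ ω ω') = V j ω) (j : ℕ) :
    law S D {ω | ¬ ‖V j ω - w‖ ≤ prox j} ≤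
      law S D {ω | ¬ ‖V 0 ω - w‖ ≤ prox 0} + ENNReal.ofReal (P.δ * (1 / 12 - prox j / 3)) := by
  have hδ := hreg.hδ
  induction j with
  | zero => exact le_self_add
  | succ j ih =>
    refine (law_stage_le hreg (hj (j + 1)) (hV j) (hV (j + 1)) (hsite j) (hVV j) (hind j)).trans ?_
    have h1 := prox_succ j
    have h2 := prox_pos (j + 1)
    have h3 := prox_le j
    have e : P.δ * (1 / 12 - prox (j + 1) / 3) =
        P.δ * (1 / 12 - prox j / 3) + P.δ * prox (j + 1) := by rw [h1]; ring
    rw [e, ENNReal.ofReal_add (mul_nonneg hδ.le (by linarith)) (by positivity), ← add_assoc]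
    gcongr

end chain

/-! ### The trials of the initialization -/

section trials
variable {d : ℕ} {P : Param} {S : Schedule}

lemma trial_congr {ω ω' : Outcome d S} {i : ℕ} (hc : ω.2 i = ω'.2 i) (j : ℕ)
    (h : ∀ k < j, initStream S ω i k = initStream S ω' i k) :
    (trial P S ω i j).1 = (trial P S ω' i j).1 := by
  induction j with
  | zero => rfl
  | succ j ih =>
    cases j with
    | zero =>
      have h1 := trial_one P S ω i
      have h2 := trial_one P S ω' i
      rw [hc, h 0 (by omega)] at h1
      exact h1.trans h2.symm
    | succ j => rw [trial_succ, trial_succ, ih fun k hk => h k (by omega), h (j + 1) (by omega)]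

variable {D : Measure (Ex d)} [IsProbabilityMeasure D] {w : Pt d}

/-- At most three fifths of the outcomes of the coins of the random aggregation are bad. -/
lemma card_bad_coins_le (hd : 8 ≤ d) (hw : ‖w‖ = 1) {T : ℕ} {r : ℝ} (hr : 0 < r) (u : ℕ → Pt d)
    (h : ∑ t ∈ Finset.range T, ‖perp (hat (u t)) w‖ ≤ r / 10 * T) (B : Finset (Fin T × Bool))
    (hB : ∀ c ∈ B, ¬ ‖sgn c.2 • hat (u c.1) - w‖ ≤ r) : (B.card : ℝ) ≤ 6 / 5 * T := by
  classical
  set F : Finset (Fin T) := Finset.univ.filter fun t => r / 2 < ‖perp (hat (u t)) w‖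
  -- `c t` is the wrong sign for the iterate `t`. It accounts for at most `T` bad outcomes; the
  -- right sign fails only for the at most `T / 5` indices with a large orthogonal component.
  let c : Fin T → Bool := fun t => decide (inner ℝ (hat (u t)) w < 0)
  have hF : (F.card : ℝ) ≤ T / 5 := by
    have h1 : (F.card : ℝ) * (r / 2) ≤ ∑ t ∈ Finset.range T, ‖perp (hat (u t)) w‖ := by
      rw [Finset.sum_range]
      calc (F.card : ℝ) * (r / 2) = ∑ t ∈ F, r / 2 := by rw [Finset.sum_const, nsmul_eq_mul]
        _ ≤ ∑ t ∈ F, ‖perp (hat (u t)) w‖ :=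
          Finset.sum_le_sum fun t ht => (Finset.mem_filter.1 ht).2.le
        _ ≤ _ := Finset.sum_le_sum_of_subset_of_nonneg (Finset.subset_univ _)
          fun _ _ _ => norm_nonneg _
    have h2 := h1.trans h
    have h3 : (r / 2) * F.card ≤ (r / 2) * (T / 5) := by linarith
    exact le_of_mul_le_mul_left h3 (by positivity)
  have hsub : B ⊆ (Finset.univ.image fun t => (t, c t)) ∪ F.image fun t => (t, !c t) := by
    rintro ⟨t, σ⟩ hσ
    have hb := hB _ hσ
    simp only [Finset.mem_union, Finset.mem_image, Finset.mem_univ, true_and, Prod.mk.injEq]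
    rcases eq_or_ne σ (c t) with h1 | h1
    · exact Or.inl ⟨t, rfl, h1.symm⟩
    · refine Or.inr ⟨t, ?_, rfl, by cases σ <;> cases hc : c t <;> simp_all⟩
      rw [Finset.mem_filter]
      refine ⟨Finset.mem_univ _, lt_of_not_ge fun h2 => hb ?_⟩
      rcases lt_or_ge (inner ℝ (hat (u t)) w) 0 with h3 | h3
      · have hσ' : σ = false := by simpa [c, h3] using h1
        have h5 : perp (-hat (u t)) w = perp (hat (u t)) w := by
          simp [perp, inner_neg_left]
        have h6 := norm_sub_le_norm_perp (e := -hat (u t)) (by rw [norm_neg, norm_hat hd]) hw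
          (by rw [inner_neg_left]; linarith)
        rw [h5] at h6
        simp only [hσ', sgn, Bool.false_eq_true, if_false, neg_one_smul]
        linarith
      · have hσ' : σ = true := by simpa [c, not_lt.2 h3] using h1
        have h6 := norm_sub_le_norm_perp (norm_hat hd (u t)) hw h3
        simp only [hσ', sgn, if_true, one_smul]
        linarith
  have h4 : B.card ≤ T + F.card := by
    refine (Finset.card_le_card hsub).trans ((Finset.card_union_le _ _).trans ?_)
    gcongr
    · exact Finset.card_image_le.trans (by simp)
    · exact Finset.card_image_le
  have h5 : (B.card : ℝ) ≤ T + F.card := by exact_mod_cast h4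
  linarith

lemma law_coin (i : ℕ) (B : Finset (Fin (S.T 0) × Bool)) {q : ℝ}
    (hB : (B.card : ℝ) ≤ 2 * q * (S.T 0 : ℕ)) :
    law S D {ω | ω.2 i ∈ B} ≤ ENNReal.ofReal q := by
  classical
  set μ := Measure.infinitePi fun _ : ℕ => (PMF.uniformOfFintype (Fin (S.T 0) × Bool)).toMeasure
  have h1 : {ω : Outcome d S | ω.2 i ∈ B} = Set.univ ×ˢ ((fun c => c i) ⁻¹' (B : Set _)) := by
    ext; simp
  have hT : (0 : ℝ) < (S.T 0 : ℕ) := by exact_mod_cast (S.T 0).pos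
  rw [h1, law, Measure.prod_prod, measure_univ, one_mul,
    (measurePreserving_eval_infinitePi (fun _ : ℕ =>
      (PMF.uniformOfFintype (Fin (S.T 0) × Bool)).toMeasure) i).measure_preimage
      B.measurableSet.nullMeasurableSet, PMF.toMeasure_uniformOfFintype_apply _ B.measurableSet]
  have h2 : (Fintype.card (Fin (S.T 0) × Bool) : ENNReal) =
      ENNReal.ofReal (2 * ((S.T 0 : ℕ+) : ℕ)) := by
    rw [ENNReal.ofReal_mul (by norm_num), ENNReal.ofReal_natCast]
    simp [mul_comm]
  have h3 : (Fintype.card ((B : Set (Fin (S.T 0) × Bool))) : ENNReal) =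
      ENNReal.ofReal (B.card : ℝ) := by
    rw [ENNReal.ofReal_natCast]; simp
  rw [h2, h3, ← ENNReal.ofReal_div_of_pos (by positivity)]
  apply ENNReal.ofReal_le_ofReal
  rw [div_le_iff₀ (by positivity)]
  linarith

/-- The start `0` is at distance `1 = 4 prox 0` from `w`, so the iterates are controlled but may
point away from `w`. The coins are independent of the examples; resampling them alone gives success
with probability at least `2/5` once the iterates are good. -/
lemma law_first_le (hreg : Regular d P D w) (hj : GoodStage P S D w 0) (i : ℕ) :
    law S D {ω | ¬ ‖(trial P S ω i 1).1 - w‖ ≤ prox 0} ≤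
      ENNReal.ofReal (P.δ * prox 0) + ENNReal.ofReal (3 / 5) := by
  classical
  obtain ⟨γ, l, Q, hadm, hm⟩ := hj
  set T : ℕ := ((S.T 0 : ℕ+) : ℕ)
  set U : ℕ → (ℕ → ℕ → Ex d) → Pt d := fun t z => iter P 0 (prox 0) (S.b 0) T z t
  have hUm : ∀ t, Measurable (U t) := fun t =>
    measurable_iter hreg.hd P (prox 0) (S.b 0) T measurable_const measurable_id t
  set X : (ℕ → ℕ → Ex d) → ℝ := fun z => ∑ t ∈ Finset.range T, ‖perp (hat (U t z)) w‖
  have hX : Measurable X := by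
    refine Finset.measurable_sum _ fun t _ => ?_
    have h1 : Measurable fun z => hat (U t z) := measurable_hat.comp (hUm t)
    have h2 : Measurable fun z => inner ℝ (hat (U t z)) w := h1.inner measurable_const
    exact (measurable_const.sub (h2.smul h1)).norm
  set G : Set (Outcome d S) := {ω | X (initStream S ω i 0) ≤ prox 0 / 10 * T} with hG
  have hGm : MeasurableSet G :=
    measurableSet_le (hX.comp (measurable_initStream S i 0)) measurable_const
  have hE := measurableSet_far (measurable_trial P S hreg.hd i 1) w (prox 0)
  have hsub : {ω | ¬ ‖(trial P S ω i 1).1 - w‖ ≤ prox 0} ⊆ Gᶜ ∪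
      ({ω | ¬ ‖(trial P S ω i 1).1 - w‖ ≤ prox 0} ∩ G) := by
    intro ω hω
    by_cases h : ω ∈ G
    · exact Or.inr ⟨hω, h⟩
    · exact Or.inl h
  refine (measure_mono hsub).trans ((measure_union_le _ _).trans ?_)
  gcongr
  · have hw₁ : ‖(0 : Pt d) - w‖ ≤ 4 * prox 0 := by
      rw [zero_sub, norm_neg, hreg.hw, prox_zero]; norm_num
    have h1 := iterates_close (D := D) hreg.hd hreg.hs hreg.hL hreg.hR hreg.hU hreg.hβ hreg.hδ
      (hreg.hδ1.trans (by norm_num)) hreg.wb hreg.hw hreg.hsp hreg.h0 hadm hm hw₁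
      (site := fun t => Site.init i 0 t) (fun t t' h => by injection h)
    exact (law_fst S D _).trans_le h1
  · refine (law_le_of_resample S D ∅ {i} (hE.inter hGm) MeasurableSet.univ
      (q := ENNReal.ofReal (3 / 5)) ?_).trans (by rw [measure_univ, mul_one])
    intro ω
    rw [Set.indicator_of_mem (Set.mem_univ _)]
    have hs : ∀ ω', initStream S (mixOutcome ∅ {i} ω ω') i 0 = initStream S ω i 0 := fun ω' =>
      funext fun t => funext fun n => mix_of_notMem _ _ (Set.notMem_empty _)
    have hc : ∀ ω', (mixOutcome ∅ {i} ω ω').2 i = ω'.2 i := fun ω' =>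
      mix_of_mem _ _ (Set.mem_singleton i)
    by_cases h : ω ∈ G
    · set B : Finset (Fin T × Bool) := Finset.univ.filter fun c =>
        ¬ ‖sgn c.2 • hat (U c.1 (initStream S ω i 0)) - w‖ ≤ prox 0
      have hB := card_bad_coins_le hreg.hd hreg.hw (prox_pos 0)
        (fun t => U t (initStream S ω i 0)) h B fun c hc => (Finset.mem_filter.1 hc).2
      refine le_trans (measure_mono ?_) (law_coin (D := D) i B (q := 3 / 5) (by linarith))
      rintro ω' ⟨h1, -⟩
      refine Finset.mem_filter.2 ⟨Finset.mem_univ _, fun h2 => h1 ?_⟩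
      rw [trial_one, optimize_random, hs, hc]
      exact h2
    · refine le_trans (measure_mono (t := ∅) ?_) (by simp)
      rintro ω' ⟨-, h1⟩
      refine h ?_
      rw [hG, Set.mem_ofPred_eq, hs] at h1
      exact h1

/-- First call and chain together: `δ/4 + 3/5 + δ/12 ≤ 3/4`, as `δ < 1/10`. -/
lemma law_cand_le (hreg : Regular d P D w) (hj : ∀ j, GoodStage P S D w j) (i : ℕ) :
    law S D {ω | ¬ ‖cand P S ω i - w‖ ≤ prox (k0 P S)} ≤ ENNReal.ofReal (3 / 4) := by
  have h1 := law_chain_le hreg hj (V := fun j ω => (trial P S ω i (j + 1)).1)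
    (fun j => measurable_trial P S hreg.hd i (j + 1)) (site := fun j t => .init i (j + 1) t)
    (fun j t t' h => by injection h) (fun j ω => trial_succ P S ω i j)
    (fun j ω ω' => trial_congr (mix_of_notMem _ _ (Set.notMem_empty _)) (j + 1) fun k hk => by
      funext t n
      refine mix_of_notMem _ _ ?_
      rintro ⟨t', h⟩
      injection h with _ h2
      omega) (k0 P S)
  refine h1.trans ((add_le_add_left (law_first_le hreg (hj 0) i) _).trans ?_)
  have h2 := prox_pos (k0 P S)
  have h3 := prox_le (k0 P S)
  have hδ := hreg.hδ
  have hδ1 := hreg.hδ1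
  rw [prox_zero, ← ENNReal.ofReal_add (by positivity) (by positivity),
    ← ENNReal.ofReal_add (by positivity) (mul_nonneg hδ.le (by linarith))]
  apply ENNReal.ofReal_le_ofReal
  nlinarith

/-- Different trials read disjoint sets of examples and coins. Resampling those of trial `n` leaves
the earlier candidates unchanged. -/
lemma law_all_cand_le (hreg : Regular d P D w) (hj : ∀ j, GoodStage P S D w j) (n : ℕ) :
    law S D (⋂ i ∈ Finset.range n, {ω | ¬ ‖cand P S ω i - w‖ ≤ prox (k0 P S)}) ≤
      ENNReal.ofReal (3 / 4) ^ n := by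
  have hm : ∀ i, MeasurableSet {ω : Outcome d S | ¬ ‖cand P S ω i - w‖ ≤ prox (k0 P S)} :=
    fun i => measurableSet_far (measurable_cand P S hreg.hd i) w _
  induction n with
  | zero => simp
  | succ n ih =>
    set F := ⋂ i ∈ Finset.range n, {ω : Outcome d S | ¬ ‖cand P S ω i - w‖ ≤ prox (k0 P S)}
    have hF : MeasurableSet F := Finset.measurableSet_biInter _ fun i _ => hm i
    rw [Finset.range_add_one, Finset.set_biInter_insert, Set.inter_comm, pow_succ']
    refine (law_le_of_resample S D {p | ∃ j t, p.1 = Site.init n j t} {n} (hF.inter (hm n)) hF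
      (q := ENNReal.ofReal (3 / 4)) fun ω => ?_).trans (by gcongr)
    set A : Set (Site × ℕ) := {p | ∃ j t, p.1 = Site.init n j t}
    have h1 : ∀ ω', cand P S (mixOutcome A {n} ω ω') n = cand P S ω' n := fun ω' =>
      trial_congr (mix_of_mem _ _ (Set.mem_singleton n)) _ fun k _ => funext fun t => funext fun m =>
        mix_of_mem _ _ (show ∃ j t', Site.init n k t = Site.init n j t' from ⟨k, t, rfl⟩)
    have h2 : ∀ ω', ∀ i < n, cand P S (mixOutcome A {n} ω ω') i = cand P S ω i := fun ω' i hi =>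
      trial_congr (mix_of_notMem _ _ (show i ∉ ({n} : Set ℕ) from hi.ne)) _ fun k _ => funext fun t => funext fun m =>
        mix_of_notMem _ _ (by
          rintro ⟨j, t', h⟩
          injection h with h3
          omega)
    by_cases h : ω ∈ F
    · rw [Set.indicator_of_mem h]
      refine le_trans (measure_mono ?_) (law_cand_le hreg hj n)
      rintro ω' ⟨-, h3⟩
      change ¬ ‖cand P S (mixOutcome A {n} ω ω') n - w‖ ≤ prox (k0 P S) at h3
      rwa [h1] at h3
    · refine le_trans (measure_mono (t := ∅) ?_) (by simp)
      rintro ω' ⟨h3, -⟩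
      refine h ?_
      simp only [F, Set.mem_iInter, Finset.mem_range] at h3 ⊢
      intro i hi
      have := h3 i hi
      change ¬ ‖cand P S (mixOutcome A {n} ω ω') i - w‖ ≤ prox (k0 P S) at this
      rwa [h2 ω' i hi] at this

end trials

/-! ### Selection of a candidate by its empirical error -/

section holdout
variable {d : ℕ} {P : Param} {S : Schedule} {D : Measure (Ex d)} [IsProbabilityMeasure D] {w : Pt d}

/-- The indicator of the event that `h_v` errs. -/
def mistake (v : Pt d) (e : Ex d) : ℝ := if halfspace v e.1 ≠ e.2 then 1 else 0

lemma measurableSet_mistake (v : Pt d) : MeasurableSet {e : Ex d | halfspace v e.1 ≠ e.2} :=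
  (measurable_const.prodMk measurable_id : Measurable fun e : Ex d => (v, e))
    measurableSet_misclassified

lemma measurable_mistake (v : Pt d) : Measurable (mistake v) :=
  Measurable.ite (measurableSet_mistake v) measurable_const measurable_const

lemma mistake_mem_Icc (v : Pt d) (e : Ex d) : mistake v e ∈ Set.Icc (0 : ℝ) 1 := by
  unfold mistake; split_ifs <;> simp

omit [IsProbabilityMeasure D] in
lemma integral_mistake (v : Pt d) : ∫ e, mistake v e ∂D = err v D := by
  have : mistake v = {e : Ex d | halfspace v e.1 ≠ e.2}.indicator 1 := by
    ext e; simp [mistake, Set.indicator]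
  rw [this, integral_indicator_one (measurableSet_mistake v), err]

/-- Hoeffding's inequality for the average of independent copies of a centered variable. -/
lemma measure_average_ge_le {ι : Type*} {site : ℕ → ι} (hsite : Function.Injective site)
    {g : Ex d → ℝ} (hg : Measurable g) {c : NNReal} (hc : HasSubgaussianMGF g c D) (hc0 : c = 1 / 4)
    (m : ℕ) {ε : ℝ} (hε : 0 ≤ ε) :
    (Measure.infinitePi fun _ : ι => D) {ω | m * ε ≤ ∑ n ∈ Finset.range m, g (ω (site n))} ≤
      ENNReal.ofReal (Real.exp (-(2 * m * ε ^ 2))) := by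
  have hind : iIndepFun (fun n (ω : ι → Ex d) => g (ω (site n)))
      (Measure.infinitePi fun _ : ι => D) :=
    (iIndepFun_infinitePi (P := fun _ : ι => D) (X := fun _ => g) fun _ => hg).precomp hsite
  have hsub : ∀ n < m, HasSubgaussianMGF (fun ω : ι → Ex d => g (ω (site n))) c
      (Measure.infinitePi fun _ : ι => D) := fun n _ => by
    refine HasSubgaussianMGF.of_map (Y := fun ω : ι → Ex d => ω (site n)) (X := g)
      (measurable_pi_apply _).aemeasurable ?_
    rwa [Measure.infinitePi_map_eval]
  have h := HasSubgaussianMGF.measure_sum_range_ge_le_of_iIndepFun hind hsub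
    (ε := m * ε) (by positivity)
  rw [← ofReal_measureReal]
  refine ENNReal.ofReal_le_ofReal (h.trans (le_of_eq ?_))
  congr 1
  rcases eq_or_ne m 0 with rfl | hm
  · simp
  · rw [hc0]
    push_cast
    field_simp
    norm_num

lemma law_deviation_le (v : Pt d) {ε : ℝ} (hε : 0 ≤ ε) :
    law S D {ω | ε < |empErr S.m v (fun n => ω.1 (.holdout, n)) - err v D|} ≤
      ENNReal.ofReal (2 * Real.exp (-(2 * (S.m : ℕ) * ε ^ 2))) := by
  set m : ℕ := ((S.m : ℕ+) : ℕ)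
  have hm : (0 : ℝ) < m := by exact_mod_cast S.m.pos
  have hs : Function.Injective fun n : ℕ => (Site.holdout, n) := fun _ _ h => (Prod.mk.inj h).2
  have hg : Measurable fun e => mistake v e - err v D := (measurable_mistake v).sub_const _
  have h1 : HasSubgaussianMGF (fun e => mistake v e - err v D) ((‖(1 : ℝ) - 0‖₊ / 2) ^ 2) D := by
    have := hasSubgaussianMGF_of_mem_Icc (μ := D) (measurable_mistake v).aemeasurable
      (Filter.Eventually.of_forall (mistake_mem_Icc v))
    rwa [integral_mistake] at this
  have hc : ((‖(1 : ℝ) - 0‖₊ / 2) ^ 2 : NNReal) = 1 / 4 := by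
    rw [sub_zero, nnnorm_one]; norm_num
  have h2 := measure_average_ge_le hs hg h1 hc m hε
  have h3 := measure_average_ge_le hs hg.neg h1.neg hc m hε
  have hsum : ∀ ω : Site × ℕ → Ex d, ∑ n ∈ Finset.range m, (mistake v (ω (.holdout, n)) - err v D) =
      m * (empErr m v (fun n => ω (.holdout, n)) - err v D) := by
    intro ω
    rw [Finset.sum_sub_distrib, Finset.sum_const, Finset.card_range, nsmul_eq_mul, empErr]
    simp only [mistake]
    field_simp
  refine (law_fst S D {ω | ε < |empErr m v (fun n => ω (.holdout, n)) - err v D|}).trans_le ?_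
  have hsub : {ω : Site × ℕ → Ex d | ε < |empErr m v (fun n => ω (.holdout, n)) - err v D|} ⊆
      {ω | m * ε ≤ ∑ n ∈ Finset.range m, (mistake v (ω (.holdout, n)) - err v D)} ∪
      {ω | m * ε ≤ ∑ n ∈ Finset.range m, -(mistake v (ω (.holdout, n)) - err v D)} := by
    intro ω hω
    have hω' : ε < |empErr m v (fun n => ω (.holdout, n)) - err v D| := hω
    rcases lt_abs.1 hω' with h | h
    · left
      rw [Set.mem_ofPred_eq, hsum]
      gcongr
    · right
      rw [Set.mem_ofPred_eq, Finset.sum_neg_distrib, hsum, ← mul_neg]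
      gcongr
  refine (measure_mono hsub).trans ((measure_union_le _ _).trans ?_)
  rw [two_mul, ENNReal.ofReal_add (by positivity) (by positivity)]
  exact add_le_add h2 h3

/-- The holdout sample is read by no trial, so resampling it freezes the candidate and reduces the
claim to Hoeffding's bound for a fixed vector. -/
lemma law_candErr_deviation_le (hd : 8 ≤ d) (i : ℕ) {ε : ℝ} (hε : 0 ≤ ε) :
    law S D {ω | ε < |candErr P S ω i - err (cand P S ω i) D|} ≤
      ENNReal.ofReal (2 * Real.exp (-(2 * (S.m : ℕ) * ε ^ 2))) := by
  have hm : MeasurableSet {ω : Outcome d S | ε < |candErr P S ω i - err (cand P S ω i) D|} := by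
    have h1 : Measurable fun ω : Outcome d S => err (cand P S ω i) D :=
      (measurable_err D).comp (measurable_cand P S hd i)
    exact measurableSet_lt measurable_const ((measurable_candErr P S hd i).sub h1).abs
  refine (law_le_of_resample S D {p | p.1 = Site.holdout} ∅ hm MeasurableSet.univ
    (q := ENNReal.ofReal (2 * Real.exp (-(2 * (S.m : ℕ) * ε ^ 2)))) fun ω => ?_).trans
    (by rw [measure_univ, mul_one])
  rw [Set.indicator_of_mem (Set.mem_univ _)]
  refine le_trans (measure_mono ?_) (law_deviation_le (S := S) (cand P S ω i) hε)
  intro ω' h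
  have h1 : cand P S (mixOutcome {p | p.1 = Site.holdout} ∅ ω ω') i = cand P S ω i :=
    trial_congr (mix_of_notMem _ _ (Set.notMem_empty _)) _ fun k _ => funext fun t => funext fun m =>
      mix_of_notMem _ _ (show ¬ Site.init i k t = Site.holdout by simp)
  have h2 : (fun n => (mixOutcome {p | p.1 = Site.holdout} ∅ ω ω').1 (.holdout, n)) =
      fun n => ω'.1 (.holdout, n) :=
    funext fun n => mix_of_mem _ _ (show Site.holdout = Site.holdout from rfl)
  have h3 : ε < |candErr P S (mixOutcome {p | p.1 = Site.holdout} ∅ ω ω') i -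
      err (cand P S (mixOutcome {p | p.1 = Site.holdout} ∅ ω ω') i) D| := h
  unfold candErr at h3
  rw [h1, h2] at h3
  exact h3

lemma candErr_best_le (hN : 0 < trials P) (ω : Outcome d S) :
    best P S ω < trials P ∧ ∀ i < trials P, candErr P S ω (best P S ω) ≤ candErr P S ω i := by
  have h : {i | i < trials P ∧ ∀ i' < trials P, candErr P S ω i ≤ candErr P S ω i'}.Nonempty := by
    obtain ⟨i, hi, h⟩ := Finset.exists_min_image (Finset.range (trials P)) (candErr P S ω)
      ⟨0, Finset.mem_range.2 hN⟩
    exact ⟨i, Finset.mem_range.1 hi, fun i' hi' => h i' (Finset.mem_range.2 hi')⟩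
  exact Nat.sInf_mem h

/-- Halfspaces with close normal vectors have close error rates. -/
lemma err_sub_err_le (hreg : Regular d P D w) {v : Pt d} {ρ M : ℝ} (hρ : 0 < ρ)
    (hv : ‖v - w‖ ≤ ρ) (hM : 0 < M) :
    err v D - err w D ≤ 2 * Real.exp (1 - M / P.β) + 4 * P.U * (ρ * M) * M := by
  have h1 := hreg.wb.disagreement_le hreg.hd hreg.hw hreg.hU.le hρ hv hM
  have hh : ∀ v : Pt d, Measurable fun x : Pt d => halfspace v x := fun v =>
    measurable_halfspace.comp (measurable_const.prodMk measurable_id)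
  have hB : MeasurableSet {x : Pt d | halfspace v x ≠ halfspace w x} :=
    (measurableSet_eq_fun (hh v) (hh w)).compl
  have h2 : {e : Ex d | halfspace v e.1 ≠ e.2} ⊆ {e | halfspace w e.1 ≠ e.2} ∪
      Prod.fst ⁻¹' {x : Pt d | halfspace v x ≠ halfspace w x} := by
    intro e he
    by_cases h : halfspace v e.1 = halfspace w e.1
    · left; rw [Set.mem_ofPred_eq] at he ⊢; rwa [← h]
    · exact Or.inr h
  have h3 := (measureReal_mono h2 (μ := D)).trans (measureReal_union_le _ _)
  rw [real_preimage_fst hB] at h3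
  change err v D ≤ err w D + _ at h3
  linarith

lemma prox_ceil_le {r : ℝ} (hr : 0 < r) : prox ⌈Real.logb 4 (1 / r)⌉₊ ≤ r := by
  have h1 := Nat.le_ceil (Real.logb 4 (1 / r))
  set k := ⌈Real.logb 4 (1 / r)⌉₊
  rw [Real.logb_le_iff_le_rpow (by norm_num) (by positivity), Real.rpow_natCast,
    div_le_iff₀ hr] at h1
  unfold prox
  rw [div_le_iff₀ (by positivity), pow_succ]
  nlinarith

lemma exp_one_sub_log {c x : ℝ} (hc : 0 < c) (hx : 0 < x) :
    Real.exp (1 - Real.log (c / x)) = Real.exp 1 * x / c := by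
  rw [Real.exp_sub, Real.exp_log (by positivity)]; field_simp

/-- The excess error of vectors within the proximity at which the procedures stop. -/
lemma err_sub_err_le_of_close (hreg : Regular d P D w) {v : Pt d} {c x q : ℝ} (hc : 1 < c)
    (hx : 0 < x) (hx1 : x ≤ 1) (hq : 0 < q) (hv : ‖v - w‖ ≤
      prox ⌈Real.logb 4 (1 / (x / (q * P.U * P.β ^ 2 * Real.log (c / x) ^ 2)))⌉₊) :
    err v D - err w D ≤ (2 * Real.exp 1 / c + 4 / q) * x := by
  have hU := hreg.hU
  have hβ := hreg.hβ
  have hl : 0 < Real.log (c / x) := Real.log_pos (by rw [lt_div_iff₀ hx]; linarith)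
  have hr : 0 < x / (q * P.U * P.β ^ 2 * Real.log (c / x) ^ 2) := by positivity
  -- The cutoff `β ln(c/x)` turns the tail term into `2e x / c` and, by the choice of the final
  -- proximity, the band term into `4x / q`.
  have h1 := err_sub_err_le hreg hr (hv.trans (prox_ceil_le hr)) (mul_pos hβ hl)
  have h2 : P.β * Real.log (c / x) / P.β = Real.log (c / x) := by field_simp
  rw [h2, exp_one_sub_log (by linarith) hx] at h1
  refine h1.trans (le_of_eq ?_)
  have : c ≠ 0 := by linarith
  field_simp

/-- The size of the labelled sample and the initial target excess error suit the noise. -/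
structure GoodHoldout (P : Param) (S : Schedule) (D : Measure (Ex d)) [IsProbabilityMeasure D]
    (w : Pt d) : Prop where
  eps_pos : 0 < S.eps0
  eps_le : S.eps0 ≤ 1
  m_ge : 8 * Real.log (8 * trials P / P.δ) / S.eps0 ^ 2 ≤ (S.m : ℕ)
  margin : ∃ γ, MarginBound D w (P.L * P.R ^ 2 / 80) (P.R / 20) γ ∧
    S.eps0 ≤ γ * (P.L * P.R ^ 2 / 80)

/-- A good candidate has excess at most `0.3 ε₀`; two deviations of `ε₀ / 4` leave the selected one
below `ε₀`. A direction farther than `1/4` from `w` would have excess at least `γ L R² / 80 ≥ ε₀`.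
-/
lemma initProc_close (hreg : Regular d P D w) (hh : GoodHoldout P S D w) (hN : 0 < trials P)
    {ω : Outcome d S} {i : ℕ} (hi : i < trials P) (hc : ‖cand P S ω i - w‖ ≤ prox (k0 P S))
    (hdev : ∀ i < trials P, |candErr P S ω i - err (cand P S ω i) D| ≤ S.eps0 / 4) :
    ‖(initProc P S ω).1 - w‖ ≤ 1 / 4 := by
  obtain ⟨h0, h1, -, γ, hm, hγ⟩ := hh
  obtain ⟨hb, hb'⟩ := candErr_best_le hN ω
  have h2 := err_sub_err_le_of_close hreg (c := 24) (q := 64) (by norm_num) h0 h1 (by norm_num) hc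
  have h3 := (abs_le.1 (hdev i hi)).2
  have h4 := (abs_le.1 (hdev _ hb)).1
  have h5 := hb' i hi
  have he := Real.exp_one_lt_d9
  rw [initProc_fst]
  by_contra! hcon
  obtain ⟨E, hEm, hEp, hE⟩ := hreg.wb.exists_disagreement hreg.hd hreg.hw hreg.hL.le hreg.hR hcon
  have h6 := hm E hEm hEp fun x hx => (hE x hx).2
  have h7 := setIntegral_margin_le_excess D w hreg.h0 fun x hx => (hE x hx).1
  have h8 : (2 * Real.exp 1 / 24 + 4 / 64) * S.eps0 ≤ 3 / 10 * S.eps0 := by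
    gcongr; linarith
  linarith

lemma trials_pos (hδ : 0 < P.δ) (hδ1 : P.δ < 1 / 10) : 0 < trials P := by
  apply Nat.ceil_pos.2
  have : 0 < Real.log (4 / P.δ) := Real.log_pos (by rw [lt_div_iff₀ hδ]; linarith)
  positivity

lemma law_initProc_le (hreg : Regular d P D w) (hj : ∀ j, GoodStage P S D w j)
    (hh : GoodHoldout P S D w) :
    law S D {ω | ¬ ‖(initProc P S ω).1 - w‖ ≤ 1 / 4} ≤ ENNReal.ofReal (P.δ / 2) := by
  have hδ := hreg.hδ
  have hN := trials_pos hδ hreg.hδ1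
  have hNr : (0 : ℝ) < trials P := by exact_mod_cast hN
  have hε := hh.eps_pos
  have hsub : {ω : Outcome d S | ¬ ‖(initProc P S ω).1 - w‖ ≤ 1 / 4} ⊆
      (⋂ i ∈ Finset.range (trials P), {ω | ¬ ‖cand P S ω i - w‖ ≤ prox (k0 P S)}) ∪
      ⋃ i ∈ Finset.range (trials P),
        {ω | S.eps0 / 4 < |candErr P S ω i - err (cand P S ω i) D|} := by
    intro ω hω
    by_contra hcon
    simp only [Set.mem_union, Set.mem_iInter, Set.mem_iUnion, Finset.mem_range, Set.mem_ofPred_eq,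
      not_or, not_forall, not_exists, not_not, not_lt] at hcon
    obtain ⟨⟨i, hi, hc⟩, hdev⟩ := hcon
    exact hω (initProc_close hreg hh hN hi hc hdev)
  refine (measure_mono hsub).trans ((measure_union_le _ _).trans ?_)
  rw [← add_halves (P.δ / 2), ENNReal.ofReal_add (by positivity) (by positivity)]
  refine add_le_add ((law_all_cand_le hreg hj _).trans ?_) ?_
  · rw [← ENNReal.ofReal_pow (by norm_num)]
    apply ENNReal.ofReal_le_ofReal
    -- The number `10 ln(4/δ)` of trials makes the probability that all of them fail at most `δ /
    -- 4`.
    have h1 : (3 / 4 : ℝ) ≤ Real.exp (-(1 / 10)) := by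
      have := Real.add_one_le_exp (-(1 / 10) : ℝ); linarith
    have h2 : 10 * Real.log (4 / P.δ) ≤ trials P := Nat.le_ceil _
    calc (3 / 4 : ℝ) ^ trials P ≤ Real.exp (-(1 / 10)) ^ trials P := by gcongr
      _ = Real.exp (-(trials P / 10)) := by rw [← Real.exp_nat_mul]; congr 1; ring
      _ ≤ Real.exp (-Real.log (4 / P.δ)) := by gcongr; linarith
      _ = P.δ / 2 / 2 := by
        rw [Real.exp_neg, Real.exp_log (by positivity), inv_div]; ring
  · refine (measure_biUnion_finset_le _ _).trans ((Finset.sum_le_sum fun i _ =>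
      law_candErr_deviation_le hreg.hd i (by positivity)).trans ?_)
    rw [Finset.sum_const, Finset.card_range, ← ENNReal.ofReal_nsmul, nsmul_eq_mul]
    apply ENNReal.ofReal_le_ofReal
    have h1 := hh.m_ge
    rw [div_le_iff₀ (by positivity)] at h1
    -- The sample size matches Hoeffding's exponent at accuracy `ε₀ / 4`, so the union bound over
    -- the trials costs another `δ / 4`.
    have h2 : Real.log (8 * trials P / P.δ) ≤ 2 * (S.m : ℕ) * (S.eps0 / 4) ^ 2 := by
      rw [div_pow]; linarith
    calc (trials P : ℝ) * (2 * Real.exp (-(2 * (S.m : ℕ) * (S.eps0 / 4) ^ 2)))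
        ≤ trials P * (2 * Real.exp (-Real.log (8 * trials P / P.δ))) := by gcongr
      _ = P.δ / 2 / 2 := by
        rw [Real.exp_neg, Real.exp_log (by positivity), inv_div]; field_simp; norm_num

lemma initProc_congr {ω ω' : Outcome d S} (hc : ω.2 = ω'.2)
    (hi : ∀ i j t n, ω.1 (.init i j t, n) = ω'.1 (.init i j t, n))
    (hh : ∀ n, ω.1 (.holdout, n) = ω'.1 (.holdout, n)) :
    (initProc P S ω).1 = (initProc P S ω').1 := by
  have h1 : ∀ i, cand P S ω i = cand P S ω' i := fun i =>
    trial_congr (by rw [hc]) _ fun k _ => funext fun t => funext fun n => hi i k t n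
  have h2 : ∀ i, candErr P S ω i = candErr P S ω' i := fun i => by
    unfold candErr; simp only [h1, hh]
  rw [initProc_fst, initProc_fst, h1]
  have h3 : best P S ω = best P S ω' := by unfold best; simp only [h2]
  rw [h3]

lemma refineState_congr {ω ω' : Outcome d S} (hc : ω.2 = ω'.2)
    (hi : ∀ i j t n, ω.1 (.init i j t, n) = ω'.1 (.init i j t, n))
    (hh : ∀ n, ω.1 (.holdout, n) = ω'.1 (.holdout, n)) (j : ℕ)
    (hr : ∀ k ≤ j, ∀ t n, ω.1 (.refine k t, n) = ω'.1 (.refine k t, n)) :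
    (refineState P S ω j).1 = (refineState P S ω' j).1 := by
  induction j with
  | zero => exact initProc_congr hc hi hh
  | succ j ih =>
    rw [refineState_succ, refineState_succ, ih fun k hk => hr k (by omega)]
    have : refineStream S ω (j + 1) = refineStream S ω' (j + 1) :=
      funext fun t => funext fun n => hr (j + 1) le_rfl t n
    rw [this]

/-- With probability at least `1 - δ` the output of the algorithm has small excess error. -/
theorem law_excess_le (hreg : Regular d P D w) (hj : ∀ j, GoodStage P S D w j)
    (hh : GoodHoldout P S D w) {ε : ℝ} (hε : 0 < ε) (hε1 : ε < 1) :
    law S D {ω | ε < err (algorithm P S ε ω).1 D - err w D} ≤ ENNReal.ofReal P.δ := by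
  have hδ := hreg.hδ
  have h1 := law_chain_le hreg hj (V := fun j ω => (refineState P S ω j).1)
    (fun j => measurable_refineState P S hreg.hd j) (site := fun j t => .refine (j + 1) t)
    (fun j t t' h => by injection h) (fun j ω => refineState_succ P S ω j)
    (fun j ω ω' => by
      apply refineState_congr
      · exact funext fun i => mix_of_notMem _ _ (Set.notMem_empty _)
      · exact fun i k t n => mix_of_notMem _ _ (by simp)
      · exact fun n => mix_of_notMem _ _ (by simp)
      · refine fun k hk t n => mix_of_notMem _ _ ?_
        rintro ⟨t', h⟩
        injection h with h2
        omega) (kEps P ε)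
  have h2 : law S D {ω | ¬ ‖(refineState P S ω 0).1 - w‖ ≤ prox 0} ≤ ENNReal.ofReal (P.δ / 2) := by
    rw [prox_zero]; exact law_initProc_le hreg hj hh
  refine le_trans (measure_mono ?_) (h1.trans ((add_le_add_left h2 _).trans ?_))
  · intro ω hω hcon
    have h3 := err_sub_err_le_of_close hreg (c := 12) (q := 32) (by norm_num) hε hε1.le
      (by norm_num) hcon
    have he := Real.exp_one_lt_d9
    have h4 : (2 * Real.exp 1 / 12 + 4 / 32) * ε ≤ 1 * ε := by gcongr; linarith
    rw [Set.mem_ofPred_eq, algorithm] at hω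
    linarith
  · have h3 := prox_pos (kEps P ε)
    have h4 := prox_le (kEps P ε)
    rw [← ENNReal.ofReal_add (by positivity) (mul_nonneg hδ.le (by linarith))]
    apply ENNReal.ofReal_le_ofReal
    nlinarith

end holdout

/-! ### Choice of the parameters -/

section parameters

/-- The constants `Y` and `X` of the schedule occur logarithmically in the lower bounds that they
must satisfy; a power eventually dominates. -/
lemma exists_log_le_rpow (A B Y₀ : ℝ) {θ : ℝ} (hθ : 0 < θ) :
    ∃ Y, Y₀ ≤ Y ∧ A + B * Real.log Y ≤ Y ^ θ := by
  have h1 := (isLittleO_log_rpow_atTop hθ).const_mul_left B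
  have h2 := h1.bound (c := 1 / 2) (by norm_num)
  have h3 := (tendsto_rpow_atTop hθ).eventually_ge_atTop (2 * A)
  obtain ⟨Y, hY2, hY3, hY0, hY1⟩ := (h2.and (h3.and
    ((Filter.eventually_ge_atTop Y₀).and (Filter.eventually_ge_atTop 0)))).exists
  refine ⟨Y, hY0, ?_⟩
  have h4 := (le_abs_self _).trans hY2
  rw [Real.norm_of_nonneg (Real.rpow_nonneg hY1 θ)] at h4
  linarith

variable {d : ℕ} {P : Param} {r g ζ c₀ Cg Y X Λ : ℝ} {n : ℕ}

/-- The bandwidth. -/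
def bandwidth (n : ℕ) (Y Λ g r : ℝ) : ℝ := 1 / (Y * Λ ^ n) * g * r

/-- The number of iterations. -/
def rounds (d s n : ℕ) (X Λ g : ℝ) : ℕ := ⌈X ^ 2 * (s * Real.log d) * Λ ^ (2 * n + 6) / g ^ 2⌉₊

/-- The bound on the density of the bands. -/
def densityConst (P : Param) (n : ℕ) (Cg Y : ℝ) : ℝ :=
  4 * P.U * P.β * (2 + Real.log Y + n + Cg) + 1

/-- The bound on the logarithm in the step size. -/
def logConst (P : Param) (n : ℕ) (Cg Y X : ℝ) : ℝ :=
  2 * Real.log X + (12 + 3 * n + 3 * Cg + Real.log Y + |Real.log (P.R * P.L)|)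

/-- The conditions on the constants of the schedule. -/
structure Suitable (P : Param) (n : ℕ) (ζ c₀ Cg Y X : ℝ) : Prop where
  Y_ge_one : 1 ≤ Y
  Y_ge : P.L * P.R ≤ Y
  Y_ge' : 80 / P.R ≤ Y
  Y_large : 960 * densityConst P n Cg Y ≤ c₀ * (P.L * P.R / 2) * P.R * Y ^ (1 - ζ)
  X_ge : 2 ≤ X
  X_large : (188 * P.β + 6 * P.R) * logConst P n Cg Y X * 320 * densityConst P n Cg Y * Y ≤
    3 * c₀ * (P.L * P.R / 2) * P.R * X

/-- `Y` is chosen first, because its constraint does not involve `X`; it needs `1 - ζ > 0`. Then `X`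
is chosen for this `Y`. -/
lemma exists_suitable (hL : 0 < P.L) (hR : 0 < P.R) (hc₀ : 0 < c₀) (hζ : ζ < 1) (n : ℕ) (Cg : ℝ) :
    ∃ Y X, Suitable P n ζ c₀ Cg Y X := by
  have hc : 0 < c₀ * (P.L * P.R / 2) * P.R := by positivity
  obtain ⟨Y, hY0, hY⟩ := exists_log_le_rpow
    (960 * (4 * P.U * P.β * (2 + n + Cg) + 1) / (c₀ * (P.L * P.R / 2) * P.R))
    (960 * (4 * P.U * P.β) / (c₀ * (P.L * P.R / 2) * P.R)) (max 1 (max (P.L * P.R) (80 / P.R)))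
    (sub_pos.2 hζ)
  set K := (188 * P.β + 6 * P.R) * 320 * densityConst P n Cg Y * Y
  have hc' : 0 < 3 * c₀ * (P.L * P.R / 2) * P.R := by positivity
  obtain ⟨X, hX0, hX⟩ := exists_log_le_rpow
    (K * (12 + 3 * n + 3 * Cg + Real.log Y + |Real.log (P.R * P.L)|) /
      (3 * c₀ * (P.L * P.R / 2) * P.R)) (K * 2 / (3 * c₀ * (P.L * P.R / 2) * P.R)) 2 one_pos
  refine ⟨Y, X, (le_max_left _ _).trans hY0, ?_, ?_, ?_, hX0, ?_⟩
  · exact ((le_max_left _ _).trans (le_max_right _ _)).trans hY0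
  · exact ((le_max_right _ _).trans (le_max_right _ _)).trans hY0
  · rw [← div_le_iff₀' hc]
    refine le_trans (le_of_eq ?_) hY
    rw [densityConst]; field_simp; ring
  · rw [Real.rpow_one] at hX
    rw [← div_le_iff₀' hc']
    refine le_trans (le_of_eq ?_) hX
    rw [logConst]
    simp only [K]
    field_simp; ring

/-- The scalars of one stage: `r` is the proximity, `g` the noise factor and `Λ` the logarithm. -/
structure StageData (d : ℕ) (P : Param) (Cg r g Λ : ℝ) : Prop where
  hd : 8 ≤ d
  hs1 : 1 ≤ P.s
  hs : P.s ≤ d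
  hL : 0 < P.L
  hR : 0 < P.R
  hU : 0 < P.U
  hβ : 0 < P.β
  hδ : 0 < P.δ
  hδ1 : P.δ < 1 / 10
  hr : 0 < r
  hr1 : r ≤ 1 / 4
  hg : 0 < g
  hg1 : g ≤ 1
  hΛ : 1 ≤ Λ
  hΛd : Real.log d ≤ Λ
  hΛr : Real.log (1 / (P.δ * r)) ≤ Λ
  hΛg : Real.log (1 / g) ≤ Cg * Λ

namespace StageData
variable (h : StageData d P Cg r g Λ)
include h

lemma δr_le : P.δ * r ≤ 1 / 40 := by
  have := h.hδ; have := h.hδ1; have := h.hr; have := h.hr1; nlinarith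

lemma log_r_le : Real.log (1 / r) ≤ Λ := by
  have := h.hδ; have := h.hδ1; have := h.hr
  refine le_trans ?_ h.hΛr
  apply Real.log_le_log (by positivity)
  apply one_div_le_one_div_of_le (by positivity)
  nlinarith

lemma Λ_pos : 0 < Λ := lt_of_lt_of_le one_pos h.hΛ

lemma bandwidth_pos (hY : 1 ≤ Y) : 0 < bandwidth n Y Λ g r := by
  have := h.Λ_pos; have := h.hg; have := h.hr
  unfold bandwidth
  positivity

lemma tau_le (hY : 1 ≤ Y) : 1 / (Y * Λ ^ n) ≤ 1 / Y := by
  apply one_div_le_one_div_of_le (by linarith)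
  exact le_mul_of_one_le_right (by linarith) (one_le_pow₀ h.hΛ)

lemma bandwidth_le (hY : 1 ≤ Y) : bandwidth n Y Λ g r ≤ r / Y := by
  have := h.hg
  have hY0 : 0 < Y := by linarith
  unfold bandwidth
  calc 1 / (Y * Λ ^ n) * g * r ≤ 1 / Y * 1 * r :=
        mul_le_mul_of_nonneg_right
          (mul_le_mul (h.tau_le hY) h.hg1 this.le (by positivity)) h.hr.le
    _ = r / Y := by ring

lemma log_bandwidth_le (hY : 1 ≤ Y) :
    0 ≤ Real.log (1 / bandwidth n Y Λ g r) ∧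
    Real.log (1 / bandwidth n Y Λ g r) ≤ (Real.log Y + n + Cg + 1) * Λ := by
  have hΛ0 := h.Λ_pos; have hg := h.hg; have hr := h.hr; have hr1 := h.hr1
  have hY0 : 0 < Y := by linarith
  constructor
  · apply Real.log_nonneg
    rw [le_div_iff₀ (h.bandwidth_pos hY), one_mul]
    refine (h.bandwidth_le hY).trans ?_
    rw [div_le_one hY0]
    linarith
  · have e : 1 / bandwidth n Y Λ g r = Y * Λ ^ n * (1 / g) * (1 / r) := by
      unfold bandwidth; field_simp
    rw [e, Real.log_mul (by positivity) (by positivity), Real.log_mul (by positivity)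
      (by positivity), Real.log_mul (by positivity) (by positivity), Real.log_pow]
    have h1 := h.hΛg
    have h2 := h.log_r_le
    have h3 : Real.log Λ ≤ Λ := (Real.log_le_sub_one_of_pos hΛ0).trans (by linarith)
    have h4 : (n : ℝ) * Real.log Λ ≤ n * Λ := by gcongr
    have h5 : Real.log Y ≤ Real.log Y * Λ := le_mul_of_one_le_right (Real.log_nonneg hY) h.hΛ
    linarith

lemma two_le_slog : 2 ≤ P.s * Real.log d := by
  have h1 := two_lt_log h.hd
  have h2 : (1 : ℝ) ≤ P.s := by exact_mod_cast h.hs1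
  nlinarith

lemma rounds_bounds (hX : 2 ≤ X) :
    X ^ 2 * (P.s * Real.log d) * Λ ^ (2 * n + 6) / g ^ 2 ≤ rounds d P.s n X Λ g ∧
    (rounds d P.s n X Λ g : ℝ) ≤ 2 * (X ^ 2 * (P.s * Real.log d) * Λ ^ (2 * n + 6) / g ^ 2) := by
  have hg := h.hg
  have h1 : 1 ≤ X ^ 2 * (P.s * Real.log d) * Λ ^ (2 * n + 6) / g ^ 2 := by
    rw [le_div_iff₀ (by positivity), one_mul]
    have h2 : g ^ 2 ≤ 1 := pow_le_one₀ hg.le h.hg1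
    have h3 : 1 ≤ Λ ^ (2 * n + 6) := one_le_pow₀ h.hΛ
    have h4 := h.two_le_slog
    have h5 : 1 ≤ X ^ 2 := one_le_pow₀ (by linarith)
    refine h2.trans (one_le_mul_of_one_le_of_one_le (one_le_mul_of_one_le_of_one_le h5 ?_) h3)
    linarith
  have h2 := (Nat.ceil_lt_add_one (zero_le_one.trans h1)).le
  exact ⟨Nat.le_ceil _, h2.trans (by linarith)⟩

lemma rounds_pos (hX : 2 ≤ X) : (1 : ℝ) ≤ rounds d P.s n X Λ g := by
  have hg := h.hg; have hΛ := h.Λ_pos; have h4 := h.two_le_slog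
  have h1 : 0 < X ^ 2 * (P.s * Real.log d) * Λ ^ (2 * n + 6) / g ^ 2 := by positivity
  exact_mod_cast Nat.ceil_pos.2 h1

lemma log_rounds_le (hX : 2 ≤ X) :
    Real.log (rounds d P.s n X Λ g) ≤ (2 * Real.log X + 9 + 2 * n + 2 * Cg) * Λ := by
  have hΛ0 := h.Λ_pos; have hg := h.hg; have h4 := h.two_le_slog
  have hd := two_lt_log h.hd
  have hs : (1 : ℝ) ≤ P.s := by exact_mod_cast h.hs1
  have e : 2 * (X ^ 2 * (P.s * Real.log d) * Λ ^ (2 * n + 6) / g ^ 2) =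
      2 * X ^ 2 * P.s * Real.log d * Λ ^ (2 * n + 6) * (1 / g) ^ 2 := by field_simp
  refine (Real.log_le_log (by linarith [h.rounds_pos (n := n) hX]) (h.rounds_bounds hX).2).trans ?_
  rw [e, Real.log_mul (by positivity) (by positivity), Real.log_mul (by positivity)
    (by positivity), Real.log_mul (by positivity) (by positivity), Real.log_mul (by positivity)
    (by positivity), Real.log_mul (by positivity) (by positivity), Real.log_pow, Real.log_pow,
    Real.log_pow]
  have h1 : Real.log P.s ≤ Λ := (Real.log_le_log (by positivity) (by exact_mod_cast h.hs)).trans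
    h.hΛd
  have h2 : Real.log (Real.log d) ≤ Λ :=
    ((Real.log_le_sub_one_of_pos (by linarith)).trans (by linarith)).trans h.hΛd
  have h3 : Real.log Λ ≤ Λ := (Real.log_le_sub_one_of_pos hΛ0).trans (by linarith)
  have h5 : ((2 * n + 6 : ℕ) : ℝ) * Real.log Λ ≤ (2 * n + 6 : ℕ) * Λ := by gcongr
  have h6 : Real.log X ≤ Real.log X * Λ :=
    le_mul_of_one_le_right (Real.log_nonneg (by linarith)) h.hΛ
  have h7 := h.hΛg
  have h8 : Real.log 2 ≤ 1 := (Real.log_le_sub_one_of_pos (by norm_num)).trans (by norm_num)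
  have h9 := h.hΛ
  push_cast at h5 ⊢
  linarith

/-- The lower bound makes the step size positive and lets constants such as the `3` in `l = D + 3`
be absorbed by `D`; the upper bound compares `D` with `Λ`. -/
lemma logConst_bounds (hY : 1 ≤ Y) (hY' : P.L * P.R ≤ Y) (hX : 2 ≤ X) :
    1 ≤ Real.log (rounds d P.s n X Λ g * d / (P.δ * r * bandwidth n Y Λ g r * P.R * P.L)) ∧
    Real.log (rounds d P.s n X Λ g * d / (P.δ * r * bandwidth n Y Λ g r * P.R * P.L)) ≤
      logConst P n Cg Y X * Λ := by
  have hΛ0 := h.Λ_pos; have hg := h.hg; have hr := h.hr; have hδ := h.hδ; have hL := h.hL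
  have hR := h.hR
  have hT := h.rounds_pos (n := n) hX
  have hb := h.bandwidth_pos (n := n) hY
  have hd : (8 : ℝ) ≤ d := by exact_mod_cast h.hd
  set b := bandwidth n Y Λ g r
  set T : ℝ := ((rounds d P.s n X Λ g : ℕ) : ℝ)
  constructor
  · rw [Real.le_log_iff_exp_le (by positivity), le_div_iff₀ (by positivity)]
    have h1 : b * P.R * P.L ≤ 1 := by
      have h2 := h.bandwidth_le (n := n) hY
      have hY0 : 0 < Y := by linarith
      calc b * P.R * P.L = b * (P.L * P.R) := by ring
        _ ≤ r / Y * Y := by gcongr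
        _ = r := by field_simp
        _ ≤ 1 := by linarith [h.hr1]
    have h3 := h.δr_le
    have h4 := Real.exp_one_lt_d9
    calc Real.exp 1 * (P.δ * r * b * P.R * P.L) = Real.exp 1 * (P.δ * r) * (b * P.R * P.L) := by
          ring
      _ ≤ 3 * (1 / 40) * 1 := by gcongr; linarith
      _ ≤ 1 * 8 := by norm_num
      _ ≤ T * d := by gcongr
  · have e : T * d / (P.δ * r * b * P.R * P.L) =
        T * d * (1 / (P.δ * r)) * (1 / b) * (P.R * P.L)⁻¹ := by field_simp
    rw [e, Real.log_mul (by positivity) (by positivity), Real.log_mul (by positivity)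
      (by positivity), Real.log_mul (by positivity) (by positivity), Real.log_mul (by positivity)
      (by positivity), Real.log_inv]
    have h1 := h.log_rounds_le (n := n) hX
    have h2 := (h.log_bandwidth_le (n := n) hY).2
    have h3 := h.hΛd
    have h4 := h.hΛr
    have h5 := neg_le_abs (Real.log (P.R * P.L))
    have h6 : |Real.log (P.R * P.L)| ≤ |Real.log (P.R * P.L)| * Λ :=
      le_mul_of_one_le_right (abs_nonneg _) h.hΛ
    unfold logConst
    linarith

lemma densityConst_pos (hY : 1 ≤ Y) (hCg : 0 ≤ Cg) : 0 < densityConst P n Cg Y := by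
  have := h.hU; have := h.hβ; have := Real.log_nonneg hY
  unfold densityConst
  positivity

/-- The cutoff `β(1 + ln(1/b))` makes the tail term exactly `b`, at the price of a logarithm in the
density constant. -/
lemma density_bound (hY : 1 ≤ Y) : ∃ M > 0,
    4 * P.U * bandwidth n Y Λ g r * M + Real.exp (1 - M / P.β) ≤
      bandwidth n Y Λ g r * (densityConst P n Cg Y * Λ) := by
  obtain ⟨h1, h2⟩ := h.log_bandwidth_le (n := n) hY
  have hb := h.bandwidth_pos (n := n) hY
  have hβ := h.hβ; have hU := h.hU; have hΛ := h.hΛ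
  set b := bandwidth n Y Λ g r
  refine ⟨P.β * (1 + Real.log (1 / b)), by positivity, ?_⟩
  have e : 1 - P.β * (1 + Real.log (1 / b)) / P.β = Real.log b := by
    rw [one_div, Real.log_inv]; field_simp; ring
  rw [e, Real.exp_log hb]
  have h3 : 1 + Real.log (1 / b) ≤ (2 + Real.log Y + n + Cg) * Λ := by linarith
  have h4 : 4 * P.U * P.β * (1 + Real.log (1 / b)) ≤
      4 * P.U * P.β * ((2 + Real.log Y + n + Cg) * Λ) := by gcongr
  unfold densityConst
  nlinarith

/-- With `l = D + 3` the exponential equals `e^{-2} δ r b R L / (T d)`. Everything cancels except `2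
e^{-2} (d + 1)/d · δr`, which is below `δr / 2`. -/
lemma tail_bound (hY : 1 ≤ Y) (hX : 2 ≤ X) :
    rounds d P.s n X Λ g * ((d + 1) * Real.exp (1 - (Real.log (rounds d P.s n X Λ g * d /
      (P.δ * r * bandwidth n Y Λ g r * P.R * P.L)) + 3)) /
      (P.L * P.R / 2 * bandwidth n Y Λ g r)) ≤ P.δ * r / 2 := by
  have hr := h.hr; have hδ := h.hδ; have hL := h.hL; have hR := h.hR
  have hT := h.rounds_pos (n := n) hX
  have hb := h.bandwidth_pos (n := n) hY
  have hd : (8 : ℝ) ≤ d := by exact_mod_cast h.hd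
  set b := bandwidth n Y Λ g r
  set T : ℝ := ((rounds d P.s n X Λ g : ℕ) : ℝ)
  have hT0 : 0 < T := by linarith
  have hd0 : (0 : ℝ) < d := by linarith
  have e : 1 - (Real.log (T * d / (P.δ * r * b * P.R * P.L)) + 3) =
      -2 + -Real.log (T * d / (P.δ * r * b * P.R * P.L)) := by ring
  rw [e, Real.exp_add, Real.exp_neg (Real.log _), Real.exp_log (by positivity)]
  have h1 : Real.exp (-2) ≤ 1 / 6 := by
    rw [Real.exp_neg, inv_eq_one_div]
    apply one_div_le_one_div_of_le (by norm_num)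
    have h2 : Real.exp 2 = Real.exp 1 * Real.exp 1 := by rw [← Real.exp_add]; norm_num
    have := Real.exp_one_gt_d9
    nlinarith
  have e2 : T * ((d + 1) * (Real.exp (-2) * (T * d / (P.δ * r * b * P.R * P.L))⁻¹) /
      (P.L * P.R / 2 * b)) = Real.exp (-2) * (2 * (P.δ * r) * ((d + 1) / d)) := by
    field_simp
  rw [e2]
  have h3 : ((d : ℝ) + 1) / d ≤ 9 / 8 := by rw [div_le_iff₀ hd0]; linarith
  calc _ ≤ 1 / 6 * (2 * (P.δ * r) * (9 / 8)) := by gcongr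
    _ ≤ _ := by nlinarith [mul_pos hδ hr]

lemma step_term_bound (hX : 2 ≤ X) :
    √(P.s * Real.log d / (rounds d P.s n X Λ g : ℕ)) ≤ g / (X * Λ ^ (n + 3)) := by
  have hg := h.hg; have hΛ := h.Λ_pos; have h4 := h.two_le_slog
  have hT := (h.rounds_bounds (n := n) hX).1
  have hT1 := h.rounds_pos (n := n) hX
  apply Real.sqrt_le_iff.2 ⟨by positivity, ?_⟩
  rw [div_le_iff₀ (by linarith)]
  calc (P.s * Real.log d : ℝ) = (g / (X * Λ ^ (n + 3))) ^ 2 *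
        (X ^ 2 * (P.s * Real.log d) * Λ ^ (2 * n + 6) / g ^ 2) := by
        rw [show 2 * n + 6 = (n + 3) * 2 by ring, pow_mul]; field_simp
    _ ≤ _ := by gcongr

lemma log_two_le : Real.log (2 / (P.δ * r)) ≤ 2 * Λ := by
  have := h.hδ; have := h.hr; have := h.hΛ; have := h.hΛr
  rw [show 2 / (P.δ * r) = 2 * (1 / (P.δ * r)) by ring, Real.log_mul (by norm_num) (by positivity)]
  have h8 : Real.log 2 ≤ 1 := (Real.log_le_sub_one_of_pos (by norm_num)).trans (by norm_num)
  linarith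

/-- Compared with `step_term_bound` one power of `Λ` is given up, to dominate `ln(2/(δr)) ≤ 2Λ` by
`s ln d · Λ²`. -/
lemma noise_term_bound (hX : 2 ≤ X) :
    √(Real.log (2 / (P.δ * r)) / (rounds d P.s n X Λ g : ℕ)) ≤ g / (X * Λ ^ (n + 2)) := by
  have hg := h.hg; have hΛ := h.Λ_pos; have h4 := h.two_le_slog
  have hT := (h.rounds_bounds (n := n) hX).1
  have hT1 := h.rounds_pos (n := n) hX
  apply Real.sqrt_le_iff.2 ⟨by positivity, ?_⟩
  rw [div_le_iff₀ (by linarith)]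
  have e : (g / (X * Λ ^ (n + 2))) ^ 2 *
      (X ^ 2 * (P.s * Real.log d) * Λ ^ (2 * n + 6) / g ^ 2) = (P.s * Real.log d) * Λ ^ 2 := by
    rw [show 2 * n + 6 = (n + 2) * 2 + 2 by ring, pow_add Λ ((n + 2) * 2),
      pow_mul Λ (n + 2)]; field_simp
  calc Real.log (2 / (P.δ * r)) ≤ 2 * Λ := h.log_two_le
    _ ≤ (P.s * Real.log d) * Λ ^ 2 := by
        have h5 : Λ ≤ Λ ^ 2 := le_self_pow₀ h.hΛ (by norm_num)
        gcongr
    _ = _ := e.symm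
    _ ≤ _ := by gcongr

lemma tau_rpow_ge (hY : 1 ≤ Y) (hζ : ζ < 1) :
    1 / (Y * Λ ^ n) ≤ (1 / (Y * Λ ^ n)) ^ ζ := by
  have hΛ := h.Λ_pos
  have h1 := Real.rpow_le_rpow_of_exponent_ge (x := 1 / (Y * Λ ^ n)) (by positivity)
    ((h.tau_le hY).trans ((div_le_one (by linarith)).2 hY)) hζ.le
  rwa [Real.rpow_one] at h1

/-- `τ^ζ = τ · τ^{-(1-ζ)}`, and `n (1 - ζ) ≥ 1` makes the second factor at least `Y^{1-ζ} Λ`: the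
power of `Λ` offsets the logarithm in the density, and `Y` the constants. -/
lemma tau_rpow_le (hY : 1 ≤ Y) (hn : 1 ≤ n * (1 - ζ)) :
    1 / (Y * Λ ^ n) * (Y ^ (1 - ζ) * Λ) ≤ (1 / (Y * Λ ^ n)) ^ ζ := by
  have hΛ := h.Λ_pos
  have hY0 : 0 < Y := by linarith
  have hτ : 0 < 1 / (Y * Λ ^ n) := by positivity
  have h1 : Y ^ (1 - ζ) * Λ ≤ (Y * Λ ^ n) ^ (1 - ζ) := by
    rw [Real.mul_rpow hY0.le (by positivity), ← Real.rpow_natCast, ← Real.rpow_mul hΛ.le]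
    gcongr
    calc Λ = Λ ^ (1 : ℝ) := (Real.rpow_one Λ).symm
      _ ≤ _ := Real.rpow_le_rpow_of_exponent_le h.hΛ hn
  have h2 : (1 / (Y * Λ ^ n)) ^ ζ = 1 / (Y * Λ ^ n) * (Y * Λ ^ n) ^ (1 - ζ) := by
    rw [one_div, Real.inv_rpow (by positivity), ← Real.rpow_neg (by positivity),
      ← Real.rpow_neg_one, ← Real.rpow_add (by positivity)]
    congr 1; ring
  rw [h2]
  gcongr

/-- A quarter of the right-hand side pays for `3b`, using `Y`; the rest pays for regret and
deviation, using `X`. The coefficient `188 β + 6R` collects `64β` and `60β` from the two regret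
terms and `64β + 6R` from the deviation. -/
lemma drift_bound (hc₀ : 0 < c₀) (hCg : 0 ≤ Cg) (hζ : ζ < 1) (hn : 1 ≤ n * (1 - ζ))
    (hsuit : Suitable P n ζ c₀ Cg Y X) {D : ℝ}
    (hD : D = Real.log (rounds d P.s n X Λ g * d / (P.δ * r * bandwidth n Y Λ g r * P.R * P.L))) :
    3 * bandwidth n Y Λ g r + 64 * r ^ 2 * (P.s * Real.log d) /
        (stepSize d P r (bandwidth n Y Λ g r) (rounds d P.s n X Λ g) * (rounds d P.s n X Λ g : ℕ)) +
      stepSize d P r (bandwidth n Y Λ g r) (rounds d P.s n X Λ g) * Real.exp 1 ^ 2 *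
        (P.β * (D + 3)) ^ 2 / 2 +
      2 * (8 * r * (P.β * (D + 3)) + 3 * bandwidth n Y Λ g r + 2 * r * P.R) *
        √(Real.log (2 / (P.δ * r)) / (rounds d P.s n X Λ g : ℕ)) ≤
    c₀ * (1 / (Y * Λ ^ n)) ^ ζ * g * (P.L * P.R / 2) * P.R /
      (4 * (densityConst P n Cg Y * Λ)) * (r / 20) := by
  obtain ⟨hY, hY1, hY2, hYl, hX, hXl⟩ := hsuit
  have hr := h.hr; have hδ := h.hδ; have hL := h.hL; have hR := h.hR; have hβ := h.hβ
  have hg := h.hg; have hΛ := h.Λ_pos; have h4 := h.two_le_slog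
  have hT := h.rounds_pos (n := n) hX
  have hb := h.bandwidth_pos (n := n) hY
  have hS1 := h.step_term_bound (n := n) hX
  have hS2 := h.noise_term_bound (n := n) hX
  have hCQ := h.densityConst_pos hY hCg (n := n)
  obtain ⟨hD1, hD2⟩ := h.logConst_bounds (n := n) hY hY1 hX
  rw [← hD] at hD1 hD2
  have hstep : stepSize d P r (bandwidth n Y Λ g r) (rounds d P.s n X Λ g) =
      r / P.β * √(P.s * Real.log d / (rounds d P.s n X Λ g : ℕ)) / D := by rw [hD]; rfl
  have hbR : bandwidth n Y Λ g r ≤ r * P.R / 80 := by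
    refine (h.bandwidth_le (n := n) hY).trans ?_
    have hY0 : 0 < Y := by linarith
    rw [div_le_iff₀ hY0]
    rw [div_le_iff₀ hR] at hY2
    nlinarith
  have hterm1 : 3 * bandwidth n Y Λ g r ≤ 1 / 4 * (c₀ * (1 / (Y * Λ ^ n)) ^ ζ * g *
      (P.L * P.R / 2) * P.R / (4 * (densityConst P n Cg Y * Λ)) * (r / 20)) := by
    have h1 := h.tau_rpow_le (n := n) hY hn
    set τ := 1 / (Y * Λ ^ n) with hτ
    have hτ0 : 0 < τ := by positivity
    have e : 1 / 4 * (c₀ * τ ^ ζ * g * (P.L * P.R / 2) * P.R / (4 * (densityConst P n Cg Y * Λ)) *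
        (r / 20)) = (c₀ * (P.L * P.R / 2) * P.R) * τ ^ ζ * (g * r) /
          (320 * densityConst P n Cg Y * Λ) := by field_simp; ring
    rw [e, le_div_iff₀ (by positivity)]
    calc 3 * bandwidth n Y Λ g r * (320 * densityConst P n Cg Y * Λ)
        = 960 * densityConst P n Cg Y * (τ * Λ * (g * r)) := by unfold bandwidth; ring
      _ ≤ c₀ * (P.L * P.R / 2) * P.R * Y ^ (1 - ζ) * (τ * Λ * (g * r)) := by gcongr
      _ = c₀ * (P.L * P.R / 2) * P.R * (τ * (Y ^ (1 - ζ) * Λ)) * (g * r) := by ring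
      _ ≤ _ := by gcongr
  have hrest : (188 * P.β + 6 * P.R) * logConst P n Cg Y X * (r * g / (X * Λ ^ (n + 1))) ≤
      3 / 4 * (c₀ * (1 / (Y * Λ ^ n)) ^ ζ * g *
      (P.L * P.R / 2) * P.R / (4 * (densityConst P n Cg Y * Λ)) * (r / 20)) := by
    have h1 := h.tau_rpow_ge (n := n) hY hζ
    have hY0 : 0 < Y := by linarith
    calc (188 * P.β + 6 * P.R) * logConst P n Cg Y X * (r * g / (X * Λ ^ (n + 1)))
        = (188 * P.β + 6 * P.R) * logConst P n Cg Y X * 320 * densityConst P n Cg Y * Y *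
          (r * g / (320 * densityConst P n Cg Y * Y * X * Λ ^ (n + 1))) := by field_simp
      _ ≤ 3 * c₀ * (P.L * P.R / 2) * P.R * X *
          (r * g / (320 * densityConst P n Cg Y * Y * X * Λ ^ (n + 1))) := by gcongr
      _ = 3 / 4 * (c₀ * (1 / (Y * Λ ^ n)) * g *
        (P.L * P.R / 2) * P.R / (4 * (densityConst P n Cg Y * Λ)) * (r / 20)) := by
          rw [pow_succ]; field_simp; ring
      _ ≤ _ := by gcongr
  rw [hstep]
  set S1 := √(P.s * Real.log d / (rounds d P.s n X Λ g : ℕ)) with hS1def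
  set S2 := √(Real.log (2 / (P.δ * r)) / (rounds d P.s n X Λ g : ℕ))
  have hsl : 0 < P.s * Real.log d := by linarith
  set T : ℝ := ((rounds d P.s n X Λ g : ℕ) : ℝ)
  have hT0 : 0 < T := by linarith
  have hS1pos : 0 < S1 := Real.sqrt_pos.2 (by positivity)
  have hS1sq : S1 ^ 2 * T = P.s * Real.log d := by
    rw [hS1def, Real.sq_sqrt (by positivity)]; field_simp
  have hD0 : 0 < D := by linarith
  have hterm2 : 64 * r ^ 2 * (P.s * Real.log d) / (r / P.β * S1 / D * T) = 64 * P.β * (r * S1 * D) := by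
    rw [← hS1sq]; field_simp
  have he : Real.exp 1 ^ 2 ≤ 15 / 2 := by
    have := Real.exp_one_lt_d9; have := Real.exp_pos 1; nlinarith
  have hterm3 : r / P.β * S1 / D * Real.exp 1 ^ 2 * (P.β * (D + 3)) ^ 2 / 2 ≤
      60 * P.β * (r * S1 * D) := by
    calc r / P.β * S1 / D * Real.exp 1 ^ 2 * (P.β * (D + 3)) ^ 2 / 2
        ≤ r / P.β * S1 / D * (15 / 2) * (P.β * (4 * D)) ^ 2 / 2 := by gcongr; linarith
      _ = _ := by field_simp; norm_num
  have hterm4 : 2 * (8 * r * (P.β * (D + 3)) + 3 * bandwidth n Y Λ g r + 2 * r * P.R) * S2 ≤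
      (64 * P.β + 6 * P.R) * (r * D * S2) := by
    have h1 : 8 * r * (P.β * (D + 3)) + 3 * bandwidth n Y Λ g r + 2 * r * P.R ≤
        8 * r * (P.β * (4 * D)) + 3 * (r * P.R * D) := by
      have h2 : 8 * r * (P.β * (D + 3)) ≤ 8 * r * (P.β * (4 * D)) := by gcongr; linarith
      have h3 : r * P.R ≤ r * P.R * D := le_mul_of_one_le_right (by positivity) hD1
      have : 0 < r * P.R := by positivity
      linarith
    calc _ ≤ 2 * (8 * r * (P.β * (4 * D)) + 3 * (r * P.R * D)) * S2 := by gcongr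
      _ = _ := by ring
  have hCD : 0 ≤ logConst P n Cg Y X := by
    by_contra! hneg
    have := mul_neg_of_neg_of_pos hneg hΛ
    linarith
  have hB1 : r * S1 * D ≤ logConst P n Cg Y X * (r * g / (X * Λ ^ (n + 1))) := by
    calc r * S1 * D ≤ r * (g / (X * Λ ^ (n + 3))) * (logConst P n Cg Y X * Λ) := by gcongr
      _ = logConst P n Cg Y X * (r * g / (X * Λ ^ (n + 2))) := by
          rw [pow_succ Λ (n + 2)]; field_simp
      _ ≤ _ := by
          have : Λ ^ (n + 1) ≤ Λ ^ (n + 2) := pow_le_pow_right₀ h.hΛ (by omega)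
          gcongr
  have hB2 : r * D * S2 ≤ logConst P n Cg Y X * (r * g / (X * Λ ^ (n + 1))) := by
    calc r * D * S2 ≤ r * (logConst P n Cg Y X * Λ) * (g / (X * Λ ^ (n + 2))) := by gcongr
      _ = logConst P n Cg Y X * (r * g / (X * Λ ^ (n + 1))) := by
          rw [pow_succ Λ (n + 1)]; field_simp
  rw [hterm2]
  set Z := logConst P n Cg Y X * (r * g / (X * Λ ^ (n + 1)))
  have hB1' : P.β * (r * S1 * D) ≤ P.β * Z := by gcongr
  have hB2' : (64 * P.β + 6 * P.R) * (r * D * S2) ≤ (64 * P.β + 6 * P.R) * Z := by gcongr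
  have hrest' : (188 * P.β + 6 * P.R) * Z ≤ _ := (mul_assoc _ _ _).symm.trans_le hrest
  linarith

/-- The chosen parameters satisfy the requirements of the analysis of `optimize`. -/
theorem admissible (hc₀ : 0 < c₀) (hCg : 0 ≤ Cg) (hζ : ζ < 1) (hn : 1 ≤ n * (1 - ζ))
    (hsuit : Suitable P n ζ c₀ Cg Y X) :
    ∃ l Q, Admissible d P r (bandwidth n Y Λ g r) (rounds d P.s n X Λ g)
      (c₀ * (1 / (Y * Λ ^ n)) ^ ζ * g) l Q := by
  have hY := hsuit.Y_ge_one
  have hX := hsuit.X_ge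
  have hr := h.hr; have hδ := h.hδ; have hL := h.hL; have hR := h.hR; have hβ := h.hβ
  have hg := h.hg; have hΛ := h.Λ_pos; have h4 := h.two_le_slog
  have hT := h.rounds_pos (n := n) hX
  have hD := h.logConst_bounds (n := n) hY hsuit.Y_ge hX
  have hY0 : 0 < Y := by linarith
  -- The tail parameter left implicit is `D + 3`, with `D` the logarithm in the step size;
  -- `drift_bound` fixes it by unification.
  refine ⟨_, densityConst P n Cg Y * Λ, hr, h.hr1, h.bandwidth_pos hY, ?_, by positivity, ?_,
    mul_pos (h.densityConst_pos hY hCg) hΛ, by exact_mod_cast hT, ?_, h.density_bound hY,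
    h.tail_bound hY hX, ?_, h.drift_bound hc₀ hCg hζ hn hsuit rfl⟩
  · refine (h.bandwidth_le (n := n) hY).trans ?_
    have hY2 := hsuit.Y_ge'
    rw [div_le_iff₀ hY0]
    rw [div_le_iff₀ hR] at hY2
    nlinarith
  · linarith [hD.1]
  · unfold stepSize
    have : 0 < P.s * Real.log d := by linarith
    exact div_pos (mul_pos (by positivity) (Real.sqrt_pos.2 (by positivity))) (by linarith [hD.1])
  · refine h.log_two_le.trans (le_trans ?_ (h.rounds_bounds hX).1)
    rw [le_div_iff₀ (by positivity)]
    have h5 : Λ ≤ Λ ^ (2 * n + 6) := le_self_pow₀ h.hΛ (by omega)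
    have h6 : g ^ 2 ≤ 1 := pow_le_one₀ hg.le h.hg1
    calc 2 * Λ * g ^ 2 ≤ 1 * (2 * Λ) * 1 := by rw [one_mul]; gcongr
      _ ≤ X ^ 2 * (P.s * Real.log d) * Λ ^ (2 * n + 6) := by
        rw [mul_one, mul_assoc (X ^ 2)]
        have h7 : 1 ≤ X ^ 2 := one_le_pow₀ (by linarith)
        gcongr

end StageData

end parameters

/-! ### The number of label queries -/

section labels
variable {d : ℕ} {P : Param} {S : Schedule}

lemma trial_snd (ω : Outcome d S) (i j : ℕ) :
    (trial P S ω i j).2 = ∑ k ∈ Finset.range j, (S.T k : ℕ) := by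
  induction j with
  | zero => rfl
  | succ j ih =>
    rw [Finset.sum_range_succ, ← ih, ← optimize_snd P (trial P S ω i j).1 (1 / 4 ^ (j + 1)) (S.b j)
      (S.T j) (fun t n => ω.1 (.init i j t, n))
      (if j = 0 then .random (ω.2 i).1 (ω.2 i).2 else .average)]
    rfl

lemma refineState_snd (ω : Outcome d S) (j : ℕ) :
    (refineState P S ω j).2 = (initProc P S ω).2 + ∑ k ∈ Finset.range j, (S.T (k + 1) : ℕ) := by
  induction j with
  | zero => rfl
  | succ j ih =>
    rw [Finset.sum_range_succ, ← add_assoc, ← ih, ← optimize_snd P (refineState P S ω j).1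
      (1 / 4 ^ (j + 1 + 1)) (S.b (j + 1)) (S.T (j + 1)) (fun t n => ω.1 (.refine (j + 1) t, n))
      .average]
    rfl

/-- The main loop starts with the call of index `1`; adding the rounds of index `0` gives both sums
the same shape, at the cost of a slightly larger bound. -/
lemma algorithm_snd_le (ε : ℝ) (ω : Outcome d S) : (algorithm P S ε ω).2 ≤
    trials P * ∑ k ∈ Finset.range (k0 P S + 1), (S.T k : ℕ) + S.m +
      ∑ k ∈ Finset.range (kEps P ε + 1), (S.T k : ℕ) := by
  have h1 : (initProc P S ω).2 =
      ∑ i ∈ Finset.range (trials P), (trial P S ω i (k0 P S + 1)).2 + S.m := rfl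
  rw [algorithm, refineState_snd, h1, Finset.sum_range_succ' _ (kEps P ε)]
  simp only [trial_snd, Finset.sum_const, Finset.card_range, smul_eq_mul]
  omega

/-- The logarithmic factor. -/
def logFactor (δ H x : ℝ) : ℝ := Real.log (H / (δ * x))

/-- The constant in the bound on the inverse of the final proximity. -/
def proxConst (U β : ℝ) : ℝ := 4 + 36864 * U * β ^ 2

lemma four_le_proxConst {U β : ℝ} (hU : 0 < U) : 4 ≤ proxConst U β := by
  unfold proxConst
  have : 0 ≤ 36864 * U * β ^ 2 := by positivity
  linarith

/-- Rounding up gives `4^(k-1) < q U β² ln²(c/x) / x` when `k > 0`, and `16 · 64 · 6² = 36864`. The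
summand `4` in `proxConst` covers `k = 0`. -/
lemma inv_prox_le {U β c q x Λ : ℝ} (hU : 0 < U) (hβ : 0 < β) (hc : 1 < c) (hc' : c ≤ 24)
    (hq : 0 < q) (hq' : q ≤ 64) (hx : 0 < x) (hx1 : x ≤ 1) (hΛ : 1 ≤ Λ)
    (hxΛ : Real.log (1 / x) ≤ Λ) {j : ℕ}
    (hj : j ≤ ⌈Real.logb 4 (1 / (x / (q * U * β ^ 2 * Real.log (c / x) ^ 2)))⌉₊) :
    (4 : ℝ) ^ (j + 1) ≤ proxConst U β * Λ ^ 2 / x := by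
  set k := ⌈Real.logb 4 (1 / (x / (q * U * β ^ 2 * Real.log (c / x) ^ 2)))⌉₊ with hk
  have hW : 0 < Real.log (c / x) := Real.log_pos (by rw [lt_div_iff₀ hx]; linarith)
  have hW' : Real.log (c / x) ≤ 6 * Λ := by
    have h1 : Real.log c ≤ 5 := by
      calc Real.log c ≤ Real.log (2 ^ 5) := Real.log_le_log (by linarith) (by linarith)
        _ = 5 * Real.log 2 := by rw [Real.log_pow]; norm_num
        _ ≤ 5 := by have := Real.log_two_lt_d9; linarith
    rw [div_eq_mul_one_div, Real.log_mul (by positivity) (by positivity)]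
    linarith
  have hΛ2 : 1 ≤ Λ ^ 2 := one_le_pow₀ hΛ
  refine (pow_le_pow_right₀ (by norm_num) (by omega : j + 1 ≤ k + 1)).trans ?_
  rw [le_div_iff₀ hx]
  unfold proxConst
  rcases Nat.eq_zero_or_pos k with h0 | hpos
  · rw [h0, zero_add, pow_one]
    have : 0 ≤ 36864 * U * β ^ 2 * Λ ^ 2 := by positivity
    nlinarith
  · have h1 : 0 < Real.logb 4 (1 / (x / (q * U * β ^ 2 * Real.log (c / x) ^ 2))) :=
      Nat.ceil_pos.1 hpos
    have h2 := Nat.ceil_lt_add_one h1.le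
    rw [← hk, ← sub_lt_iff_lt_add, Real.lt_logb_iff_rpow_lt (by norm_num) (by positivity),
      Real.rpow_sub_one (by norm_num), Real.rpow_natCast, one_div_div, lt_div_iff₀ hx] at h2
    have h3 : q * U * β ^ 2 * Real.log (c / x) ^ 2 ≤ 64 * U * β ^ 2 * (6 * Λ) ^ 2 := by gcongr
    rw [pow_succ]
    nlinarith

/-- The relation between the two scales that occur in the label bounds. -/
lemma sum_rounds_le {U β c q x δ H Ct : ℝ} {s K e : ℕ} {T : ℕ → ℕ} {G : ℝ → ℝ} (hd : 8 ≤ d)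
    (hU : 0 < U) (hβ : 0 < β) (hc : 1 < c) (hc' : c ≤ 24) (hq : 0 < q) (hq' : q ≤ 64) (hx : 0 < x)
    (hx1 : x ≤ 1) (hδ : 0 < δ) (hH : 0 < H) (hCt : 0 ≤ Ct) (hΛ : 1 ≤ logFactor δ H x)
    (hxΛ : Real.log (1 / x) ≤ logFactor δ H x) (hdΛ : Real.log d ≤ logFactor δ H x)
    (hΛj : ∀ j, 1 ≤ logFactor δ H (prox j)) (hG0 : 0 ≤ G x)
    (hG : ∀ u v y : ℝ, 0 < u → 0 < v → u ≤ 1 → v ≤ 1 → 1 ≤ y → v ≤ y * u → G u ≤ y ^ e * G v)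
    (hT : ∀ j, (T j : ℝ) ≤ Ct * (s * Real.log d * G (prox j)) * logFactor δ H (prox j) ^ K) :
    ((∑ k ∈ Finset.range (⌈Real.logb 4 (1 / (x / (q * U * β ^ 2 * Real.log (c / x) ^ 2)))⌉₊ + 1),
      T k : ℕ) : ℝ) ≤ Ct * (Real.log (proxConst U β) + 3) ^ (K + 1) * proxConst U β ^ e *
        (s * G x) * logFactor δ H x ^ (K + 2 + 2 * e) := by
  set Λ := logFactor δ H x with hΛdef
  set k := ⌈Real.logb 4 (1 / (x / (q * U * β ^ 2 * Real.log (c / x) ^ 2)))⌉₊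
  set C2 := proxConst U β
  have hC2 : 4 ≤ C2 := four_le_proxConst hU
  have hlogC2 : 0 ≤ Real.log C2 := Real.log_nonneg (by linarith)
  have hinv : ∀ j ≤ k, (4 : ℝ) ^ (j + 1) ≤ C2 * Λ ^ 2 / x := fun j hj =>
    inv_prox_le hU hβ hc hc' hq hq' hx hx1 hΛ hxΛ hj
  have hlogΛ : Real.log Λ ≤ Λ := (Real.log_le_sub_one_of_pos (by linarith)).trans (by linarith)
  have hlog2 : Real.log d ≥ 0 := by have := two_lt_log hd; linarith
  have hC2Λ : Real.log C2 ≤ Real.log C2 * Λ := le_mul_of_one_le_right hlogC2 hΛ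
  -- The final proximity is polynomial in `x / Λ`, so the number of stages is `O(Λ)`. For the same
  -- reason the logarithms and the costs `G` of all stages are comparable with those at `x`, up to
  -- powers of `Λ`.
  have hcount : (k : ℝ) + 1 ≤ (Real.log C2 + 3) * Λ := by
    have h1 := Real.log_le_log (by positivity) (hinv k le_rfl)
    rw [Real.log_pow, mul_div_assoc, Real.log_mul (by positivity) (by positivity),
      div_eq_mul_one_div, Real.log_mul (by positivity) (by positivity), Real.log_pow] at h1
    have h2 : 1 ≤ Real.log 4 := by
      rw [show (4 : ℝ) = 2 ^ 2 by norm_num, Real.log_pow]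
      have := Real.log_two_gt_d9
      push_cast; linarith
    have h3 : ((k + 1 : ℕ) : ℝ) * 1 ≤ (k + 1 : ℕ) * Real.log 4 := by gcongr
    push_cast at h1 h3
    linarith
  have hlogj : ∀ j ≤ k, logFactor δ H (prox j) ≤ (Real.log C2 + 3) * Λ := by
    intro j hj
    have h1 : H / (δ * prox j) ≤ C2 * Λ ^ 2 * (H / (δ * x)) := by
      have e1 : H / (δ * prox j) = H / δ * 4 ^ (j + 1) := by unfold prox; field_simp
      have e2 : C2 * Λ ^ 2 * (H / (δ * x)) = H / δ * (C2 * Λ ^ 2 / x) := by field_simp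
      rw [e1, e2]
      gcongr
      exact hinv j hj
    have h2 := Real.log_le_log (by have := prox_pos j; positivity) h1
    rw [Real.log_mul (by positivity) (by positivity), Real.log_mul (by positivity) (by positivity),
      Real.log_pow] at h2
    change logFactor δ H (prox j) ≤ Real.log C2 + (2 : ℕ) * Real.log Λ + Λ at h2
    push_cast at h2
    linarith
  have hGj : ∀ j ≤ k, G (prox j) ≤ (C2 * Λ ^ 2) ^ e * G x := by
    intro j hj
    have hΛ2 : 1 ≤ Λ ^ 2 := one_le_pow₀ hΛ
    refine hG _ _ _ (prox_pos j) hx ((prox_le j).trans (by norm_num)) hx1 (by nlinarith) ?_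
    have h1 := hinv j hj
    rw [le_div_iff₀ hx] at h1
    unfold prox
    rw [mul_one_div, le_div_iff₀ (by positivity)]
    linarith
  have hterm : ∀ j ∈ Finset.range (k + 1), (T j : ℝ) ≤
      Ct * (s * Λ * ((C2 * Λ ^ 2) ^ e * G x)) * ((Real.log C2 + 3) * Λ) ^ K := by
    intro j hj
    have hj' : j ≤ k := by have := Finset.mem_range.1 hj; omega
    have h0 := hΛj j
    calc (T j : ℝ) ≤ Ct * (s * Real.log d * G (prox j)) * logFactor δ H (prox j) ^ K := hT j
      _ ≤ Ct * (s * Real.log d * ((C2 * Λ ^ 2) ^ e * G x)) * logFactor δ H (prox j) ^ K := by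
          gcongr
          exact hGj j hj'
      _ ≤ _ := by
          gcongr
          exact hlogj j hj'
  push_cast
  refine (Finset.sum_le_sum hterm).trans ?_
  rw [Finset.sum_const, Finset.card_range, nsmul_eq_mul]
  push_cast
  calc ((k : ℝ) + 1) * (Ct * (s * Λ * ((C2 * Λ ^ 2) ^ e * G x)) * ((Real.log C2 + 3) * Λ) ^ K)
      ≤ (Real.log C2 + 3) * Λ *
        (Ct * (s * Λ * ((C2 * Λ ^ 2) ^ e * G x)) * ((Real.log C2 + 3) * Λ) ^ K) := by gcongr
    _ = _ := by
        rw [mul_pow, mul_pow, ← pow_mul, pow_add Λ, pow_add Λ, pow_succ (Real.log C2 + 3)]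
        ring

end labels

/-! ### The guarantee for a general noise factor -/

section master
variable {d : ℕ}

/-- What the analysis uses about the noise: `g` is the noise factor at a given proximity. -/
structure NoiseInterface (P : Param) (c₀ ζ : ℝ) (g : ℝ → ℝ) (eps0 : ℝ) (D : Measure (Ex d))
    [IsProbabilityMeasure D] (w : Pt d) : Prop where
  nonneg : ∀ᵐ x ∂D.fst, noiseRate D w x ≤ 1 / 2
  margin : ∀ r τ, 0 < r → r ≤ 1 / 4 → 0 < τ → τ ≤ 1 →
    MarginBound D w (P.L * P.R / 2 * (τ * g r * r)) (r * P.R / 80) (c₀ * τ ^ ζ * g r)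
  holdout : ∃ γ, MarginBound D w (P.L * P.R ^ 2 / 80) (P.R / 20) γ ∧
    eps0 ≤ γ * (P.L * P.R ^ 2 / 80)

/-- The conditions on the noise factor `g`, its cost `G` and the initial target `eps0`. -/
structure Setup (d : ℕ) (P : Param) (Cg H eps0 : ℝ) (g : ℝ → ℝ) : Prop where
  hd : 8 ≤ d
  hs1 : 1 ≤ P.s
  hs : P.s ≤ d
  hL : 0 < P.L
  hR : 0 < P.R
  hU : 0 < P.U
  hβ : 0 < P.β
  hδ : 0 < P.δ
  hδ1 : P.δ < 1 / 10
  hH : d ≤ H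
  hg : ∀ r, 0 < r → r ≤ 1 / 4 → 0 < g r ∧ g r ≤ 1 ∧ Real.log (1 / g r) ≤ Cg * logFactor P.δ H r
  eps_pos : 0 < eps0
  eps_le : eps0 ≤ 1

variable {P : Param} {Cg H eps0 : ℝ} {g : ℝ → ℝ}

namespace Setup
variable (h : Setup d P Cg H eps0 g)
include h

lemma H_pos : 8 ≤ H := le_trans (by exact_mod_cast h.hd) h.hH

lemma log_le_logFactor {x : ℝ} (hx : 0 < x) (hx1 : x ≤ 1) : 4 ≤ logFactor P.δ H x ∧
    Real.log d ≤ logFactor P.δ H x ∧ Real.log (1 / (P.δ * x)) ≤ logFactor P.δ H x ∧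
    Real.log (1 / x) ≤ logFactor P.δ H x ∧ Real.log (1 / P.δ) ≤ logFactor P.δ H x := by
  have hH := h.H_pos; have hδ := h.hδ; have hδ1 := h.hδ1
  have hd : (8 : ℝ) ≤ d := by exact_mod_cast h.hd
  have hδx : P.δ * x ≤ 1 / 10 := by nlinarith
  have hδx0 : 0 < P.δ * x := by positivity
  unfold logFactor
  refine ⟨?_, ?_, ?_, ?_, ?_⟩
  · rw [Real.le_log_iff_exp_le (by positivity), le_div_iff₀ hδx0]
    have h1 : Real.exp 4 ≤ 80 := by
      have h2 : Real.exp 4 = Real.exp 1 ^ 4 := by rw [← Real.exp_nat_mul]; norm_num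
      have h3 := Real.exp_one_lt_d9
      have h4 := Real.exp_pos 1
      rw [h2]
      calc Real.exp 1 ^ 4 ≤ 2.8 ^ 4 := by gcongr; linarith
        _ ≤ 80 := by norm_num
    calc Real.exp 4 * (P.δ * x) ≤ 80 * (1 / 10) := by gcongr
      _ ≤ H := by linarith
  · apply Real.log_le_log (by linarith)
    rw [le_div_iff₀ hδx0]
    nlinarith [h.hH]
  · apply Real.log_le_log (by positivity)
    gcongr; linarith
  · apply Real.log_le_log (by positivity)
    rw [div_le_div_iff₀ hx hδx0]
    nlinarith
  · apply Real.log_le_log (by positivity)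
    rw [div_le_div_iff₀ hδ hδx0]
    nlinarith

lemma stageData (j : ℕ) :
    StageData d P Cg (prox j) (g (prox j)) (logFactor P.δ H (prox j)) := by
  have h1 := prox_pos j
  have h2 := prox_le j
  obtain ⟨h3, h4, h5⟩ := h.hg _ h1 h2
  obtain ⟨h6, h7, h8, -⟩ := h.log_le_logFactor h1 (h2.trans (by norm_num))
  exact ⟨h.hd, h.hs1, h.hs, h.hL, h.hR, h.hU, h.hβ, h.hδ, h.hδ1, h1, h2, h3, h4, by linarith,
    h7, h8, h5⟩

end Setup

/-- The schedule for the noise factor `g`. -/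
def schedule (d n : ℕ) (P : Param) (Y X H : ℝ) (g : ℝ → ℝ) (eps0 : ℝ) : Schedule where
  b j := bandwidth n Y (logFactor P.δ H (prox j)) (g (prox j)) (prox j)
  T j := (rounds d P.s n X (logFactor P.δ H (prox j)) (g (prox j))).toPNat'
  eps0 := eps0
  m := ⌈8 * Real.log (8 * trials P / P.δ) / eps0 ^ 2⌉₊.toPNat'

variable {n : ℕ} {ζ c₀ Y X : ℝ}

lemma coe_toPNat' {n : ℕ} (h : 0 < n) : ((n.toPNat' : ℕ+) : ℕ) = n := by
  rw [Nat.toPNat'_coe, if_pos h]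

namespace Setup
variable (h : Setup d P Cg H eps0 g)
include h

lemma schedule_T (hX : 2 ≤ X) (j : ℕ) : (((schedule d n P Y X H g eps0).T j : ℕ+) : ℕ) =
    rounds d P.s n X (logFactor P.δ H (prox j)) (g (prox j)) :=
  coe_toPNat' (by exact_mod_cast (h.stageData j).rounds_pos (n := n) hX)

lemma trials_bounds {x : ℝ} (hx : 0 < x) (hx1 : x ≤ 1) :
    (1 : ℝ) ≤ trials P ∧ (trials P : ℝ) ≤ 31 * logFactor P.δ H x := by
  have hδ := h.hδ
  have h1 : (0 : ℝ) < 4 / P.δ := by positivity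
  have h2 : 0 ≤ 10 * Real.log (4 / P.δ) := by
    have : 1 ≤ 4 / P.δ := by rw [le_div_iff₀ hδ]; linarith [h.hδ1]
    have := Real.log_nonneg this
    positivity
  refine ⟨by exact_mod_cast trials_pos hδ h.hδ1, ?_⟩
  have h3 := (Nat.ceil_lt_add_one h2).le
  obtain ⟨h4, -, -, -, h5⟩ := h.log_le_logFactor hx hx1
  have h6 : Real.log (4 / P.δ) ≤ 3 + Real.log (1 / P.δ) := by
    rw [div_eq_mul_one_div, Real.log_mul (by norm_num) (by positivity)]
    have : Real.log 4 ≤ 3 := (Real.log_le_sub_one_of_pos (by norm_num)).trans (by norm_num)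
    linarith
  change (trials P : ℝ) ≤ _ at h3
  linarith

lemma log_trials_bounds {x : ℝ} (hx : 0 < x) (hx1 : x ≤ 1) :
    1 ≤ Real.log (trials P / P.δ) ∧
    Real.log (8 * trials P / P.δ) ≤ 2 * Real.log (trials P / P.δ) ∧
    Real.log (8 * trials P / P.δ) ≤ 40 * logFactor P.δ H x := by
  have hδ := h.hδ; have hδ1 := h.hδ1
  obtain ⟨h1, h2⟩ := h.trials_bounds hx hx1
  obtain ⟨h4, -, -, -, h5⟩ := h.log_le_logFactor hx hx1
  set N : ℝ := ((trials P : ℕ) : ℝ)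
  have hN : 10 ≤ N / P.δ := by rw [le_div_iff₀ hδ]; linarith
  have h8 : Real.log 8 ≤ 7 := (Real.log_le_sub_one_of_pos (by norm_num)).trans (by norm_num)
  refine ⟨?_, ?_, ?_⟩
  · rw [Real.le_log_iff_exp_le (by positivity)]
    have := Real.exp_one_lt_d9
    linarith
  · rw [mul_div_assoc, Real.log_mul (by norm_num) (by positivity), two_mul]
    gcongr
    linarith
  · rw [show 8 * N / P.δ = 8 * N * (1 / P.δ) by ring, Real.log_mul (by positivity) (by positivity),
      Real.log_mul (by norm_num) (by positivity)]
    have h9 : Real.log N ≤ N := (Real.log_le_sub_one_of_pos (by linarith)).trans (by linarith)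
    linarith

lemma schedule_m : 8 * Real.log (8 * trials P / P.δ) / eps0 ^ 2 ≤
      (((schedule d n P Y X H g eps0).m : ℕ+) : ℕ) ∧
    (((schedule d n P Y X H g eps0).m : ℕ+) : ℝ) ≤
      8 * Real.log (8 * trials P / P.δ) / eps0 ^ 2 + 1 := by
  have hδ := h.hδ
  have h0 := h.eps_pos
  have h1 := h.trials_bounds one_pos le_rfl
  have h2 : 0 < Real.log (8 * trials P / P.δ) := by
    apply Real.log_pos
    rw [lt_div_iff₀ hδ]
    linarith [h.hδ1]
  have h3 : 0 < 8 * Real.log (8 * trials P / P.δ) / eps0 ^ 2 := by positivity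
  have e : (((schedule d n P Y X H g eps0).m : ℕ+) : ℕ) =
    ⌈8 * Real.log (8 * trials P / P.δ) / eps0 ^ 2⌉₊ := coe_toPNat' (Nat.ceil_pos.2 h3)
  rw [e]
  exact ⟨Nat.le_ceil _, (Nat.ceil_lt_add_one h3.le).le⟩

lemma one_le_inv_eps : 1 ≤ 1 / eps0 ^ 2 := by
  have h0 := h.eps_pos
  rw [le_div_iff₀ (by positivity), one_mul]
  exact pow_le_one₀ h0.le h.eps_le

lemma validHoldout {C : ℝ} (hC : 17 ≤ C) : ValidHoldout C P (schedule d n P Y X H g eps0) := by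
  have h0 := h.eps_pos
  refine ⟨h0, h.eps_le, ?_⟩
  obtain ⟨h1, h2, -⟩ := h.log_trials_bounds one_pos le_rfl
  have h3 := h.one_le_inv_eps
  have h4 : 1 ≤ 1 / eps0 ^ 2 * Real.log (trials P / P.δ) :=
    one_le_mul_of_one_le_of_one_le h3 h1
  calc _ ≤ 8 * Real.log (8 * trials P / P.δ) / eps0 ^ 2 + 1 := h.schedule_m.2
    _ ≤ 8 * (2 * Real.log (trials P / P.δ)) / eps0 ^ 2 + 1 := by gcongr
    _ = 16 * (1 / eps0 ^ 2 * Real.log (trials P / P.δ)) + 1 := by ring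
    _ ≤ 17 * (1 / eps0 ^ 2 * Real.log (trials P / P.δ)) := by linarith
    _ ≤ _ := mul_le_mul_of_nonneg_right hC (by linarith)

lemma thetaTilde (hY : 1 ≤ Y) {C : ℝ} {k : ℕ} (hC : Y ≤ C) (hk : n ≤ k) (j : ℕ) :
    ThetaTilde C k (logFactor P.δ H (prox j)) ((schedule d n P Y X H g eps0).b j)
      (g (prox j) * prox j) := by
  have hs := h.stageData j
  have hΛ := hs.hΛ
  have hr := hs.hr
  have hg := hs.hg
  have hY0 : 0 < Y := by linarith
  have hΛ0 := hs.Λ_pos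
  change _ / _ ≤ bandwidth _ _ _ _ _ ∧ bandwidth _ _ _ _ _ ≤ _
  set Λ := logFactor P.δ H (prox j)
  have hC1 : 1 ≤ C := hY.trans hC
  unfold bandwidth
  constructor
  · have : Y * Λ ^ n ≤ C * Λ ^ k := by gcongr
    rw [mul_assoc, one_div_mul_eq_div]
    gcongr
  · have h1 : 1 / (Y * Λ ^ n) ≤ 1 := (hs.tau_le hY).trans ((div_le_one hY0).2 hY)
    have h2 : 1 ≤ C * Λ ^ k := one_le_mul_of_one_le_of_one_le hC1 (one_le_pow₀ hΛ)
    calc _ = 1 / (Y * Λ ^ n) * (g (prox j) * prox j) := by ring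
      _ ≤ (C * Λ ^ k) * (g (prox j) * prox j) := by gcongr; linarith
      _ = _ := by ring

lemma schedule_T_le (hX : 2 ≤ X) {G : ℝ → ℝ}
    (hG : ∀ r, 0 < r → r ≤ 1 / 4 → 1 / g r ^ 2 ≤ G r) (j : ℕ) :
    (((schedule d n P Y X H g eps0).T j : ℕ+) : ℝ) ≤
      2 * X ^ 2 * (P.s * Real.log d * G (prox j)) * logFactor P.δ H (prox j) ^ (2 * n + 6) := by
  have hs := h.stageData j
  have h1 := (hs.rounds_bounds (n := n) hX).2
  have h2 := hG _ hs.hr hs.hr1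
  have h3 := hs.two_le_slog
  have hΛ := hs.Λ_pos
  rw [h.schedule_T hX]
  refine h1.trans ?_
  calc _ = 2 * X ^ 2 * (P.s * Real.log d * (1 / g (prox j) ^ 2)) *
        logFactor P.δ H (prox j) ^ (2 * n + 6) := by ring
    _ ≤ _ := by gcongr

lemma goodStage (hc₀ : 0 < c₀) (hCg : 0 ≤ Cg) (hζ : ζ < 1) (hn : 1 ≤ n * (1 - ζ))
    (hsuit : Suitable P n ζ c₀ Cg Y X) {D : Measure (Ex d)} [IsProbabilityMeasure D] {w : Pt d}
    (hnoise : NoiseInterface P c₀ ζ g eps0 D w) (j : ℕ) :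
    GoodStage P (schedule d n P Y X H g eps0) D w j := by
  have hs := h.stageData j
  obtain ⟨l, Q, hadm⟩ := hs.admissible hc₀ hCg hζ hn hsuit
  refine ⟨_, l, Q, ?_, hnoise.margin (prox j) (1 / (Y * logFactor P.δ H (prox j) ^ n)) hs.hr hs.hr1
    ?_ ?_⟩
  · rw [h.schedule_T hsuit.X_ge]
    exact hadm
  · have := hs.Λ_pos
    have := hsuit.Y_ge_one
    positivity
  · have hY := hsuit.Y_ge_one
    exact (hs.tau_le hY).trans ((div_le_one (by linarith)).2 hY)

lemma goodHoldout {D : Measure (Ex d)} [IsProbabilityMeasure D] {w : Pt d}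
    (hnoise : NoiseInterface P c₀ ζ g eps0 D w) :
    GoodHoldout P (schedule d n P Y X H g eps0) D w :=
  ⟨h.eps_pos, h.eps_le, h.schedule_m.1, hnoise.holdout⟩

end Setup

/-- The constant of a stage in the label bound. -/
def labelConst (P : Param) (n e : ℕ) (X : ℝ) : ℝ :=
  2 * X ^ 2 * (Real.log (proxConst P.U P.β) + 3) ^ (2 * n + 6 + 1) * proxConst P.U P.β ^ e

/-- The label bound. -/
lemma Setup.labels_le (h : Setup d P Cg H eps0 g) (hX : 2 ≤ X) {G M : ℝ → ℝ} {e : ℕ} {Ce CG : ℝ}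
    (hgG : ∀ r, 0 < r → r ≤ 1 / 4 → 1 / g r ^ 2 ≤ G r)
    (hG0 : ∀ r, 0 < r → 0 ≤ G r)
    (hG : ∀ u v y : ℝ, 0 < u → 0 < v → u ≤ 1 → v ≤ 1 → 1 ≤ y → v ≤ y * u → G u ≤ y ^ e * G v)
    (hCG : 0 ≤ CG) {ε : ℝ} (hε : 0 < ε) (hε1 : ε < 1) (hM : 0 ≤ M ε)
    (hCe : logFactor P.δ H eps0 ≤ Ce * logFactor P.δ H ε) (hM1 : G eps0 ≤ CG * M ε)
    (hM2 : 1 / eps0 ^ 2 ≤ CG * M ε) (hM3 : G ε ≤ CG * M ε)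
    (ω : Outcome d (schedule d n P Y X H g eps0)) :
    ((algorithm P (schedule d n P Y X H g eps0) ε ω).2 : ℝ) ≤
      CG * (31 * labelConst P n e X * Ce ^ (2 * n + 6 + 2 + 2 * e) + 321 + labelConst P n e X) *
        (P.s * M ε) * logFactor P.δ H ε ^ (2 * n + 6 + 2 + 2 * e + 1) := by
  refine (Nat.cast_le.2 (algorithm_snd_le (P := P) ε ω)).trans ?_
  clear ω
  set S := schedule d n P Y X H g eps0
  have h0 := h.eps_pos
  have hT := h.schedule_T_le (n := n) (Y := Y) hX hgG
  have hH := h.H_pos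
  have hΛj : ∀ j, 1 ≤ logFactor P.δ H (prox j) := fun j => (h.stageData j).hΛ
  obtain ⟨ha1, ha2, ha3, ha4, ha5⟩ := h.log_le_logFactor h0 h.eps_le
  obtain ⟨hb1, hb2, hb3, hb4, hb5⟩ := h.log_le_logFactor hε hε1.le
  have ha1' : 1 ≤ logFactor P.δ H eps0 := by linarith
  have hK := four_le_proxConst (β := P.β) h.hU
  have hlogK : 0 ≤ Real.log (proxConst P.U P.β) := Real.log_nonneg (by linarith)
  have hs : (1 : ℝ) ≤ P.s := by exact_mod_cast h.hs1
  have hlc : 0 ≤ labelConst P n e X := by unfold labelConst; positivity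
  have hA : ((∑ k ∈ Finset.range (k0 P S + 1), (S.T k : ℕ) : ℕ) : ℝ) ≤ labelConst P n e X *
      (P.s * G eps0) * logFactor P.δ H eps0 ^ (2 * n + 6 + 2 + 2 * e) :=
    sum_rounds_le (T := fun k => (S.T k : ℕ)) h.hd h.hU h.hβ (c := 24) (q := 64) (x := eps0) (by norm_num)
      (by norm_num) (by norm_num) (by norm_num) h0 h.eps_le h.hδ (by linarith) (by positivity)
      ha1' ha4 ha2 hΛj (hG0 _ h0) hG hT
  have hB : ((∑ k ∈ Finset.range (kEps P ε + 1), (S.T k : ℕ) : ℕ) : ℝ) ≤ labelConst P n e X *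
      (P.s * G ε) * logFactor P.δ H ε ^ (2 * n + 6 + 2 + 2 * e) :=
    sum_rounds_le (T := fun k => (S.T k : ℕ)) h.hd h.hU h.hβ (c := 12) (q := 32) (by norm_num)
      (by norm_num) (by norm_num) (by norm_num) hε hε1.le h.hδ (by linarith) (by positivity)
      (by linarith) hb4 hb2 hΛj (hG0 _ hε) hG hT
  set Λ := logFactor P.δ H ε
  set A := ∑ k ∈ Finset.range (k0 P S + 1), (S.T k : ℕ)
  set B := ∑ k ∈ Finset.range (kEps P ε + 1), (S.T k : ℕ)
  set k₁ := 2 * n + 6 + 2 + 2 * e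
  set LC := labelConst P n e X
  have hΛ1 : 1 ≤ Λ := by linarith
  have hΛk : 1 ≤ Λ ^ k₁ := one_le_pow₀ hΛ1
  have hCe0 : 0 ≤ Ce := by
    by_contra! hneg
    have := mul_neg_of_neg_of_pos hneg (by linarith : 0 < Λ)
    linarith
  have hA' : (A : ℝ) ≤ LC * (P.s * (CG * M ε)) * (Ce * Λ) ^ k₁ := by
    refine hA.trans ?_
    have := hG0 _ h0
    gcongr
  have hB' : (B : ℝ) ≤ LC * (P.s * (CG * M ε)) * Λ ^ k₁ := by
    refine hB.trans ?_
    gcongr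
  have hN := (h.trials_bounds hε hε1.le).2
  have hm : ((S.m : ℕ) : ℝ) ≤ 321 * (CG * M ε) * Λ := by
    have h3 := h.one_le_inv_eps
    -- `ln(8N/δ) ≤ 40Λ` turns the sample size into at most `320Λ/ε₀²`, plus `1` for rounding up.
    have h4 := (h.log_trials_bounds hε hε1.le).2.2
    calc ((S.m : ℕ) : ℝ) ≤ 8 * Real.log (8 * trials P / P.δ) / eps0 ^ 2 + 1 := h.schedule_m.2
      _ ≤ 8 * (40 * Λ) / eps0 ^ 2 + 1 := by gcongr
      _ = 320 * (1 / eps0 ^ 2 * Λ) + 1 := by ring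
      _ ≤ 321 * (1 / eps0 ^ 2 * Λ) := by
          have := one_le_mul_of_one_le_of_one_le h3 hΛ1
          linarith
      _ ≤ 321 * ((CG * M ε) * Λ) := by gcongr
      _ = _ := by ring
  have hZ : 0 ≤ CG * M ε := by positivity
  push_cast
  calc (trials P : ℝ) * A + (S.m : ℕ) + B
      ≤ 31 * Λ * (LC * (P.s * (CG * M ε)) * (Ce * Λ) ^ k₁) + 321 * (CG * M ε) * Λ +
        LC * (P.s * (CG * M ε)) * Λ ^ k₁ := by gcongr
    _ ≤ 31 * Λ * (LC * (P.s * (CG * M ε)) * (Ce * Λ) ^ k₁) +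
        321 * (P.s * (CG * M ε)) * (Λ ^ k₁ * Λ) + LC * (P.s * (CG * M ε)) * (Λ ^ k₁ * Λ) := by
        have e1 : CG * M ε ≤ P.s * (CG * M ε) := le_mul_of_one_le_left hZ hs
        have e2 : Λ ≤ Λ ^ k₁ * Λ := le_mul_of_one_le_left (by linarith) hΛk
        have e3 : Λ ^ k₁ ≤ Λ ^ k₁ * Λ := le_mul_of_one_le_right (by linarith) hΛ1
        gcongr
    _ = _ := by rw [mul_pow, pow_succ Λ k₁]; ring

/-- The algorithm works for every noise condition with a noise factor. -/
theorem exists_schedule (ζ : ℝ) (hζ : ζ < 1) (e : ℕ) : ∃ k : ℕ, ∀ L R U β : ℝ, 0 < L → 0 < R →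
    0 < U → 0 < β → ∀ c₀ Cg Ce CG : ℝ, 0 < c₀ → 0 ≤ Cg → 0 ≤ Ce → 0 ≤ CG → ∃ C : ℝ, 1 ≤ C ∧
    ∀ (d s : ℕ) (δ H eps0 : ℝ) (g G M : ℝ → ℝ), Setup d ⟨s, L, R, U, β, δ⟩ Cg H eps0 g →
      (∀ r, 0 < r → r ≤ 1 / 4 → 1 / g r ^ 2 ≤ G r) → (∀ r, 0 < r → 0 ≤ G r) →
      (∀ u v y : ℝ, 0 < u → 0 < v → u ≤ 1 → v ≤ 1 → 1 ≤ y → v ≤ y * u → G u ≤ y ^ e * G v) →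
      (∀ ε, 0 < ε → ε < 1 → 0 ≤ M ε ∧ logFactor δ H eps0 ≤ Ce * logFactor δ H ε ∧
        G eps0 ≤ CG * M ε ∧ 1 / eps0 ^ 2 ≤ CG * M ε ∧ G ε ≤ CG * M ε) →
      ∃ S : Schedule, S.eps0 = eps0 ∧ ValidHoldout C ⟨s, L, R, U, β, δ⟩ S ∧
        (∀ j, ThetaTilde C k (logFactor δ H (prox j)) (S.b j) (g (prox j) * prox j)) ∧
        (∀ j, (S.T j : ℝ) ≤
          C * (s * Real.log d * G (prox j)) * logFactor δ H (prox j) ^ k) ∧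
        ∀ Noise : (D : Measure (Ex d)) → [IsFiniteMeasure D] → Pt d → Prop,
          (∀ (D : Measure (Ex d)) [IsProbabilityMeasure D] (w : Pt d), Noise D w →
            NoiseInterface ⟨s, L, R, U, β, δ⟩ c₀ ζ g eps0 D w) →
          Guarantee d ⟨s, L, R, U, β, δ⟩ S Noise fun ε =>
            C * (s * M ε) * logFactor δ H ε ^ k := by
  -- The smallest power of `Λ` with `n (1 - ζ) ≥ 1`. It depends only on `ζ`, so the final exponent
  -- depends only on the noise condition and `α`.
  set n := ⌈1 / (1 - ζ)⌉₊
  have hζ' : 0 < 1 - ζ := by linarith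
  have hn : 1 ≤ n * (1 - ζ) := by
    rw [← div_le_iff₀ hζ']
    exact Nat.le_ceil _
  refine ⟨2 * n + 6 + 2 + 2 * e + 1, fun L R U β hL hR hU hβ c₀ Cg Ce CG hc₀ hCg hCe hCG => ?_⟩
  obtain ⟨Y, X, hsuit⟩ := exists_suitable (P := ⟨0, L, R, U, β, 0⟩) hL hR hc₀ hζ n Cg
  have hY := hsuit.Y_ge_one
  have hX := hsuit.X_ge
  set LC := labelConst ⟨0, L, R, U, β, 0⟩ n e X
  have hLC : 0 ≤ LC := by
    have hK := four_le_proxConst (β := β) hU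
    have hlogK : 0 ≤ Real.log (proxConst U β) := Real.log_nonneg (by linarith)
    simp only [LC, labelConst]
    positivity
  set C' := CG * (31 * LC * Ce ^ (2 * n + 6 + 2 + 2 * e) + 321 + LC) with hC'
  have hC'0 : 0 ≤ C' := by positivity
  refine ⟨17 + Y + 2 * X ^ 2 + C', by nlinarith, fun d s δ H eps0 g G M h hgG hG0 hG hM => ?_⟩
  have hsuit' : Suitable ⟨s, L, R, U, β, δ⟩ n ζ c₀ Cg Y X := ⟨hsuit.Y_ge_one, hsuit.Y_ge,
    hsuit.Y_ge', hsuit.Y_large, hsuit.X_ge, hsuit.X_large⟩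
  have hX2 : 0 ≤ 2 * X ^ 2 := by positivity
  refine ⟨schedule d n ⟨s, L, R, U, β, δ⟩ Y X H g eps0, rfl, h.validHoldout (by linarith),
    h.thetaTilde hY (by linarith) (by omega), fun j => ?_, fun Noise hN => ?_⟩
  · have hs := h.stageData j
    have h1 := h.schedule_T_le (n := n) (Y := Y) hX hgG j
    have h2 := hs.two_le_slog
    have h3 := hG0 _ hs.hr
    have h4 : 0 ≤ s * Real.log d := zero_le_two.trans h2
    have hΛ : 1 ≤ logFactor δ H (prox j) := hs.hΛ
    refine h1.trans ?_
    change 2 * X ^ 2 * (s * Real.log d * G (prox j)) * logFactor δ H (prox j) ^ (2 * n + 6) ≤ _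
    have hp : logFactor δ H (prox j) ^ (2 * n + 6) ≤
        logFactor δ H (prox j) ^ (2 * n + 6 + 2 + 2 * e + 1) := pow_le_pow_right₀ hΛ (by omega)
    gcongr
    linarith
  · intro ε hε hε1 D _ w hw hsp hwb hnoise
    have hint := hN D w hnoise
    refine ⟨law_excess_le ⟨h.hd, h.hs, hL, hR, hU, hβ, h.hδ, h.hδ1, hwb, hw, hsp, hint.nonneg⟩
      (h.goodStage hc₀ hCg hζ hn hsuit' hint) (h.goodHoldout hint) hε hε1, fun ω => ?_⟩
    obtain ⟨hM0, hM1, hM2, hM3, hM4⟩ := hM ε hε hε1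
    refine (h.labels_le hX hgG hG0 hG hCG hε hε1 hM0 hM1 hM2 hM3 hM4 ω).trans ?_
    have hΛ : 4 ≤ logFactor δ H ε := (h.log_le_logFactor hε hε1.le).1
    change C' * (s * M ε) * logFactor δ H ε ^ (2 * n + 6 + 2 + 2 * e + 1) ≤
      (17 + Y + 2 * X ^ 2 + C') * (s * M ε) * logFactor δ H ε ^ (2 * n + 6 + 2 + 2 * e + 1)
    gcongr
    linarith

end master

/-! ### The three noise conditions -/

section cases
variable {d : ℕ}

lemma MarginBound.mono {D : Measure (Ex d)} [IsProbabilityMeasure D] {w : Pt d} {p ρ γ γ' : ℝ}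
    (h : MarginBound D w p ρ γ) (hp : 0 ≤ p) (hγ : γ' ≤ γ) : MarginBound D w p ρ γ' :=
  fun E hE hpE hρ => (mul_le_mul_of_nonneg_right hγ hp).trans (h E hE hpE hρ)

lemma one_le_log_prox {δ : ℝ} (hδ : 0 < δ) (hδ1 : δ < 1 / 10) (j : ℕ) :
    1 ≤ Real.log (1 / (δ * prox j)) ^ 3 := by
  apply one_le_pow₀
  have h1 := prox_pos j
  have h2 := prox_le j
  rw [Real.le_log_iff_exp_le (by positivity), le_div_iff₀ (by positivity)]
  have := Real.exp_one_lt_d9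
  calc Real.exp 1 * (δ * prox j) ≤ 3 * (1 / 10 * (1 / 4)) := by gcongr; linarith
    _ ≤ 1 := by norm_num

lemma one_le_logFactor {δ H x : ℝ} (hδ : 0 < δ) (hδ1 : δ < 1 / 10) (hH : 8 ≤ H) (hx : 0 < x)
    (hx1 : x ≤ 1) : 1 ≤ logFactor δ H x := by
  unfold logFactor
  rw [Real.le_log_iff_exp_le (by positivity), le_div_iff₀ (by positivity)]
  have := Real.exp_one_lt_d9
  calc Real.exp 1 * (δ * x) ≤ 3 * (1 / 10 * 1) := by gcongr; linarith
    _ ≤ H := by linarith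

/-- The rounds of the schedule carry no separate cubed logarithm; the one allowed in the stated
bound is at least `1`. -/
lemma mul_logFactor_le {δ H C a : ℝ} (hδ : 0 < δ) (hδ1 : δ < 1 / 10) (hH : 8 ≤ H) (hC : 0 ≤ C)
    (ha : 0 ≤ a) (k j : ℕ) : C * a * logFactor δ H (prox j) ^ k ≤
      C * (a * Real.log (1 / (δ * prox j)) ^ 3) * logFactor δ H (prox j) ^ k := by
  have h1 := one_le_log_prox hδ hδ1 j
  have h2 := one_le_logFactor hδ hδ1 hH (prox_pos j) ((prox_le j).trans (by norm_num))
  have h3 : a ≤ a * Real.log (1 / (δ * prox j)) ^ 3 := le_mul_of_one_le_right ha h1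
  gcongr

/-- The initial target may be much smaller than `ε`, but `ε₀ H ≥ κ` bounds `H/(δε₀)` by `1/κ` times
the square of `H/(δε)`, so the two logarithms are comparable. -/
lemma logFactor_le {δ H eps0 ε κ : ℝ} (hδ : 0 < δ) (hδ1 : δ < 1 / 10) (hH : 8 ≤ H)
    (h0 : 0 < eps0) (hε : 0 < ε) (hε1 : ε < 1) (hκ : 0 < κ) (hκ1 : κ ≤ 1)
    (h : κ ≤ eps0 * H) :
    logFactor δ H eps0 ≤ (Real.log (1 / κ) + 2) * logFactor δ H ε := by
  have hΛ := one_le_logFactor hδ hδ1 hH hε hε1.le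
  have h1 : H / (δ * eps0) ≤ 1 / κ * (H / (δ * ε)) * (H / (δ * ε)) := by
    have e : 1 / κ * (H / (δ * ε)) * (H / (δ * ε)) = H ^ 2 / (κ * (δ * ε) ^ 2) := by
      field_simp
    rw [e, div_le_div_iff₀ (by positivity) (by positivity)]
    have h2 : (δ * ε) ^ 2 ≤ δ := by
      have : (δ * ε) ^ 2 ≤ (δ * 1) ^ 2 := by gcongr
      nlinarith
    calc H * (κ * (δ * ε) ^ 2) ≤ H * ((eps0 * H) * δ) := by gcongr
      _ = H ^ 2 * (δ * eps0) := by ring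
  have h3 := Real.log_le_log (by positivity) h1
  rw [Real.log_mul (by positivity) (by positivity), Real.log_mul (by positivity)
    (by positivity)] at h3
  have h4 : 0 ≤ Real.log (1 / κ) := Real.log_nonneg (by rw [le_div_iff₀ hκ]; linarith)
  have h5 : Real.log (1 / κ) ≤ Real.log (1 / κ) * logFactor δ H ε := le_mul_of_one_le_right h4 hΛ
  change logFactor δ H eps0 ≤ Real.log (1 / κ) + logFactor δ H ε + logFactor δ H ε at h3
  linarith

/-- The margin is uniformly at least `1 - 2η`, so the noise factor is constant and `ζ = e = 0`. The
initial target is `κ(1 - 2η)`, whose inverse square is of the order of the main term. -/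
theorem massart_guarantee : ∃ k : ℕ, ∀ L R U β : ℝ, 0 < L → 0 < R → 0 < U → 0 < β →
    ∃ C : ℝ, 0 < C ∧ ∀ (d s : ℕ) (δ η : ℝ), 8 ≤ d → 1 ≤ s → s ≤ d → 0 < δ → δ < 1 / 10 →
      0 ≤ η → η < 1 / 2 → ∃ S : Schedule, MassartSchedule C k d ⟨s, L, R, U, β, δ⟩ η S ∧
        Guarantee d ⟨s, L, R, U, β, δ⟩ S (fun D _ wstar => Massart η D wstar) fun ε =>
          C * (s / (1 - 2 * η) ^ 2) * Real.log (d / (ε * δ * (1 - 2 * η))) ^ k := by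
  obtain ⟨k, hk⟩ := exists_schedule 0 one_pos 0
  refine ⟨k, fun L R U β hL hR hU hβ => ?_⟩
  set κ := min 1 (L * R ^ 2 / 80) with hκ
  have hκ0 : 0 < κ := by positivity
  have hκ1 : κ ≤ 1 := min_le_left _ _
  have hlogκ : 0 ≤ Real.log (1 / κ) := Real.log_nonneg (by rw [le_div_iff₀ hκ0]; linarith)
  obtain ⟨C, hC, hk⟩ := hk L R U β hL hR hU hβ 1 1 (Real.log (1 / κ) + 2) (1 / κ ^ 2) one_pos
    zero_le_one (by positivity) (by positivity)
  refine ⟨C, by linarith, fun d s δ η hd hs1 hs hδ hδ1 hη hη1 => ?_⟩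
  set h := 1 - 2 * η with hh
  have hh0 : 0 < h := by linarith
  have hh1 : h ≤ 1 := by linarith
  have hdr : (8 : ℝ) ≤ d := by exact_mod_cast hd
  have hdH : d ≤ d / h := by
    rw [le_div_iff₀ hh0]; nlinarith
  have hlog : ∀ x, Real.log (d / (δ * x * h)) = logFactor δ (d / h) x := fun x => by
    rw [logFactor, div_div, mul_comm h]
  have hκh : κ * h ≤ 1 := by nlinarith
  obtain ⟨S, hS0, hSv, hSb, hST, hSG⟩ := hk d s δ (d / h) (κ * h) (fun _ => h)
    (fun _ => 1 / h ^ 2) (fun _ => 1 / h ^ 2)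
    { hd := hd, hs1 := hs1, hs := hs, hL := hL, hR := hR, hU := hU, hβ := hβ, hδ := hδ, hδ1 := hδ1
      hH := hdH, eps_pos := by positivity, eps_le := hκh
      hg := fun r hr hr1 => ⟨hh0, hh1, by
        rw [one_mul, logFactor]
        apply Real.log_le_log (by positivity)
        rw [div_div, div_le_div_iff₀ hh0 (by positivity), one_mul, ← mul_assoc]
        have : h * (δ * r) ≤ h * 1 := by gcongr; nlinarith
        nlinarith⟩ }
    (fun _ _ _ => le_rfl) (fun _ _ => by positivity)
    (fun _ _ _ _ _ _ _ _ _ => by rw [pow_zero, one_mul]) (fun ε hε hε1 => by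
      have h1 : 1 ≤ 1 / κ ^ 2 := by
        rw [le_div_iff₀ (by positivity), one_mul]; exact pow_le_one₀ hκ0.le hκ1
      have h2 : 1 / h ^ 2 ≤ 1 / κ ^ 2 * (1 / h ^ 2) :=
        le_mul_of_one_le_left (by positivity) h1
      refine ⟨by positivity, ?_, h2, by rw [mul_pow]; field_simp; rfl, h2⟩
      apply logFactor_le hδ hδ1 (hdr.trans hdH) (by positivity) hε hε1 hκ0 hκ1
      rw [mul_assoc, mul_div_cancel₀ _ hh0.ne']
      nlinarith)
  refine ⟨S, ⟨fun j => ⟨?_, ?_⟩, ?_, hSv⟩, ?_⟩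
  · rw [hlog]; exact hSb j
  · rw [hlog]
    have := two_lt_log hd
    exact (hST j).trans (mul_logFactor_le hδ hδ1 (hdr.trans hdH) (by linarith) (by positivity) k j)
  · rw [hS0]
    exact mul_le_mul_of_nonneg_right (hκ1.trans hC) hh0.le
  · have hG := hSG (fun D _ wstar => Massart η D wstar) fun D _ w hD =>
      { nonneg := hD.margin_nonneg hη1
        margin := fun r τ _ _ _ _ => by
          rw [Real.rpow_zero, one_mul, one_mul]; exact hD.marginBound hη1 _ _
        holdout := ⟨h, hD.marginBound hη1 _ _, by
          rw [mul_comm h]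
          exact mul_le_mul_of_nonneg_right (min_le_right _ _) hh0.le⟩ }
    have e : (fun ε => C * (s * (1 / h ^ 2)) * logFactor δ (d / h) ε ^ k) = fun ε =>
        C * (s / h ^ 2) * Real.log (d / (ε * δ * h)) ^ k := by
      funext ε
      rw [mul_comm ε δ, hlog, mul_one_div]
    rwa [e] at hG

lemma one_le_mul_one_add {y a : ℝ} (e : ℕ) (hy : 1 ≤ y) {b : ℝ} (h : a ≤ y ^ e * b) :
    1 + a ≤ y ^ e * (1 + b) := by
  have : 1 ≤ y ^ e := one_le_pow₀ hy
  linarith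

/-- The exponent of `y` is rounded up because `exists_schedule` measures the growth of the cost by a
natural power; this affects only logarithmic factors. -/
lemma rpow_le_pow_mul_rpow {p u v y : ℝ} (hp : 0 ≤ p) (hu : 0 < u) (hv : 0 < v) (hy : 1 ≤ y)
    (h : v ≤ y * u) : (1 / u) ^ p ≤ y ^ ⌈p⌉₊ * (1 / v) ^ p := by
  have h1 : 1 / u ≤ y * (1 / v) := by
    rw [mul_one_div, div_le_div_iff₀ hu hv]; linarith
  calc (1 / u) ^ p ≤ (y * (1 / v)) ^ p := by gcongr
    _ = y ^ p * (1 / v) ^ p := Real.mul_rpow (by linarith) (by positivity)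
    _ ≤ y ^ (⌈p⌉₊ : ℝ) * (1 / v) ^ p := by
        gcongr
        exact Nat.le_ceil p
    _ = _ := by rw [Real.rpow_natCast]

end cases

/-! ### Geometric Tsybakov noise. -/

section cases
variable {d : ℕ}

lemma log_one_div_le_logFactor {δ H r : ℝ} (hδ : 0 < δ) (hδ1 : δ < 1 / 10) (hH : 8 ≤ H)
    (hr : 0 < r) : Real.log (1 / r) ≤ logFactor δ H r := by
  apply Real.log_le_log (by positivity)
  rw [div_le_div_iff₀ hr (by positivity)]
  nlinarith

lemma log_inv_min_mul_rpow_le {δ H B ξ r : ℝ} (hδ : 0 < δ) (hδ1 : δ < 1 / 10) (hH : 8 ≤ H)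
    (hB : 0 < B) (hBH : 1 / B ≤ H) (hξ : 0 ≤ ξ) (hr : 0 < r) (hr1 : r ≤ 1) :
    Real.log (1 / min 1 (B * r ^ ξ)) ≤ (1 + ξ) * logFactor δ H r := by
  have hΛ := one_le_logFactor hδ hδ1 hH hr hr1
  rcases min_cases 1 (B * r ^ ξ) with ⟨h1, -⟩ | ⟨h1, -⟩
  · rw [h1, div_one, Real.log_one]; positivity
  · rw [h1, show 1 / (B * r ^ ξ) = 1 / B * (1 / r) ^ ξ by
      rw [Real.div_rpow zero_le_one hr.le, Real.one_rpow]; field_simp,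
      Real.log_mul (by positivity) (by positivity), Real.log_rpow (by positivity)]
    have hδr : δ * r ≤ 1 := by nlinarith
    have h2 : Real.log (1 / B) ≤ logFactor δ H r := by
      apply Real.log_le_log (by positivity)
      rw [le_div_iff₀ (by positivity)]
      have : 1 / B * (δ * r) ≤ 1 / B := mul_le_of_le_one_right (by positivity) hδr
      linarith
    have h4 := mul_le_mul_of_nonneg_left (log_one_div_le_logFactor hδ hδ1 hH hr) hξ
    linarith

lemma one_div_min_one_sq_le {a c : ℝ} (hc : 0 ≤ c) (h : 1 / a ^ 2 ≤ c) :
    1 / min 1 a ^ 2 ≤ 1 + c := by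
  rcases min_cases 1 a with ⟨h1, -⟩ | ⟨h1, -⟩
  · rw [h1]; norm_num; exact hc
  · rw [h1]; linarith

lemma one_div_mul_rpow_sq {B ξ r : ℝ} (hr : 0 < r) :
    1 / (B * r ^ ξ) ^ 2 = 1 / B ^ 2 * (1 / r) ^ (2 * ξ) := by
  rw [mul_comm 2 ξ, Real.rpow_mul (by positivity), Real.div_rpow zero_le_one hr.le, Real.one_rpow,
    Real.rpow_two, mul_pow]
  ring

lemma one_div_sq_mul_min_rpow_le {B q : ℝ} (hB : 0 < B) :
    1 / B ^ 2 * (1 / min 1 B) ^ q ≤ 1 + (1 / B) ^ (2 + q) := by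
  have hB' : 0 < 1 / B := by positivity
  have h0 : 0 ≤ (1 / B) ^ (2 + q) := by positivity
  rcases min_cases 1 B with ⟨h1, h2⟩ | ⟨h1, h2⟩
  · rw [h1, div_one, Real.one_rpow, mul_one]
    have : 1 / B ^ 2 ≤ 1 := by
      rw [div_le_one (by positivity)]; exact one_le_pow₀ h2
    linarith
  · rw [h1, Real.rpow_add hB', Real.rpow_two, div_pow, one_pow]
    linarith

lemma one_div_sq_le_rpow {B q : ℝ} (hB : 0 < B) (hq : 0 ≤ q) :
    1 / min 1 B ^ 2 ≤ 1 + (1 / B) ^ (2 + q) := by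
  have hB' : 0 < 1 / B := by positivity
  have h0 : 0 ≤ (1 / B) ^ (2 + q) := by positivity
  rcases min_cases 1 B with ⟨h1, h2⟩ | ⟨h1, h2⟩
  · rw [h1]; norm_num; simpa using h0
  · have h3 : (1 / B) ^ (2 : ℝ) ≤ (1 / B) ^ (2 + q) := by
      apply Real.rpow_le_rpow_of_exponent_le _ (by linarith)
      rw [le_div_iff₀ hB]; linarith
    rw [h1, ← one_div_pow, ← Real.rpow_two]; linarith

/-- The initial accuracy `κ m` costs at most a constant factor more than the bound `M`. -/
lemma cost_init_le {κ m M x q : ℝ} (hκ : 0 < κ) (hm : 0 < m) (hM : 1 ≤ M)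
    (h1 : x * (1 / m) ^ q ≤ M) (h2 : 1 / m ^ 2 ≤ M) :
    1 + x * (1 / (κ * m)) ^ q ≤ (1 + (1 / κ) ^ q + 1 / κ ^ 2) * M ∧
      1 / (κ * m) ^ 2 ≤ (1 + (1 / κ) ^ q + 1 / κ ^ 2) * M := by
  have a3 : 0 ≤ (1 / κ) ^ q := by positivity
  have a4 : 0 ≤ 1 / κ ^ 2 := by positivity
  have e1 : x * (1 / (κ * m)) ^ q = (1 / κ) ^ q * (x * (1 / m) ^ q) := by
    rw [← one_div_mul_one_div, Real.mul_rpow (by positivity) (by positivity)]; ring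
  have e2 : 1 / (κ * m) ^ 2 = 1 / κ ^ 2 * (1 / m ^ 2) := by rw [mul_pow, one_div_mul_one_div]
  have h3 := mul_le_mul_of_nonneg_left h1 a3
  have h4 := mul_le_mul_of_nonneg_left h2 a4
  have h5 : 0 ≤ (1 / κ) ^ q * M := by positivity
  have h6 : 0 ≤ 1 / κ ^ 2 * M := by positivity
  rw [e1, e2]
  constructor <;> linarith

/-- This separates constants depending on `R` from the noise factor, in spite of the truncation at
`1`. -/
lemma min_one_mul_min_one_le {B a c x : ℝ} (hB : 0 ≤ B) (ha : 0 ≤ a) (hc : 0 ≤ c)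
    (hx : a * c = x) : min 1 a * min 1 (B * c) ≤ min 1 (B * x) := by
  apply le_min
  · exact mul_le_one₀ (min_le_left _ _) (by positivity) (min_le_left _ _)
  · calc min 1 a * min 1 (B * c) ≤ a * (B * c) :=
        mul_le_mul (min_le_right _ _) (min_le_right _ _) (by positivity) ha
      _ = B * x := by rw [← hx]; ring

/-- The informative points satisfy `|⟨w⋆, x⟩| ≥ rR / 80`, so their margin is at least of order `min
1 (B r^((1-α)/α))`. This is independent of the bandwidth, whence `ζ = 0`. -/
lemma GeomTsybakov.noiseInterface {s : ℕ} {L R U β δ α B : ℝ} (hL : 0 < L) (hR : 0 < R)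
    (hα : 0 < α) (hα1 : α ≤ 1) (hB : 0 < B) {D : Measure (Ex d)} [IsProbabilityMeasure D] {w : Pt d}
    (h : GeomTsybakov B α D w) :
    NoiseInterface ⟨s, L, R, U, β, δ⟩ (min 1 ((R / 80) ^ ((1 - α) / α))) 0
      (fun r => min 1 (B * r ^ ((1 - α) / α)))
      (min 1 (L * R ^ 2 / 80) * min 1 ((R / 20) ^ ((1 - α) / α)) * min 1 B) D w where
  nonneg := h.margin_nonneg hB
  margin r τ hr _ hτ _ := by
    rw [Real.rpow_zero, mul_one]
    refine (h.marginBound hB hα hα1 _ (by positivity)).mono (by positivity) ?_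
    apply min_one_mul_min_one_le hB.le (by positivity) (by positivity)
    rw [← Real.mul_rpow (by positivity) hr.le]
    congr 1; ring
  holdout := by
    refine ⟨_, h.marginBound hB hα hα1 _ (by positivity), ?_⟩
    have h1 : min 1 ((R / 20) ^ ((1 - α) / α)) * min 1 (B * 1) ≤
        min 1 (B * (R / 20) ^ ((1 - α) / α)) :=
      min_one_mul_min_one_le hB.le (by positivity) zero_le_one (mul_one _)
    rw [mul_one] at h1
    rw [mul_assoc, mul_comm (min 1 (L * R ^ 2 / 80))]
    exact mul_le_mul h1 (min_le_right _ _) (by positivity) (by positivity)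

lemma geomTsybakov_setup {s : ℕ} {L R U β δ B ξ κ : ℝ} (hd : 8 ≤ d) (hs1 : 1 ≤ s) (hs : s ≤ d)
    (hL : 0 < L) (hR : 0 < R) (hU : 0 < U) (hβ : 0 < β) (hδ : 0 < δ) (hδ1 : δ < 1 / 10)
    (hB : 0 < B) (hξ : 0 ≤ ξ) (hκ : 0 < κ) (hκ1 : κ ≤ 1) :
    Setup d ⟨s, L, R, U, β, δ⟩ (1 + ξ) (d * (1 + 1 / B)) (κ * min 1 B)
      fun r => min 1 (B * r ^ ξ) := by
  have hdr : (8 : ℝ) ≤ d := by exact_mod_cast hd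
  have hB' : 0 < 1 / B := by positivity
  have hdH : (d : ℝ) ≤ d * (1 + 1 / B) := le_mul_of_one_le_right (by positivity) (by linarith)
  have hBH : 1 / B ≤ d * (1 + 1 / B) := by nlinarith
  exact { hd := hd, hs1 := hs1, hs := hs, hL := hL, hR := hR, hU := hU, hβ := hβ, hδ := hδ
          hδ1 := hδ1, hH := hdH, eps_pos := by positivity
          eps_le := mul_le_one₀ hκ1 (by positivity) (min_le_left _ _)
          hg := fun r hr hr1 => ⟨by positivity, min_le_left _ _,
            log_inv_min_mul_rpow_le hδ hδ1 (hdr.trans hdH) hB hBH hξ hr (by linarith)⟩ }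

lemma one_le_min_one_mul {B x : ℝ} (hB : 0 < B) (hx : 1 ≤ x) :
    1 ≤ min 1 B * (x * (1 + 1 / B)) := by
  have hB' : 0 < 1 / B := by positivity
  rcases min_cases 1 B with ⟨h1, -⟩ | ⟨h1, -⟩
  · rw [h1]; nlinarith
  · rw [h1, show B * (x * (1 + 1 / B)) = x * B + x by field_simp]; nlinarith

/-- At an initial target of order `min 1 B` a stage costs `B^{-2} B^{-2ξ}` for `B ≤ 1`. As `2 + 2ξ =
2/α`, this is the middle term of the bound, and it also dominates the holdout sample. -/
lemma geomTsybakov_cost {δ B ξ κ ε x : ℝ} (hδ : 0 < δ) (hδ1 : δ < 1 / 10) (hB : 0 < B)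
    (hξ : 0 ≤ ξ) (hκ : 0 < κ) (hκ1 : κ ≤ 1) (hε : 0 < ε) (hε1 : ε < 1) (hx : 8 ≤ x) :
    let M := 1 + (1 / B) ^ (2 + 2 * ξ) + 1 / B ^ 2 * (1 / ε) ^ (2 * ξ)
    let CG := 1 + (1 / κ) ^ (2 * ξ) + 1 / κ ^ 2
    0 ≤ M ∧ logFactor δ (x * (1 + 1 / B)) (κ * min 1 B) ≤
        (Real.log (1 / κ) + 2) * logFactor δ (x * (1 + 1 / B)) ε ∧
      1 + 1 / B ^ 2 * (1 / (κ * min 1 B)) ^ (2 * ξ) ≤ CG * M ∧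
      1 / (κ * min 1 B) ^ 2 ≤ CG * M ∧ 1 + 1 / B ^ 2 * (1 / ε) ^ (2 * ξ) ≤ CG * M := by
  intro M CG
  have hB' : 0 < 1 / B := by positivity
  have a1 : 0 ≤ (1 / B) ^ (2 + 2 * ξ) := by positivity
  have a2 : 0 ≤ 1 / B ^ 2 * (1 / ε) ^ (2 * ξ) := by positivity
  have a3 : 0 ≤ (1 / κ) ^ (2 * ξ) := by positivity
  have a4 : 0 ≤ 1 / κ ^ 2 := by positivity
  have hM : 1 ≤ M := by simp only [M]; linarith
  have hCG : 1 ≤ CG := by simp only [CG]; linarith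
  have b1 : 1 / B ^ 2 * (1 / min 1 B) ^ (2 * ξ) ≤ M :=
    (one_div_sq_mul_min_rpow_le hB).trans (by simp only [M]; linarith)
  have b2 : 1 / min 1 B ^ 2 ≤ M :=
    (one_div_sq_le_rpow (q := 2 * ξ) hB (by positivity)).trans (by simp only [M]; linarith)
  obtain ⟨c1, c2⟩ := cost_init_le hκ (by positivity : 0 < min 1 B) hM b1 b2
  refine ⟨by linarith, ?_, c1, c2, ?_⟩
  · apply logFactor_le hδ hδ1 (by nlinarith) (by positivity) hε hε1 hκ hκ1
    rw [mul_assoc]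
    exact le_mul_of_one_le_right hκ.le (one_le_min_one_mul hB (by linarith))
  · have : 1 + 1 / B ^ 2 * (1 / ε) ^ (2 * ξ) ≤ M := by simp only [M]; linarith
    exact this.trans (le_mul_of_one_le_left (by linarith) hCG)

theorem geomTsybakov_guarantee (α : ℝ) (hα : 0 < α) (hα1 : α ≤ 1) : ∃ k : ℕ, ∀ L R U β : ℝ,
    0 < L → 0 < R → 0 < U → 0 < β → ∃ C : ℝ, 0 < C ∧
    ∀ (d s : ℕ) (δ B : ℝ), 8 ≤ d → 1 ≤ s → s ≤ d → 0 < δ → δ < 1 / 10 → 0 < B →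
      ∃ S : Schedule, GeomTsybakovSchedule C k d ⟨s, L, R, U, β, δ⟩ B α S ∧
        Guarantee d ⟨s, L, R, U, β, δ⟩ S (fun D _ wstar => GeomTsybakov B α D wstar) fun ε =>
          C * (s * (1 + (1 / B) ^ (2 / α) + 1 / B ^ 2 * (1 / ε) ^ ((2 - 2 * α) / α))) *
            Real.log (d * (1 + 1 / B) / (ε * δ)) ^ k := by
  have hξ : 0 ≤ (1 - α) / α := div_nonneg (by linarith) hα.le
  have hp : (2 - 2 * α) / α = 2 * ((1 - α) / α) := by ring
  have hξα : 1 / α = (1 - α) / α + 1 := by field_simp; ring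
  have h2α : 2 / α = 2 + 2 * ((1 - α) / α) := by field_simp; ring
  obtain ⟨k, hk⟩ := exists_schedule 0 one_pos ⌈2 * ((1 - α) / α)⌉₊
  refine ⟨k, fun L R U β hL hR hU hβ => ?_⟩
  obtain ⟨κ, hκ⟩ : ∃ κ, κ = min 1 (L * R ^ 2 / 80) * min 1 ((R / 20) ^ ((1 - α) / α)) := ⟨_, rfl⟩
  have hκ0 : 0 < κ := by rw [hκ]; positivity
  have hκ1 : κ ≤ 1 := by
    rw [hκ]; exact mul_le_one₀ (min_le_left _ _) (by positivity) (min_le_left _ _)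
  have hlogκ : 0 ≤ Real.log (1 / κ) := Real.log_nonneg (by rw [le_div_iff₀ hκ0]; linarith)
  obtain ⟨C, hC, hk⟩ := hk L R U β hL hR hU hβ (min 1 ((R / 80) ^ ((1 - α) / α)))
    (1 + (1 - α) / α) (Real.log (1 / κ) + 2) (1 + (1 / κ) ^ (2 * ((1 - α) / α)) + 1 / κ ^ 2)
    (by positivity) (by positivity) (by positivity) (by positivity)
  refine ⟨C, by linarith, fun d s δ B hd hs1 hs hδ hδ1 hB => ?_⟩
  have hdr : (8 : ℝ) ≤ d := by exact_mod_cast hd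
  have hsetup := geomTsybakov_setup hd hs1 hs hL hR hU hβ hδ hδ1 hB hξ hκ0 hκ1
  have hlog : ∀ x, Real.log (d * (1 + 1 / B) / (δ * x)) = logFactor δ (d * (1 + 1 / B)) x :=
    fun x => rfl
  obtain ⟨S, hS0, hSv, hSb, hST, hSG⟩ := hk d s δ (d * (1 + 1 / B)) (κ * min 1 B)
    (fun r => min 1 (B * r ^ ((1 - α) / α)))
    (fun r => 1 + 1 / B ^ 2 * (1 / r) ^ (2 * ((1 - α) / α)))
    (fun ε => 1 + (1 / B) ^ (2 + 2 * ((1 - α) / α)) +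
      1 / B ^ 2 * (1 / ε) ^ (2 * ((1 - α) / α))) hsetup
    (fun r hr _ => one_div_min_one_sq_le (by positivity) (one_div_mul_rpow_sq hr).le)
    (fun r hr => by positivity)
    (fun u v y hu hv _ _ hy h => by
      apply one_le_mul_one_add _ hy
      rw [mul_left_comm]
      exact mul_le_mul_of_nonneg_left (rpow_le_pow_mul_rpow (by positivity) hu hv hy h)
        (by positivity))
    (fun ε hε hε1 => geomTsybakov_cost hδ hδ1 hB hξ hκ0 hκ1 hε hε1 hdr)
  refine ⟨S, ⟨fun j => ⟨?_, ?_⟩, ?_, hSv⟩, ?_⟩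
  · have e : min 1 (B * prox j ^ ((1 - α) / α)) * prox j =
        min (prox j) (B * prox j ^ (1 / α)) := by
      rw [min_mul_of_nonneg _ _ (prox_pos j).le, one_mul, hξα, Real.rpow_add_one (prox_pos j).ne',
        mul_assoc]
    rw [← e]; exact hSb j
  · have h1 := two_lt_log hd
    have h2 := prox_pos j
    rw [hp, hlog]
    refine (hST j).trans ((mul_logFactor_le hδ hδ1 (hdr.trans hsetup.hH) (by linarith)
      (by positivity) k j).trans (le_of_eq ?_))
    ring
  · rw [hS0]
    exact mul_le_mul (hκ1.trans hC) (min_le_right _ _) (by positivity) (by linarith)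
  · have hG := hSG (fun D _ wstar => GeomTsybakov B α D wstar) fun D _ w hD => by
      rw [hκ]; exact hD.noiseInterface hL hR hα hα1 hB
    simp only [hp, h2α]
    simp only [mul_comm _ δ, hlog]
    exact hG

end cases

/-! ### Tsybakov noise. -/

section cases
variable {d : ℕ}

lemma log_inv_min_div_rpow_le {δ H A θ r : ℝ} (hδ : 0 < δ) (hδ1 : δ < 1 / 10) (hH : 8 ≤ H)
    (hA : 0 < A) (hAH : A ≤ H) (hθ : 0 ≤ θ) (hr : 0 < r) (hr1 : r ≤ 1) :
    Real.log (1 / min 1 ((r / A) ^ θ)) ≤ θ * logFactor δ H r := by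
  have hΛ := one_le_logFactor hδ hδ1 hH hr hr1
  rcases min_cases 1 ((r / A) ^ θ) with ⟨h1, -⟩ | ⟨h1, -⟩
  · rw [h1, div_one, Real.log_one]; positivity
  · rw [h1, show 1 / (r / A) ^ θ = (A / r) ^ θ by
      rw [Real.div_rpow hr.le hA.le, one_div_div, Real.div_rpow hA.le hr.le],
      Real.log_rpow (by positivity)]
    apply mul_le_mul_of_nonneg_left _ hθ
    apply Real.log_le_log (by positivity)
    rw [div_le_div_iff₀ hr (by positivity)]
    have h2 : δ * r ≤ r := mul_le_of_le_one_left hr.le (by linarith)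
    exact mul_le_mul hAH h2 (by positivity) (by linarith)

lemma one_div_div_rpow_sq {A θ r : ℝ} (hA : 0 < A) (hr : 0 < r) :
    1 / ((r / A) ^ θ) ^ 2 = A ^ (2 * θ) * (1 / r) ^ (2 * θ) := by
  rw [← Real.mul_rpow hA.le (by positivity), mul_comm 2 θ, Real.rpow_mul (by positivity),
    Real.rpow_two, ← one_div_pow, show r / A = (A * (1 / r))⁻¹ by field_simp,
    Real.inv_rpow (by positivity), one_div, inv_inv]

section exponents
variable {A θ ζ : ℝ}

lemma min_one_one_div_rpow_of_le_one (hA : 0 < A) (hA1 : A ≤ 1) (hζ : 0 ≤ ζ) :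
    min 1 ((1 / A) ^ ζ) = 1 :=
  min_eq_left (Real.one_le_rpow (by rw [le_div_iff₀ hA]; linarith) hζ)

lemma one_div_min_one_one_div_rpow (hA1 : 1 ≤ A) (hζ : 0 ≤ ζ) :
    1 / min 1 ((1 / A) ^ ζ) = A ^ ζ := by
  have hA : 0 < A := by linarith
  rw [min_eq_right (Real.rpow_le_one (by positivity) (by rw [div_le_one hA]; linarith) hζ),
    one_div, one_div, Real.inv_rpow hA.le, inv_inv]

/-- For `A ≥ 1` the initial target is of order `A^{-ζ}`, so a stage there costs `(A · A^ζ)^{2θ}`.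
This is the origin of the `ε`-independent term of the label bound. -/
lemma rpow_mul_one_div_min_le (hA : 0 < A) (hθ : 0 ≤ θ) (hζ : 0 ≤ ζ) :
    A ^ (2 * θ) * (1 / min 1 ((1 / A) ^ ζ)) ^ (2 * θ) ≤ 1 + A ^ (2 * θ * (1 + ζ)) := by
  have h0 : 0 ≤ A ^ (2 * θ * (1 + ζ)) := by positivity
  rcases le_total A 1 with hA1 | hA1
  · rw [min_one_one_div_rpow_of_le_one hA hA1 hζ, div_one, Real.one_rpow, mul_one]
    have := Real.rpow_le_one hA.le hA1 (by positivity : 0 ≤ 2 * θ)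
    linarith
  · rw [one_div_min_one_one_div_rpow hA1 hζ, ← Real.rpow_mul hA.le, ← Real.rpow_add hA,
      show 2 * θ + ζ * (2 * θ) = 2 * θ * (1 + ζ) by ring]
    linarith

lemma one_div_min_sq_le (hA : 0 < A) (hθ : 0 ≤ θ) (hζ : 0 ≤ ζ) (hζθ : ζ * (θ + 1) = θ) :
    1 / min 1 ((1 / A) ^ ζ) ^ 2 ≤ 1 + A ^ (2 * θ * (1 + ζ)) := by
  have h0 : 0 ≤ A ^ (2 * θ * (1 + ζ)) := by positivity
  rcases le_total A 1 with hA1 | hA1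
  · rw [min_one_one_div_rpow_of_le_one hA hA1 hζ, one_pow, div_one]
    linarith
  · rw [← one_div_pow, one_div_min_one_one_div_rpow hA1 hζ, ← Real.rpow_two, ← Real.rpow_mul hA.le]
    have h1 : ζ * 2 ≤ 2 * θ * (1 + ζ) := by
      have := mul_nonneg hζ hθ
      nlinarith
    have := Real.rpow_le_rpow_of_exponent_le hA1 h1
    linarith

lemma one_le_min_one_one_div_rpow_mul {x : ℝ} (hA : 0 < A) (hζ : 0 ≤ ζ) (hζ1 : ζ ≤ 1)
    (hx : 1 ≤ x) : 1 ≤ min 1 ((1 / A) ^ ζ) * (x * (1 + A)) := by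
  rcases le_total A 1 with hA1 | hA1
  · rw [min_one_one_div_rpow_of_le_one hA hA1 hζ]
    nlinarith
  · rw [← one_div_one_div (min 1 _), one_div_min_one_one_div_rpow hA1 hζ, one_div_mul_eq_div,
      le_div_iff₀ (by positivity), one_mul]
    have := Real.rpow_le_rpow_of_exponent_le hA1 hζ1
    rw [Real.rpow_one] at this
    nlinarith

/-- The noise factor `g r = min 1 ((r / A) ^ θ)` satisfies `g r ≤ (g r * r / A) ^ ζ`. -/
lemma min_div_rpow_le {r : ℝ} (hA : 0 < A) (hr : 0 < r) (hζ : 0 ≤ ζ)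
    (hθ : 0 ≤ θ) (hζθ : ζ * (θ + 1) = θ) :
    min 1 ((r / A) ^ θ) ≤ (min 1 ((r / A) ^ θ) * r / A) ^ ζ := by
  rcases le_total (r / A) 1 with h | h
  · rw [min_eq_right (Real.rpow_le_one (by positivity) h hθ), mul_div_assoc,
      ← Real.rpow_add_one (by positivity), ← Real.rpow_mul (by positivity), mul_comm _ ζ, hζθ]
  · rw [min_eq_left (Real.one_le_rpow h hθ), one_mul]
    exact Real.one_le_rpow h hζ

end exponents

/-- Here the margin depends on the probability of the informative box and hence on the bandwidth: it
is of order `(τ g r / A)^ζ` with `ζ = (1 - α)/α`. Requiring this to be at least `τ^ζ g` leads to `g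
= (g r / A)^ζ`, solved by `g = (r / A)^θ` with `θ = ζ/(1 - ζ)` and truncated at `1`. -/
lemma Tsybakov.noiseInterface {s : ℕ} {L R U β δ α A θ : ℝ} (hL : 0 < L) (hR : 0 < R)
    (hα : 1 / 2 < α) (hα1 : α ≤ 1) (hA : 0 < A) (hθ : 0 ≤ θ) (hζθ : (1 - α) / α * (θ + 1) = θ)
    {D : Measure (Ex d)} [IsProbabilityMeasure D] {w : Pt d} (h : Tsybakov A α D w) :
    NoiseInterface ⟨s, L, R, U, β, δ⟩ (min (1 / 4) ((L * R / 2 / 2) ^ ((1 - α) / α)))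
      ((1 - α) / α) (fun r => min 1 ((r / A) ^ θ))
      (min 1 (L * R ^ 2 / 80) * min (1 / 4) ((L * R ^ 2 / 80 / 2) ^ ((1 - α) / α)) *
        min 1 ((1 / A) ^ ((1 - α) / α))) D w := by
  have hα0 : 0 < α := by linarith
  have hζ : 0 ≤ (1 - α) / α := div_nonneg (by linarith) hα0.le
  refine ⟨h.margin_nonneg hα hα1, fun r τ hr _ hτ hτ1 => ?_, ?_⟩
  · have hg : 0 < min 1 ((r / A) ^ θ) := by positivity
    have hg1 : min 1 ((r / A) ^ θ) ≤ 1 := min_le_left _ _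
    refine (h.marginBound hA hα hα1 (by positivity) _).mono (by positivity) (le_min ?_ ?_)
    · have h1 : τ ^ ((1 - α) / α) ≤ 1 := Real.rpow_le_one hτ.le hτ1 hζ
      have h2 : min (1 / 4) ((L * R / 2 / 2) ^ ((1 - α) / α)) ≤ 1 / 4 := min_le_left _ _
      calc _ ≤ 1 / 4 * 1 * 1 := mul_le_mul (mul_le_mul h2 h1 (by positivity) (by norm_num)) hg1
            hg.le (by norm_num)
        _ = 1 / 4 := by norm_num
    · have e : L * R / 2 * (τ * min 1 ((r / A) ^ θ) * r) / (2 * A) =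
          L * R / 2 / 2 * τ * (min 1 ((r / A) ^ θ) * r / A) := by field_simp
      change _ ≤ (L * R / 2 * (τ * min 1 ((r / A) ^ θ) * r) / (2 * A)) ^ ((1 - α) / α)
      rw [e, Real.mul_rpow (by positivity) (by positivity), Real.mul_rpow (by positivity) hτ.le]
      exact mul_le_mul (mul_le_mul_of_nonneg_right (min_le_right _ _) (by positivity))
        (min_div_rpow_le hA hr hζ hθ hζθ) hg.le (by positivity)
  · refine ⟨_, h.marginBound hA hα hα1 (by positivity) _, ?_⟩
    have e : (L * R ^ 2 / 80 / (2 * A)) ^ ((1 - α) / α) =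
        (L * R ^ 2 / 80 / 2) ^ ((1 - α) / α) * (1 / A) ^ ((1 - α) / α) := by
      rw [← Real.mul_rpow (by positivity) (by positivity)]
      congr 1; field_simp
    have h1 : min (1 / 4) ((L * R ^ 2 / 80 / 2) ^ ((1 - α) / α)) * min 1 ((1 / A) ^ ((1 - α) / α)) ≤
        min (1 / 4) ((L * R ^ 2 / 80 / (2 * A)) ^ ((1 - α) / α)) := by
      apply le_min
      · exact (mul_le_mul (min_le_left _ _) (min_le_left _ _) (by positivity) (by norm_num)).trans
          (mul_one _).le
      · rw [e]
        exact mul_le_mul (min_le_right _ _) (min_le_right _ _) (by positivity) (by positivity)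
    rw [mul_assoc, mul_comm (min 1 (L * R ^ 2 / 80))]
    exact mul_le_mul h1 (min_le_right _ _) (by positivity) (by positivity)

lemma tsybakov_setup {s : ℕ} {L R U β δ A θ ζ κ : ℝ} (hd : 8 ≤ d) (hs1 : 1 ≤ s) (hs : s ≤ d)
    (hL : 0 < L) (hR : 0 < R) (hU : 0 < U) (hβ : 0 < β) (hδ : 0 < δ) (hδ1 : δ < 1 / 10)
    (hA : 0 < A) (hθ : 0 ≤ θ) (hκ : 0 < κ) (hκ1 : κ ≤ 1) :
    Setup d ⟨s, L, R, U, β, δ⟩ θ (d * (1 + A)) (κ * min 1 ((1 / A) ^ ζ))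
      fun r => min 1 ((r / A) ^ θ) := by
  have hdr : (8 : ℝ) ≤ d := by exact_mod_cast hd
  have hdH : (d : ℝ) ≤ d * (1 + A) := le_mul_of_one_le_right (by positivity) (by linarith)
  have hAH : A ≤ d * (1 + A) := by nlinarith
  exact { hd := hd, hs1 := hs1, hs := hs, hL := hL, hR := hR, hU := hU, hβ := hβ, hδ := hδ
          hδ1 := hδ1, hH := hdH, eps_pos := by positivity
          eps_le := mul_le_one₀ hκ1 (by positivity) (min_le_left _ _)
          hg := fun r hr hr1 => ⟨by positivity, min_le_left _ _,
            log_inv_min_div_rpow_le hδ hδ1 (hdr.trans hdH) hA hAH hθ hr (by linarith)⟩ }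

lemma tsybakov_cost {δ A θ ζ κ ε x : ℝ} (hδ : 0 < δ) (hδ1 : δ < 1 / 10) (hA : 0 < A)
    (hθ : 0 ≤ θ) (hζ : 0 ≤ ζ) (hζ1 : ζ ≤ 1) (hζθ : ζ * (θ + 1) = θ) (hκ : 0 < κ) (hκ1 : κ ≤ 1)
    (hε : 0 < ε) (hε1 : ε < 1) (hx : 8 ≤ x) :
    let M := 1 + A ^ (2 * θ * (1 + ζ)) + A ^ (2 * θ) * (1 / ε) ^ (2 * θ)
    let CG := 1 + (1 / κ) ^ (2 * θ) + 1 / κ ^ 2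
    let m := min 1 ((1 / A) ^ ζ)
    0 ≤ M ∧ logFactor δ (x * (1 + A)) (κ * m) ≤
        (Real.log (1 / κ) + 2) * logFactor δ (x * (1 + A)) ε ∧
      1 + A ^ (2 * θ) * (1 / (κ * m)) ^ (2 * θ) ≤ CG * M ∧
      1 / (κ * m) ^ 2 ≤ CG * M ∧ 1 + A ^ (2 * θ) * (1 / ε) ^ (2 * θ) ≤ CG * M := by
  intro M CG m
  have a1 : 0 ≤ A ^ (2 * θ * (1 + ζ)) := by positivity
  have a2 : 0 ≤ A ^ (2 * θ) * (1 / ε) ^ (2 * θ) := by positivity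
  have a3 : 0 ≤ (1 / κ) ^ (2 * θ) := by positivity
  have a4 : 0 ≤ 1 / κ ^ 2 := by positivity
  have hm : 0 < m := by positivity
  have hM : 1 ≤ M := by simp only [M]; linarith
  have hCG : 1 ≤ CG := by simp only [CG]; linarith
  have b1 : A ^ (2 * θ) * (1 / m) ^ (2 * θ) ≤ M :=
    (rpow_mul_one_div_min_le hA hθ hζ).trans (by simp only [M]; linarith)
  have b2 : 1 / m ^ 2 ≤ M :=
    (one_div_min_sq_le hA hθ hζ hζθ).trans (by simp only [M]; linarith)
  obtain ⟨c1, c2⟩ := cost_init_le hκ hm hM b1 b2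
  refine ⟨by linarith, ?_, c1, c2, ?_⟩
  · apply logFactor_le hδ hδ1 (by nlinarith) (by positivity) hε hε1 hκ hκ1
    rw [mul_assoc]
    exact le_mul_of_one_le_right hκ.le
      (one_le_min_one_one_div_rpow_mul hA hζ hζ1 (by linarith))
  · have : 1 + A ^ (2 * θ) * (1 / ε) ^ (2 * θ) ≤ M := by simp only [M]; linarith
    exact this.trans (le_mul_of_one_le_left (by linarith) hCG)

/-- The assumption `α > 1/2` is what makes `ζ = (1 - α)/α < 1`, so that a bandwidth small against
the margin times `r` exists. Since `1 + ζ = 1/α`, the initial cost exponent `2θ(1 + ζ)` takes the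
stated form. -/
theorem tsybakov_guarantee (α : ℝ) (hα : 1 / 2 < α) (hα1 : α ≤ 1) : ∃ k : ℕ,
    ∀ L R U β : ℝ, 0 < L → 0 < R → 0 < U → 0 < β → ∃ C : ℝ, 0 < C ∧
    ∀ (d s : ℕ) (δ A : ℝ), 8 ≤ d → 1 ≤ s → s ≤ d → 0 < δ → δ < 1 / 10 → 0 < A →
      ∃ S : Schedule, TsybakovSchedule C k d ⟨s, L, R, U, β, δ⟩ A α S ∧
        Guarantee d ⟨s, L, R, U, β, δ⟩ S (fun D _ wstar => Tsybakov A α D wstar) fun ε =>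
          C * (s * (1 + A ^ ((2 - 2 * α) / (α * (2 * α - 1))) +
              (A / ε) ^ ((2 - 2 * α) / (2 * α - 1)))) *
            Real.log (d * (1 + A) / (ε * δ)) ^ k := by
  have hα0 : 0 < α := by linarith
  have hα2 : 0 < 2 * α - 1 := by linarith
  have hζ : 0 ≤ (1 - α) / α := div_nonneg (by linarith) hα0.le
  have hζ1 : (1 - α) / α < 1 := by rw [div_lt_one hα0]; linarith
  obtain ⟨θ, hθe⟩ : ∃ θ, θ = (1 - α) / (2 * α - 1) := ⟨_, rfl⟩
  have hθ : 0 ≤ θ := by rw [hθe]; exact div_nonneg (by linarith) hα2.le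
  have hp : (2 - 2 * α) / (2 * α - 1) = 2 * θ := by rw [hθe]; ring
  have hθ1 : α / (2 * α - 1) = θ + 1 := by
    rw [hθe, div_add_one hα2.ne']; congr 1; ring
  have hζθ : (1 - α) / α * (θ + 1) = θ := by rw [← hθ1, hθe]; field_simp
  have hpα : (2 - 2 * α) / (α * (2 * α - 1)) = 2 * θ * (1 + (1 - α) / α) := by
    rw [hθe]; field_simp; ring
  have hdiv : ∀ {A r : ℝ}, 0 < A → 0 < r →
      (A / r) ^ (2 * θ) = A ^ (2 * θ) * (1 / r) ^ (2 * θ) := fun hA hr => by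
    rw [← Real.mul_rpow hA.le (by positivity), mul_one_div]
  obtain ⟨k, hk⟩ := exists_schedule ((1 - α) / α) hζ1 ⌈2 * θ⌉₊
  refine ⟨k, fun L R U β hL hR hU hβ => ?_⟩
  obtain ⟨κ, hκ⟩ : ∃ κ, κ = min 1 (L * R ^ 2 / 80) *
    min (1 / 4) ((L * R ^ 2 / 80 / 2) ^ ((1 - α) / α)) := ⟨_, rfl⟩
  have hκ0 : 0 < κ := by rw [hκ]; positivity
  have hκ1 : κ ≤ 1 := by
    rw [hκ]
    exact mul_le_one₀ (min_le_left _ _) (by positivity) ((min_le_left _ _).trans (by norm_num))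
  have hlogκ : 0 ≤ Real.log (1 / κ) := Real.log_nonneg (by rw [le_div_iff₀ hκ0]; linarith)
  obtain ⟨C, hC, hk⟩ := hk L R U β hL hR hU hβ
    (min (1 / 4) ((L * R / 2 / 2) ^ ((1 - α) / α))) θ (Real.log (1 / κ) + 2)
    (1 + (1 / κ) ^ (2 * θ) + 1 / κ ^ 2) (by positivity) hθ (by positivity) (by positivity)
  refine ⟨C, by linarith, fun d s δ A hd hs1 hs hδ hδ1 hA => ?_⟩
  have hdr : (8 : ℝ) ≤ d := by exact_mod_cast hd
  have hsetup := tsybakov_setup (ζ := (1 - α) / α) hd hs1 hs hL hR hU hβ hδ hδ1 hA hθ hκ0 hκ1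
  have hlog : ∀ x, Real.log (d * (1 + A) / (δ * x)) = logFactor δ (d * (1 + A)) x :=
    fun x => rfl
  obtain ⟨S, hS0, hSv, hSb, hST, hSG⟩ := hk d s δ (d * (1 + A)) (κ * min 1 ((1 / A) ^ ((1 - α) / α)))
    (fun r => min 1 ((r / A) ^ θ)) (fun r => 1 + A ^ (2 * θ) * (1 / r) ^ (2 * θ))
    (fun ε => 1 + A ^ (2 * θ * (1 + (1 - α) / α)) + A ^ (2 * θ) * (1 / ε) ^ (2 * θ)) hsetup
    (fun r hr _ => one_div_min_one_sq_le (by positivity) (one_div_div_rpow_sq hA hr).le)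
    (fun r hr => by positivity)
    (fun u v y hu hv _ _ hy h => by
      apply one_le_mul_one_add _ hy
      rw [mul_left_comm]
      exact mul_le_mul_of_nonneg_left (rpow_le_pow_mul_rpow (by positivity) hu hv hy h)
        (by positivity))
    (fun ε hε hε1 => tsybakov_cost hδ hδ1 hA hθ hζ hζ1.le hζθ hκ0 hκ1 hε hε1 hdr)
  refine ⟨S, ⟨fun j => ⟨?_, ?_⟩, ?_, hSv⟩, ?_⟩
  · have h2 := prox_pos j
    have e : min 1 ((prox j / A) ^ θ) * prox j =
        min (prox j) ((1 / A) ^ θ * prox j ^ (θ + 1)) := by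
      rw [min_mul_of_nonneg _ _ h2.le, one_mul, Real.rpow_add_one h2.ne', ← mul_assoc,
        ← Real.mul_rpow (by positivity) h2.le, one_div_mul_eq_div]
    rw [hθ1, ← hθe, ← e]; exact hSb j
  · have h1 := two_lt_log hd
    have h2 := prox_pos j
    rw [hp, hlog, hdiv hA h2]
    refine (hST j).trans ((mul_logFactor_le hδ hδ1 (hdr.trans hsetup.hH) (by linarith)
      (by positivity) k j).trans (le_of_eq ?_))
    ring
  · rw [hS0]
    exact mul_le_mul (hκ1.trans hC) (min_le_right _ _) (by positivity) (by linarith)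
  · have hG := hSG (fun D _ wstar => Tsybakov A α D wstar) fun D _ w hD => by
      rw [hκ]; exact hD.noiseInterface hL hR hα hα1 hA hθ hζθ
    intro ε hε hε1
    have hGε := hG ε hε hε1
    simp only [hp, hpα]
    rw [hdiv hA hε, mul_comm ε δ, hlog]
    exact hGε

end cases

end SparseHalfspace

end

open SparseHalfspace in
theorem mainTheorem3 :
    -- Massart noise
    (∃ k : ℕ, ∀ L R U β : ℝ, 0 < L → 0 < R → 0 < U → 0 < β → ∃ C : ℝ, 0 < C ∧
      ∀ (d s : ℕ) (δ η : ℝ), 8 ≤ d → 1 ≤ s → s ≤ d → 0 < δ → δ < 1 / 10 → 0 ≤ η → η < 1 / 2 →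
        ∃ S : Schedule, MassartSchedule C k d ⟨s, L, R, U, β, δ⟩ η S ∧
          Guarantee d ⟨s, L, R, U, β, δ⟩ S (fun D _ wstar => Massart η D wstar) fun ε =>
            C * (s / (1 - 2 * η) ^ 2) * Real.log (d / (ε * δ * (1 - 2 * η))) ^ k) ∧
    -- Tsybakov noise
    (∀ α : ℝ, 1 / 2 < α → α ≤ 1 → ∃ k : ℕ,
      ∀ L R U β : ℝ, 0 < L → 0 < R → 0 < U → 0 < β → ∃ C : ℝ, 0 < C ∧
      ∀ (d s : ℕ) (δ A : ℝ), 8 ≤ d → 1 ≤ s → s ≤ d → 0 < δ → δ < 1 / 10 → 0 < A →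
        ∃ S : Schedule, TsybakovSchedule C k d ⟨s, L, R, U, β, δ⟩ A α S ∧
          Guarantee d ⟨s, L, R, U, β, δ⟩ S (fun D _ wstar => Tsybakov A α D wstar) fun ε =>
            C * (s * (1 + A ^ ((2 - 2 * α) / (α * (2 * α - 1))) +
                (A / ε) ^ ((2 - 2 * α) / (2 * α - 1)))) *
              Real.log (d * (1 + A) / (ε * δ)) ^ k) ∧
    -- geometric Tsybakov noise
    (∀ α : ℝ, 0 < α → α ≤ 1 → ∃ k : ℕ,
      ∀ L R U β : ℝ, 0 < L → 0 < R → 0 < U → 0 < β → ∃ C : ℝ, 0 < C ∧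
      ∀ (d s : ℕ) (δ B : ℝ), 8 ≤ d → 1 ≤ s → s ≤ d → 0 < δ → δ < 1 / 10 → 0 < B →
        ∃ S : Schedule, GeomTsybakovSchedule C k d ⟨s, L, R, U, β, δ⟩ B α S ∧
          Guarantee d ⟨s, L, R, U, β, δ⟩ S (fun D _ wstar => GeomTsybakov B α D wstar) fun ε =>
            C * (s * (1 + (1 / B) ^ (2 / α) +
                1 / B ^ 2 * (1 / ε) ^ ((2 - 2 * α) / α))) *
              Real.log (d * (1 + 1 / B) / (ε * δ)) ^ k) :=
  ⟨massart_guarantee, tsybakov_guarantee, geomTsybakov_guarantee⟩
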